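/- Let $\mathcal X$ be a separable metric space with Borel $\sigma$-field $\mathcal B$, $m$ a diffuse probability measure on $\mathcal B$ (i.e. $m\{x\}=0$ for all $x$), and $\alpha>0$, $\beta<1$, $c>-\beta$ real numbers. For a finite measure $\nu$ on $\mathcal B$ with diffuse part $\nu_c$ and atomic part $\sum_j\gamma_j\delta_{x_j}$ (the $x_j$ distinct), where $\gamma_j\le 1$, let $\mathrm{BeP}(\nu)$ denote the law of $M'+M''$, where $M'$ and $M''$ are independent, $M'$ is a Poisson random measure with intensity $\nu_c$, and $M''=\sum_jV_j\delta_{x_j}$ with independent indicators $V_j$, $P(V_j=1)=\gamma_j$. On a probability space $(\Omega,\mathcal A,P)$ let $(M_n)_{n\ge1}$ be random finite measures on $\mathcal B$ and $(R_n)_{n\ge1}$ real random variables (the weights) such that, with $\mathcal F_0$ trivial and $\mathcal F_n=\sigma(M_1,\dots,M_n,R_1,\dots,R_n)$: * there is a constant $u>\max(\beta,0)$ such that, for each $n\ge1$, $R_n\ge u$ a.s. and $R_n$ is independent of $(M_1,\dots,M_n,R_1,\dots,R_{n-1})$; * for each $n\ge0$, conditionally on $\mathcal F_n$, $M_{n+1}$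 has law $\mathrm{BeP}(\nu_n)$, where $S_n=\{x: M_i\{x\}=1\text{ for some }1\le i\le n\}$ and $$\nu_n=\sum_{x\in S_n}\frac{\sum_{i=1}^nR_iM_i\{x\}-\beta}{c+\sum_{i=1}^nR_i}\,\delta_x+\frac{\Gamma(c+1)\,\Gamma(c+\beta+\sum_{i=1}^nR_i)}{\Gamma(c+\beta)\,\Gamma(c+1+\sum_{i=1}^nR_i)}\,\alpha\, m$$ (so $\nu_0=\alpha m$). Let $K_i=M_i(\mathcal X)$ and $\overline K_n=\frac1n\sum_{i=1}^nK_i$. A sequence $(Y_n)$ of real random variables converges *stably* to a random probability measure $\kappa$ on $\mathbb R$ if $E\{f(Y_n)\mid H\}\to E\{\int f\,d\kappa\mid H\}$ for all $H\in\mathcal A$ with $P(H)>0$ and all bounded continuous $f:\mathbb R\to\mathbb R$; $\mathcal N(0,v)$ is the Gaussian law with mean $0$ and variance $v\ge0$, where $\mathcal N(0,0)=\delta_0$. **Theorem.** Suppose that, for some constants $b,r,q$, $R_n\le b$ a.s. for all $n$, $E(R_n)\to r$ and $E(R_n^2)\to q$. Suppose moreover that $\beta<1/2$, or that $R_n=1$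 a.s. for all $n$ (and $\beta<1$ is arbitrary). Then every $K_n$ is integrable, and there are real random variables $Z$ and $Q$ such that $$\overline K_n\to Z\ \text{ a.s.},\qquad \frac1n\sum_{i=1}^nK_i^2\to Q\ \text{ a.s.},$$ and $Z^2<Q$ a.s. on the event $\{K_i\neq0\text{ for some }i\}$ that at least one dish is ever tried; if $\beta\ge0$, then $Z^2<Q$ a.s. without restriction. Moreover, $$\sqrt n\,\{\overline K_n-Z\}\to\mathcal N(0,\sigma^2)\ \text{ stably},\qquad \sqrt n\,\{\overline K_n-E(K_{n+1}\mid\mathcal F_n)\}\to\mathcal N(0,\tau^2)\ \text{ stably},$$ where $$\sigma^2=\frac{2q-r^2}{r^2}\,(Q-Z^2),\qquad \tau^2=\frac{q-r^2}{r^2}\,(Q-Z^2).$$ -/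

import Mathlib

open MeasureTheory ProbabilityTheory Filter
open scoped Topology ENNReal NNReal BoundedContinuousFunction

noncomputable section

namespace WeightedIBP

section RandomMeasures

variable {X : Type*} [MeasurableSpace X]

/-- The law of a Poisson random measure with (finite) intensity `ν`: the law of `∑_{j < N} δ_{X_j}`,
where `N` is Poisson with mean `ν(X)` and, independently of `N`, the `X_j` are i.i.d. with
distribution `ν / ν(X)` (if `ν = 0`, then `N = 0` almost surely and this is the point mass
at the zero measure). -/
def poissonLaw (ν : Measure X) : Measure (Measure X) :=
  (poissonMeasure (ν Set.univ).toNNReal).bind fun k =>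
    (Measure.pi fun _ : Fin k => ν[|Set.univ]).map fun x => ∑ j, Measure.dirac (x j)

/-- The atoms of `ν`. -/
def atoms (ν : Measure X) : Set X := {x | ν {x} ≠ 0}

/-- The diffuse part of `ν`. -/
def diffusePart (ν : Measure X) : Measure X := ν.restrict (atoms ν)ᶜ

/-- The law of `∑_j V_j δ_{x_j}`, where the `x_j` are the atoms of `ν` and the `V_j` are independent
indicators with `P(V_j = 1) = ν{x_j}` (assumed to be at most `1`). -/
def atomicLaw (ν : Measure X) : Measure (Measure X) :=
  (Measure.infinitePi fun x : atoms ν =>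
    bernoulliMeasure (1 : ℝ≥0∞) 0 (Set.projIcc (0 : ℝ) 1 zero_le_one (ν {(x : X)}).toReal)).map
    fun V => Measure.sum fun x : atoms ν => V x • Measure.dirac (x : X)

/-- `BeP(ν)`: the law of a Bernoulli random measure with hazard measure `ν`, that is, of the sum of
two independent random measures, the first being a Poisson random measure whose intensity is the
diffuse part of `ν` and the second one as in `atomicLaw`. -/
def bernoulliLaw (ν : Measure X) : Measure (Measure X) :=
  ((poissonLaw (diffusePart ν)).prod (atomicLaw ν)).map fun μ => μ.1 + μ.2

/-! The maps above are measurable, so that the laws are probability measures. -/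

theorem measurable_sum_dirac (k : ℕ) :
    Measurable fun x : Fin k → X => (∑ j, Measure.dirac (x j) : Measure X) := by
  refine Finset.measurable_fun_sum _ fun i _ => ?_
  exact Measure.measurable_dirac.comp (measurable_pi_apply i)

theorem isProbabilityMeasure_poissonLaw (ν : Measure X) [IsFiniteMeasure ν] :
    IsProbabilityMeasure (poissonLaw ν) := by
  constructor
  rw [poissonLaw, Measure.bind_apply MeasurableSet.univ (Measurable.of_discrete).aemeasurable]
  by_cases h : ν = 0
  · subst h
    have h0 : poissonMeasure (((0 : Measure X) Set.univ).toNNReal) = Measure.dirac 0 := by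
      refine Measure.ext_iff_singleton.2 fun n => ?_
      rw [poissonMeasure_singleton]
      rcases n with _ | n <;> simp
    rw [h0, lintegral_dirac, Measure.map_apply (measurable_sum_dirac 0) MeasurableSet.univ,
      Measure.pi_of_empty]
    simp
  · have h1 : IsProbabilityMeasure (ν[|Set.univ]) :=
      cond_isProbabilityMeasure (by simpa using h)
    have h2 : ∀ k : ℕ, ((Measure.pi fun _ : Fin k => ν[|Set.univ]).map
        fun x => (∑ j, Measure.dirac (x j) : Measure X)) Set.univ = 1 := by
      intro k
      rw [Measure.map_apply (measurable_sum_dirac k) MeasurableSet.univ]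
      simp
    simp [h2]

theorem countable_atoms [MeasurableSingletonClass X] (ν : Measure X) [IsFiniteMeasure ν] :
    (atoms ν).Countable := by
  have h := Measure.countable_meas_pos_of_disjoint_iUnion (μ := ν)
    (As := fun x : X => ({x} : Set X)) (fun x => measurableSet_singleton x)
    (fun x y hxy => Set.disjoint_singleton.2 hxy)
  exact h.mono fun x hx => pos_iff_ne_zero.2 hx

theorem isProbabilityMeasure_atomicLaw [MeasurableSingletonClass X] (ν : Measure X)
    [IsFiniteMeasure ν] : IsProbabilityMeasure (atomicLaw ν) := by
  have : Countable (atoms ν) := (countable_atoms ν).to_subtype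
  refine Measure.isProbabilityMeasure_map (Measurable.aemeasurable ?_)
  refine Measure.measurable_of_measurable_coe _ fun s hs => ?_
  simp only [Measure.sum_apply _ hs, Measure.smul_apply, smul_eq_mul]
  exact Measurable.tsum fun x => (measurable_pi_apply x).mul_const _

theorem isProbabilityMeasure_bernoulliLaw [MeasurableSingletonClass X] (ν : Measure X)
    [IsFiniteMeasure ν] : IsProbabilityMeasure (bernoulliLaw ν) := by
  have : IsFiniteMeasure (diffusePart ν) := by unfold diffusePart; infer_instance
  have := isProbabilityMeasure_poissonLaw (diffusePart ν)
  have := isProbabilityMeasure_atomicLaw ν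
  exact Measure.isProbabilityMeasure_map (by fun_prop)

end RandomMeasures

section Model

variable {Ω X : Type*} [MeasurableSpace X]

/-! Customers are numbered from `0`: `M i` and `R i` are the random measure and the weight of
customer number `i + 1`. -/

/-- The dishes `S_n` tried by the first `n` customers. -/
def tried (M : ℕ → Ω → Measure X) (n : ℕ) (ω : Ω) : Set X :=
  {x | ∃ i < n, M i ω {x} = 1}

/-- The total weight of the first `n` customers. -/
def totalWeight (R : ℕ → Ω → ℝ) (n : ℕ) (ω : Ω) : ℝ := ∑ i ∈ Finset.range n, R i ω

/-- The probability that customer `n + 1` includes the dish `x ∈ S_n`. -/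
def inclusionProb (β c : ℝ) (M : ℕ → Ω → Measure X) (R : ℕ → Ω → ℝ) (n : ℕ) (ω : Ω) (x : X) : ℝ :=
  ((∑ i ∈ Finset.range n, R i ω * (M i ω).real {x}) - β) / (totalWeight R n ω + c)

/-- The rate `Λ_n` at which customer `n + 1` tries new dishes. -/
def newRate (α β c : ℝ) (R : ℕ → Ω → ℝ) (n : ℕ) (ω : Ω) : ℝ :=
  α * (Real.Gamma (c + 1) * Real.Gamma (c + β + totalWeight R n ω)) /
    (Real.Gamma (c + β) * Real.Gamma (c + 1 + totalWeight R n ω))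

/-- The random hazard measure `ν_n`. -/
def hazard (m : Measure X) (α β c : ℝ) (M : ℕ → Ω → Measure X) (R : ℕ → Ω → ℝ) (n : ℕ) (ω : Ω) :
    Measure X :=
  (Measure.sum fun x : tried M n ω =>
      ENNReal.ofReal (inclusionProb β c M R n ω (x : X)) • Measure.dirac (x : X)) +
    ENNReal.ofReal (newRate α β c R n ω) • m

/-- The σ-field `F_n` generated by the measures and the weights of the first `n` customers
(the trivial one for `n = 0`). -/
@[reducible]
def past (M : ℕ → Ω → Measure X) (R : ℕ → Ω → ℝ) (n : ℕ) : MeasurableSpace Ω :=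
  ⨆ i, ⨆ (_ : i < n), MeasurableSpace.comap (M i) inferInstance ⊔
    MeasurableSpace.comap (R i) inferInstance

/-- `((M_n, R_n))` is a weighted Indian buffet process with parameters `m, α, β, c`. -/
structure IsWeightedIBP [MeasurableSpace Ω] (P : Measure Ω) (m : Measure X) (α β c : ℝ)
    (M : ℕ → Ω → Measure X) (R : ℕ → Ω → ℝ) : Prop where
  alpha_pos : 0 < α
  beta_lt : β < 1
  c_gt : -β < c
  isProbabilityMeasure : IsProbabilityMeasure m
  diffuse : ∀ x, m {x} = 0
  measurable_M : ∀ n, Measurable (M n)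
  finite_M : ∀ n ω, IsFiniteMeasure (M n ω)
  measurable_R : ∀ n, Measurable (R n)
  weight_ge : ∃ u : ℝ, max β 0 < u ∧ ∀ n, ∀ᵐ ω ∂P, u ≤ R n ω
  /-- `R_n` is independent of `(M_1, …, M_n, R_1, …, R_{n-1})`. -/
  indep_R : ∀ n, Indep (MeasurableSpace.comap (R n) inferInstance)
    (past M R n ⊔ MeasurableSpace.comap (M n) inferInstance) P
  /-- Conditionally on `F_n`, the law of `M_{n+1}` is `BeP(ν_n)`. -/
  law_M : ∀ n (A : Set (Measure X)), MeasurableSet A →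
    P⟦M n ⁻¹' A | past M R n⟧ =ᵐ[P] fun ω => (bernoulliLaw (hazard m α β c M R n ω)).real A

/-- The number of dishes tried by customer `n + 1`. -/
def dishes (M : ℕ → Ω → Measure X) (n : ℕ) (ω : Ω) : ℝ := (M n ω).real Set.univ

/-- The mean number of dishes tried by each of the first `n` customers. -/
def meanDishes (M : ℕ → Ω → Measure X) (n : ℕ) (ω : Ω) : ℝ :=
  (1 / (n : ℝ)) * ∑ i ∈ Finset.range n, dishes M i ω

end Model

/-- Stable convergence of the `E`-valued random variables `Y n` to the random probability
measure `κ`. -/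
def StablyConverges {Ω E : Type*} [MeasurableSpace Ω] [TopologicalSpace E] [MeasurableSpace E]
    (P : Measure Ω) (Y : ℕ → Ω → E) (κ : Ω → Measure E) : Prop :=
  Measurable κ ∧ (∀ ω, IsProbabilityMeasure (κ ω)) ∧
  ∀ H : Set Ω, MeasurableSet H → 0 < P H → ∀ f : E →ᵇ ℝ,
    Tendsto (fun n => ∫ ω, f (Y n ω) ∂P[|H]) atTop (𝓝 (∫ ω, (∫ y, f y ∂κ ω) ∂P[|H]))

/-- The random probability measure `N(0, v)`, for a random variance `v ≥ 0`. -/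
def centeredGaussian {Ω : Type*} (v : Ω → ℝ) (ω : Ω) : Measure ℝ :=
  gaussianReal 0 (v ω).toNNReal

end WeightedIBP

end

noncomputable section

namespace WeightedIBP

/-! ### Moments of Poisson and Bernoulli laws -/

/-! Given the past, customer n+1 tries a Poisson number of new dishes, with mean `Λ n`, and
independently each old dish x with its inclusion probability p(x). Let `D n` be the sum of the p(x)
and `G n` the sum of the p(x)². Then the number `K n` of dishes has predictive mean J = `D n + Λ n`
and predictive variance J - `G n` (`lintegral_sq_univ_bernoulliLaw`). Both `D` and `G` satisfy
recursions driven by `K n`, the number `N n` of new dishes, the sum `C n` of p(x) over the old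
dishes tried, and the weight `R n`. All later arguments use only these recursions and conditional
moments, collected in `IsPredictiveSystem`.

Laws of large numbers. Since `R n` is independent of the past and of `M n`, multiplying a centred
function of these by a bounded function of the weights leaves it centred
(`condExp_mul_indep_eq_zero`). Hence the increments of `D` and of `G` are martingale differences
plus a nonnegative drift. The drift of `D` is of order `Λ n / n`, which is summable because `Λ n` is
at most of order n to the power max(β,0) - 1. So `D` and `G ≤ D` are submartingales bounded in L¹,
and J → Z, J - G → V almost surely. The strong law for martingale differences, applied as long as J
stays below a level a, gives the limits Z of the means and Q = Z² + V of the mean squares.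

Central limit theorems. Let B be a predictive mean that is a martingale up to small errors.
Summation by parts (`sqrt_mul_mean_sub_eq`) writes √n (K̄_n - B_N), for N ≥ n, as a sum over k < N
with weights 1/√n for k < n and √n/(k+1) for k ≥ n. The leading summand is (K_k - J_k) times 1{k<n}
- R_k/r, because (k+1) over the total weight tends to 1/r. The second moment of this factor tends to
(q - r²)/r² for k < n and to q/r² for k ≥ n. The squared weights have total mass 1 on the first
range and n ∑ 1/(k+1)² on the second. With N = n the second mass is 0 and the variance is τ²; with N
≥ n² it tends to 1 and the variance is σ². In the latter case N is also taken so large that B_N may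
be replaced by Z. The leading sum is handled by a stable central limit theorem for martingale
difference arrays (`tendsto_setIntegral_exp_sum`).

The error terms in B decide the hypothesis on β. For β < 1/2 one takes B = D, since `Λ` is square
summable and √n `Λ n` → 0. For unit weights B = D + Λ is an exact martingale, by the functional
equation of the Gamma function (`rateOf_add_one`).

Positivity of V. Fix a dish that has been tried. Its weight minus β and the total weight plus c form
a randomly reinforced urn, whose proportion p is the inclusion probability, and J - G ≥ p(1 - p).
Once both colours exceed the bound b on the weights, the inverse proportions shifted by b have
nonincreasing expectations (`urn_ratio_le`), so Fatou's lemma excludes p(1 - p) → 0. For β ≥ 0 some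
dish is tried almost surely, since `Λ n` is at least of order 1/n and the conditional Borel–Cantelli
lemma applies. -/

theorem lintegral_poissonMeasure (r : ℝ≥0) (f : ℕ → ℝ≥0∞) :
    ∫⁻ k, f k ∂poissonMeasure r
      = ∑' k, ENNReal.ofReal (Real.exp (-r) * r ^ k / k.factorial) * f k := by
  rw [poissonMeasure, lintegral_sum_measure]
  simp

/-- The Stein–Chen identity for the Poisson law. -/
theorem lintegral_mul_poissonMeasure (r : ℝ≥0) (f : ℕ → ℝ≥0∞) :
    ∫⁻ k, (k : ℝ≥0∞) * f k ∂poissonMeasure r = r * ∫⁻ k, f (k + 1) ∂poissonMeasure r := by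
  rw [lintegral_poissonMeasure, lintegral_poissonMeasure, tsum_eq_zero_add' ENNReal.summable,
    ← ENNReal.tsum_mul_left]
  simp only [Nat.cast_zero, zero_mul, mul_zero, zero_add]
  refine tsum_congr fun k => ?_
  rw [← mul_assoc, ← mul_assoc]
  congr 1
  rw [← ENNReal.ofReal_natCast, ← ENNReal.ofReal_mul (by positivity),
    ← ENNReal.ofReal_coe_nnreal, ← ENNReal.ofReal_mul (by positivity)]
  congr 1
  rw [Nat.factorial_succ]
  push_cast
  field_simp
  ring

theorem lintegral_id_poissonMeasure (r : ℝ≥0) :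
    ∫⁻ k, (k : ℝ≥0∞) ∂poissonMeasure r = r := by
  have := lintegral_mul_poissonMeasure r fun _ => 1
  simpa using this

theorem lintegral_sq_poissonMeasure (r : ℝ≥0) :
    ∫⁻ k, (k : ℝ≥0∞) ^ 2 ∂poissonMeasure r = (r : ℝ≥0∞) ^ 2 + r := by
  have := lintegral_mul_poissonMeasure r fun k => (k : ℝ≥0∞)
  simp only [← pow_two] at this
  rw [this]
  push_cast
  rw [lintegral_add_right _ measurable_const, lintegral_id_poissonMeasure]
  simp
  ring

/-- Only the value of the moment generating function at 1 is needed: it dominates the fourth moment.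
-/
theorem lintegral_exp_poissonMeasure (r : ℝ≥0) :
    ∫⁻ k, ENNReal.ofReal (Real.exp k) ∂poissonMeasure r
      = ENNReal.ofReal (Real.exp ((Real.exp 1 - 1) * r)) := by
  rw [lintegral_poissonMeasure]
  have h1 : ∀ k : ℕ, ENNReal.ofReal (Real.exp (-r) * r ^ k / k.factorial) *
      ENNReal.ofReal (Real.exp k)
      = ENNReal.ofReal (Real.exp (-r) * ((r * Real.exp 1) ^ k / k.factorial)) := by
    intro k
    rw [← ENNReal.ofReal_mul (by positivity)]
    congr 1
    rw [mul_pow, ← Real.exp_nat_mul]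
    simp
    ring
  simp_rw [h1]
  have h2 := (NormedSpace.expSeries_div_hasSum_exp ((r : ℝ) * Real.exp 1)).mul_left
    (Real.exp (-r))
  rw [← Real.exp_eq_exp_ℝ] at h2
  rw [← ENNReal.ofReal_tsum_of_nonneg (fun k => by positivity) h2.summable, h2.tsum_eq,
    ← Real.exp_add]
  congr 2
  ring

/-! ### Moments of sums of independent indicators -/

section Indicators

variable {ι : Type*} [Fintype ι]

/-- The Bernoulli law on `{0, 1} ⊆ [0, ∞]` with mean `p ∧ 1`. -/
abbrev indicatorLaw (p : ℝ≥0∞) : Measure ℝ≥0∞ :=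
  bernoulliMeasure (1 : ℝ≥0∞) 0 (Set.projIcc (0 : ℝ) 1 zero_le_one p.toReal)

theorem lintegral_indicatorLaw {p : ℝ≥0∞} (hp : p ≤ 1) (f : ℝ≥0∞ → ℝ≥0∞) :
    ∫⁻ v, f v ∂indicatorLaw p = p * f 1 + (1 - p) * f 0 := by
  have h0 : p ≠ ∞ := ne_top_of_le_ne_top ENNReal.one_ne_top hp
  have h1 : p.toReal ∈ Set.Icc (0 : ℝ) 1 :=
    ⟨ENNReal.toReal_nonneg, by simpa using ENNReal.toReal_mono ENNReal.one_ne_top hp⟩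
  rw [indicatorLaw, bernoulliMeasure_def, Set.projIcc_of_mem _ h1, lintegral_add_measure]
  simp only [lintegral_smul_measure, lintegral_dirac, ENNReal.smul_def, smul_eq_mul]
  congr 2
  · refine (ENNReal.toReal_eq_toReal_iff' (by simp) h0).1 ?_
    simp [unitInterval.toNNReal]
    rfl
  · refine (ENNReal.toReal_eq_toReal_iff' (by simp) (by simp)).1 ?_
    rw [ENNReal.toReal_sub_of_le hp ENNReal.one_ne_top]
    simp [unitInterval.toNNReal, unitInterval.symm]
    rfl

variable {p : ι → ℝ≥0∞}

theorem ae_indicator_pi :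
    ∀ᵐ V ∂Measure.pi fun i => indicatorLaw (p i), ∀ i, V i = 0 ∨ V i = 1 := by
  refine ae_all_iff.2 fun i => ?_
  have h := (measurePreserving_eval (fun i => indicatorLaw (p i)) i).quasiMeasurePreserving
  refine h.ae (p := fun v => v = 0 ∨ v = 1) ?_
  have : {v : ℝ≥0∞ | v = 0 ∨ v = 1}ᶜ = {0, 1}ᶜ := by ext; simp
  rw [ae_iff]
  change indicatorLaw (p i) {v : ℝ≥0∞ | v = 0 ∨ v = 1}ᶜ = 0
  rw [this]
  apply bernoulliMeasure_apply_of_notMem_of_notMem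
  · exact (Set.toFinite _).measurableSet.compl
  · simp
  · simp

theorem lintegral_indicator_pi (hp : ∀ i, p i ≤ 1) (i : ι) :
    ∫⁻ V, V i ∂Measure.pi (fun i => indicatorLaw (p i)) = p i := by
  rw [(measurePreserving_eval (fun i => indicatorLaw (p i)) i).lintegral_comp
    (f := fun v => v) measurable_id, lintegral_indicatorLaw (hp i)]
  simp

theorem iIndepFun_indicator_pi :
    iIndepFun (fun (i : ι) (V : ι → ℝ≥0∞) => V i) (Measure.pi fun i => indicatorLaw (p i)) :=
  iIndepFun_pi (X := fun _ v => v) fun _ => aemeasurable_id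

/-- Off the diagonal the expectation of the product factors; on the diagonal V² = V. The squares are
added on the left because subtraction is truncated in `ℝ≥0∞`. -/
theorem lintegral_sq_sum_indicator_pi (hp : ∀ i, p i ≤ 1) :
    ∫⁻ V, (∑ i, V i) ^ 2 ∂Measure.pi (fun i => indicatorLaw (p i)) + ∑ i, p i ^ 2
      = (∑ i, p i) ^ 2 + ∑ i, p i := by
  classical
  set μ := Measure.pi fun i => indicatorLaw (p i)
  have hm : ∀ i, Measurable fun V : ι → ℝ≥0∞ => V i := fun i => measurable_pi_apply i
  have h1 : ∫⁻ V, (∑ i, V i) ^ 2 ∂μ = ∑ i, ∑ j, ∫⁻ V, V i * V j ∂μ := by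
    simp_rw [pow_two, Finset.sum_mul_sum]
    rw [lintegral_finsetSum _ fun i _ => by fun_prop]
    refine Finset.sum_congr rfl fun i _ => ?_
    rw [lintegral_finsetSum _ fun j _ => by fun_prop]
  have h2 : ∀ i j, ∫⁻ V, V i * V j ∂μ + (if i = j then p i ^ 2 else 0)
      = p i * p j + if i = j then p i else 0 := by
    intro i j
    split_ifs with h
    · subst h
      have : ∫⁻ V, V i * V i ∂μ = ∫⁻ V, V i ∂μ := by
        refine lintegral_congr_ae ?_
        filter_upwards [ae_indicator_pi (p := p)] with V hV
        rcases hV i with h | h <;> simp [h]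
      rw [this, lintegral_indicator_pi hp, pow_two, add_comm]
    · have := lintegral_mul_eq_lintegral_mul_lintegral_of_indepFun (hm i) (hm j)
        (iIndepFun_indicator_pi (p := p) |>.indepFun h)
      simp only [Pi.mul_apply] at this
      rw [this, lintegral_indicator_pi hp, lintegral_indicator_pi hp]
  -- Single sums become sums over the diagonal, so that the identity can be checked entry by entry
  -- with `h2`.
  have h3 : ∀ f : ι → ℝ≥0∞, ∑ i, f i = ∑ i, ∑ j, if i = j then f i else 0 := by
    intro f
    simp
  rw [h1, h3 fun i => p i ^ 2, h3 fun i => p i, pow_two (∑ i, ∑ j, _), ← h3 p, Finset.sum_mul_sum,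
    h3 p]
  simp_rw [← Finset.sum_add_distrib]
  exact Finset.sum_congr rfl fun i _ => Finset.sum_congr rfl fun j _ => h2 i j

/-- By independence the left side is the product of the factors 1 + (e - 1) p, each of which is at
most exp((e - 1) p). -/
theorem lintegral_exp_sum_indicator_pi_le (hp : ∀ i, p i ≤ 1) :
    ∫⁻ V, ENNReal.ofReal (Real.exp (∑ i, V i).toReal) ∂Measure.pi (fun i => indicatorLaw (p i))
      ≤ ENNReal.ofReal (Real.exp ((Real.exp 1 - 1) * ∑ i, (p i).toReal)) := by
  set μ := Measure.pi fun i => indicatorLaw (p i)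
  let f : ℝ≥0∞ → ℝ≥0∞ := fun v => ENNReal.ofReal (Real.exp v.toReal)
  have hf : Measurable f := by fun_prop
  have h1 : ∫⁻ V, ENNReal.ofReal (Real.exp (∑ i, V i).toReal) ∂μ
      = ∫⁻ V, ∏ i, f (V i) ∂μ := by
    refine lintegral_congr_ae ?_
    filter_upwards [ae_indicator_pi (p := p)] with V hV
    have hV' : ∀ i ∈ Finset.univ, V i ≠ ∞ := fun i _ => by rcases hV i with h | h <;> simp [h]
    rw [ENNReal.toReal_sum hV', Real.exp_sum, ENNReal.ofReal_prod_of_nonneg]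
    exact fun i _ => (Real.exp_pos _).le
  have h2 := lintegral_prod_eq_prod_lintegral_of_indepFun (μ := μ) Finset.univ
    (fun i V => f (V i)) ((iIndepFun_indicator_pi (p := p)).comp (fun _ => f) fun _ => hf)
    (fun i => by fun_prop)
  rw [h1, h2, Finset.mul_sum, Real.exp_sum, ENNReal.ofReal_prod_of_nonneg
    fun i _ => (Real.exp_pos _).le]
  refine Finset.prod_le_prod' fun i _ => ?_
  rw [(measurePreserving_eval (fun i => indicatorLaw (p i)) i).lintegral_comp hf,
    lintegral_indicatorLaw (hp i)]
  have h0 : p i ≠ ∞ := ne_top_of_le_ne_top ENNReal.one_ne_top (hp i)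
  have h01 : (p i).toReal ≤ 1 := by simpa using ENNReal.toReal_mono ENNReal.one_ne_top (hp i)
  have h3 : p i * f 1 + (1 - p i) * f 0
      = ENNReal.ofReal ((Real.exp 1 - 1) * (p i).toReal + 1) := by
    conv_lhs => rw [← ENNReal.ofReal_toReal h0, ← ENNReal.ofReal_one,
      ← ENNReal.ofReal_sub _ ENNReal.toReal_nonneg]
    simp only [f, ENNReal.toReal_ofReal zero_le_one, ENNReal.toReal_zero, Real.exp_zero]
    rw [← ENNReal.ofReal_mul (by positivity), ← ENNReal.ofReal_mul (by linarith),
      ← ENNReal.ofReal_add (by positivity) (by linarith)]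
    congr 1
    ring
  rw [h3]
  exact ENNReal.ofReal_le_ofReal (Real.add_one_le_exp _)

end Indicators

end WeightedIBP

namespace WeightedIBP

/-! ### Measurable functionals of finite measures -/

section FiniteMeasures

variable {X : Type*} [MeasurableSpace X]

/-- The kernel that normalizes finite measures to total mass at most one, and discards the
others. -/
def normalizedKernel (X : Type*) [MeasurableSpace X] : Kernel (Measure X) X where
  toFun μ := if μ Set.univ = ∞ then 0 else (μ Set.univ)⁻¹ • μ
  measurable' := by
    have h : Measurable fun μ : Measure X => μ Set.univ :=
      Measure.measurable_coe MeasurableSet.univ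
    refine Measurable.ite (h (measurableSet_singleton _)) measurable_const ?_
    refine Measure.measurable_of_measurable_coe _ fun s hs => ?_
    simp only [Measure.smul_apply, smul_eq_mul]
    exact h.inv.mul (Measure.measurable_coe hs)

instance : IsFiniteKernel (normalizedKernel X) := by
  refine ⟨1, ENNReal.one_lt_top, fun μ => ?_⟩
  change (if μ Set.univ = ∞ then 0 else (μ Set.univ)⁻¹ • μ : Measure X) Set.univ ≤ 1
  split_ifs
  · simp
  · simp [ENNReal.inv_mul_le_one]

theorem smul_normalizedKernel (μ : Measure X) [IsFiniteMeasure μ] :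
    μ Set.univ • normalizedKernel X μ = μ := by
  change μ Set.univ • (if μ Set.univ = ∞ then 0 else (μ Set.univ)⁻¹ • μ : Measure X) = μ
  rw [if_neg (measure_ne_top _ _), smul_smul]
  by_cases h : μ Set.univ = 0
  · rw [Measure.measure_univ_eq_zero.1 h]; simp
  · rw [ENNReal.mul_inv_cancel h (measure_ne_top _ _), one_smul]

/-- The integral of `φ` against a finite measure; a version that is jointly measurable. -/
def finIntegral (φ : X → ℝ≥0∞) (μ : Measure X) : ℝ≥0∞ :=
  μ Set.univ * ∫⁻ x, φ x ∂normalizedKernel X μ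

theorem finIntegral_eq (φ : X → ℝ≥0∞) (μ : Measure X) [IsFiniteMeasure μ] :
    finIntegral φ μ = ∫⁻ x, φ x ∂μ := by
  conv_rhs => rw [← smul_normalizedKernel μ]
  rw [lintegral_smul_measure, finIntegral, smul_eq_mul]

/-- Integrals with a parameter are measurable along s-finite kernels. The identity map on measures
is not such a kernel in general; its normalization is one, and the total mass is restored as a
factor. -/
theorem measurable_finIntegral {Y : Type*} [MeasurableSpace Y] {φ : Y × X → ℝ≥0∞}
    (hφ : Measurable φ) :
    Measurable fun q : Y × Measure X => finIntegral (fun x => φ (q.1, x)) q.2 := by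
  have h : Measurable fun q : Y × Measure X => q.2 Set.univ :=
    (Measure.measurable_coe MeasurableSet.univ).comp measurable_snd
  refine h.mul ?_
  have h2 : Measurable fun z : (Y × Measure X) × X => φ (z.1.1, z.2) := by fun_prop
  exact h2.lintegral_kernel_prod_right (κ := (normalizedKernel X).comap Prod.snd measurable_snd)

/-- Finite sums of distinct unit point masses. -/
def IsSimple (μ : Measure X) : Prop := IsFiniteMeasure μ ∧ ∀ᵐ x ∂μ, μ {x} = 1

variable [MeasurableEq X] [MeasurableSingletonClass X]

/-- The mass of the point `x`, as a jointly measurable function for finite measures. -/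
def pointMass (μ : Measure X) (x : X) : ℝ≥0∞ :=
  finIntegral (fun y => Set.indicator (Set.diagonal X) 1 (x, y)) μ

theorem pointMass_eq (μ : Measure X) [IsFiniteMeasure μ] (x : X) : pointMass μ x = μ {x} := by
  rw [pointMass, finIntegral_eq, ← lintegral_indicator_one (measurableSet_singleton x)]
  refine lintegral_congr fun y => ?_
  by_cases h : x = y
  · subst h; simp
  · rw [Set.indicator_of_notMem (by simpa using h),
      Set.indicator_of_notMem (by simpa using Ne.symm h)]

theorem measurable_pointMass : Measurable fun q : Measure X × X => pointMass q.1 q.2 :=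
  (measurable_finIntegral (φ := Set.indicator (Set.diagonal X) 1)
    (measurable_one.indicator MeasurableEq.measurableSet_diagonal)).comp measurable_swap

/-- The almost everywhere condition says that a jointly measurable indicator has integral zero
against the measure itself. Measurability matters because the conditional law of the process is
prescribed on measurable sets of measures only. -/
theorem measurableSet_isSimple : MeasurableSet {μ : Measure X | IsSimple μ} := by
  have h1 : MeasurableSet {q : Measure X × X | pointMass q.1 q.2 ≠ 1} :=
    measurable_pointMass (measurableSet_singleton _).compl
  have h2 := (measurable_finIntegral (φ := Set.indicator _ 1) (measurable_one.indicator h1)).comp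
    (measurable_id.prodMk measurable_id)
  have h3 : {μ : Measure X | IsSimple μ} = {μ | μ Set.univ ≠ ∞} ∩ {μ | finIntegral (fun x =>
      Set.indicator {q : Measure X × X | pointMass q.1 q.2 ≠ 1} 1 (μ, x)) μ = 0} := by
    ext μ
    simp only [IsSimple, Set.mem_ofPred_eq, Set.mem_inter_iff]
    have : IsFiniteMeasure μ ↔ μ Set.univ ≠ ∞ :=
      ⟨fun h => measure_ne_top _ _, fun h => ⟨lt_top_iff_ne_top.2 h⟩⟩
    rw [this]
    refine and_congr_right fun h => ?_
    have := this.2 h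
    have h4 : ∀ x, Set.indicator {q : Measure X × X | pointMass q.1 q.2 ≠ 1} (1 : Measure X × X → ℝ≥0∞) (μ, x)
        = Set.indicator {x | μ {x} ≠ 1} 1 x := by
      intro x
      by_cases h : μ {x} = 1
      · rw [Set.indicator_of_notMem (by simpa [pointMass_eq] using h),
          Set.indicator_of_notMem (by simpa using h)]
      · rw [Set.indicator_of_mem (by simpa [pointMass_eq] using h),
          Set.indicator_of_mem (by simpa using h)]
        rfl
    rw [finIntegral_eq]
    simp_rw [h4]
    rw [lintegral_indicator_one, ae_iff]
    have h5 : {x | μ {x} ≠ 1} = {x | pointMass μ x ≠ 1} := by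
      ext x; simp [pointMass_eq]
    rw [h5]
    exact (measurable_pointMass.comp measurable_prodMk_left) (measurableSet_singleton _).compl
  rw [h3]
  refine MeasurableSet.inter ?_ (h2 (measurableSet_singleton _))
  exact (Measure.measurable_coe MeasurableSet.univ) (measurableSet_singleton _).compl

end FiniteMeasures

/-! ### Bernoulli random measures with finitely many fixed atoms -/

section BernoulliLaw

variable {X : Type*} [MeasurableSpace X]

theorem lintegral_poissonLaw (ν : Measure X) [IsFiniteMeasure ν] {F : Measure X → ℝ≥0∞}
    (hF : Measurable F) :
    ∫⁻ μ, F μ ∂poissonLaw ν = ∫⁻ k, ∫⁻ x, F (∑ j, Measure.dirac (x j))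
      ∂(Measure.pi fun _ : Fin k => ν[|Set.univ]) ∂poissonMeasure (ν Set.univ).toNNReal := by
  rw [poissonLaw, Measure.lintegral_bind (Measurable.of_discrete).aemeasurable hF.aemeasurable]
  refine lintegral_congr fun k => ?_
  rw [lintegral_map hF (measurable_sum_dirac k)]

variable [MeasurableSingletonClass X] (ν : Measure X) [IsFiniteMeasure ν]

theorem measurable_sum_smul_dirac {ι : Type*} [Countable ι] (x : ι → X) :
    Measurable fun V : ι → ℝ≥0∞ => Measure.sum fun i => V i • Measure.dirac (x i) := by
  refine Measure.measurable_of_measurable_coe _ fun s hs => ?_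
  simp only [Measure.sum_apply _ hs, Measure.smul_apply, smul_eq_mul]
  exact Measurable.tsum fun i => (measurable_pi_apply i).mul_const _

theorem atomicLaw_eq [Fintype (atoms ν)] :
    atomicLaw ν = (Measure.pi fun x : atoms ν => indicatorLaw (ν {(x : X)})).map
      fun V => Measure.sum fun x : atoms ν => V x • Measure.dirac (x : X) := by
  rw [atomicLaw, Measure.infinitePi_eq_pi]

instance : IsFiniteMeasure (diffusePart ν) := by unfold diffusePart; infer_instance

theorem diffusePart_atoms : diffusePart ν (atoms ν) = 0 := by
  rw [diffusePart, Measure.restrict_apply (countable_atoms ν).measurableSet]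
  simp

theorem diffusePart_univ : diffusePart ν Set.univ = ν (atoms ν)ᶜ := by
  rw [diffusePart, Measure.restrict_apply_univ]

theorem diffusePart_singleton (x : X) : diffusePart ν {x} = 0 := by
  rw [diffusePart, Measure.restrict_apply (measurableSet_singleton x)]
  by_cases h : x ∈ atoms ν
  · rw [Set.inter_comm, Set.inter_singleton_eq_empty.2 (by simpa using h)]; simp
  · refine measure_mono_null Set.inter_subset_left ?_
    simpa [atoms] using h

theorem lintegral_diffusePart_add [Fintype (atoms ν)] (φ : X → ℝ≥0∞) :
    ∫⁻ x, φ x ∂ν = ∫⁻ x, φ x ∂diffusePart ν + ∑ x : atoms ν, ν {(x : X)} * φ x := by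
  have h := (countable_atoms ν).measurableSet
  rw [diffusePart, ← lintegral_add_compl φ h, add_comm]
  congr 1
  rw [← lintegral_subtype_comap h, lintegral_fintype]
  refine Finset.sum_congr rfl fun x _ => ?_
  rw [Measure.comap_apply _ Subtype.val_injective (fun s hs => h.subtype_image hs) _
    (measurableSet_singleton x)]
  simp [mul_comm]

/-- Disintegration into the number of Poisson points, their positions, and the indicators at the
atoms. The atoms of the hazard measures are the dishes tried so far, hence finitely many, which
turns the infinite product into a finite one. -/
theorem lintegral_bernoulliLaw [Fintype (atoms ν)] {F : Measure X → ℝ≥0∞} (hF : Measurable F) :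
    ∫⁻ μ, F μ ∂bernoulliLaw ν
      = ∫⁻ k, ∫⁻ x, ∫⁻ V, F (∑ j, Measure.dirac (x j) + ∑ z, V z • Measure.dirac (z : X))
        ∂(Measure.pi fun z : atoms ν => indicatorLaw (ν {(z : X)}))
        ∂(Measure.pi fun _ : Fin k => (diffusePart ν)[|Set.univ])
        ∂poissonMeasure (ν (atoms ν)ᶜ).toNNReal := by
  have := isProbabilityMeasure_poissonLaw (diffusePart ν)
  have := isProbabilityMeasure_atomicLaw ν
  have hadd : Measurable fun μ : Measure X × Measure X => μ.1 + μ.2 := by fun_prop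
  have hF2 : Measurable fun μ : Measure X × Measure X => F (μ.1 + μ.2) := hF.comp hadd
  have h1 : ∀ μ : Measure X, ∫⁻ μ', F (μ + μ') ∂atomicLaw ν
      = ∫⁻ V, F (μ + ∑ z, V z • Measure.dirac (z : X))
        ∂(Measure.pi fun z : atoms ν => indicatorLaw (ν {(z : X)})) := by
    intro μ
    have h2 : Measurable fun μ' : Measure X => F (μ + μ') := hF2.comp measurable_prodMk_left
    rw [atomicLaw_eq, lintegral_map h2 (measurable_sum_smul_dirac _)]
    simp_rw [Measure.sum_fintype]
  rw [bernoulliLaw, lintegral_map hF hadd, lintegral_prod _ hF2.aemeasurable,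
    lintegral_poissonLaw _ hF2.lintegral_prod_right']
  simp_rw [h1, diffusePart_univ]

theorem ae_bernoulliLaw [Fintype (atoms ν)] {p : Measure X → Prop} (hp : MeasurableSet {μ | p μ})
    (h : ∀ k, ∀ᵐ x ∂(Measure.pi fun _ : Fin k => (diffusePart ν)[|Set.univ]),
      ∀ᵐ V ∂(Measure.pi fun z : atoms ν => indicatorLaw (ν {(z : X)})),
        p (∑ j, Measure.dirac (x j) + ∑ z : atoms ν, V z • Measure.dirac (z : X))) :
    ∀ᵐ μ ∂bernoulliLaw ν, p μ := by
  rw [ae_iff]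
  change bernoulliLaw ν {μ | p μ}ᶜ = 0
  rw [← lintegral_indicator_one hp.compl,
    lintegral_bernoulliLaw ν (measurable_one.indicator hp.compl)]
  refine (lintegral_congr fun k => ?_).trans lintegral_zero
  refine (lintegral_congr_ae ?_).trans lintegral_zero
  filter_upwards [h k] with x hx
  refine (lintegral_congr_ae ?_).trans lintegral_zero
  filter_upwards [hx] with V hV
  simpa using hV

theorem ae_pi_notMem_atoms (k : ℕ) :
    ∀ᵐ x ∂(Measure.pi fun _ : Fin k => (diffusePart ν)[|Set.univ]), ∀ j, x j ∉ atoms ν := by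
  refine ae_all_iff.2 fun j => ?_
  have h := Measure.quasiMeasurePreserving_eval (fun _ : Fin k => (diffusePart ν)[|Set.univ]) j
  refine h.ae (p := fun v => v ∉ atoms ν) ?_
  refine cond_absolutelyContinuous.ae_le ?_
  rw [mem_ae_iff]
  convert diffusePart_atoms ν
  ext
  simp [atoms]

/-- For independent positions with a diffuse law the diagonal is a null set. -/
theorem ae_pi_injective [MeasurableEq X] (k : ℕ) :
    ∀ᵐ x ∂(Measure.pi fun _ : Fin k => (diffusePart ν)[|Set.univ]), Function.Injective x := by
  set κ := (diffusePart ν)[|Set.univ] with hκ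
  have h0 : ∀ y, κ {y} = 0 := fun y => cond_absolutelyContinuous (diffusePart_singleton ν y)
  suffices h : ∀ i j : Fin k, i ≠ j → ∀ᵐ x ∂(Measure.pi fun _ : Fin k => κ), x i ≠ x j by
    filter_upwards [ae_all_iff.2 fun i => ae_all_iff.2 fun j => ae_all_iff.2 fun hij => h i j hij]
      with x hx i j hij
    by_contra hne
    exact hx i j hne hij
  intro i j hij
  -- With zero intensity the conditioned measure is 0 rather than a probability; then the product
  -- measure vanishes too, as `i` shows that its index set is nonempty.
  by_cases hd : diffusePart ν Set.univ = 0
  · have h1 : κ = 0 := by rw [hκ, Measure.measure_univ_eq_zero.1 hd]; simp [ProbabilityTheory.cond]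
    have h2 : Measure.pi (fun _ : Fin k => κ) = 0 := by
      rw [← Measure.measure_univ_eq_zero, Measure.pi_univ]
      exact Finset.prod_eq_zero (Finset.mem_univ i) (by simp [h1])
    simp [h2]
  have : IsProbabilityMeasure κ := cond_isProbabilityMeasure hd
  have h1 : IndepFun (fun x : Fin k → X => x i) (fun x => x j) (Measure.pi fun _ => κ) :=
    (iIndepFun_pi (X := fun (_ : Fin k) (v : X) => v) fun _ => aemeasurable_id).indepFun hij
  rw [indepFun_iff_map_prod_eq_prod_map_map (measurable_pi_apply i).aemeasurable
    (measurable_pi_apply j).aemeasurable] at h1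
  have h2 : ∀ l, (Measure.pi fun _ : Fin k => κ).map (fun x => x l) = κ := fun l =>
    (measurePreserving_eval (fun _ : Fin k => κ) l).map_eq
  rw [h2, h2] at h1
  have h3 : (κ.prod κ) (Set.diagonal X) = 0 := by
    rw [Measure.measure_prod_null MeasurableEq.measurableSet_diagonal]
    refine Eventually.of_forall fun y => ?_
    rw [Pi.zero_apply, ← h0 y]
    have h4 : Prod.mk y ⁻¹' Set.diagonal X = {y} := by
      ext z
      simp [eq_comm]
    change κ (Prod.mk y ⁻¹' Set.diagonal X) = _
    rw [h4]
  rw [← h1, Measure.map_apply (by fun_prop) MeasurableEq.measurableSet_diagonal] at h3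
  rw [ae_iff]
  convert h3 using 2
  ext x
  simp

/-- The Poisson points are distinct and avoid the atoms, and the mass at each atom is 0 or 1. -/
theorem ae_isSimple_bernoulliLaw [MeasurableEq X] [Fintype (atoms ν)] :
    ∀ᵐ μ ∂bernoulliLaw ν, IsSimple μ := by
  classical
  refine ae_bernoulliLaw ν measurableSet_isSimple fun k => ?_
  filter_upwards [ae_pi_notMem_atoms ν k, ae_pi_injective ν k] with x hx hinj
  filter_upwards [ae_indicator_pi (p := fun z : atoms ν => ν {(z : X)})] with V hV
  have hV' : ∀ z, V z ≠ ∞ := fun z => by rcases hV z with h | h <;> simp [h]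
  have h1 : ∀ y, (∑ j, Measure.dirac (x j) + ∑ z : atoms ν, V z • Measure.dirac (z : X)) {y}
      = (∑ j, if x j = y then 1 else 0) + ∑ z : atoms ν, if (z : X) = y then V z else 0 := by
    intro y
    simp only [Measure.add_apply, Measure.finsetSum_apply, Measure.smul_apply, smul_eq_mul,
      Measure.dirac_apply' _ (measurableSet_singleton y)]
    refine congrArg₂ _ ?_ ?_
    · exact Finset.sum_congr rfl fun j _ => by simp [Set.indicator_apply]
    · exact Finset.sum_congr rfl fun j _ => by simp [Set.indicator_apply]
  refine ⟨⟨?_⟩, ?_⟩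
  · simp only [Measure.add_apply, Measure.finsetSum_apply, Measure.smul_apply, smul_eq_mul,
      measure_univ, mul_one]
    exact ENNReal.add_lt_top.2 ⟨ENNReal.sum_lt_top.2 fun _ _ => by simp,
      ENNReal.sum_lt_top.2 fun z _ => (hV' z).lt_top⟩
  · simp only [h1]
    refine ae_add_measure_iff.2 ⟨?_, ?_⟩
    · rw [← Measure.sum_fintype, Measure.ae_sum_iff]
      intro i
      rw [ae_dirac_eq]
      change _ = _
      rw [Finset.sum_eq_single i (fun j _ hj => if_neg fun h => hj (hinj h))
          (fun h => absurd (Finset.mem_univ i) h),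
        Finset.sum_eq_zero fun (z : atoms ν) _ => if_neg fun h : (z : X) = x i => hx i (h ▸ z.2)]
      simp
    · rw [← Measure.sum_fintype, Measure.ae_sum_iff]
      intro z
      rcases hV z with h | h
      · simp [h]
      rw [h, one_smul, ae_dirac_eq]
      change _ = _
      rw [Finset.sum_eq_zero fun j _ => if_neg fun h : x j = (z : X) => hx j (h ▸ z.2),
        Finset.sum_eq_single z (fun w _ hw => if_neg fun h => hw (Subtype.ext h)) (by simp)]
      simp [h]

/-- Campbell's formula. The assumption on the diffuse part makes the position law a probability; it
holds for the buffet because new dishes always have a positive rate. -/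
theorem lintegral_lintegral_bernoulliLaw [Fintype (atoms ν)] (hν : ∀ x, ν {x} ≤ 1)
    (hd : ν (atoms ν)ᶜ ≠ 0) {φ : X → ℝ≥0∞} (hφ : Measurable φ) :
    ∫⁻ μ, ∫⁻ x, φ x ∂μ ∂bernoulliLaw ν = ∫⁻ x, φ x ∂ν := by
  have hd' : diffusePart ν Set.univ ≠ 0 := by rwa [diffusePart_univ]
  have : IsProbabilityMeasure ((diffusePart ν)[|Set.univ]) := cond_isProbabilityMeasure hd'
  rw [lintegral_bernoulliLaw ν (Measure.measurable_lintegral hφ), lintegral_diffusePart_add ν]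
  have h1 : ∀ (k : ℕ) (x : Fin k → X) (V : atoms ν → ℝ≥0∞),
      ∫⁻ y, φ y ∂(∑ j, Measure.dirac (x j) + ∑ z : atoms ν, V z • Measure.dirac (z : X))
      = ∑ j, φ (x j) + ∑ z : atoms ν, V z * φ z := by
    intro k x V
    simp [lintegral_add_measure, lintegral_finsetSum_measure, lintegral_dirac' _ hφ]
  simp_rw [h1]
  have h2 : ∀ (k : ℕ) (x : Fin k → X), ∫⁻ V, (∑ j, φ (x j) + ∑ z : atoms ν, V z * φ z)
      ∂(Measure.pi fun z : atoms ν => indicatorLaw (ν {(z : X)}))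
      = ∑ j, φ (x j) + ∑ z : atoms ν, ν {(z : X)} * φ z := by
    intro k x
    rw [lintegral_add_left measurable_const, lintegral_const, measure_univ, mul_one,
      lintegral_finsetSum _ fun z _ => by fun_prop]
    congr 1
    refine Finset.sum_congr rfl fun z _ => ?_
    rw [lintegral_mul_const _ (measurable_pi_apply z),
      lintegral_indicator_pi (p := fun z : atoms ν => ν {(z : X)}) fun _ => hν _]
  simp_rw [h2]
  have h3 : ∀ k : ℕ, ∫⁻ x, (∑ j, φ (x j) + ∑ z : atoms ν, ν {(z : X)} * φ z)
      ∂(Measure.pi fun _ : Fin k => (diffusePart ν)[|Set.univ])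
      = k * ∫⁻ x, φ x ∂(diffusePart ν)[|Set.univ] + ∑ z : atoms ν, ν {(z : X)} * φ z := by
    intro k
    rw [lintegral_add_right _ measurable_const, lintegral_const, measure_univ, mul_one,
      lintegral_finsetSum _ fun z _ => by fun_prop]
    congr 1
    have : ∀ j : Fin k, ∫⁻ x, φ (x j) ∂(Measure.pi fun _ : Fin k => (diffusePart ν)[|Set.univ])
        = ∫⁻ x, φ x ∂(diffusePart ν)[|Set.univ] := fun j =>
      (measurePreserving_eval (fun _ : Fin k => (diffusePart ν)[|Set.univ]) j).lintegral_comp hφ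
    simp [this]
  simp_rw [h3]
  rw [lintegral_add_right _ measurable_const, lintegral_const, measure_univ, mul_one,
    lintegral_mul_const _ (by fun_prop), lintegral_id_poissonMeasure, ProbabilityTheory.cond,
    lintegral_smul_measure, Measure.restrict_univ, smul_eq_mul, ← mul_assoc, diffusePart_univ,
    ENNReal.coe_toNNReal (measure_ne_top _ _), ENNReal.mul_inv_cancel hd (measure_ne_top _ _),
    one_mul]

/-- Under `BeP(ν)`, the numbers of points outside the atoms of `ν` and at the atoms of `ν` are
independent, the first one being Poisson and the second one a sum of independent indicators. -/
theorem lintegral_atoms_bernoulliLaw [Fintype (atoms ν)]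
    (hd : ν (atoms ν)ᶜ ≠ 0) {f : ℝ≥0∞ → ℝ≥0∞ → ℝ≥0∞} (hf : Measurable (Function.uncurry f)) :
    ∫⁻ μ, f (μ (atoms ν)ᶜ) (μ (atoms ν)) ∂bernoulliLaw ν
      = ∫⁻ k, ∫⁻ V, f k (∑ z, V z)
        ∂(Measure.pi fun z : atoms ν => indicatorLaw (ν {(z : X)}))
        ∂poissonMeasure (ν (atoms ν)ᶜ).toNNReal := by
  have hd' : diffusePart ν Set.univ ≠ 0 := by rwa [diffusePart_univ]
  have : IsProbabilityMeasure ((diffusePart ν)[|Set.univ]) := cond_isProbabilityMeasure hd'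
  have hA := (countable_atoms ν).measurableSet
  rw [lintegral_bernoulliLaw ν (F := fun μ => f (μ (atoms ν)ᶜ) (μ (atoms ν)))
    (hf.comp ((Measure.measurable_coe hA.compl).prodMk (Measure.measurable_coe hA)))]
  refine lintegral_congr fun k => ?_
  trans ∫⁻ _, ∫⁻ V, f k (∑ z, V z) ∂(Measure.pi fun z : atoms ν => indicatorLaw (ν {(z : X)}))
    ∂(Measure.pi fun _ : Fin k => (diffusePart ν)[|Set.univ])
  · refine lintegral_congr_ae ?_
    filter_upwards [ae_pi_notMem_atoms ν k] with x hx
    refine lintegral_congr fun V => ?_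
    simp [Measure.dirac_apply' _ hA, Measure.dirac_apply' _ hA.compl, hx]
  · simp

theorem measure_atoms_eq_sum [Fintype (atoms ν)] :
    ν (atoms ν) = ∑ z : atoms ν, ν {(z : X)} := by
  have h := lintegral_diffusePart_add ν ((atoms ν).indicator 1)
  have hA := (countable_atoms ν).measurableSet
  rw [lintegral_indicator_one hA, lintegral_indicator_one hA, diffusePart_atoms, zero_add] at h
  rw [h]
  simp

/-- The variance of the total mass is ν(X) - ∑ ν{z}²: the Poisson part contributes its mean, an
indicator contributes p - p². This is the source of the predictive variance. -/
theorem lintegral_sq_univ_bernoulliLaw [Fintype (atoms ν)] (hν : ∀ x, ν {x} ≤ 1)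
    (hd : ν (atoms ν)ᶜ ≠ 0) :
    ∫⁻ μ, μ Set.univ ^ 2 ∂bernoulliLaw ν + ∑ z : atoms ν, ν {(z : X)} ^ 2
      = ν Set.univ ^ 2 + ν Set.univ := by
  have hA := (countable_atoms ν).measurableSet
  set r := (ν (atoms ν)ᶜ).toNNReal with hr
  have hr' : ν (atoms ν)ᶜ = r := (ENNReal.coe_toNNReal (measure_ne_top _ _)).symm
  have h1 := lintegral_atoms_bernoulliLaw ν hd (f := fun a b => (a + b) ^ 2) (by fun_prop)
  have h2 : ∀ μ : Measure X, μ (atoms ν)ᶜ + μ (atoms ν) = μ Set.univ := fun μ => by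
    rw [add_comm, measure_add_measure_compl hA]
  simp_rw [h2] at h1
  set π := Measure.pi fun z : atoms ν => indicatorLaw (ν {(z : X)})
  have h3 : ∫⁻ V : atoms ν → ℝ≥0∞, ∑ z, V z ∂π = ν (atoms ν) := by
    rw [lintegral_finsetSum _ fun z _ => by fun_prop, measure_atoms_eq_sum]
    exact Finset.sum_congr rfl fun z _ =>
      lintegral_indicator_pi (p := fun z : atoms ν => ν {(z : X)}) (fun _ => hν _) z
  have h4 : ∀ k : ℕ, ∫⁻ V : atoms ν → ℝ≥0∞, (k + ∑ z, V z) ^ 2 ∂π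
      = (k : ℝ≥0∞) ^ 2 + 2 * ν (atoms ν) * k + ∫⁻ V : atoms ν → ℝ≥0∞, (∑ z, V z) ^ 2 ∂π := by
    intro k
    have : ∀ V : atoms ν → ℝ≥0∞, ((k : ℝ≥0∞) + ∑ z, V z) ^ 2
        = ((k : ℝ≥0∞) ^ 2 + 2 * k * ∑ z, V z) + (∑ z, V z) ^ 2 := fun V => by ring
    simp_rw [this]
    rw [lintegral_add_left (by fun_prop), lintegral_add_left (by fun_prop),
      lintegral_const_mul _ (by fun_prop), h3]
    simp
    ring
  rw [h1]
  simp_rw [h4]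
  rw [lintegral_add_right _ measurable_const, lintegral_add_right _ (by fun_prop),
    lintegral_const_mul _ (by fun_prop), lintegral_sq_poissonMeasure, lintegral_id_poissonMeasure,
    lintegral_const, measure_univ, mul_one, add_assoc,
    lintegral_sq_sum_indicator_pi (p := fun z : atoms ν => ν {(z : X)}) fun _ => hν _,
    ← measure_atoms_eq_sum, ← h2 ν, hr', ENNReal.toNNReal_coe]
  ring

theorem lintegral_sq_compl_atoms_bernoulliLaw [Fintype (atoms ν)] (hd : ν (atoms ν)ᶜ ≠ 0) :
    ∫⁻ μ, μ (atoms ν)ᶜ ^ 2 ∂bernoulliLaw ν = ν (atoms ν)ᶜ ^ 2 + ν (atoms ν)ᶜ := by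
  rw [lintegral_atoms_bernoulliLaw ν hd (f := fun a _ => a ^ 2) (by fun_prop)]
  simp [lintegral_sq_poissonMeasure, ENNReal.coe_toNNReal (measure_ne_top ν _)]

theorem bernoulliLaw_compl_atoms_eq_zero [Fintype (atoms ν)] (hd : ν (atoms ν)ᶜ ≠ 0) :
    bernoulliLaw ν {μ | μ (atoms ν)ᶜ = 0} = ENNReal.ofReal (Real.exp (-ν.real (atoms ν)ᶜ)) := by
  have hA := (countable_atoms ν).measurableSet
  have h1 := lintegral_atoms_bernoulliLaw ν hd
    (f := fun a _ => Set.indicator {0} 1 a)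
    ((measurable_one.indicator (measurableSet_singleton 0)).comp measurable_fst)
  rw [← lintegral_indicator_one]
  swap
  · exact (Measure.measurable_coe hA.compl) (measurableSet_singleton 0)
  trans ∫⁻ k : ℕ, Set.indicator {0} 1 k ∂poissonMeasure (ν (atoms ν)ᶜ).toNNReal
  · refine (lintegral_congr fun μ => ?_).trans (h1.trans (lintegral_congr fun k => ?_))
    · rfl
    rcases k with _ | k
    · simp
    · rw [Set.indicator_of_notMem (by simp), lintegral_const, Set.indicator_of_notMem (by simp)]
      simp
  · rw [lintegral_indicator_one (measurableSet_singleton 0), poissonMeasure_singleton]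
    simp [Measure.real, ENNReal.coe_toNNReal_eq_toReal]

/-- The bound depends on the total mass of the hazard alone, so it is uniform wherever the
predictive mean is bounded. -/
theorem lintegral_exp_univ_bernoulliLaw_le [Fintype (atoms ν)] (hν : ∀ x, ν {x} ≤ 1)
    (hd : ν (atoms ν)ᶜ ≠ 0) :
    ∫⁻ μ, ENNReal.ofReal (Real.exp (μ.real Set.univ)) ∂bernoulliLaw ν
      ≤ ENNReal.ofReal (Real.exp ((Real.exp 1 - 1) * ν.real Set.univ)) := by
  have hA := (countable_atoms ν).measurableSet
  have h1 := lintegral_atoms_bernoulliLaw ν hd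
    (f := fun a b => ENNReal.ofReal (Real.exp (a + b).toReal)) (by fun_prop)
  have h2 : ∀ μ : Measure X, μ (atoms ν)ᶜ + μ (atoms ν) = μ Set.univ := fun μ => by
    rw [add_comm, measure_add_measure_compl hA]
  simp_rw [h2] at h1
  change ∫⁻ μ : Measure X, ENNReal.ofReal (Real.exp (μ Set.univ).toReal) ∂bernoulliLaw ν ≤ _
  rw [h1]
  set π := Measure.pi fun z : atoms ν => indicatorLaw (ν {(z : X)})
  have h3 : ∀ k : ℕ, ∫⁻ V : atoms ν → ℝ≥0∞, ENNReal.ofReal (Real.exp (k + ∑ z, V z).toReal) ∂π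
      = ENNReal.ofReal (Real.exp k)
        * ∫⁻ V : atoms ν → ℝ≥0∞, ENNReal.ofReal (Real.exp (∑ z, V z).toReal) ∂π := by
    intro k
    rw [← lintegral_const_mul _ (by fun_prop)]
    refine lintegral_congr_ae ?_
    filter_upwards [ae_indicator_pi (p := fun z : atoms ν => ν {(z : X)})] with V hV
    have hV' : ∀ z, V z ≠ ∞ := fun z => by rcases hV z with h | h <;> simp [h]
    rw [ENNReal.toReal_add (by simp) (ENNReal.sum_ne_top.2 fun z _ => hV' z),
      ← ENNReal.ofReal_mul (by positivity), ← Real.exp_add]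
    simp
  simp_rw [h3]
  rw [lintegral_mul_const _ (by fun_prop), lintegral_exp_poissonMeasure]
  have h4 := lintegral_exp_sum_indicator_pi_le (p := fun z : atoms ν => ν {(z : X)}) fun _ => hν _
  refine (mul_le_mul_right h4 _).trans ?_
  rw [← ENNReal.ofReal_mul (by positivity), ← Real.exp_add, ← mul_add,
    ENNReal.coe_toNNReal_eq_toReal,
    ← ENNReal.toReal_sum fun z _ => measure_ne_top _ _, ← measure_atoms_eq_sum,
    ← ENNReal.toReal_add (measure_ne_top _ _) (measure_ne_top _ _), h2]
  rfl

end BernoulliLaw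

end WeightedIBP

namespace WeightedIBP

/-! ### A stable central limit theorem for martingale difference arrays -/

section Taylor

/-- For |y| ≤ 1 this is Taylor's formula of order three; for |y| ≥ 1 each term is dominated by |y|³.
-/
theorem norm_exp_mul_I_sub_taylor_le (y : ℝ) :
    ‖Complex.exp (y * Complex.I) - (1 + y * Complex.I - y ^ 2 / 2)‖ ≤ 4 * |y| ^ 3 := by
  have hn : ‖(y : ℂ) * Complex.I‖ = |y| := by simp
  rcases le_total |y| 1 with h | h
  · have h1 := Complex.exp_bound (x := (y : ℂ) * Complex.I) (by rwa [hn]) (n := 3) (by norm_num)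
    rw [hn] at h1
    have h2 : ∑ m ∈ Finset.range 3, ((y : ℂ) * Complex.I) ^ m / (m.factorial : ℂ)
        = 1 + y * Complex.I - y ^ 2 / 2 := by
      simp [Finset.sum_range_succ, mul_pow]
      ring
    rw [h2] at h1
    refine h1.trans ?_
    have : (0 : ℝ) ≤ |y| ^ 3 := by positivity
    norm_num [Nat.factorial]
    linarith
  · calc _ ≤ ‖Complex.exp (y * Complex.I)‖ + ‖(1 + y * Complex.I - y ^ 2 / 2 : ℂ)‖ := norm_sub_le _ _
      _ ≤ 1 + (1 + |y| + |y| ^ 2 / 2) := by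
        rw [Complex.norm_exp_ofReal_mul_I]
        gcongr
        refine (norm_sub_le _ _).trans ?_
        gcongr
        · refine (norm_add_le _ _).trans ?_
          simp
        · simp
      _ ≤ 4 * |y| ^ 3 := by
        have h2 : |y| ≤ |y| ^ 3 := le_self_pow₀ h (by norm_num)
        have h3 : |y| ^ 2 ≤ |y| ^ 3 := pow_le_pow_right₀ h (by norm_num)
        linarith

/-- The expression equals (e^c - 1 - c) - a (e^c - 1) + (c - a), so it is of second order up to the
difference of a and c. Here a is half a conditional variance times t², and c is the compensator used
in its place. -/
theorem abs_exp_mul_sub_one_le {a c : ℝ} (ha : 0 ≤ a) (hc : 0 ≤ c) :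
    |Real.exp c * (1 - a) - 1| ≤ (c ^ 2 + a * c) * Real.exp c + |a - c| := by
  have h1 : 1 + c ≤ Real.exp c := by linarith [Real.add_one_le_exp c]
  have h2 : Real.exp c - 1 ≤ c * Real.exp c := by
    have := Real.add_one_le_exp (-c)
    have h3 : Real.exp c * Real.exp (-c) = 1 := by rw [← Real.exp_add]; simp
    nlinarith [Real.exp_pos c]
  have h3 : Real.exp c - 1 - c ≤ c ^ 2 * Real.exp c := by nlinarith
  rw [abs_le]
  have h4 := abs_le.1 (le_refl |a - c|)
  constructor
  · nlinarith [mul_le_mul_of_nonneg_left h2 ha, Real.exp_pos c, sq_nonneg c,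
      mul_nonneg (sq_nonneg c) (Real.exp_pos c).le]
  · nlinarith [mul_nonneg (mul_nonneg ha hc) (Real.exp_pos c).le]

end Taylor

section CLT

variable {Ω : Type*} {m mΩ : MeasurableSpace Ω} {P : Measure Ω} [IsProbabilityMeasure P]

theorem integral_mul_eq_of_condExp (hm : m ≤ mΩ) {f f' : Ω → ℝ}
    (hf : Integrable f P) (hff' : P[f | m] =ᵐ[P] f') {g : Ω → ℂ} (hg : StronglyMeasurable[m] g)
    {b : ℝ} (hb : ∀ ω, ‖g ω‖ ≤ b) :
    ∫ ω, g ω * f ω ∂P = ∫ ω, g ω * f' ω ∂P := by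
  have hfg : Integrable (f • g) P :=
    hf.smul_bdd b (hg.mono hm).aestronglyMeasurable (ae_of_all _ hb)
  have h1 := condExp_smul_of_aestronglyMeasurable_right hf hfg hg.aestronglyMeasurable
  have h2 := integral_condExp hm (μ := P) (f := f • g)
  rw [integral_congr_ae h1] at h2
  have h3 : ∫ ω, g ω * f ω ∂P = ∫ ω, (f • g) ω ∂P := by
    refine integral_congr_ae (ae_of_all _ fun ω => ?_)
    simp [mul_comm]
  rw [h3, ← h2]
  refine integral_congr_ae ?_
  filter_upwards [hff'] with ω hω
  simp [hω, mul_comm]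

theorem integrable_of_integrable_cube {X : Ω → ℝ} (hX : Measurable X)
    (hX3 : Integrable (fun ω => |X ω| ^ 3) P) : Integrable X P := by
  refine ((integrable_const (1 : ℝ)).add hX3).mono' hX.aestronglyMeasurable (ae_of_all _ fun ω => ?_)
  rw [Pi.add_apply, Real.norm_eq_abs]
  rcases le_total |X ω| 1 with h | h
  · have : 0 ≤ |X ω| ^ 3 := by positivity
    linarith
  · have := le_self_pow₀ h (show 3 ≠ 0 by norm_num)
    linarith

theorem integrable_sq_of_integrable_cube {X : Ω → ℝ} (hX : Measurable X)
    (hX3 : Integrable (fun ω => |X ω| ^ 3) P) : Integrable (fun ω => X ω ^ 2) P := by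
  refine ((integrable_const (1 : ℝ)).add hX3).mono' (hX.pow_const 2).aestronglyMeasurable
    (ae_of_all _ fun ω => ?_)
  rw [Pi.add_apply, Real.norm_eq_abs, abs_pow]
  rcases le_total |X ω| 1 with h | h
  · have : 0 ≤ |X ω| ^ 3 := by positivity
    have : |X ω| ^ 2 ≤ 1 := pow_le_one₀ (abs_nonneg _) h
    linarith
  · have := pow_le_pow_right₀ h (show 2 ≤ 3 by norm_num)
    linarith

/-- One step of the exponential martingale argument. -/
theorem norm_integral_exp_step_le (hm : m ≤ mΩ) {X v w : Ω → ℝ}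
    {θ t C B : ℝ} (hX : Measurable X) (hX3 : Integrable (fun ω => |X ω| ^ 3) P)
    (hX1 : P[X | m] =ᵐ[P] 0) (hX2 : P[fun ω => X ω ^ 2 | m] =ᵐ[P] fun ω => θ * v ω)
    (hv : Measurable[m] v) (hw : Measurable[m] w) (hv0 : ∀ ω, 0 ≤ v ω) (hvC : ∀ ω, v ω ≤ C)
    (hw0 : ∀ ω, 0 ≤ w ω) (hwC : ∀ ω, w ω ≤ C) (hθ : 0 ≤ θ)
    {g : Ω → ℂ} (hg : StronglyMeasurable[m] g) (hgB : ∀ ω, ‖g ω‖ ≤ B) :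
    ‖∫ ω, g ω * Complex.exp (t * X ω * Complex.I + (t ^ 2 / 2 * θ * w ω : ℝ)) ∂P - ∫ ω, g ω ∂P‖
      ≤ B * Real.exp (t ^ 2 / 2 * θ * C) * (2 * (t ^ 2 / 2 * θ * C) ^ 2
        + t ^ 2 / 2 * θ * ∫ ω, |v ω - w ω| ∂P + 4 * |t| ^ 3 * ∫ ω, |X ω| ^ 3 ∂P) := by
  obtain ⟨ω₀⟩ : Nonempty Ω := nonempty_of_isProbabilityMeasure P
  have hB : 0 ≤ B := (norm_nonneg _).trans (hgB ω₀)
  have hC : 0 ≤ C := (hv0 ω₀).trans (hvC ω₀)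
  set κ := t ^ 2 / 2 * θ * C with hκ
  have hκ0 : 0 ≤ κ := by positivity
  have ht : 0 ≤ t ^ 2 / 2 * θ := by positivity
  set c : Ω → ℝ := fun ω => t ^ 2 / 2 * θ * w ω with hc
  set a : Ω → ℝ := fun ω => t ^ 2 / 2 * θ * v ω with ha
  have hc0 : ∀ ω, 0 ≤ c ω := fun ω => mul_nonneg ht (hw0 ω)
  have ha0 : ∀ ω, 0 ≤ a ω := fun ω => mul_nonneg ht (hv0 ω)
  have hcκ : ∀ ω, c ω ≤ κ := fun ω => mul_le_mul_of_nonneg_left (hwC ω) ht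
  have haκ : ∀ ω, a ω ≤ κ := fun ω => mul_le_mul_of_nonneg_left (hvC ω) ht
  have hcm : Measurable[m] c := hw.const_mul _
  -- The compensator is known at the earlier time, so it joins the bounded prefactor.
  set G : Ω → ℂ := fun ω => g ω * (Real.exp (c ω) : ℝ) with hG
  have hGm : StronglyMeasurable[m] G :=
    hg.mul (Complex.measurable_ofReal.comp (Real.measurable_exp.comp hcm)).stronglyMeasurable
  have hGB : ∀ ω, ‖G ω‖ ≤ B * Real.exp κ := by
    intro ω
    rw [hG, norm_mul, Complex.norm_real, Real.norm_eq_abs, abs_of_pos (Real.exp_pos _)]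
    exact mul_le_mul (hgB ω) (Real.exp_le_exp.2 (hcκ ω)) (Real.exp_pos _).le hB
  have hXi := integrable_of_integrable_cube hX hX3
  have hX2i := integrable_sq_of_integrable_cube hX hX3
  have hGae : AEStronglyMeasurable G P := (hGm.mono hm).aestronglyMeasurable
  have hGi : Integrable G P := Integrable.of_bound hGae _ (ae_of_all _ hGB)
  have hgae : AEStronglyMeasurable g P := (hg.mono hm).aestronglyMeasurable
  have hgi : Integrable g P := Integrable.of_bound hgae _ (ae_of_all _ hgB)
  have hGX : Integrable (fun ω => G ω * X ω) P := hXi.ofReal.bdd_mul hGae (ae_of_all _ hGB)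
  have hGX2 : Integrable (fun ω => G ω * (X ω ^ 2 : ℝ)) P :=
    hX2i.ofReal.bdd_mul hGae (ae_of_all _ hGB)
  have hvi : Integrable v P := Integrable.of_bound (hv.mono hm le_rfl).aestronglyMeasurable C
    (ae_of_all _ fun ω => by rw [Real.norm_eq_abs, abs_of_nonneg (hv0 ω)]; exact hvC ω)
  have hwi : Integrable w P := Integrable.of_bound (hw.mono hm le_rfl).aestronglyMeasurable C
    (ae_of_all _ fun ω => by rw [Real.norm_eq_abs, abs_of_nonneg (hw0 ω)]; exact hwC ω)
  have hGv : Integrable (fun ω => G ω * (θ * v ω : ℝ)) P :=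
    (hvi.const_mul θ).ofReal.bdd_mul hGae (ae_of_all _ hGB)
  -- In the Taylor expansion the linear term integrates to zero and the quadratic one may be
  -- replaced by the conditional variance; what remains is the Taylor remainder and the second-order
  -- difference of variance and compensator.
  have e1 : ∫ ω, G ω * X ω ∂P = 0 := by
    rw [integral_mul_eq_of_condExp hm hXi hX1 hGm hGB]
    simp
  have e2 : ∫ ω, G ω * (X ω ^ 2 : ℝ) ∂P = ∫ ω, G ω * (θ * v ω : ℝ) ∂P :=
    integral_mul_eq_of_condExp hm hX2i hX2 hGm hGB
  set ρ : Ω → ℂ := fun ω => Complex.exp ((t * X ω : ℝ) * Complex.I)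
    - (1 + (t * X ω : ℝ) * Complex.I - (t * X ω : ℝ) ^ 2 / 2) with hρ
  have hρm : Measurable ρ := by fun_prop
  have hρB : ∀ ω, ‖ρ ω‖ ≤ 4 * |t| ^ 3 * |X ω| ^ 3 := by
    intro ω
    refine (norm_exp_mul_I_sub_taylor_le _).trans_eq ?_
    rw [abs_mul, mul_pow, mul_assoc]
  have hρi : Integrable ρ P :=
    (hX3.const_mul (4 * |t| ^ 3)).mono' hρm.aestronglyMeasurable (ae_of_all _ hρB)
  have hGρ : Integrable (fun ω => G ω * ρ ω) P := hρi.bdd_mul hGae (ae_of_all _ hGB)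
  have e3 : ∫ ω, g ω * Complex.exp (t * X ω * Complex.I + (c ω : ℝ)) ∂P
      = ∫ ω, G ω * ρ ω ∂P + (∫ ω, G ω ∂P + (t * Complex.I) * ∫ ω, G ω * X ω ∂P
        - (t ^ 2 / 2 : ℝ) * ∫ ω, G ω * (X ω ^ 2 : ℝ) ∂P) := by
    have i1 : Integrable (fun ω => G ω + t * Complex.I * (G ω * X ω)) P :=
      hGi.add (hGX.const_mul _)
    have i2 : Integrable (fun ω => G ω + t * Complex.I * (G ω * X ω)
        - (t ^ 2 / 2 : ℝ) * (G ω * (X ω ^ 2 : ℝ))) P := i1.sub (hGX2.const_mul _)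
    rw [← integral_const_mul, ← integral_const_mul, ← integral_add hGi (hGX.const_mul _),
      ← integral_sub i1 (hGX2.const_mul _), ← integral_add hGρ i2]
    refine integral_congr_ae (ae_of_all _ fun ω => ?_)
    simp only [hG, hρ, Complex.exp_add]
    push_cast
    ring
  have e4 : ∫ ω, g ω * Complex.exp (t * X ω * Complex.I + (c ω : ℝ)) ∂P - ∫ ω, g ω ∂P
      = ∫ ω, G ω * ρ ω ∂P + ∫ ω, g ω * (Real.exp (c ω) * (1 - a ω) - 1 : ℝ) ∂P := by
    rw [e3, e1, e2, mul_zero, add_zero, add_sub_assoc]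
    congr 1
    have i1 : Integrable (fun ω => G ω - (t ^ 2 / 2 : ℝ) * (G ω * (θ * v ω : ℝ))) P :=
      hGi.sub (hGv.const_mul _)
    rw [← integral_const_mul, ← integral_sub hGi (hGv.const_mul _), ← integral_sub i1 hgi]
    refine integral_congr_ae (ae_of_all _ fun ω => ?_)
    simp only [hG, ha]
    push_cast
    ring
  rw [e4]
  have b1 : ‖∫ ω, G ω * ρ ω ∂P‖ ≤ B * Real.exp κ * (4 * |t| ^ 3 * ∫ ω, |X ω| ^ 3 ∂P) := by
    rw [← integral_const_mul, ← integral_const_mul]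
    refine norm_integral_le_of_norm_le ((hX3.const_mul _).const_mul _) (ae_of_all _ fun ω => ?_)
    rw [norm_mul]
    exact mul_le_mul (hGB ω) (hρB ω) (norm_nonneg _) (by positivity)
  have b2 : ‖∫ ω, g ω * (Real.exp (c ω) * (1 - a ω) - 1 : ℝ) ∂P‖
      ≤ B * Real.exp κ * (2 * κ ^ 2 + t ^ 2 / 2 * θ * ∫ ω, |v ω - w ω| ∂P) := by
    have hvw : Integrable (fun ω => |v ω - w ω|) P := (hvi.sub hwi).abs
    have : B * Real.exp κ * (2 * κ ^ 2 + t ^ 2 / 2 * θ * ∫ ω, |v ω - w ω| ∂P)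
        = ∫ ω, B * Real.exp κ * (2 * κ ^ 2 + t ^ 2 / 2 * θ * |v ω - w ω|) ∂P := by
      rw [integral_const_mul (B * Real.exp κ), integral_add (integrable_const _)
        (hvw.const_mul _), integral_const_mul (t ^ 2 / 2 * θ)]
      simp
    rw [this]
    refine norm_integral_le_of_norm_le
      (((integrable_const _).add (hvw.const_mul _)).const_mul _) (ae_of_all _ fun ω => ?_)
    rw [norm_mul, Complex.norm_real, Real.norm_eq_abs, mul_assoc]
    refine mul_le_mul (hgB ω) ?_ (abs_nonneg _) hB
    refine (abs_exp_mul_sub_one_le (ha0 ω) (hc0 ω)).trans ?_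
    have h1 : |a ω - c ω| = t ^ 2 / 2 * θ * |v ω - w ω| := by
      simp only [ha, hc]
      rw [← mul_sub, abs_mul, abs_of_nonneg ht]
    have h2 : c ω ^ 2 + a ω * c ω ≤ 2 * κ ^ 2 := by
      have := mul_le_mul (haκ ω) (hcκ ω) (hc0 ω) hκ0
      have := pow_le_pow_left₀ (hc0 ω) (hcκ ω) 2
      nlinarith
    have h3 : Real.exp (c ω) ≤ Real.exp κ := Real.exp_le_exp.2 (hcκ ω)
    have h4 : 1 ≤ Real.exp κ := Real.one_le_exp hκ0
    have h5 : 0 ≤ t ^ 2 / 2 * θ * |v ω - w ω| := by positivity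
    rw [h1]
    calc (c ω ^ 2 + a ω * c ω) * Real.exp (c ω) + t ^ 2 / 2 * θ * |v ω - w ω|
        ≤ (2 * κ ^ 2) * Real.exp κ + t ^ 2 / 2 * θ * |v ω - w ω| := by
          gcongr
      _ ≤ _ := by nlinarith
  refine (norm_add_le _ _).trans ((add_le_add b1 b2).trans_eq ?_)
  ring

/-- The one-step estimate is added up from m to N. The compensator uses the variance frozen at time
m: the total compensation is then known at time m and can be cancelled by the choice of `g`, at the
price of the mean distance of `v k` from `v m`. -/
theorem norm_integral_exp_sum_sub_le (ℱ : Filtration ℕ mΩ) {X v : ℕ → Ω → ℝ} {θ : ℕ → ℝ}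
    {t C : ℝ} (hX : ∀ k, Measurable[ℱ (k + 1)] (X k))
    (hX3 : ∀ k, Integrable (fun ω => |X k ω| ^ 3) P) (hX1 : ∀ k, P[X k | ℱ k] =ᵐ[P] 0)
    (hX2 : ∀ k, P[fun ω => X k ω ^ 2 | ℱ k] =ᵐ[P] fun ω => θ k * v k ω)
    (hv : ∀ k, Measurable[ℱ k] (v k)) (hv0 : ∀ k ω, 0 ≤ v k ω) (hvC : ∀ k ω, v k ω ≤ C)
    (hθ : ∀ k, 0 ≤ θ k) {m N : ℕ} (hmN : m ≤ N)
    {g : Ω → ℂ} (hg : StronglyMeasurable[ℱ m] g) (hg1 : ∀ ω, ‖g ω‖ ≤ 1) :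
    ‖∫ ω, g ω * Complex.exp (t * (∑ k ∈ Finset.Ico m N, X k ω : ℝ) * Complex.I
        + (t ^ 2 / 2 * (∑ k ∈ Finset.Ico m N, θ k) * v m ω : ℝ)) ∂P - ∫ ω, g ω ∂P‖
      ≤ Real.exp (t ^ 2 / 2 * (∑ k ∈ Finset.Ico m N, θ k) * C) * ∑ k ∈ Finset.Ico m N,
        (2 * (t ^ 2 / 2 * θ k * C) ^ 2 + t ^ 2 / 2 * θ k * ∫ ω, |v k ω - v m ω| ∂P
          + 4 * |t| ^ 3 * ∫ ω, |X k ω| ^ 3 ∂P) := by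
  obtain ⟨ω₀⟩ : Nonempty Ω := nonempty_of_isProbabilityMeasure P
  have hC : 0 ≤ C := (hv0 0 ω₀).trans (hvC 0 ω₀)
  induction N, hmN using Nat.le_induction with
  | base => simp
  | succ N hmN ih =>
    set S := ∑ k ∈ Finset.Ico m N, θ k with hS
    have hS0 : 0 ≤ S := Finset.sum_nonneg fun k _ => hθ k
    simp only [Finset.sum_Ico_succ_top hmN, ← hS]
    set e : ℕ → ℝ := fun k => 2 * (t ^ 2 / 2 * θ k * C) ^ 2
      + t ^ 2 / 2 * θ k * ∫ ω, |v k ω - v m ω| ∂P + 4 * |t| ^ 3 * ∫ ω, |X k ω| ^ 3 ∂P with he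
    have he0 : ∀ k, 0 ≤ e k := fun k => by
      have h1 : 0 ≤ ∫ ω, |v k ω - v m ω| ∂P := integral_nonneg fun _ => abs_nonneg _
      have h2 : 0 ≤ ∫ ω, |X k ω| ^ 3 ∂P := integral_nonneg fun _ => by positivity
      have := hθ k
      positivity
    -- The product up to time N is the prefactor of the next step; its modulus is controlled by the
    -- accumulated compensator, since `v m` is bounded by `C`.
    set g' : Ω → ℂ := fun ω => g ω * Complex.exp (t * (∑ k ∈ Finset.Ico m N, X k ω : ℝ) * Complex.I
        + (t ^ 2 / 2 * S * v m ω : ℝ)) with hg'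
    have hgm' : StronglyMeasurable[ℱ N] g' := by
      refine (hg.mono (ℱ.mono hmN)).mul ?_
      refine (Complex.measurable_exp.comp ?_).stronglyMeasurable
      have h1 : Measurable[ℱ N] fun ω => ∑ k ∈ Finset.Ico m N, X k ω :=
        Finset.measurable_fun_sum _ fun k hk =>
          (hX k).mono (ℱ.mono (Finset.mem_Ico.1 hk).2) le_rfl
      have h2 : Measurable[ℱ N] (v m) := (hv m).mono (ℱ.mono hmN) le_rfl
      exact (((Complex.measurable_ofReal.comp h1).const_mul _).mul_const _).add
        (Complex.measurable_ofReal.comp (h2.const_mul _))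
    have hgB' : ∀ ω, ‖g' ω‖ ≤ Real.exp (t ^ 2 / 2 * S * C) := by
      intro ω
      rw [hg', norm_mul, Complex.norm_exp]
      have h1 : (t * (∑ k ∈ Finset.Ico m N, X k ω : ℝ) * Complex.I
        + (t ^ 2 / 2 * S * v m ω : ℝ) : ℂ).re = t ^ 2 / 2 * S * v m ω := by
        rw [Complex.add_re, ← Complex.ofReal_mul, Complex.re_ofReal_mul, Complex.ofReal_re]
        simp
      rw [h1]
      have h2 : Real.exp (t ^ 2 / 2 * S * v m ω) ≤ Real.exp (t ^ 2 / 2 * S * C) :=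
        Real.exp_le_exp.2 (mul_le_mul_of_nonneg_left (hvC m ω) (by positivity))
      calc _ ≤ 1 * Real.exp (t ^ 2 / 2 * S * v m ω) := by gcongr; exact hg1 ω
        _ ≤ _ := by rwa [one_mul]
    have step := norm_integral_exp_step_le (ℱ.le N) (t := t) (((hX N).mono (ℱ.le _) le_rfl))
      (hX3 N) (hX1 N) (hX2 N) (hv N) ((hv m).mono (ℱ.mono hmN) le_rfl) (hv0 N) (hvC N) (hv0 m)
      (hvC m) (hθ N) hgm' hgB'
    have e1 : ∀ ω, g ω * Complex.exp (t * ((∑ k ∈ Finset.Ico m N, X k ω) + X N ω : ℝ) * Complex.I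
        + (t ^ 2 / 2 * (S + θ N) * v m ω : ℝ))
        = g' ω * Complex.exp (t * X N ω * Complex.I + (t ^ 2 / 2 * θ N * v m ω : ℝ)) := by
      intro ω
      simp only [hg']
      rw [mul_assoc (g ω), ← Complex.exp_add]
      congr 2
      push_cast
      ring
    simp_rw [e1]
    have e2 : Real.exp (t ^ 2 / 2 * S * C) * Real.exp (t ^ 2 / 2 * θ N * C)
        = Real.exp (t ^ 2 / 2 * (S + θ N) * C) := by
      rw [← Real.exp_add]; congr 1; ring
    rw [e2] at step
    have e3 : Real.exp (t ^ 2 / 2 * S * C) ≤ Real.exp (t ^ 2 / 2 * (S + θ N) * C) := by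
      rw [← e2]
      exact le_mul_of_one_le_right (Real.exp_pos _).le
        (Real.one_le_exp (by have := hθ N; positivity))
    have e4 : ∀ x y z : ℂ, x - z = (x - y) + (y - z) := fun x y z => by ring
    rw [e4 _ (∫ ω, g' ω ∂P), mul_add, add_comm (Real.exp _ * ∑ k ∈ _, _)]
    refine (norm_add_le _ _).trans (add_le_add step (ih.trans ?_))
    exact mul_le_mul_of_nonneg_right e3 (Finset.sum_nonneg fun k _ => he0 k)

end CLT

end WeightedIBP

namespace WeightedIBP

section CLT

variable {Ω : Type*} {m mΩ : MeasurableSpace Ω} {P : Measure Ω} [IsProbabilityMeasure P]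

/-- Lévy's upward theorem in L¹. It makes the convergence stable: an event is almost independent of
the far increments once it is replaced by its conditional probability at a large time. -/
theorem tendsto_integral_abs_condExp_sub (ℱ : Filtration ℕ mΩ) (f : Ω → ℝ) :
    Tendsto (fun k => ∫ ω, |P[f | ℱ k] ω - P[f | ⨆ k, ℱ k] ω| ∂P) atTop (𝓝 0) := by
  have h := (ENNReal.tendsto_toReal ENNReal.zero_ne_top).comp
    (tendsto_eLpNorm_condExp (ℱ := ℱ) (μ := P) f)
  rw [ENNReal.toReal_zero] at h
  refine h.congr fun k => ?_
  have hi : Integrable (P[f | ℱ k] - P[f | ⨆ k, ℱ k]) P :=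
    integrable_condExp.sub integrable_condExp
  rw [Function.comp_apply, eLpNorm_one_eq_lintegral_enorm,
    ← integral_norm_eq_lintegral_enorm hi.aestronglyMeasurable]
  rfl

/-- Integrate |x| ≤ √ε + x²/√ε. -/
theorem integral_abs_le_of_integral_sq_le {X : Ω → ℝ} {a ε : ℝ} (hX : Integrable X P)
    (hX2 : Integrable (fun ω => X ω ^ 2) P) (hε : 0 < ε) (h : ∫ ω, X ω ^ 2 ∂P ≤ a * ε) :
    ∫ ω, |X ω| ∂P ≤ (1 + a) * √ε := by
  have hs : 0 < √ε := Real.sqrt_pos.2 hε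
  have h1 : ∀ ω, |X ω| ≤ √ε + X ω ^ 2 / √ε := by
    intro ω
    rw [← sub_nonneg]
    have : √ε + X ω ^ 2 / √ε - |X ω| = ((√ε - |X ω|) ^ 2 + √ε * |X ω|) / √ε := by
      field_simp
      rw [← sq_abs (X ω)]
      ring
    rw [this]
    positivity
  calc ∫ ω, |X ω| ∂P ≤ ∫ ω, (√ε + X ω ^ 2 / √ε) ∂P :=
        integral_mono hX.abs ((integrable_const _).add (hX2.div_const _)) h1
    _ = √ε + (∫ ω, X ω ^ 2 ∂P) / √ε := by
        rw [integral_add (integrable_const _) (hX2.div_const _), integral_div]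
        simp
    _ ≤ √ε + a * ε / √ε := by gcongr
    _ = (1 + a) * √ε := by
        rw [mul_div_assoc, Real.div_sqrt]; ring

theorem norm_exp_ofReal_mul_I_sub_le (x y : ℝ) :
    ‖Complex.exp (x * Complex.I) - Complex.exp (y * Complex.I)‖ ≤ |x - y| := by
  have h : Complex.exp (x * Complex.I) - Complex.exp (y * Complex.I)
      = Complex.exp (y * Complex.I) * (Complex.exp (Complex.I * (x - y : ℝ)) - 1) := by
    rw [mul_sub, ← Complex.exp_add, mul_one]
    congr 2
    push_cast
    ring
  rw [h, norm_mul, Complex.norm_exp_ofReal_mul_I, one_mul]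
  exact Real.norm_exp_I_mul_ofReal_sub_one_le

theorem abs_exp_neg_sub_exp_neg_le {x y : ℝ} (hx : 0 ≤ x) (hy : 0 ≤ y) :
    |Real.exp (-x) - Real.exp (-y)| ≤ |x - y| := by
  wlog h : x ≤ y generalizing x y
  · rw [abs_sub_comm, abs_sub_comm x]
    exact this hy hx (le_of_not_ge h)
  have h1 : Real.exp (-y) ≤ Real.exp (-x) := Real.exp_le_exp.2 (by linarith)
  rw [abs_of_nonneg (by linarith), abs_of_nonpos (by linarith)]
  have h2 : Real.exp (-y) = Real.exp (-x) * Real.exp (-(y - x)) := by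
    rw [← Real.exp_add]; congr 1; ring
  have h3 : Real.exp (-x) ≤ 1 := Real.exp_le_one_iff.2 (by linarith)
  have h4 := Real.add_one_le_exp (-(y - x))
  have h5 : Real.exp (-(y - x)) ≤ 1 := Real.exp_le_one_iff.2 (by linarith)
  rw [h2]
  nlinarith [Real.exp_pos (-x)]

/-- A stable central limit theorem for martingale difference arrays, in terms of characteristic
functions. The conditional variances are of the form `θ n k * v k`. -/
theorem tendsto_setIntegral_exp_sum (ℱ : Filtration ℕ mΩ) {X : ℕ → ℕ → Ω → ℝ} {v : ℕ → Ω → ℝ}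
    {v' : Ω → ℝ} {θ : ℕ → ℕ → ℝ} {θ' C : ℝ} {N : ℕ → ℕ} {ε : ℕ → ℝ} (hN : Tendsto N atTop atTop)
    (hX : ∀ n k, Measurable[ℱ (k + 1)] (X n k))
    (hX3 : ∀ n k, Integrable (fun ω => |X n k ω| ^ 3) P) (hX1 : ∀ n k, P[X n k | ℱ k] =ᵐ[P] 0)
    (hX2 : ∀ n k, P[fun ω => X n k ω ^ 2 | ℱ k] =ᵐ[P] fun ω => θ n k * v k ω)
    (hv : ∀ k, Measurable[ℱ k] (v k)) (hv0 : ∀ k ω, 0 ≤ v k ω) (hvC : ∀ k ω, v k ω ≤ C)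
    (hvm' : Measurable v') (hv' : ∀ᵐ ω ∂P, Tendsto (fun k => v k ω) atTop (𝓝 (v' ω)))
    (hθ : ∀ n k, 0 ≤ θ n k) (hθε : ∀ n k, θ n k ≤ ε n) (hε0 : ∀ n, 0 < ε n)
    (hε : Tendsto ε atTop (𝓝 0))
    (hθ' : Tendsto (fun n => ∑ k ∈ Finset.range (N n), θ n k) atTop (𝓝 θ'))
    (hρ : Tendsto (fun n => ∑ k ∈ Finset.range (N n), ∫ ω, |X n k ω| ^ 3 ∂P) atTop (𝓝 0))
    {H : Set Ω} (hH : MeasurableSet H) (t : ℝ) :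
    Tendsto (fun n => ∫ ω in H, Complex.exp (t * (∑ k ∈ Finset.range (N n), X n k ω : ℝ)
      * Complex.I) ∂P) atTop (𝓝 (∫ ω in H, (Real.exp (-(t ^ 2 / 2 * θ' * v' ω)) : ℂ) ∂P)) := by
  obtain ⟨ω₀⟩ : Nonempty Ω := nonempty_of_isProbabilityMeasure P
  have hC : 0 ≤ C := (hv0 0 ω₀).trans (hvC 0 ω₀)
  have hθ0' : 0 ≤ θ' := ge_of_tendsto' hθ' fun n => Finset.sum_nonneg fun k _ => hθ n k
  have hvmΩ : ∀ k, Measurable (v k) := fun k => (hv k).mono (ℱ.le k) le_rfl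
  have hXmΩ : ∀ n k, Measurable (X n k) := fun n k => (hX n k).mono (ℱ.le _) le_rfl
  have hv'0 : ∀ᵐ ω ∂P, 0 ≤ v' ω := by
    filter_upwards [hv'] with ω hω using ge_of_tendsto' hω fun k => hv0 k ω
  have hv'C : ∀ᵐ ω ∂P, v' ω ≤ C := by
    filter_upwards [hv'] with ω hω using le_of_tendsto' hω fun k => hvC k ω
  have hvi : ∀ k, Integrable (v k) P := fun k =>
    Integrable.of_bound (hvmΩ k).aestronglyMeasurable C
      (ae_of_all _ fun ω => by rw [Real.norm_eq_abs, abs_of_nonneg (hv0 k ω)]; exact hvC k ω)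
  have hvi' : Integrable v' P := Integrable.of_bound hvm'.aestronglyMeasurable C (by
    filter_upwards [hv'0, hv'C] with ω h0 h1
    rwa [Real.norm_eq_abs, abs_of_nonneg h0])
  -- convergence in mean of the conditional variances
  have hvL : Tendsto (fun k => ∫ ω, |v k ω - v' ω| ∂P) atTop (𝓝 0) := by
    have : Tendsto (fun k => ∫ ω, |v k ω - v' ω| ∂P) atTop (𝓝 (∫ _, (0 : ℝ) ∂P)) := by
      refine tendsto_integral_of_dominated_convergence (fun _ => C)
        (fun k => ((hvmΩ k).sub hvm').abs.aestronglyMeasurable) (integrable_const _) (fun k => ?_) ?_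
      · filter_upwards [hv'0, hv'C] with ω h0 h1
        rw [Real.norm_eq_abs, abs_abs, abs_le]
        constructor <;> linarith [hv0 k ω, hvC k ω]
      · filter_upwards [hv'] with ω hω
        have := (hω.sub_const (v' ω)).abs
        simpa using this
    simpa using this
  -- a bounded version of the conditional probabilities of `H`
  set f : Ω → ℝ := H.indicator 1 with hf
  have hfm : Measurable f := measurable_one.indicator hH
  have hfb : ∀ ω, |f ω| ≤ 1 := fun ω => by by_cases h : ω ∈ H <;> simp [hf, h]
  have hfi : Integrable f P := Integrable.of_bound hfm.aestronglyMeasurable 1 (ae_of_all _ hfb)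
  set h : ℕ → Ω → ℝ := fun k ω => max (-1) (min 1 (P[f | ℱ k] ω)) with hh
  have hhm : ∀ k, Measurable[ℱ k] (h k) := fun k =>
    measurable_const.max (measurable_const.min stronglyMeasurable_condExp.measurable)
  have hhb : ∀ k ω, |h k ω| ≤ 1 := fun k ω =>
    abs_le.2 ⟨le_max_left _ _, max_le (by norm_num) (min_le_left _ _)⟩
  have hh_ae : ∀ k, P[f | ℱ k] =ᵐ[P] h k := by
    intro k
    have h1 : ∀ᵐ ω ∂P, |P[f | ℱ k] ω| ≤ 1 :=
      ae_bdd_condExp_of_ae_bdd (R := 1) (ae_of_all _ hfb)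
    filter_upwards [h1] with ω hω
    rw [abs_le] at hω
    simp only [hh]
    rw [min_eq_right hω.2, max_eq_right hω.1]
  have hhi : ∀ k, Integrable (h k) P := fun k => Integrable.of_bound
    ((hhm k).mono (ℱ.le k) le_rfl).aestronglyMeasurable 1 (ae_of_all _ (hhb k))
  have hpull : ∀ k {Y : Ω → ℂ}, StronglyMeasurable[ℱ k] Y → (∀ ω, ‖Y ω‖ ≤ 1) →
      ∫ ω, Y ω * f ω ∂P = ∫ ω, Y ω * h k ω ∂P := fun k Y hY hY1 =>
    integral_mul_eq_of_condExp (ℱ.le k) hfi (hh_ae k) hY hY1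
  set h' : Ω → ℝ := P[f | ⨆ k, ℱ k] with hh'
  have hhL : Tendsto (fun k => ∫ ω, |h k ω - h' ω| ∂P) atTop (𝓝 0) := by
    refine (tendsto_integral_abs_condExp_sub (P := P) ℱ f).congr fun k => integral_congr_ae ?_
    filter_upwards [hh_ae k] with ω hω
    rw [hω]
  -- constants
  obtain ⟨Θ, hΘ⟩ : ∃ Θ : ℝ, ∀ n, ∑ k ∈ Finset.range (N n), θ n k ≤ Θ := by
    obtain ⟨Θ, hΘ⟩ := hθ'.bddAbove_range
    exact ⟨Θ, fun n => hΘ ⟨n, rfl⟩⟩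
  have hΘ0 : 0 ≤ Θ := (Finset.sum_nonneg fun k _ => hθ 0 k).trans (hΘ 0)
  set E := Real.exp (t ^ 2 / 2 * Θ * C) with hE
  -- `L` collects the errors that are small because m is large: conditioning `H`, freezing the
  -- variances, and replacing `v m` by its limit. `A m n` collects those that vanish as n → ∞ with m
  -- fixed: the first m terms, the second- and third-order errors, and the sum of the `θ n k`.
  set L : ℝ := 2 + E * (t ^ 2 / 2 * Θ * 2) + t ^ 2 / 2 * θ' with hL
  set A : ℕ → ℕ → ℝ := fun m n => |t| * (m * ((1 + C) * √(ε n)))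
    + E * (2 * (t ^ 2 / 2 * C) ^ 2 * ε n * Θ
      + 4 * |t| ^ 3 * ∑ k ∈ Finset.range (N n), ∫ ω, |X n k ω| ^ 3 ∂P)
    + t ^ 2 / 2 * C * (|∑ k ∈ Finset.range (N n), θ n k - θ'| + m * ε n) with hA
  have hA0 : ∀ m, Tendsto (A m) atTop (𝓝 0) := by
    intro m
    have h1 : Tendsto (fun n => √(ε n)) atTop (𝓝 0) := by
      have := (Real.continuous_sqrt.tendsto 0).comp hε
      rwa [Real.sqrt_zero] at this
    have h2 : Tendsto (fun n => |∑ k ∈ Finset.range (N n), θ n k - θ'|) atTop (𝓝 0) := by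
      have := (hθ'.sub_const θ').abs
      simpa using this
    have := ((((h1.const_mul (1 + C)).const_mul (m : ℝ)).const_mul |t|).add
      ((((hε.const_mul (2 * (t ^ 2 / 2 * C) ^ 2)).mul_const Θ).add
        (hρ.const_mul (4 * |t| ^ 3))).const_mul E)).add
      ((h2.add (hε.const_mul (m : ℝ))).const_mul (t ^ 2 / 2 * C))
    simpa using this
  -- the main estimate
  have key : ∀ δ > 0, ∃ m, ∀ᶠ n in atTop,
      ‖∫ ω in H, Complex.exp (t * (∑ k ∈ Finset.range (N n), X n k ω : ℝ) * Complex.I) ∂P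
        - ∫ ω in H, (Real.exp (-(t ^ 2 / 2 * θ' * v' ω)) : ℂ) ∂P‖ ≤ A m n + L * δ := by
    intro δ hδ
    -- From time m on, both the conditional variances and the conditional probabilities of `H` are
    -- within δ of their limits in mean.
    obtain ⟨m, hm⟩ := eventually_atTop.1 ((hvL.eventually_lt_const hδ).and
      (hhL.eventually_lt_const hδ))
    refine ⟨m, ?_⟩
    filter_upwards [hN.eventually_ge_atTop m] with n hn
    obtain ⟨hvm, -⟩ := hm m le_rfl
    have hvv : ∀ k, m ≤ k → ∫ ω, |v k ω - v m ω| ∂P ≤ 2 * δ := by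
      intro k hk
      have h1 : ∫ ω, |v k ω - v m ω| ∂P ≤ ∫ ω, (|v k ω - v' ω| + |v m ω - v' ω|) ∂P := by
        refine integral_mono ((hvi k).sub (hvi m)).abs
          (((hvi k).sub hvi').abs.add ((hvi m).sub hvi').abs) fun ω => ?_
        have := abs_sub_le (v k ω) (v' ω) (v m ω)
        rwa [abs_sub_comm (v' ω)] at this
      have i1 : ∀ k, Integrable (fun ω => |v k ω - v' ω|) P := fun k => ((hvi k).sub hvi').abs
      rw [integral_add (i1 k) (i1 m)] at h1
      linarith [(hm k hk).1]
    have hset : ∀ Y : Ω → ℂ, ∫ ω in H, Y ω ∂P = ∫ ω, Y ω * f ω ∂P := by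
      intro Y
      rw [← integral_indicator hH]
      refine integral_congr_ae (ae_of_all _ fun ω => ?_)
      by_cases hω : ω ∈ H <;> simp [hf, hω]
    set W : Ω → ℂ := fun ω => Complex.exp (t * (∑ k ∈ Finset.Ico m (N n), X n k ω : ℝ) * Complex.I)
      with hW
    have hWm : StronglyMeasurable[ℱ (N n)] W := by
      have h1 : Measurable[ℱ (N n)] fun ω => ∑ k ∈ Finset.Ico m (N n), X n k ω :=
        Finset.measurable_fun_sum _ fun k hk =>
          (hX n k).mono (ℱ.mono (Finset.mem_Ico.1 hk).2) le_rfl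
      exact (Complex.measurable_exp.comp
        (((Complex.measurable_ofReal.comp h1).const_mul _).mul_const _)).stronglyMeasurable
    have hW1 : ∀ ω, ‖W ω‖ = 1 := fun ω => by
      rw [hW]
      simp only
      rw [← Complex.ofReal_mul, Complex.norm_exp_ofReal_mul_I]
    have hWae : AEStronglyMeasurable W P := (hWm.mono (ℱ.le _)).aestronglyMeasurable
    set Θm := ∑ k ∈ Finset.Ico m (N n), θ n k with hΘm
    have hΘm0 : 0 ≤ Θm := Finset.sum_nonneg fun k _ => hθ n k
    have hsplit : ∀ a : ℕ → ℝ, ∑ k ∈ Finset.range (N n), a k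
        = ∑ k ∈ Finset.range m, a k + ∑ k ∈ Finset.Ico m (N n), a k := fun a =>
      (Finset.sum_range_add_sum_Ico a hn).symm
    have hΘmΘ : Θm ≤ Θ := by
      have := hΘ n
      rw [hsplit] at this
      have h2 : 0 ≤ ∑ k ∈ Finset.range m, θ n k := Finset.sum_nonneg fun k _ => hθ n k
      linarith
    have hexp : ∀ {a : ℝ}, 0 ≤ a → Real.exp (-a) ≤ 1 := fun ha =>
      Real.exp_le_one_iff.2 (by linarith)
    have hvmn : ∀ {a : ℝ}, 0 ≤ a → ∀ ω, 0 ≤ t ^ 2 / 2 * a * v m ω := fun ha ω => by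
      have := hv0 m ω
      positivity
    set g : Ω → ℂ := fun ω => (Real.exp (-(t ^ 2 / 2 * Θm * v m ω)) : ℂ) * h m ω with hg
    have hgexp : ∀ a : ℝ, StronglyMeasurable[ℱ m]
        fun ω => (Real.exp (-(t ^ 2 / 2 * a * v m ω)) : ℂ) := fun a =>
      (Complex.measurable_ofReal.comp (Real.measurable_exp.comp
        ((hv m).const_mul _).neg)).stronglyMeasurable
    have hgm : StronglyMeasurable[ℱ m] g :=
      (hgexp Θm).mul (Complex.measurable_ofReal.comp (hhm m)).stronglyMeasurable
    have hgexp1 : ∀ {a : ℝ}, 0 ≤ a → ∀ ω, ‖(Real.exp (-(t ^ 2 / 2 * a * v m ω)) : ℂ)‖ ≤ 1 := by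
      intro a ha ω
      rw [Complex.norm_real, Real.norm_eq_abs, abs_of_pos (Real.exp_pos _)]
      exact hexp (hvmn ha ω)
    have hg1 : ∀ ω, ‖g ω‖ ≤ 1 := by
      intro ω
      rw [hg, norm_mul]
      exact mul_le_one₀ (hgexp1 hΘm0 ω) (norm_nonneg _)
        (by rw [Complex.norm_real]; exact hhb m ω)
    -- remove the first terms
    have b1 : ‖∫ ω in H, Complex.exp (t * (∑ k ∈ Finset.range (N n), X n k ω : ℝ) * Complex.I) ∂P
        - ∫ ω, W ω * f ω ∂P‖ ≤ |t| * (m * ((1 + C) * √(ε n))) := by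
      have hXi : ∀ k, Integrable (X n k) P := fun k =>
        integrable_of_integrable_cube (hXmΩ n k) (hX3 n k)
      have hX2i : ∀ k, Integrable (fun ω => X n k ω ^ 2) P := fun k =>
        integrable_sq_of_integrable_cube (hXmΩ n k) (hX3 n k)
      have h1 : ∀ k, ∫ ω, |X n k ω| ∂P ≤ (1 + C) * √(ε n) := by
        intro k
        refine integral_abs_le_of_integral_sq_le (hXi k) (hX2i k) (hε0 n) ?_
        rw [← integral_condExp (ℱ.le k), integral_congr_ae (hX2 n k), integral_const_mul, mul_comm C]
        refine mul_le_mul (hθε n k) ?_ (integral_nonneg (hv0 k)) (hε0 n).le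
        have := integral_mono (hvi k) (integrable_const C) (hvC k)
        simpa using this
      rw [← hset, ← integral_sub]
      rotate_left
      · refine Integrable.of_bound (C := 1) (Measurable.aestronglyMeasurable ?_)
          (ae_of_all _ fun ω => ?_)
        · have := hXmΩ n
          fun_prop
        · rw [← Complex.ofReal_mul, Complex.norm_exp_ofReal_mul_I]
      · exact Integrable.of_bound (C := 1) (hWae.mono_measure Measure.restrict_le_self)
          (ae_of_all _ fun ω => (hW1 ω).le)
      have hXs : Integrable (fun ω => |t| * ∑ k ∈ Finset.range m, |X n k ω|) P :=
        (integrable_finsetSum _ fun k _ => (hXi k).abs).const_mul _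
      calc _ ≤ ∫ ω in H, |t| * ∑ k ∈ Finset.range m, |X n k ω| ∂P := by
            refine norm_integral_le_of_norm_le hXs.integrableOn (ae_of_all _ fun ω => ?_)
            rw [hW]
            simp only
            rw [← Complex.ofReal_mul, ← Complex.ofReal_mul]
            refine (norm_exp_ofReal_mul_I_sub_le _ _).trans ?_
            rw [hsplit fun k => X n k ω, ← mul_sub, add_sub_cancel_right, abs_mul]
            exact mul_le_mul_of_nonneg_left (Finset.abs_sum_le_sum_abs _ _) (abs_nonneg _)
        _ ≤ ∫ ω, |t| * ∑ k ∈ Finset.range m, |X n k ω| ∂P :=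
            setIntegral_le_integral hXs (ae_of_all _ fun ω => by positivity)
        _ = |t| * ∑ k ∈ Finset.range m, ∫ ω, |X n k ω| ∂P := by
            rw [integral_const_mul, integral_finsetSum _ fun k _ => (hXi k).abs]
        _ ≤ _ := by
            refine mul_le_mul_of_nonneg_left ?_ (abs_nonneg _)
            refine (Finset.sum_le_sum fun k _ => h1 k).trans_eq ?_
            simp
    -- replace `H` by its conditional probability given `ℱ m`
    have b2 : ‖∫ ω, W ω * f ω ∂P - ∫ ω, W ω * h m ω ∂P‖ ≤ 2 * δ := by
      have i2 : ∀ k, Integrable (fun ω => W ω * h k ω) P := fun k =>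
        (hhi k).ofReal.bdd_mul hWae (ae_of_all _ fun ω => (hW1 ω).le)
      rw [hpull (N n) hWm fun ω => (hW1 ω).le, ← integral_sub (i2 _) (i2 _)]
      have i1 : ∀ k, Integrable (fun ω => |h k ω - h' ω|) P := fun k =>
        ((hhi k).sub integrable_condExp).abs
      refine (norm_integral_le_of_norm_le ((i1 (N n)).add (i1 m))
        (ae_of_all _ fun ω => ?_)).trans ?_
      · rw [← mul_sub, norm_mul, hW1, one_mul, ← Complex.ofReal_sub, Complex.norm_real,
          Real.norm_eq_abs]
        have := abs_sub_le (h (N n) ω) (h' ω) (h m ω)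
        rwa [abs_sub_comm (h' ω)] at this
      · rw [integral_add' (i1 _) (i1 _)]
        linarith [(hm (N n) hn).2, (hm m le_rfl).2]
    -- the exponential martingale
    have b3 : ‖∫ ω, W ω * h m ω ∂P - ∫ ω, g ω ∂P‖
        ≤ E * (2 * (t ^ 2 / 2 * C) ^ 2 * ε n * Θ
          + 4 * |t| ^ 3 * ∑ k ∈ Finset.range (N n), ∫ ω, |X n k ω| ^ 3 ∂P)
          + E * (t ^ 2 / 2 * Θ * 2) * δ := by
      have h1 := norm_integral_exp_sum_sub_le (P := P) ℱ (t := t) (hX n) (hX3 n) (hX1 n) (hX2 n) hv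
        hv0 hvC (hθ n) hn hgm hg1
      have h2 : ∀ ω, g ω * Complex.exp (t * (∑ k ∈ Finset.Ico m (N n), X n k ω : ℝ) * Complex.I
          + (t ^ 2 / 2 * (∑ k ∈ Finset.Ico m (N n), θ n k) * v m ω : ℝ)) = W ω * h m ω := by
        intro ω
        simp only [hg, hW, ← hΘm]
        rw [mul_right_comm, Complex.ofReal_exp, ← Complex.exp_add]
        congr 2
        push_cast
        ring
      simp_rw [h2, ← hΘm] at h1
      refine h1.trans ?_
      rw [mul_assoc E, ← mul_add]
      refine mul_le_mul ?_ ?_ ?_ (Real.exp_pos _).le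
      · exact Real.exp_le_exp.2 (by gcongr)
      · rw [Finset.sum_add_distrib, Finset.sum_add_distrib]
        have c1 : ∑ k ∈ Finset.Ico m (N n), 2 * (t ^ 2 / 2 * θ n k * C) ^ 2
            ≤ 2 * (t ^ 2 / 2 * C) ^ 2 * ε n * Θ := by
          calc _ ≤ ∑ k ∈ Finset.Ico m (N n), 2 * (t ^ 2 / 2 * C) ^ 2 * ε n * θ n k := by
                refine Finset.sum_le_sum fun k _ => ?_
                have : θ n k * θ n k ≤ ε n * θ n k :=
                  mul_le_mul_of_nonneg_right (hθε n k) (hθ n k)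
                have h3 : 0 ≤ 2 * (t ^ 2 / 2 * C) ^ 2 := by positivity
                nlinarith [mul_le_mul_of_nonneg_left this h3]
            _ = 2 * (t ^ 2 / 2 * C) ^ 2 * ε n * Θm := by rw [← Finset.mul_sum]
            _ ≤ _ := by
                have := (hε0 n).le
                gcongr
        have c2 : ∑ k ∈ Finset.Ico m (N n), t ^ 2 / 2 * θ n k * ∫ ω, |v k ω - v m ω| ∂P
            ≤ t ^ 2 / 2 * Θ * 2 * δ := by
          calc _ ≤ ∑ k ∈ Finset.Ico m (N n), t ^ 2 / 2 * (2 * δ) * θ n k := by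
                refine Finset.sum_le_sum fun k hk => ?_
                have h3 := hvv k (Finset.mem_Ico.1 hk).1
                have h4 := hθ n k
                rw [mul_right_comm]
                gcongr
            _ = t ^ 2 / 2 * (2 * δ) * Θm := by rw [← Finset.mul_sum]
            _ ≤ t ^ 2 / 2 * (2 * δ) * Θ := by gcongr
            _ = _ := by ring
        have c3 : ∑ k ∈ Finset.Ico m (N n), ∫ ω, |X n k ω| ^ 3 ∂P
            ≤ ∑ k ∈ Finset.range (N n), ∫ ω, |X n k ω| ^ 3 ∂P := by
          rw [hsplit]
          have : 0 ≤ ∑ k ∈ Finset.range m, ∫ ω, |X n k ω| ^ 3 ∂P :=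
            Finset.sum_nonneg fun k _ => integral_nonneg fun ω => by positivity
          linarith
        have c4 : 0 ≤ 4 * |t| ^ 3 := by positivity
        rw [← Finset.mul_sum _ _ (4 * |t| ^ 3)]
        linarith [mul_le_mul_of_nonneg_left c3 c4]
      · refine Finset.sum_nonneg fun k _ => ?_
        have h3 : 0 ≤ ∫ ω, |v k ω - v m ω| ∂P := integral_nonneg fun _ => abs_nonneg _
        have h4 : 0 ≤ ∫ ω, |X n k ω| ^ 3 ∂P := integral_nonneg fun _ => by positivity
        have := hθ n k
        positivity
    -- adjust the sum of the weights
    have b4 : ‖∫ ω, g ω ∂P - ∫ ω, (Real.exp (-(t ^ 2 / 2 * θ' * v m ω)) : ℂ) * h m ω ∂P‖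
        ≤ t ^ 2 / 2 * C * (|∑ k ∈ Finset.range (N n), θ n k - θ'| + m * ε n) := by
      have i1 : ∀ a : ℝ, 0 ≤ a → Integrable
          (fun ω => (Real.exp (-(t ^ 2 / 2 * a * v m ω)) : ℂ) * h m ω) P := fun a ha =>
        (hhi m).ofReal.bdd_mul ((hgexp a).mono (ℱ.le m)).aestronglyMeasurable
          (ae_of_all _ (hgexp1 ha))
      rw [hg, ← integral_sub (i1 _ hΘm0) (i1 _ hθ0')]
      have hd : |Θm - θ'| ≤ |∑ k ∈ Finset.range (N n), θ n k - θ'| + m * ε n := by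
        have h1 : ∑ k ∈ Finset.range m, θ n k ≤ m * ε n := by
          refine (Finset.sum_le_sum fun k _ => hθε n k).trans_eq ?_
          simp
        have h2 : 0 ≤ ∑ k ∈ Finset.range m, θ n k := Finset.sum_nonneg fun k _ => hθ n k
        have h3 : Θm - θ' = (∑ k ∈ Finset.range (N n), θ n k - θ')
          - ∑ k ∈ Finset.range m, θ n k := by rw [hsplit]; ring
        rw [h3]
        refine (abs_sub _ _).trans ?_
        rw [abs_of_nonneg h2]
        linarith
      have := norm_integral_le_of_norm_le_const (μ := P) (f := fun ω =>
        (Real.exp (-(t ^ 2 / 2 * Θm * v m ω)) : ℂ) * h m ω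
          - (Real.exp (-(t ^ 2 / 2 * θ' * v m ω)) : ℂ) * h m ω)
        (C := t ^ 2 / 2 * C * (|∑ k ∈ Finset.range (N n), θ n k - θ'| + m * ε n))
        (ae_of_all _ fun ω => ?_)
      · simpa using this
      · rw [← sub_mul, norm_mul, ← Complex.ofReal_sub, Complex.norm_real, Complex.norm_real,
          Real.norm_eq_abs, Real.norm_eq_abs]
        calc _ ≤ |t ^ 2 / 2 * Θm * v m ω - t ^ 2 / 2 * θ' * v m ω| * 1 :=
              mul_le_mul (abs_exp_neg_sub_exp_neg_le (hvmn hΘm0 ω) (hvmn hθ0' ω)) (hhb m ω)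
                (abs_nonneg _) (abs_nonneg _)
          _ = t ^ 2 / 2 * v m ω * |Θm - θ'| := by
              rw [mul_one, ← sub_mul, ← mul_sub, abs_mul, abs_mul, abs_of_nonneg (hv0 m ω),
                abs_of_nonneg (by positivity : 0 ≤ t ^ 2 / 2)]
              ring
          _ ≤ _ := by
              have := hv0 m ω
              have := hvC m ω
              gcongr
    -- go to the limit
    have b5 : ‖∫ ω, (Real.exp (-(t ^ 2 / 2 * θ' * v m ω)) : ℂ) * h m ω ∂P
        - ∫ ω in H, (Real.exp (-(t ^ 2 / 2 * θ' * v' ω)) : ℂ) ∂P‖ ≤ t ^ 2 / 2 * θ' * δ := by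
      rw [← hpull m (hgexp θ') (hgexp1 hθ0'), hset]
      have i1 : Integrable (fun ω => (Real.exp (-(t ^ 2 / 2 * θ' * v m ω)) : ℂ) * f ω) P :=
        hfi.ofReal.bdd_mul ((hgexp θ').mono (ℱ.le m)).aestronglyMeasurable
          (ae_of_all _ (hgexp1 hθ0'))
      have i2 : Integrable (fun ω => (Real.exp (-(t ^ 2 / 2 * θ' * v' ω)) : ℂ) * f ω) P := by
        refine hfi.ofReal.bdd_mul (c := 1) (Measurable.aestronglyMeasurable (by fun_prop)) ?_
        filter_upwards [hv'0] with ω hω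
        rw [Complex.norm_real, Real.norm_eq_abs, abs_of_pos (Real.exp_pos _)]
        exact hexp (by positivity)
      rw [← integral_sub i1 i2]
      have i3 : Integrable (fun ω => t ^ 2 / 2 * θ' * |v m ω - v' ω|) P :=
        ((hvi m).sub hvi').abs.const_mul _
      refine (norm_integral_le_of_norm_le i3 ?_).trans ?_
      · filter_upwards [hv'0] with ω hω
        rw [← sub_mul, norm_mul, ← Complex.ofReal_sub, Complex.norm_real, Complex.norm_real,
          Real.norm_eq_abs, Real.norm_eq_abs]
        calc _ ≤ |t ^ 2 / 2 * θ' * v m ω - t ^ 2 / 2 * θ' * v' ω| * 1 :=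
              mul_le_mul (abs_exp_neg_sub_exp_neg_le (hvmn hθ0' ω) (by positivity)) (hfb ω)
                (abs_nonneg _) (abs_nonneg _)
          _ = _ := by
              rw [mul_one, ← mul_sub, abs_mul, abs_of_nonneg (by positivity : 0 ≤ t ^ 2 / 2 * θ')]
      · rw [integral_const_mul]
        have : 0 ≤ t ^ 2 / 2 * θ' := by positivity
        gcongr
    have e : ∀ x₀ x₁ x₂ x₃ x₄ x₅ : ℂ, x₀ - x₅ = (x₀ - x₁) + (x₁ - x₂) + (x₂ - x₃) + (x₃ - x₄)
      + (x₄ - x₅) := fun _ _ _ _ _ _ => by ring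
    rw [e _ (∫ ω, W ω * f ω ∂P) (∫ ω, W ω * h m ω ∂P) (∫ ω, g ω ∂P)
      (∫ ω, (Real.exp (-(t ^ 2 / 2 * θ' * v m ω)) : ℂ) * h m ω ∂P)]
    refine (norm_add₄_le.trans (by gcongr : _ ≤ _ + _ + _ + _) |> fun h' =>
      (norm_add_le _ _).trans (add_le_add_left h' _)).trans ?_
    simp only [hA, hL]
    linarith
  rw [Metric.tendsto_atTop]
  intro r hr
  have hLpos : 0 < L := by positivity
  obtain ⟨m, hm⟩ := key (r / (2 * L)) (by positivity)
  obtain ⟨n₀, hn₀⟩ := eventually_atTop.1 (hm.and ((hA0 m).eventually_lt_const (half_pos hr)))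
  refine ⟨n₀, fun n hn => ?_⟩
  rw [dist_eq_norm]
  refine (hn₀ n hn).1.trans_lt ?_
  have : L * (r / (2 * L)) = r / 2 := by field_simp
  rw [this]
  linarith [(hn₀ n hn).2]

end CLT

end WeightedIBP

namespace WeightedIBP

/-! ### Stable convergence and negligible perturbations -/

section Stable

variable {Ω : Type*} {m mΩ : MeasurableSpace Ω} {P : Measure Ω} [IsProbabilityMeasure P]

theorem gaussianReal_zero_eq_map (v : ℝ≥0) :
    gaussianReal 0 v = (gaussianReal 0 1).map fun y => √(v : ℝ) * y := by
  rw [gaussianReal_map_const_mul]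
  congr 1
  · simp
  · ext
    simp

/-- As the image of the standard Gaussian under scaling, the measure of a set is the measure of a
section of a measurable subset of Ω × ℝ. -/
theorem measurable_centeredGaussian {v : Ω → ℝ} (hv : Measurable v) :
    Measurable (centeredGaussian v) := by
  refine Measure.measurable_of_measurable_coe _ fun s hs => ?_
  have h1 : ∀ ω, centeredGaussian v ω s
      = gaussianReal 0 1 (Prod.mk ω ⁻¹' {z : Ω × ℝ | √((v z.1).toNNReal : ℝ) * z.2 ∈ s}) := by
    intro ω
    rw [centeredGaussian, gaussianReal_zero_eq_map, Measure.map_apply (by fun_prop) hs]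
    rfl
  simp_rw [h1]
  refine measurable_measure_prodMk_left ?_
  have : Measurable fun z : Ω × ℝ => √((v z.1).toNNReal : ℝ) * z.2 := by fun_prop
  exact this hs

/-- Stable convergence to a centred Gaussian law with random variance follows from the
convergence of the characteristic functions on all events. -/
theorem stablyConverges_centeredGaussian {Y : ℕ → Ω → ℝ} (hY : ∀ n, Measurable (Y n))
    {v : Ω → ℝ} (hv : Measurable v) (hv0 : ∀ᵐ ω ∂P, 0 ≤ v ω)
    (h : ∀ H, MeasurableSet H → ∀ t : ℝ, Tendsto
      (fun n => ∫ ω in H, Complex.exp (t * Y n ω * Complex.I) ∂P) atTop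
      (𝓝 (∫ ω in H, (Real.exp (-(t ^ 2 / 2 * v ω)) : ℂ) ∂P))) :
    StablyConverges P Y (centeredGaussian v) := by
  refine ⟨measurable_centeredGaussian hv, fun ω => by unfold centeredGaussian; infer_instance,
    fun H hH hPH f => ?_⟩
  have hHP : IsProbabilityMeasure P[|H] := cond_isProbabilityMeasure hPH.ne'
  let κ : Kernel Ω ℝ := ⟨centeredGaussian v, measurable_centeredGaussian hv⟩
  have hκ : IsMarkovKernel κ := ⟨fun ω => by
    change IsProbabilityMeasure (gaussianReal 0 _); infer_instance⟩
  let μ : ℕ → ProbabilityMeasure ℝ := fun n =>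
    ⟨P[|H].map (Y n), Measure.isProbabilityMeasure_map (hY n).aemeasurable⟩
  -- On each event the claim is weak convergence of the conditional law of `Y n` to a mixture of
  -- Gaussian laws, to which Lévy's continuity theorem applies.
  let μ₀ : ProbabilityMeasure ℝ := ⟨P[|H].bind κ, by infer_instance⟩
  have hcond : ∀ g : Ω → ℂ, ∫ ω, g ω ∂P[|H] = (P H)⁻¹.toReal • ∫ ω in H, g ω ∂P := fun g => by
    rw [ProbabilityTheory.cond, integral_smul_measure]
  have hbind : P[|H].bind κ = (κ ∘ₖ Kernel.const Unit P[|H]) () := by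
    rw [Kernel.comp_apply, Kernel.const_apply]
  have hlim : Tendsto μ atTop (𝓝 μ₀) := by
    rw [ProbabilityMeasure.tendsto_iff_tendsto_charFun]
    intro t
    have h1 : ∀ n, charFun (μ n : Measure ℝ) t
        = (P H)⁻¹.toReal • ∫ ω in H, Complex.exp (t * Y n ω * Complex.I) ∂P := by
      intro n
      rw [← hcond, charFun_apply_real]
      change ∫ x, _ ∂P[|H].map (Y n) = _
      rw [integral_map (hY n).aemeasurable (by fun_prop)]
    have h2 : charFun (μ₀ : Measure ℝ) t
        = (P H)⁻¹.toReal • ∫ ω in H, (Real.exp (-(t ^ 2 / 2 * v ω)) : ℂ) ∂P := by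
      rw [← hcond, charFun_apply_real]
      change ∫ x, _ ∂P[|H].bind κ = _
      rw [hbind, Kernel.integral_comp]
      · refine integral_congr_ae ?_
        have hac : ∀ᵐ ω ∂P[|H], 0 ≤ v ω := cond_absolutelyContinuous.ae_le hv0
        filter_upwards [hac] with ω hω
        rw [← charFun_apply_real]
        change charFun (gaussianReal 0 (v ω).toNNReal) t = _
        rw [charFun_gaussianReal]
        simp only [Complex.ofReal_zero, mul_zero, zero_mul, zero_sub]
        rw [Complex.ofReal_exp]
        congr 1
        rw [show (((v ω).toNNReal : ℝ≥0) : ℂ) = ((v ω : ℝ) : ℂ) by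
          rw [Real.coe_toNNReal _ hω]]
        push_cast
        ring
      · refine Integrable.of_bound (C := 1) (by fun_prop) (ae_of_all _ fun x => ?_)
        rw [← Complex.ofReal_mul, Complex.norm_exp_ofReal_mul_I]
    rw [h2]
    simp_rw [h1]
    exact (h H hH t).const_smul _
  have h3 := (ProbabilityMeasure.tendsto_iff_forall_integral_tendsto.1 hlim) f
  have h4 : ∀ n, ∫ x, f x ∂(μ n : Measure ℝ) = ∫ ω, f (Y n ω) ∂P[|H] := by
    intro n
    change ∫ x, _ ∂P[|H].map (Y n) = _
    rw [integral_map (hY n).aemeasurable (by fun_prop)]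
  have h5 : ∫ x, f x ∂(μ₀ : Measure ℝ) = ∫ ω, ∫ y, f y ∂centeredGaussian v ω ∂P[|H] := by
    change ∫ x, _ ∂P[|H].bind κ = _
    rw [hbind, Kernel.integral_comp]
    · rfl
    · exact f.integrable _
  simp_rw [h4, h5] at h3
  exact h3

/-- Convergence to zero in probability. -/
def NegligibleInProbability (P : Measure Ω) (Y : ℕ → Ω → ℝ) : Prop :=
  Tendsto (fun n => ∫ ω, min 1 |Y n ω| ∂P) atTop (𝓝 0)

theorem integrable_min_one_abs {Y : Ω → ℝ} (hY : AEStronglyMeasurable Y P) :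
    Integrable (fun ω => min 1 |Y ω|) P := by
  refine Integrable.of_bound (C := 1) ?_ (ae_of_all _ fun ω => ?_)
  · exact (continuous_const.min continuous_abs).comp_aestronglyMeasurable hY
  · rw [Real.norm_eq_abs, abs_of_nonneg (le_min zero_le_one (abs_nonneg _))]
    exact min_le_left _ _

theorem NegligibleInProbability.add {Y Z : ℕ → Ω → ℝ} (hYm : ∀ n, AEStronglyMeasurable (Y n) P)
    (hZm : ∀ n, AEStronglyMeasurable (Z n) P) (hY : NegligibleInProbability P Y)
    (hZ : NegligibleInProbability P Z) : NegligibleInProbability P fun n ω => Y n ω + Z n ω := by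
  have hs := Tendsto.add hY hZ
  rw [add_zero] at hs
  refine squeeze_zero (fun n => integral_nonneg fun ω => le_min zero_le_one (abs_nonneg _))
    (fun n => ?_) hs
  rw [← integral_add (integrable_min_one_abs (hYm n)) (integrable_min_one_abs (hZm n))]
  refine integral_mono (integrable_min_one_abs ((hYm n).add (hZm n)))
    ((integrable_min_one_abs (hYm n)).add (integrable_min_one_abs (hZm n))) fun ω => ?_
  simp only
  have := abs_add_le (Y n ω) (Z n ω)
  rcases le_total 1 |Y n ω| with h1 | h1
  · rw [min_eq_left h1]
    have : min 1 |Y n ω + Z n ω| ≤ 1 := min_le_left _ _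
    have : 0 ≤ min 1 |Z n ω| := le_min zero_le_one (abs_nonneg _)
    linarith
  rcases le_total 1 |Z n ω| with h2 | h2
  · rw [min_eq_left h2]
    have : min 1 |Y n ω + Z n ω| ≤ 1 := min_le_left _ _
    have : 0 ≤ min 1 |Y n ω| := le_min zero_le_one (abs_nonneg _)
    linarith
  · rw [min_eq_right h1, min_eq_right h2]
    exact (min_le_right _ _).trans this

theorem NegligibleInProbability.of_ae_tendsto {Y : ℕ → Ω → ℝ}
    (hYm : ∀ n, AEStronglyMeasurable (Y n) P)
    (h : ∀ᵐ ω ∂P, Tendsto (fun n => Y n ω) atTop (𝓝 0)) : NegligibleInProbability P Y := by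
  have : Tendsto (fun n => ∫ ω, min 1 |Y n ω| ∂P) atTop (𝓝 (∫ _, (0 : ℝ) ∂P)) := by
    refine tendsto_integral_of_dominated_convergence (fun _ => 1)
      (fun n => (integrable_min_one_abs (hYm n)).aestronglyMeasurable) (integrable_const _)
      (fun n => ae_of_all _ fun ω => ?_) ?_
    · rw [Real.norm_eq_abs, abs_of_nonneg (le_min zero_le_one (abs_nonneg _))]
      exact min_le_left _ _
    · filter_upwards [h] with ω hω
      have := (tendsto_const_nhds (x := (1 : ℝ))).min hω.abs
      simpa using this
  simpa [NegligibleInProbability] using this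

theorem NegligibleInProbability.of_integral_abs {Y : ℕ → Ω → ℝ} (hYi : ∀ n, Integrable (Y n) P)
    (h : Tendsto (fun n => ∫ ω, |Y n ω| ∂P) atTop (𝓝 0)) : NegligibleInProbability P Y := by
  refine squeeze_zero (fun n => integral_nonneg fun ω => le_min zero_le_one (abs_nonneg _))
    (fun n => ?_) h
  exact integral_mono (integrable_min_one_abs (hYi n).aestronglyMeasurable) (hYi n).abs
    fun ω => min_le_right _ _

theorem NegligibleInProbability.of_integral_sq {Y : ℕ → Ω → ℝ} (hYm : ∀ n, Measurable (Y n))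
    (hYi : ∀ n, Integrable (fun ω => Y n ω ^ 2) P)
    (h : Tendsto (fun n => ∫ ω, Y n ω ^ 2 ∂P) atTop (𝓝 0)) : NegligibleInProbability P Y := by
  have hi : ∀ n, Integrable (Y n) P := fun n =>
    ((memLp_two_iff_integrable_sq (hYm n).aestronglyMeasurable).2 (hYi n)).integrable one_le_two
  refine .of_integral_abs hi ?_
  have h2 : Tendsto (fun n => √(∫ ω, Y n ω ^ 2 ∂P)) atTop (𝓝 0) := by
    have := (Real.continuous_sqrt.tendsto 0).comp h
    rwa [Real.sqrt_zero] at this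
  refine squeeze_zero (fun n => integral_nonneg fun ω => abs_nonneg _) (fun n => ?_) h2
  refine Real.le_sqrt_of_sq_le ?_
  have := variance_nonneg |Y n| P
  rw [variance_eq_sub ((memLp_two_iff_integrable_sq (hYm n).aestronglyMeasurable).2 (hYi n)).abs]
    at this
  simp only [Pi.pow_apply, Pi.abs_apply, sq_abs] at this
  linarith

/-- Perturbation and localization of the convergence of characteristic functions. -/
theorem tendsto_setIntegral_exp_of_approx {Y : ℕ → Ω → ℝ} (hY : ∀ n, Measurable (Y n))
    {v : Ω → ℝ} (hv : Measurable v) (hv0 : ∀ᵐ ω ∂P, 0 ≤ v ω) {Y' R : ℕ → ℕ → Ω → ℝ}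
    {v' : ℕ → Ω → ℝ} {G : ℕ → Set Ω} (hY' : ∀ a n, Measurable (Y' a n))
    (hR : ∀ a n, Measurable (R a n)) (hv' : ∀ a, Measurable (v' a))
    (hv0' : ∀ a, ∀ᵐ ω ∂P, 0 ≤ v' a ω) (hG : ∀ a, MeasurableSet (G a))
    (hG1 : Tendsto (fun a => P.real (G a)ᶜ) atTop (𝓝 0))
    (hRneg : ∀ a, NegligibleInProbability P (R a))
    (hYR : ∀ a n, ∀ᵐ ω ∂P, ω ∈ G a → Y n ω = Y' a n ω + R a n ω)
    (hvv : ∀ a, ∀ᵐ ω ∂P, ω ∈ G a → v ω = v' a ω) {H : Set Ω} (hH : MeasurableSet H) (t : ℝ)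
    (h : ∀ a, Tendsto (fun n => ∫ ω in H, Complex.exp (t * Y' a n ω * Complex.I) ∂P) atTop
      (𝓝 (∫ ω in H, (Real.exp (-(t ^ 2 / 2 * v' a ω)) : ℂ) ∂P))) :
    Tendsto (fun n => ∫ ω in H, Complex.exp (t * Y n ω * Complex.I) ∂P) atTop
      (𝓝 (∫ ω in H, (Real.exp (-(t ^ 2 / 2 * v ω)) : ℂ) ∂P)) := by
  have hi1 : ∀ {Z : Ω → ℝ}, Measurable Z →
      IntegrableOn (fun ω => Complex.exp (t * Z ω * Complex.I)) H P := fun hZ => by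
    refine Integrable.of_bound (C := 1) (by fun_prop) (ae_of_all _ fun ω => ?_)
    rw [← Complex.ofReal_mul, Complex.norm_exp_ofReal_mul_I]
  have hexp : ∀ {a : ℝ}, 0 ≤ a → Real.exp (-a) ≤ 1 := fun ha =>
    Real.exp_le_one_iff.2 (by linarith)
  have hi2 : ∀ {w : Ω → ℝ}, Measurable w → (∀ᵐ ω ∂P, 0 ≤ w ω) →
      IntegrableOn (fun ω => (Real.exp (-(t ^ 2 / 2 * w ω)) : ℂ)) H P := fun hw hw0 => by
    refine Integrable.of_bound (C := 1) (Measurable.aestronglyMeasurable (by fun_prop)) ?_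
    filter_upwards [ae_restrict_of_ae hw0] with ω hω
    rw [Complex.norm_real, Real.norm_eq_abs, abs_of_pos (Real.exp_pos _)]
    exact hexp (by positivity)
  have hGi : ∀ a, Integrable ((G a)ᶜ.indicator (1 : Ω → ℝ)) P := fun a =>
    (integrable_const (1 : ℝ)).indicator (hG a).compl
  have hGint : ∀ a, ∫ ω, (G a)ᶜ.indicator (1 : Ω → ℝ) ω ∂P = P.real (G a)ᶜ := fun a =>
    integral_indicator_one (hG a).compl
  -- Two numbers on the unit circle differ by at most 2, which serves off `G a` and where the
  -- remainder exceeds 1; elsewhere the difference is at most |t| times the remainder.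
  have b1 : ∀ a n, ‖∫ ω in H, Complex.exp (t * Y n ω * Complex.I) ∂P
      - ∫ ω in H, Complex.exp (t * Y' a n ω * Complex.I) ∂P‖
      ≤ 2 * P.real (G a)ᶜ + (2 + |t|) * ∫ ω, min 1 |R a n ω| ∂P := by
    intro a n
    have hRi := integrable_min_one_abs (P := P) (hR a n).aestronglyMeasurable
    rw [← integral_sub (hi1 (hY n)) (hi1 (hY' a n)), ← hGint, ← integral_const_mul,
      ← integral_const_mul, ← integral_add ((hGi a).const_mul _) (hRi.const_mul _)]
    refine (norm_integral_le_of_norm_le (((hGi a).const_mul _).add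
      (hRi.const_mul _)).integrableOn (ae_restrict_of_ae ?_)).trans
      (setIntegral_le_integral (((hGi a).const_mul _).add (hRi.const_mul _))
        (ae_of_all _ fun ω => ?_))
    · filter_upwards [hYR a n] with ω hω
      have h2 : ‖Complex.exp (t * Y n ω * Complex.I) - Complex.exp (t * Y' a n ω * Complex.I)‖
          ≤ 2 := by
        refine (norm_sub_le _ _).trans ?_
        rw [← Complex.ofReal_mul, ← Complex.ofReal_mul, Complex.norm_exp_ofReal_mul_I,
          Complex.norm_exp_ofReal_mul_I]
        norm_num
      have h0 : 0 ≤ min 1 |R a n ω| := le_min zero_le_one (abs_nonneg _)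
      simp only [Pi.add_apply]
      by_cases hω' : ω ∈ G a
      · rw [Set.indicator_of_notMem (by simpa using hω'), mul_zero, zero_add]
        rcases le_total 1 |R a n ω| with h1 | h1
        · rw [min_eq_left h1]
          linarith [abs_nonneg t]
        · rw [min_eq_right h1, ← Complex.ofReal_mul, ← Complex.ofReal_mul]
          refine (norm_exp_ofReal_mul_I_sub_le _ _).trans ?_
          rw [hω hω', ← mul_sub, add_sub_cancel_left, abs_mul]
          nlinarith [abs_nonneg (R a n ω)]
      · rw [Set.indicator_of_mem (by simpa using hω')]
        have : 0 ≤ (2 + |t|) * min 1 |R a n ω| := by positivity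
        simp only [Pi.one_apply]
        linarith
    · have h0 : 0 ≤ min 1 |R a n ω| := le_min zero_le_one (abs_nonneg _)
      have h1 : 0 ≤ (G a)ᶜ.indicator (1 : Ω → ℝ) ω :=
        Set.indicator_nonneg (fun _ _ => zero_le_one) _
      simp only [Pi.add_apply, Pi.zero_apply]
      positivity
  have b2 : ∀ a, ‖∫ ω in H, (Real.exp (-(t ^ 2 / 2 * v' a ω)) : ℂ) ∂P
      - ∫ ω in H, (Real.exp (-(t ^ 2 / 2 * v ω)) : ℂ) ∂P‖ ≤ P.real (G a)ᶜ := by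
    intro a
    rw [← integral_sub (hi2 (hv' a) (hv0' a)) (hi2 hv hv0), ← hGint]
    refine (norm_integral_le_of_norm_le (hGi a).integrableOn (ae_restrict_of_ae ?_)).trans
      (setIntegral_le_integral (hGi a) (ae_of_all _ fun ω =>
        Set.indicator_nonneg (fun _ _ => zero_le_one) _))
    filter_upwards [hvv a, hv0, hv0' a] with ω h1 h2 h3
    by_cases hω' : ω ∈ G a
    · rw [Set.indicator_of_notMem (by simpa using hω'), h1 hω']
      simp
    · rw [Set.indicator_of_mem (by simpa using hω'), ← Complex.ofReal_sub, Complex.norm_real,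
        Real.norm_eq_abs, abs_le, Pi.one_apply]
      have := hexp (show 0 ≤ t ^ 2 / 2 * v ω by positivity)
      have := hexp (show 0 ≤ t ^ 2 / 2 * v' a ω by positivity)
      constructor <;> linarith [Real.exp_pos (-(t ^ 2 / 2 * v ω)),
        Real.exp_pos (-(t ^ 2 / 2 * v' a ω))]
  rw [Metric.tendsto_atTop]
  intro r hr
  -- The localization level is fixed before n, since the remainders are negligible only for each
  -- level separately.
  obtain ⟨a, ha⟩ := (hG1.eventually_lt_const (show 0 < r / 8 by positivity)).exists
  have h1 := ((hRneg a).const_mul (2 + |t|))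
  rw [mul_zero] at h1
  obtain ⟨n₀, hn₀⟩ := eventually_atTop.1 ((h1.eventually_lt_const (show 0 < r / 8 by positivity)).and
    ((Metric.tendsto_nhds.1 (h a)) (r / 8) (by positivity)))
  refine ⟨n₀, fun n hn => ?_⟩
  obtain ⟨h2, h3⟩ := hn₀ n hn
  rw [dist_eq_norm] at h3 ⊢
  have e : ∀ x y z w : ℂ, x - w = (x - y) + (y - z) + (z - w) := fun x y z w => by ring
  rw [e _ (∫ ω in H, Complex.exp (t * Y' a n ω * Complex.I) ∂P)
    (∫ ω in H, (Real.exp (-(t ^ 2 / 2 * v' a ω)) : ℂ) ∂P)]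
  refine norm_add₃_le.trans_lt ?_
  linarith [b1 a n, b2 a]

end Stable

end WeightedIBP

namespace WeightedIBP

/-! ### Conditional laws -/

section CondLaw

variable {Ω E : Type*} {m m' mΩ : MeasurableSpace Ω} [MeasurableSpace E] {P : Measure Ω}
  [IsProbabilityMeasure P]

/-- Conditional probabilities given set by set determine the integrals of functions of the past and
of `Y` jointly. `κ` is not assumed to be a measurable kernel, so almost everywhere measurability of
the inner integrals is proved along with the formula; no regularity of `E` is needed. -/
theorem lintegral_condLaw (hm : m ≤ mΩ) {Y : Ω → E} (hY : Measurable Y) {κ : Ω → Measure E}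
    (hκ : ∀ ω, IsProbabilityMeasure (κ ω))
    (h : ∀ A, MeasurableSet A → P⟦Y ⁻¹' A | m⟧ =ᵐ[P] fun ω => (κ ω).real A)
    {Φ : Ω × E → ℝ≥0∞} (hΦ : Measurable[m.prod inferInstance] Φ) :
    AEMeasurable (fun ω => ∫⁻ y, Φ (ω, y) ∂κ ω) P ∧
      ∫⁻ ω, Φ (ω, Y ω) ∂P = ∫⁻ ω, ∫⁻ y, Φ (ω, y) ∂κ ω ∂P := by
  have hpair : Measurable[mΩ, m.prod inferInstance] fun ω => (ω, Y ω) :=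
    @Measurable.prodMk _ mΩ _ _ m _ _ _ (measurable_id'' hm) hY
  have hsec : ∀ {Φ : Ω × E → ℝ≥0∞}, Measurable[m.prod inferInstance] Φ →
      ∀ ω, Measurable fun y => Φ (ω, y) := fun hΦ ω =>
    hΦ.comp (@measurable_prodMk_left Ω E m _ ω)
  have hset : ∀ D, MeasurableSet[m.prod inferInstance] D →
      AEMeasurable (fun ω => κ ω (Prod.mk ω ⁻¹' D)) P ∧
        P ((fun ω => (ω, Y ω)) ⁻¹' D) = ∫⁻ ω, κ ω (Prod.mk ω ⁻¹' D) ∂P := by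
    intro D hD
    have hsecD : ∀ {D : Set (Ω × E)}, MeasurableSet[m.prod inferInstance] D → ∀ ω,
        MeasurableSet (Prod.mk ω ⁻¹' D) := fun hD ω => (@measurable_prodMk_left Ω E m _ ω) hD
    -- Dynkin's π-λ argument from rectangles, where the formula is the definition of conditional
    -- expectation.
    induction D, hD using MeasurableSpace.induction_on_inter
      (@generateFrom_prod Ω E m _).symm (@isPiSystem_prod Ω E m _) with
    | empty => simp
    | basic D hD =>
      obtain ⟨G, hG, A, hA, rfl⟩ := hD
      have h1 : ∀ ω, κ ω (Prod.mk ω ⁻¹' (G ×ˢ A))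
          = G.indicator (fun ω => ENNReal.ofReal ((κ ω).real A)) ω := by
        intro ω
        by_cases hω : ω ∈ G
        · rw [Set.indicator_of_mem hω, Set.mk_preimage_prod_right hω, ofReal_measureReal]
        · rw [Set.indicator_of_notMem hω, Set.mk_preimage_prod_right_eq_empty hω, measure_empty]
      simp_rw [h1]
      have h2 : AEMeasurable (fun ω => (κ ω).real A) P :=
        (stronglyMeasurable_condExp.mono hm).measurable.aemeasurable.congr (h A hA)
      refine ⟨h2.ennreal_ofReal.indicator (hm _ hG), ?_⟩
      have h3 : Integrable (fun ω => (κ ω).real A) P :=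
        integrable_condExp.congr (h A hA)
      rw [lintegral_indicator (hm _ hG), ← ofReal_integral_eq_lintegral_ofReal h3.integrableOn
        (ae_of_all _ fun ω => measureReal_nonneg)]
      have h4 : ∫ ω in G, (κ ω).real A ∂P = ∫ ω in G, (Y ⁻¹' A).indicator (fun _ => (1 : ℝ)) ω ∂P := by
        rw [← setIntegral_condExp hm (f := (Y ⁻¹' A).indicator fun _ => (1 : ℝ))
          ((integrable_const _).indicator (hY hA)) hG]
        exact setIntegral_congr_ae (hm _ hG) ((h A hA).mono fun ω hω _ => hω.symm)
      rw [h4, integral_indicator_const _ (hY hA), smul_eq_mul, mul_one, ofReal_measureReal,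
        Measure.restrict_apply (hY hA), Set.inter_comm]
      rfl
    | compl D hD ih =>
      have hc : ∀ ω, κ ω (Prod.mk ω ⁻¹' Dᶜ) = 1 - κ ω (Prod.mk ω ⁻¹' D) := fun ω => by
        rw [Set.preimage_compl, prob_compl_eq_one_sub (hsecD hD ω)]
      simp_rw [hc]
      refine ⟨aemeasurable_const.sub ih.1, ?_⟩
      rw [Set.preimage_compl, prob_compl_eq_one_sub (hpair hD), ih.2, lintegral_sub' ih.1]
      · simp
      · rw [← ih.2]; exact measure_ne_top _ _
      · exact ae_of_all _ fun ω => prob_le_one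
    | iUnion D hd hD ih =>
      have hc : ∀ ω, κ ω (Prod.mk ω ⁻¹' ⋃ i, D i) = ∑' i, κ ω (Prod.mk ω ⁻¹' D i) := fun ω => by
        rw [Set.preimage_iUnion, measure_iUnion (fun i j hij => (hd hij).preimage _)
          fun i => hsecD (hD i) ω]
      simp_rw [hc]
      refine ⟨AEMeasurable.tsum fun i => (ih i).1, ?_⟩
      rw [Set.preimage_iUnion, measure_iUnion (fun i j hij => (hd hij).preimage _)
          fun i => hpair (hD i), lintegral_tsum fun i => (ih i).1]
      exact tsum_congr fun i => (ih i).2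
  refine @Measurable.ennreal_induction (Ω × E) (m.prod inferInstance)
    (fun Φ => AEMeasurable (fun ω => ∫⁻ y, Φ (ω, y) ∂κ ω) P ∧
      ∫⁻ ω, Φ (ω, Y ω) ∂P = ∫⁻ ω, ∫⁻ y, Φ (ω, y) ∂κ ω ∂P) ?_ ?_ ?_ Φ hΦ
  · intro a D hD
    obtain ⟨h1, h2⟩ := hset D hD
    have h3 : ∀ ω, ∫⁻ y, D.indicator (fun _ => a) (ω, y) ∂κ ω = a * κ ω (Prod.mk ω ⁻¹' D) := by
      intro ω
      rw [← lintegral_indicator_const ((@measurable_prodMk_left Ω E m _ ω) hD)]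
      rfl
    simp_rw [h3]
    refine ⟨h1.const_mul a, ?_⟩
    rw [lintegral_const_mul'' _ h1, ← h2, ← lintegral_indicator_const (hpair hD)]
    rfl
  · intro Φ Ψ _ hΦ hΨ ihΦ ihΨ
    have h3 : ∀ ω, ∫⁻ y, (Φ + Ψ) (ω, y) ∂κ ω = ∫⁻ y, Φ (ω, y) ∂κ ω + ∫⁻ y, Ψ (ω, y) ∂κ ω :=
      fun ω => lintegral_add_left (hsec hΦ ω) _
    simp_rw [h3]
    refine ⟨ihΦ.1.add ihΨ.1, ?_⟩
    rw [lintegral_add_left' ihΦ.1, ← ihΦ.2, ← ihΨ.2]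
    exact lintegral_add_left (hΦ.comp hpair) _
  · intro Φ hΦ hmono ih
    have h3 : ∀ ω, ∫⁻ y, ⨆ n, Φ n (ω, y) ∂κ ω = ⨆ n, ∫⁻ y, Φ n (ω, y) ∂κ ω := fun ω =>
      lintegral_iSup (fun n => hsec (hΦ n) ω) fun i j hij y => hmono hij _
    simp_rw [h3]
    refine ⟨AEMeasurable.iSup fun n => (ih n).1, ?_⟩
    rw [lintegral_iSup' (fun n => (ih n).1) (ae_of_all _ fun ω i j hij =>
      lintegral_mono fun y => hmono hij _)]
    exact (lintegral_iSup (fun n => (hΦ n).comp hpair) fun i j hij ω => hmono hij _).trans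
      (iSup_congr fun n => (ih n).2)

/-- Working in `ℝ≥0∞` yields integrability of `f` as a conclusion, so no moments of the process need
to be known beforehand. -/
theorem integrable_and_condExp_eq_of_lintegral (hm : m ≤ mΩ) {f g : Ω → ℝ} (hf : Measurable f)
    (hf0 : ∀ᵐ ω ∂P, 0 ≤ f ω) (hg : StronglyMeasurable[m] g) (hg0 : ∀ᵐ ω ∂P, 0 ≤ g ω)
    (hgi : Integrable g P)
    (h : ∀ A, MeasurableSet[m] A →
      ∫⁻ ω in A, ENNReal.ofReal (f ω) ∂P = ∫⁻ ω in A, ENNReal.ofReal (g ω) ∂P) :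
    Integrable f P ∧ P[f | m] =ᵐ[P] g := by
  have hfi : Integrable f P := by
    refine ⟨hf.aestronglyMeasurable, ?_⟩
    rw [hasFiniteIntegral_iff_ofReal hf0]
    have := h Set.univ MeasurableSet.univ
    rw [Measure.restrict_univ] at this
    rw [this]
    exact (hasFiniteIntegral_iff_ofReal hg0).1 hgi.2
  refine ⟨hfi, (ae_eq_condExp_of_forall_setIntegral_eq hm hfi (fun A _ _ => hgi.integrableOn)
    (fun A hA _ => ?_) hg.aestronglyMeasurable).symm⟩
  rw [integral_eq_lintegral_of_nonneg_ae (ae_restrict_of_ae hg0)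
    (hgi.integrableOn.aestronglyMeasurable), integral_eq_lintegral_of_nonneg_ae
    (ae_restrict_of_ae hf0) (hfi.integrableOn.aestronglyMeasurable), h A hA]

/-- A centred factor stays centred when multiplied by a function of the past and of an independent
variable. -/
theorem condExp_mul_indep_eq_zero {S : Type*} [MeasurableSpace S] (hm : m ≤ m')
    (hm' : m' ≤ mΩ) {ζ R : Ω → ℝ} {T : Ω → S} (hζ : StronglyMeasurable[m'] ζ) (hζi : Integrable ζ P)
    (hζ0 : P[ζ | m] =ᵐ[P] 0) (hT : Measurable[m] T) (hR : Measurable R)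
    (hind : Indep (MeasurableSpace.comap R inferInstance) m' P) {φ : S × ℝ → ℝ}
    (hφ : Measurable φ) {B : ℝ} (hB : ∀ z, |φ z| ≤ B) :
    P[fun ω => ζ ω * φ (T ω, R ω) | m] =ᵐ[P] 0 := by
  have hmΩ := hm.trans hm'
  have hTm : Measurable T := hT.mono hmΩ le_rfl
  have hφTR : Measurable fun ω => φ (T ω, R ω) := hφ.comp (hTm.prodMk hR)
  have hi : Integrable (fun ω => ζ ω * φ (T ω, R ω)) P :=
    hζi.mul_bdd (c := B) hφTR.aestronglyMeasurable (ae_of_all _ fun ω => hB _)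
  refine (ae_eq_condExp_of_forall_setIntegral_eq hmΩ hi (fun A _ _ => integrableOn_zero)
    (fun A hA _ => ?_) aestronglyMeasurable_const).symm
  simp only [Pi.zero_apply, integral_zero]
  symm
  -- Bundling the centred factor with the past variable gives one `m'`-measurable variable
  -- independent of `R`. Its joint law with `R` is a product, and Fubini allows integrating out the
  -- centred factor first.
  let Y : Ω → ℝ × S := fun ω => (A.indicator ζ ω, T ω)
  have hYm' : Measurable[m'] Y :=
    (hζ.measurable.indicator (hm _ hA)).prodMk (hT.mono hm le_rfl)
  have hY : Measurable Y := hYm'.mono hm' le_rfl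
  have hYR : IndepFun Y R P := by
    rw [IndepFun_iff_Indep]
    exact (indep_of_indep_of_le_right hind hYm'.comap_le).symm
  have hmap := (indepFun_iff_map_prod_eq_prod_map_map hY.aemeasurable hR.aemeasurable).1 hYR
  let F : (ℝ × S) × ℝ → ℝ := fun z => z.1.1 * φ (z.1.2, z.2)
  have hF : Measurable F := by fun_prop
  have h1 : ∫ ω in A, ζ ω * φ (T ω, R ω) ∂P = ∫ z, F z ∂(P.map Y).prod (P.map R) := by
    rw [← hmap, integral_map (hY.prodMk hR).aemeasurable hF.aestronglyMeasurable,
      ← integral_indicator (hmΩ _ hA)]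
    refine integral_congr_ae (ae_of_all _ fun ω => ?_)
    by_cases hω : ω ∈ A <;> simp [F, Y, hω]
  have hFi : Integrable F ((P.map Y).prod (P.map R)) := by
    rw [← hmap, integrable_map_measure hF.aestronglyMeasurable (hY.prodMk hR).aemeasurable]
    refine (hi.indicator (hmΩ _ hA)).congr (ae_of_all _ fun ω => ?_)
    by_cases hω : ω ∈ A <;> simp [F, Y, hω]
  have : IsProbabilityMeasure (P.map Y) := Measure.isProbabilityMeasure_map hY.aemeasurable
  have : IsProbabilityMeasure (P.map R) := Measure.isProbabilityMeasure_map hR.aemeasurable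
  rw [h1, integral_prod_symm _ hFi]
  refine (integral_congr_ae (ae_of_all _ fun ρ => ?_)).trans (integral_zero _ _)
  have hFρ : Measurable fun y : ℝ × S => F (y, ρ) := hF.comp measurable_prodMk_right
  rw [integral_map hY.aemeasurable hFρ.aestronglyMeasurable]
  -- With the value ρ of `R` frozen, the cofactor of ζ is a bounded function of the past, so the
  -- integral vanishes.
  have hg : StronglyMeasurable[m] fun ω => A.indicator (fun ω => φ (T ω, ρ)) ω :=
    ((hφ.comp (hT.prodMk measurable_const)).indicator hA).stronglyMeasurable
  have hgB : ∀ ω, ‖A.indicator (fun ω => φ (T ω, ρ)) ω‖ ≤ B := fun ω => by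
    by_cases hω : ω ∈ A
    · simpa [hω] using hB _
    · simpa [hω] using (abs_nonneg _).trans (hB (T ω, ρ))
  have h2 := condExp_stronglyMeasurable_mul_of_bound hmΩ hg hζi B (ae_of_all _ hgB)
  have h3 := integral_condExp hmΩ (μ := P) (f := (fun ω => A.indicator (fun ω => φ (T ω, ρ)) ω) * ζ)
  rw [integral_congr_ae h2] at h3
  have h4 : ∫ ω, F (Y ω, ρ) ∂P = ∫ ω, ((fun ω => A.indicator (fun ω => φ (T ω, ρ)) ω) * ζ) ω ∂P := by
    refine integral_congr_ae (ae_of_all _ fun ω => ?_)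
    by_cases hω : ω ∈ A <;> simp [F, Y, hω, mul_comm]
  rw [h4, ← h3]
  refine (integral_congr_ae ?_).trans (integral_zero _ _)
  filter_upwards [hζ0] with ω hω
  simp [hω]

/-- Split `f` into its conditional expectation and a centred part. The centred part contributes
nothing by `condExp_mul_indep_eq_zero`; the other is pulled out. -/
theorem condExp_mul_comp_indep (hm : m ≤ m') (hm' : m' ≤ mΩ)
    {f f' R : Ω → ℝ} (hf : StronglyMeasurable[m'] f) (hfi : Integrable f P)
    (hff' : P[f | m] =ᵐ[P] f') (hR : Measurable R)
    (hind : Indep (MeasurableSpace.comap R inferInstance) m' P) {ψ : ℝ → ℝ}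
    (hψ : Measurable ψ) {B : ℝ} (hB : ∀ z, |ψ z| ≤ B) :
    P[fun ω => f ω * ψ (R ω) | m] =ᵐ[P] fun ω => (∫ ω, ψ (R ω) ∂P) * f' ω := by
  have hmΩ := hm.trans hm'
  have hψR : Measurable fun ω => ψ (R ω) := hψ.comp hR
  have hψi : Integrable (fun ω => ψ (R ω)) P :=
    Integrable.of_bound hψR.aestronglyMeasurable B (ae_of_all _ fun ω => hB _)
  set e := P[f | m] with he
  have hem : StronglyMeasurable[m] e := stronglyMeasurable_condExp
  have h1 := condExp_mul_indep_eq_zero (ζ := f - e) (T := fun _ => 0) (φ := fun z => ψ z.2) hm hm'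
    (hf.sub (hem.mono hm)) (hfi.sub integrable_condExp) (by
      refine (condExp_sub hfi integrable_condExp m).trans ?_
      rw [condExp_of_stronglyMeasurable hmΩ hem integrable_condExp]
      simp [he]) measurable_const hR hind (by fun_prop) fun z => hB _
  have h2 : Integrable (fun ω => e ω * ψ (R ω)) P :=
    integrable_condExp.mul_bdd (c := B) hψR.aestronglyMeasurable (ae_of_all _ fun ω => hB _)
  have h3 : Integrable (fun ω => f ω * ψ (R ω)) P :=
    hfi.mul_bdd (c := B) hψR.aestronglyMeasurable (ae_of_all _ fun ω => hB _)
  have h4 : P[fun ω => e ω * ψ (R ω) | m] =ᵐ[P] fun ω => e ω * ∫ ω, ψ (R ω) ∂P := by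
    have h5 := condExp_mul_of_stronglyMeasurable_left hem h2 hψi
    have h6 : P[fun ω => ψ (R ω) | m] =ᵐ[P] fun _ => ∫ ω, ψ (R ω) ∂P := by
      refine condExp_indep_eq (m₁ := MeasurableSpace.comap R inferInstance) hR.comap_le hmΩ ?_
        (indep_of_indep_of_le_right hind hm)
      exact (hψ.comp (comap_measurable R)).stronglyMeasurable
    filter_upwards [h5, h6] with ω h5 h6
    refine h5.trans ?_
    rw [Pi.mul_apply, h6]
  have h7 := condExp_sub h3 h2 m
  have h8 : (fun ω => f ω * ψ (R ω)) - (fun ω => e ω * ψ (R ω))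
      = fun ω => (f - e) ω * ψ (R ω) := by
    ext ω; simp [sub_mul]
  rw [h8] at h7
  filter_upwards [h1, h4, h7, hff'] with ω h1 h4 h7 h9
  have h10 := h7.symm.trans h1
  simp only [Pi.sub_apply, Pi.zero_apply] at h10
  rw [sub_eq_zero.1 h10, h4, ← h9, mul_comm]

end CondLaw

end WeightedIBP

namespace WeightedIBP

/-! ### Martingale differences -/

section MartingaleDifferences

variable {Ω : Type*} {m mΩ : MeasurableSpace Ω} {P : Measure Ω} [IsProbabilityMeasure P]

theorem integrable_of_integrable_sq {f : Ω → ℝ} (hf : AEStronglyMeasurable f P)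
    (h : Integrable (fun ω => f ω ^ 2) P) : Integrable f P :=
  ((memLp_two_iff_integrable_sq hf).2 h).integrable one_le_two

theorem integrable_mul_of_integrable_sq {f g : Ω → ℝ} (hf : AEStronglyMeasurable f P)
    (hg : AEStronglyMeasurable g P) (hf2 : Integrable (fun ω => f ω ^ 2) P)
    (hg2 : Integrable (fun ω => g ω ^ 2) P) : Integrable (fun ω => f ω * g ω) P :=
  ((memLp_two_iff_integrable_sq hf).2 hf2).integrable_mul ((memLp_two_iff_integrable_sq hg).2 hg2)

theorem integral_mul_eq_zero_of_condExp (hm : m ≤ mΩ) {f g : Ω → ℝ} (hf : StronglyMeasurable[m] f)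
    (hg : Integrable g P) (hfg : Integrable (fun ω => f ω * g ω) P) (h : P[g | m] =ᵐ[P] 0) :
    ∫ ω, f ω * g ω ∂P = 0 := by
  rw [← integral_condExp hm (f := fun ω => f ω * g ω)]
  refine (integral_congr_ae ?_).trans (integral_zero _ _)
  filter_upwards [condExp_mul_of_stronglyMeasurable_left hf hfg hg, h] with ω h1 h2
  refine h1.trans ?_
  simp [h2]

variable {ℱ : Filtration ℕ mΩ} {x : ℕ → Ω → ℝ}

theorem measurable_sum_of_measurable_succ (hx : ∀ k, Measurable[ℱ (k + 1)] (x k)) (n : ℕ) :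
    Measurable[ℱ n] fun ω => ∑ k ∈ Finset.range n, x k ω :=
  Finset.measurable_fun_sum _ fun k hk =>
    (hx k).mono (ℱ.mono (Finset.mem_range.1 hk)) le_rfl

/-- Martingale differences are orthogonal. -/
theorem integral_sq_sum_eq (hx : ∀ k, Measurable[ℱ (k + 1)] (x k))
    (hx2 : ∀ k, Integrable (fun ω => x k ω ^ 2) P) (hx0 : ∀ k, P[x k | ℱ k] =ᵐ[P] 0) (n : ℕ) :
    Integrable (fun ω => (∑ k ∈ Finset.range n, x k ω) ^ 2) P ∧
      ∫ ω, (∑ k ∈ Finset.range n, x k ω) ^ 2 ∂P = ∑ k ∈ Finset.range n, ∫ ω, x k ω ^ 2 ∂P := by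
  induction n with
  | zero => simp
  | succ n ih =>
    have hS := measurable_sum_of_measurable_succ hx n
    have hSm : Measurable fun ω => ∑ k ∈ Finset.range n, x k ω := hS.mono (ℱ.le n) le_rfl
    have hxm : Measurable (x n) := (hx n).mono (ℱ.le _) le_rfl
    have hSx := integrable_mul_of_integrable_sq hSm.aestronglyMeasurable hxm.aestronglyMeasurable
      ih.1 (hx2 n)
    have h0 := integral_mul_eq_zero_of_condExp (ℱ.le n) hS.stronglyMeasurable
      (integrable_of_integrable_sq hxm.aestronglyMeasurable (hx2 n)) hSx (hx0 n)
    have he : ∀ ω, (∑ k ∈ Finset.range (n + 1), x k ω) ^ 2 = (∑ k ∈ Finset.range n, x k ω) ^ 2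
        + 2 * ((∑ k ∈ Finset.range n, x k ω) * x n ω) + x n ω ^ 2 := fun ω => by
      rw [Finset.sum_range_succ]; ring
    simp_rw [he]
    refine ⟨(ih.1.add (hSx.const_mul 2)).add (hx2 n), ?_⟩
    have hadd : Integrable (fun ω => (∑ k ∈ Finset.range n, x k ω) ^ 2
        + 2 * ((∑ k ∈ Finset.range n, x k ω) * x n ω)) P := ih.1.add (hSx.const_mul 2)
    rw [integral_add hadd (hx2 n), integral_add ih.1 (hSx.const_mul 2), integral_const_mul, h0, ih.2, Finset.sum_range_succ]
    ring

/-- Kronecker's lemma. By Abel summation the Cesàro mean is S_n minus the Cesàro mean of the partial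
sums S_k, and both tend to s. -/
theorem tendsto_cesaro_of_tendsto_sum_div {x : ℕ → ℝ} {s : ℝ}
    (h : Tendsto (fun n => ∑ k ∈ Finset.range n, x k / (k + 1)) atTop (𝓝 s)) :
    Tendsto (fun n : ℕ => (1 / (n : ℝ)) * ∑ k ∈ Finset.range n, x k) atTop (𝓝 0) := by
  set S : ℕ → ℝ := fun n => ∑ k ∈ Finset.range n, x k / (k + 1) with hS
  have hAbel : ∀ n : ℕ, ∑ k ∈ Finset.range n, x k = n * S n - ∑ k ∈ Finset.range n, S k := by
    intro n
    induction n with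
    | zero => simp
    | succ n ih =>
      have h1 : S (n + 1) = S n + x n / (n + 1) := Finset.sum_range_succ _ _
      rw [Finset.sum_range_succ, ih, Finset.sum_range_succ, h1]
      have : (n : ℝ) + 1 ≠ 0 := by positivity
      push_cast
      field_simp
      ring
  have h2 := h.sub h.cesaro
  rw [sub_self] at h2
  refine h2.congr' ?_
  filter_upwards [eventually_gt_atTop 0] with n hn
  have : (n : ℝ) ≠ 0 := by positivity
  rw [hAbel]
  simp only [hS]
  field_simp

/-- The strong law of large numbers for martingale differences that are bounded in `L²`. -/
theorem tendsto_cesaro_martingale_differences (hx : ∀ k, Measurable[ℱ (k + 1)] (x k))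
    (hx2 : ∀ k, Integrable (fun ω => x k ω ^ 2) P) (hx0 : ∀ k, P[x k | ℱ k] =ᵐ[P] 0) {B : ℝ}
    (hB : ∀ k, ∫ ω, x k ω ^ 2 ∂P ≤ B) :
    ∀ᵐ ω ∂P, Tendsto (fun n : ℕ => (1 / (n : ℝ)) * ∑ k ∈ Finset.range n, x k ω) atTop (𝓝 0) := by
  -- Dividing by k + 1 makes the second moments summable, so the partial sums are a martingale
  -- bounded in L², hence in L¹, and converge; Kronecker's lemma then applies.
  set y : ℕ → Ω → ℝ := fun k ω => x k ω / (k + 1) with hy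
  have hym : ∀ k, Measurable[ℱ (k + 1)] (y k) := fun k => (hx k).div_const _
  have hy2' : ∀ k ω, y k ω ^ 2 = x k ω ^ 2 / ((k : ℝ) + 1) ^ 2 := fun k ω => div_pow _ _ _
  have hy2 : ∀ k, Integrable (fun ω => y k ω ^ 2) P := fun k => by
    simp_rw [hy2']; exact (hx2 k).div_const _
  have hyi : ∀ k, Integrable (y k) P := fun k => integrable_of_integrable_sq
    ((hym k).mono (ℱ.le _) le_rfl).aestronglyMeasurable (hy2 k)
  have hy0 : ∀ k, P[y k | ℱ k] =ᵐ[P] 0 := fun k => by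
    have h := condExp_smul (μ := P) (((k : ℝ) + 1)⁻¹) (x k) (ℱ k)
    have h1 : ((k : ℝ) + 1)⁻¹ • x k = y k := by
      ext ω; simp [hy, div_eq_inv_mul]
    rw [h1] at h
    filter_upwards [h, hx0 k] with ω h h0
    simp [h, h0]
  set S : ℕ → Ω → ℝ := fun n ω => ∑ k ∈ Finset.range n, y k ω with hS
  have hSm := measurable_sum_of_measurable_succ hym
  have hSi : ∀ n, Integrable (S n) P := fun n => integrable_finsetSum _ fun k _ => hyi k
  have hmart : Martingale S ℱ P := by
    refine martingale_of_condExp_sub_eq_zero_nat (fun n => (hSm n).stronglyMeasurable) hSi fun n => ?_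
    have : S (n + 1) - S n = y n := by
      ext ω; simp [hS, Finset.sum_range_succ]
    rw [this]
    exact hy0 n
  have hsum := (summable_nat_add_iff 1).2 (Real.summable_one_div_nat_pow.2 one_lt_two)
  set A : ℝ := ∑' k : ℕ, 1 / (((k + 1 : ℕ) : ℝ)) ^ 2
  have hSbd : ∀ n, ∫ ω, S n ω ^ 2 ∂P ≤ B * A := fun n => by
    have hB0 : 0 ≤ B := (integral_nonneg fun ω => sq_nonneg _).trans (hB 0)
    rw [(integral_sq_sum_eq hym hy2 hy0 n).2]
    calc ∑ k ∈ Finset.range n, ∫ ω, y k ω ^ 2 ∂P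
        ≤ ∑ k ∈ Finset.range n, B * (1 / (((k + 1 : ℕ) : ℝ)) ^ 2) := by
          refine Finset.sum_le_sum fun k _ => ?_
          simp_rw [hy2']
          rw [integral_div, mul_one_div]
          push_cast
          gcongr
          exact hB k
      _ = B * ∑ k ∈ Finset.range n, (1 / (((k + 1 : ℕ) : ℝ)) ^ 2) := by rw [Finset.mul_sum]
      _ ≤ B * A := by
          gcongr
          exact hsum.sum_le_tsum _ fun k _ => by positivity
  have hL1 : ∀ n, eLpNorm (S n) 1 P ≤ ((1 + B * A).toNNReal : ℝ≥0) := fun n => by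
    rw [eLpNorm_one_eq_lintegral_enorm, ← ofReal_integral_norm_eq_lintegral_enorm (hSi n)]
    refine ENNReal.ofReal_le_ofReal ?_
    have h1 : ∫ ω, ‖S n ω‖ ∂P ≤ ∫ ω, (1 + S n ω ^ 2) ∂P := by
      refine integral_mono (hSi n).norm
        ((integrable_const _).add (integral_sq_sum_eq hym hy2 hy0 n).1) fun ω => ?_
      simp only [Real.norm_eq_abs]
      nlinarith [sq_abs (S n ω), sq_nonneg (|S n ω| - 1)]
    rw [integral_add (integrable_const _) (integral_sq_sum_eq hym hy2 hy0 n).1] at h1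
    simp only [integral_const, probReal_univ, smul_eq_mul, mul_one] at h1
    linarith [hSbd n]
  filter_upwards [hmart.submartingale.exists_ae_tendsto_of_bdd hL1] with ω ⟨s, hs⟩
  exact tendsto_cesaro_of_tendsto_sum_div hs

end MartingaleDifferences

/-! ### Weighted sums -/

/-- A Toeplitz lemma: finitely many early terms disappear since the weights are uniformly small,
late ones since `a` is small and the total weight is bounded. -/
theorem tendsto_sum_weights_mul {w : ℕ → ℕ → ℝ} {N : ℕ → ℕ} {A : ℝ} {δ : ℕ → ℝ}
    (hw : ∀ n k, 0 ≤ w n k) (hwδ : ∀ n k, w n k ≤ δ n) (hδ : Tendsto δ atTop (𝓝 0))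
    (hA : ∀ n, ∑ k ∈ Finset.range (N n), w n k ≤ A) {a : ℕ → ℝ}
    (hN : Tendsto N atTop atTop) (ha : Tendsto a atTop (𝓝 0)) :
    Tendsto (fun n => ∑ k ∈ Finset.range (N n), w n k * a k) atTop (𝓝 0) := by
  have hA0 : 0 ≤ A := (Finset.sum_nonneg fun k _ => hw 0 k).trans (hA 0)
  have hδ0 : ∀ n, 0 ≤ δ n := fun n => (hw n 0).trans (hwδ n 0)
  rw [Metric.tendsto_atTop]
  intro ε hε
  obtain ⟨k₀, hk₀⟩ := Metric.tendsto_atTop.1 ha (ε / (2 * (A + 1))) (by positivity)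
  have h1 : Tendsto (fun n => δ n * ∑ k ∈ Finset.range k₀, |a k|) atTop (𝓝 0) := by
    simpa using hδ.mul_const (∑ k ∈ Finset.range k₀, |a k|)
  have h2 := (h1.eventually (gt_mem_nhds (half_pos hε))).and (hN.eventually_ge_atTop k₀)
  obtain ⟨n₀, hn₀⟩ := eventually_atTop.1 h2
  refine ⟨n₀, fun n hn => ?_⟩
  obtain ⟨h3, h4⟩ := hn₀ n hn
  rw [Real.dist_0_eq_abs, ← Finset.sum_range_add_sum_Ico _ h4]
  have h5 : |∑ k ∈ Finset.range k₀, w n k * a k| ≤ δ n * ∑ k ∈ Finset.range k₀, |a k| := by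
    rw [Finset.mul_sum]
    refine (Finset.abs_sum_le_sum_abs _ _).trans (Finset.sum_le_sum fun k _ => ?_)
    rw [abs_mul, abs_of_nonneg (hw n k)]
    exact mul_le_mul_of_nonneg_right (hwδ n k) (abs_nonneg _)
  have h6 : |∑ k ∈ Finset.Ico k₀ (N n), w n k * a k| ≤ A * (ε / (2 * (A + 1))) := by
    refine (Finset.abs_sum_le_sum_abs _ _).trans ?_
    calc ∑ k ∈ Finset.Ico k₀ (N n), |w n k * a k|
        ≤ ∑ k ∈ Finset.Ico k₀ (N n), w n k * (ε / (2 * (A + 1))) := by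
          refine Finset.sum_le_sum fun k hk => ?_
          rw [abs_mul, abs_of_nonneg (hw n k)]
          have := hk₀ k (Finset.mem_Ico.1 hk).1
          rw [Real.dist_0_eq_abs] at this
          exact mul_le_mul_of_nonneg_left this.le (hw n k)
      _ = (∑ k ∈ Finset.Ico k₀ (N n), w n k) * (ε / (2 * (A + 1))) := by rw [Finset.sum_mul]
      _ ≤ A * (ε / (2 * (A + 1))) := by
          gcongr
          refine (Finset.sum_le_sum_of_subset_of_nonneg (fun k hk => ?_) fun k _ _ => hw n k).trans
            (hA n)
          exact Finset.mem_range.2 (Finset.mem_Ico.1 hk).2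
  have h7 : A * (ε / (2 * (A + 1))) ≤ ε / 2 := by
    rw [mul_div_assoc', div_le_iff₀ (by positivity)]
    nlinarith
  linarith [abs_add_le (∑ k ∈ Finset.range k₀, w n k * a k) (∑ k ∈ Finset.Ico k₀ (N n), w n k * a k)]

/-- The ℓ² version, in which Cauchy–Schwarz treats the late terms. It serves the deterministic
errors, for which only the squares of the weights have a bounded sum. -/
theorem tendsto_sum_weights_mul_of_summable_sq {w : ℕ → ℕ → ℝ} {N : ℕ → ℕ} {A : ℝ} {δ : ℕ → ℝ}
    (hw : ∀ n k, 0 ≤ w n k) (hwδ : ∀ n k, w n k ≤ δ n) (hδ : Tendsto δ atTop (𝓝 0))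
    (hA : ∀ n, ∑ k ∈ Finset.range (N n), w n k ^ 2 ≤ A) {a : ℕ → ℝ} (ha0 : ∀ k, 0 ≤ a k)
    (hN : Tendsto N atTop atTop) (ha : Summable fun k => a k ^ 2) :
    Tendsto (fun n => ∑ k ∈ Finset.range (N n), w n k * a k) atTop (𝓝 0) := by
  have hA0 : 0 ≤ A := (Finset.sum_nonneg fun k _ => sq_nonneg _).trans (hA 0)
  rw [Metric.tendsto_atTop]
  intro ε hε
  have htail := tendsto_sum_nat_add fun k => a k ^ 2
  obtain ⟨k₀, hk₀⟩ := (htail.eventually (gt_mem_nhds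
    (show 0 < ε ^ 2 / (4 * (A + 1)) by positivity))).exists
  have h1 : Tendsto (fun n => δ n * ∑ k ∈ Finset.range k₀, |a k|) atTop (𝓝 0) := by
    simpa using hδ.mul_const (∑ k ∈ Finset.range k₀, |a k|)
  have h2 := (h1.eventually (gt_mem_nhds (half_pos hε))).and (hN.eventually_ge_atTop k₀)
  obtain ⟨n₀, hn₀⟩ := eventually_atTop.1 h2
  refine ⟨n₀, fun n hn => ?_⟩
  obtain ⟨h3, h4⟩ := hn₀ n hn
  rw [Real.dist_0_eq_abs, ← Finset.sum_range_add_sum_Ico _ h4]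
  have h5 : |∑ k ∈ Finset.range k₀, w n k * a k| ≤ δ n * ∑ k ∈ Finset.range k₀, |a k| := by
    rw [Finset.mul_sum]
    refine (Finset.abs_sum_le_sum_abs _ _).trans (Finset.sum_le_sum fun k _ => ?_)
    rw [abs_mul, abs_of_nonneg (hw n k)]
    exact mul_le_mul_of_nonneg_right (hwδ n k) (abs_nonneg _)
  have h6 : |∑ k ∈ Finset.Ico k₀ (N n), w n k * a k| ≤ ε / 2 := by
    refine abs_le_of_sq_le_sq ?_ (by positivity)
    refine (Finset.sum_mul_sq_le_sq_mul_sq _ _ _).trans ?_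
    have h8 : ∑ k ∈ Finset.Ico k₀ (N n), w n k ^ 2 ≤ A :=
      (Finset.sum_le_sum_of_subset_of_nonneg (fun k hk =>
        Finset.mem_range.2 (Finset.mem_Ico.1 hk).2) fun k _ _ => sq_nonneg _).trans (hA n)
    have h9 : ∑ k ∈ Finset.Ico k₀ (N n), a k ^ 2 ≤ ε ^ 2 / (4 * (A + 1)) := by
      rw [Finset.sum_Ico_eq_sum_range]
      refine le_trans ?_ hk₀.le
      have := ((summable_nat_add_iff k₀).2 ha).sum_le_tsum (Finset.range (N n - k₀))
        fun k _ => sq_nonneg _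
      simpa [add_comm] using this
    calc _ ≤ A * (ε ^ 2 / (4 * (A + 1))) := by gcongr
      _ ≤ (ε / 2) ^ 2 := by
        rw [mul_div_assoc', div_le_iff₀ (by positivity)]
        nlinarith [sq_nonneg ε]
  linarith [abs_add_le (∑ k ∈ Finset.range k₀, w n k * a k) (∑ k ∈ Finset.Ico k₀ (N n), w n k * a k)]

/-- The weights by which the increments of the predictive means enter
`√n (K̄_n - B_N)`. -/
def tailWeight (N : ℕ → ℕ) (n k : ℕ) : ℝ :=
  if k < n then 1 / √n else if k < N n then √n / (k + 1) else 0

theorem tailWeight_nonneg (N : ℕ → ℕ) (n k : ℕ) : 0 ≤ tailWeight N n k := by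
  unfold tailWeight; split_ifs <;> positivity

theorem tailWeight_le (N : ℕ → ℕ) (n k : ℕ) : tailWeight N n k ≤ 1 / √n := by
  unfold tailWeight
  split_ifs with h h'
  · exact le_rfl
  -- For n = 0 both sides are 0, as division by zero gives 0.
  · rcases Nat.eq_zero_or_pos n with rfl | hn
    · simp
    · have hn' : (0 : ℝ) < n := by exact_mod_cast hn
      rw [div_le_div_iff₀ (by positivity) (by positivity), Real.mul_self_sqrt hn'.le]
      have : (n : ℝ) ≤ k := by exact_mod_cast not_lt.1 h
      linarith
  · positivity

/-- Compare 1/(k+1)² with the telescoping 1/(k(k+1)); the matching lower bound below uses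
1/((k+1)(k+2)). -/
theorem sum_Ico_one_div_sq_le (n N : ℕ) (h : n ≤ N) :
    (n : ℝ) * ∑ k ∈ Finset.Ico n N, 1 / ((k : ℝ) + 1) ^ 2 ≤ 1 := by
  rcases Nat.eq_zero_or_pos n with rfl | hn
  · simp
  have hn' : (0 : ℝ) < n := by exact_mod_cast hn
  have h1 : ∑ k ∈ Finset.Ico n N, 1 / ((k : ℝ) + 1) ^ 2
      ≤ ∑ k ∈ Finset.Ico n N, (-(1 / ((k + 1 : ℕ) : ℝ)) - -(1 / (k : ℝ))) := by
    refine Finset.sum_le_sum fun k hk => ?_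
    have hk : (0 : ℝ) < k := by exact_mod_cast hn.trans_le (Finset.mem_Ico.1 hk).1
    push_cast
    have : -(1 / ((k : ℝ) + 1)) - -(1 / (k : ℝ)) = 1 / (k * (k + 1)) := by field_simp; ring
    rw [this]
    gcongr
    nlinarith
  rw [Finset.sum_Ico_sub (fun k : ℕ => -(1 / (k : ℝ))) h] at h1
  have h2 : (0 : ℝ) ≤ 1 / N := by positivity
  calc _ ≤ (n : ℝ) * (1 / (n : ℝ)) := by gcongr; linarith
    _ = 1 := by field_simp

theorem le_sum_Ico_one_div_sq (n N : ℕ) (h : n ≤ N) :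
    (n : ℝ) / (n + 1) - n / (N + 1) ≤ (n : ℝ) * ∑ k ∈ Finset.Ico n N, 1 / ((k : ℝ) + 1) ^ 2 := by
  have h1 : ∑ k ∈ Finset.Ico n N, (-(1 / (((k + 1 : ℕ) : ℝ) + 1)) - -(1 / ((k : ℝ) + 1)))
      ≤ ∑ k ∈ Finset.Ico n N, 1 / ((k : ℝ) + 1) ^ 2 := by
    refine Finset.sum_le_sum fun k hk => ?_
    push_cast
    have : -(1 / ((k : ℝ) + 1 + 1)) - -(1 / ((k : ℝ) + 1)) = 1 / ((k + 1) * (k + 1 + 1)) := by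
      field_simp; ring
    rw [this]
    gcongr
    nlinarith
  rw [Finset.sum_Ico_sub (fun k : ℕ => -(1 / ((k : ℝ) + 1))) h] at h1
  calc _ = (n : ℝ) * (-(1 / ((N : ℝ) + 1)) - -(1 / ((n : ℝ) + 1))) := by ring
    _ ≤ _ := by gcongr

theorem sum_range_tailWeight_sq_mul {N : ℕ → ℕ} {n : ℕ} (hN : n ≤ N n) (a : ℕ → ℝ) :
    ∑ k ∈ Finset.range (N n), tailWeight N n k ^ 2 * a k
      = (1 / (n : ℝ)) * ∑ k ∈ Finset.range n, a k
        + (n : ℝ) * ∑ k ∈ Finset.Ico n (N n), 1 / ((k : ℝ) + 1) ^ 2 * a k := by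
  rw [← Finset.sum_range_add_sum_Ico _ hN, Finset.mul_sum, Finset.mul_sum]
  congr 1
  · refine Finset.sum_congr rfl fun k hk => ?_
    rw [tailWeight, if_pos (Finset.mem_range.1 hk), div_pow, one_pow, Real.sq_sqrt (by positivity)]
  · refine Finset.sum_congr rfl fun k hk => ?_
    rw [tailWeight, if_neg (not_lt.2 (Finset.mem_Ico.1 hk).1), if_pos (Finset.mem_Ico.1 hk).2,
      div_pow, Real.sq_sqrt (by positivity)]
    ring

theorem sum_range_tailWeight_sq_le {N : ℕ → ℕ} {n : ℕ} (hN : n ≤ N n) :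
    ∑ k ∈ Finset.range (N n), tailWeight N n k ^ 2 ≤ 2 := by
  have h := sum_range_tailWeight_sq_mul hN fun _ => (1 : ℝ)
  simp only [mul_one] at h
  rw [h]
  have h1 := sum_Ico_one_div_sq_le n (N n) hN
  have h2 : 1 / (n : ℝ) * ∑ k ∈ Finset.range n, (1 : ℝ) ≤ 1 := by
    simp only [Finset.sum_const, Finset.card_range, nsmul_eq_mul, mul_one]
    rw [one_div]
    exact inv_mul_le_one
  linarith

end WeightedIBP

namespace WeightedIBP

/-! ### Predictive systems

The sequence of the numbers of dishes, together with the predictive quantities that govern it. -/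

variable {Ω : Type*}

/-- `K n`, `N n` and `C n` stand for the number of dishes of customer `n + 1`, the number of new
dishes, and the sum of the inclusion probabilities of the old dishes tried; `D n`, `G n` for the
sums of the inclusion probabilities and of their squares, and `Λ n` for the rate of new dishes. -/
structure IsPredictiveSystem {mΩ : MeasurableSpace Ω} (P : Measure Ω) (ℱ : Filtration ℕ mΩ)
    (𝒢 : ℕ → MeasurableSpace Ω) (R K N C Λ D G : ℕ → Ω → ℝ) (β c u b : ℝ) (ℓ : ℕ → ℝ) : Prop where
  le_mid : ∀ n, ℱ n ≤ 𝒢 n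
  mid_le : ∀ n, 𝒢 n ≤ ℱ (n + 1)
  u_pos : 0 < u
  beta_le : β ≤ u
  u_add_c : 0 < u + c
  measurable_R : ∀ n, Measurable[ℱ (n + 1)] (R n)
  le_R : ∀ n ω, u ≤ R n ω
  R_le : ∀ n ω, R n ω ≤ b
  indep_R : ∀ n, Indep (MeasurableSpace.comap (R n) inferInstance) (𝒢 n) P
  measurable_K : ∀ n, Measurable[𝒢 n] (K n)
  measurable_N : ∀ n, Measurable[𝒢 n] (N n)
  measurable_C : ∀ n, Measurable[𝒢 n] (C n)
  measurable_Λ : ∀ n, Measurable[ℱ n] (Λ n)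
  measurable_D : ∀ n, Measurable[ℱ n] (D n)
  measurable_G : ∀ n, Measurable[ℱ n] (G n)
  integrable_K : ∀ n, Integrable (K n) P
  integrable_N : ∀ n, Integrable (N n) P
  integrable_C : ∀ n, Integrable (C n) P
  condExp_K : ∀ n, P[K n | ℱ n] =ᵐ[P] fun ω => D n ω + Λ n ω
  condExp_N : ∀ n, P[N n | ℱ n] =ᵐ[P] Λ n
  condExp_C : ∀ n, P[C n | ℱ n] =ᵐ[P] G n
  Λ_nonneg : ∀ n ω, 0 ≤ Λ n ω
  Λ_le : ∀ n ω, Λ n ω ≤ ℓ n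
  ℓ_tendsto : Tendsto ℓ atTop (𝓝 0)
  ℓ_summable : Summable fun n : ℕ => ℓ n / (n + 1)
  D_zero : ∀ ω, D 0 ω = 0
  D_succ : ∀ n ω, D (n + 1) ω = (D n ω * (totalWeight R n ω + c) + R n ω * K n ω - β * N n ω) /
    (totalWeight R (n + 1) ω + c)
  G_succ : ∀ n ω, G (n + 1) ω = (G n ω * (totalWeight R n ω + c) ^ 2
    + 2 * R n ω * (totalWeight R n ω + c) * C n ω + R n ω ^ 2 * (K n ω - N n ω)
    + (R n ω - β) ^ 2 * N n ω) / (totalWeight R (n + 1) ω + c) ^ 2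
  N_nonneg : ∀ n, ∀ᵐ ω ∂P, 0 ≤ N n ω
  G_nonneg : ∀ n, ∀ᵐ ω ∂P, 0 ≤ G n ω
  G_le : ∀ n, ∀ᵐ ω ∂P, G n ω ≤ D n ω
  integrable_sq_N : ∀ n, Integrable (fun ω => (N n ω - Λ n ω) ^ 2) P
  integral_sq_N : ∀ n, ∫ ω, (N n ω - Λ n ω) ^ 2 ∂P ≤ ℓ n
  condExp_sq : ∀ a n, P[{ω | D n ω + Λ n ω ≤ a}.indicator fun ω => K n ω ^ 2 | ℱ n] =ᵐ[P]
    {ω | D n ω + Λ n ω ≤ a}.indicator fun ω => (D n ω + Λ n ω) ^ 2 + (D n ω + Λ n ω - G n ω)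
  fourth_moment : ∀ a, ∃ B, ∀ n,
    Integrable ({ω | D n ω + Λ n ω ≤ a}.indicator fun ω => K n ω ^ 4) P ∧
    ∫ ω, {ω | D n ω + Λ n ω ≤ a}.indicator (fun ω => K n ω ^ 4) ω ∂P ≤ B

namespace IsPredictiveSystem

variable {mΩ : MeasurableSpace Ω} {P : Measure Ω} [IsProbabilityMeasure P] {ℱ : Filtration ℕ mΩ}
  {𝒢 : ℕ → MeasurableSpace Ω} {R K N C Λ D G : ℕ → Ω → ℝ} {β c u b : ℝ} {ℓ : ℕ → ℝ}

theorem mid_le' (h : IsPredictiveSystem P ℱ 𝒢 R K N C Λ D G β c u b ℓ) (n : ℕ) : 𝒢 n ≤ mΩ :=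
  (h.mid_le n).trans (ℱ.le _)

theorem b_pos (h : IsPredictiveSystem P ℱ 𝒢 R K N C Λ D G β c u b ℓ) : 0 < b := by
  obtain ⟨ω⟩ := nonempty_of_isProbabilityMeasure P
  exact h.u_pos.trans_le ((h.le_R 0 ω).trans (h.R_le 0 ω))

theorem measurable_totalWeight (h : IsPredictiveSystem P ℱ 𝒢 R K N C Λ D G β c u b ℓ) (n : ℕ) :
    Measurable[ℱ n] (totalWeight R n) :=
  measurable_sum_of_measurable_succ h.measurable_R n

theorem totalWeight_succ (R : ℕ → Ω → ℝ) (n : ℕ) (ω : Ω) :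
    totalWeight R (n + 1) ω = totalWeight R n ω + R n ω := Finset.sum_range_succ _ _

theorem min_pos (h : IsPredictiveSystem P ℱ 𝒢 R K N C Λ D G β c u b ℓ) : 0 < min u (u + c) :=
  lt_min h.u_pos h.u_add_c

/-- Linear growth of the denominators. For negative c the slope u + c works because n + 1 ≥ 1. -/
theorem mul_le_totalWeight (h : IsPredictiveSystem P ℱ 𝒢 R K N C Λ D G β c u b ℓ) (n : ℕ) (ω : Ω) :
    min u (u + c) * (n + 1) ≤ totalWeight R (n + 1) ω + c := by
  have h1 : u * (n + 1) ≤ totalWeight R (n + 1) ω := by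
    have := Finset.card_nsmul_le_sum (Finset.range (n + 1)) (fun i => R i ω) u fun i _ => h.le_R i ω
    simp only [Finset.card_range, nsmul_eq_mul] at this
    rw [totalWeight]
    push_cast at this
    linarith
  have hn : (0 : ℝ) ≤ n := n.cast_nonneg
  rcases le_total 0 c with hc | hc
  · have : min u (u + c) * (n + 1) ≤ u * (n + 1) :=
      mul_le_mul_of_nonneg_right (min_le_left _ _) (by positivity)
    linarith
  · have : min u (u + c) * (n + 1) ≤ (u + c) * (n + 1) :=
      mul_le_mul_of_nonneg_right (min_le_right _ _) (by positivity)
    nlinarith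

theorem totalWeight_pos (h : IsPredictiveSystem P ℱ 𝒢 R K N C Λ D G β c u b ℓ) (n : ℕ) (ω : Ω) :
    0 < totalWeight R (n + 1) ω + c :=
  (mul_pos h.min_pos (by positivity)).trans_le (h.mul_le_totalWeight n ω)

/-- The possible values of the total weight and of the next weight. -/
def weightRegion (c u b : ℝ) (n : ℕ) : Set (ℝ × ℝ) :=
  {z | u ≤ z.2 ∧ z.2 ≤ b ∧ min u (u + c) * (n + 1) ≤ z.1 + z.2 + c}

theorem mem_weightRegion (h : IsPredictiveSystem P ℱ 𝒢 R K N C Λ D G β c u b ℓ) (n : ℕ) (ω : Ω) :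
    (totalWeight R n ω, R n ω) ∈ weightRegion c u b n :=
  ⟨h.le_R n ω, h.R_le n ω, by simpa [totalWeight_succ] using h.mul_le_totalWeight n ω⟩

theorem measurableSet_weightRegion (c u b : ℝ) (n : ℕ) : MeasurableSet (weightRegion c u b n) :=
  (measurableSet_le measurable_const measurable_snd).inter
    ((measurableSet_le measurable_snd measurable_const).inter
      (measurableSet_le measurable_const ((measurable_fst.add measurable_snd).add_const c)))

/-- The weights enter each increment through a quotient that is bounded on the region of possible
values only; cutting it off outside the region changes nothing and makes the independence argument
applicable. -/
theorem condExp_mul_eq_zero (h : IsPredictiveSystem P ℱ 𝒢 R K N C Λ D G β c u b ℓ) {n : ℕ}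
    {ζ : Ω → ℝ} (hζ : Measurable[𝒢 n] ζ) (hζi : Integrable ζ P) (hζ0 : P[ζ | ℱ n] =ᵐ[P] 0)
    {φ : ℝ × ℝ → ℝ} (hφ : Measurable φ) {B : ℝ} (hB : ∀ z ∈ weightRegion c u b n, |φ z| ≤ B) :
    Integrable (fun ω => ζ ω * φ (totalWeight R n ω, R n ω)) P ∧
      P[fun ω => ζ ω * φ (totalWeight R n ω, R n ω) | ℱ n] =ᵐ[P] 0 := by
  have hi : ∀ ω, (weightRegion c u b n).indicator φ (totalWeight R n ω, R n ω)
      = φ (totalWeight R n ω, R n ω) := fun ω => Set.indicator_of_mem (h.mem_weightRegion n ω) _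
  have hR := (h.measurable_R n).mono (ℱ.le _) le_rfl
  have hT := (h.measurable_totalWeight n).mono (ℱ.le _) le_rfl
  refine ⟨hζi.mul_bdd (c := B) (hφ.comp (hT.prodMk hR)).aestronglyMeasurable
    (ae_of_all _ fun ω => hB _ (h.mem_weightRegion n ω)), ?_⟩
  have := condExp_mul_indep_eq_zero (h.le_mid n) (h.mid_le' n) hζ.stronglyMeasurable hζi hζ0
    (h.measurable_totalWeight n) hR (h.indep_R n)
    (hφ.indicator (measurableSet_weightRegion c u b n)) (B := max B 0) fun z => by
      by_cases hz : z ∈ weightRegion c u b n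
      · rw [Set.indicator_of_mem hz]; exact (hB z hz).trans (le_max_left _ _)
      · rw [Set.indicator_of_notMem hz, abs_zero]; exact le_max_right _ _
  simpa only [hi] using this

theorem measurable_J (h : IsPredictiveSystem P ℱ 𝒢 R K N C Λ D G β c u b ℓ) (n : ℕ) :
    Measurable[ℱ n] fun ω => D n ω + Λ n ω := (h.measurable_D n).add (h.measurable_Λ n)

theorem integrable_Λ (h : IsPredictiveSystem P ℱ 𝒢 R K N C Λ D G β c u b ℓ) (n : ℕ) :
    Integrable (Λ n) P :=
  Integrable.of_bound ((h.measurable_Λ n).mono (ℱ.le n) le_rfl).aestronglyMeasurable (ℓ n)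
    (ae_of_all _ fun ω => by
      rw [Real.norm_eq_abs, abs_of_nonneg (h.Λ_nonneg n ω)]; exact h.Λ_le n ω)

theorem integrable_D (h : IsPredictiveSystem P ℱ 𝒢 R K N C Λ D G β c u b ℓ) (n : ℕ) :
    Integrable (D n) P := by
  have h1 : Integrable (fun ω => D n ω + Λ n ω) P := integrable_condExp.congr (h.condExp_K n)
  exact (h1.sub (h.integrable_Λ n)).congr (ae_of_all _ fun ω => by simp)

theorem integrable_J (h : IsPredictiveSystem P ℱ 𝒢 R K N C Λ D G β c u b ℓ) (n : ℕ) :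
    Integrable (fun ω => D n ω + Λ n ω) P := (h.integrable_D n).add (h.integrable_Λ n)

theorem integrable_G (h : IsPredictiveSystem P ℱ 𝒢 R K N C Λ D G β c u b ℓ) (n : ℕ) :
    Integrable (G n) P := integrable_condExp.congr (h.condExp_C n)

theorem condExp_sub_eq_zero {m : MeasurableSpace Ω} (hm : m ≤ mΩ) {f g : Ω → ℝ}
    (hf : Integrable f P) (hg : Measurable[m] g) (hgi : Integrable g P) (h : P[f | m] =ᵐ[P] g) :
    P[fun ω => f ω - g ω | m] =ᵐ[P] 0 := by
  have h1 := condExp_sub hf hgi m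
  rw [condExp_of_stronglyMeasurable hm hg.stronglyMeasurable hgi] at h1
  filter_upwards [h1, h] with ω h1 h
  refine h1.trans ?_
  simp [h]

/-- Doob-like splitting: the first two terms are centred, the third is the drift caused by new
dishes. -/
theorem D_sub (h : IsPredictiveSystem P ℱ 𝒢 R K N C Λ D G β c u b ℓ) (n : ℕ) (ω : Ω) :
    D (n + 1) ω - D n ω = (R n ω * (K n ω - (D n ω + Λ n ω)) - β * (N n ω - Λ n ω)
      + (R n ω - β) * Λ n ω) / (totalWeight R (n + 1) ω + c) := by
  have hT := (h.totalWeight_pos n ω).ne'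
  rw [h.D_succ, eq_div_iff hT, sub_mul, div_mul_cancel₀ _ hT, totalWeight_succ]
  ring

theorem G_sub (h : IsPredictiveSystem P ℱ 𝒢 R K N C Λ D G β c u b ℓ) (n : ℕ) (ω : Ω) :
    G (n + 1) ω - G n ω = (2 * R n ω * (totalWeight R n ω + c) * (C n ω - G n ω)
      + R n ω ^ 2 * ((K n ω - N n ω) - D n ω) + ((R n ω - β) ^ 2 * N n ω
      + R n ω ^ 2 * (D n ω - G n ω))) / (totalWeight R (n + 1) ω + c) ^ 2 := by
  have hT := pow_ne_zero 2 (h.totalWeight_pos n ω).ne'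
  rw [h.G_succ, eq_div_iff hT, sub_mul, div_mul_cancel₀ _ hT, totalWeight_succ]
  ring

theorem condExp_K_sub (h : IsPredictiveSystem P ℱ 𝒢 R K N C Λ D G β c u b ℓ) (n : ℕ) :
    P[fun ω => K n ω - (D n ω + Λ n ω) | ℱ n] =ᵐ[P] 0 :=
  condExp_sub_eq_zero (ℱ.le n) (h.integrable_K n) (h.measurable_J n) (h.integrable_J n)
    (h.condExp_K n)

theorem condExp_N_sub (h : IsPredictiveSystem P ℱ 𝒢 R K N C Λ D G β c u b ℓ) (n : ℕ) :
    P[fun ω => N n ω - Λ n ω | ℱ n] =ᵐ[P] 0 :=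
  condExp_sub_eq_zero (ℱ.le n) (h.integrable_N n) (h.measurable_Λ n) (h.integrable_Λ n)
    (h.condExp_N n)

theorem condExp_C_sub (h : IsPredictiveSystem P ℱ 𝒢 R K N C Λ D G β c u b ℓ) (n : ℕ) :
    P[fun ω => C n ω - G n ω | ℱ n] =ᵐ[P] 0 :=
  condExp_sub_eq_zero (ℱ.le n) (h.integrable_C n) (h.measurable_G n) (h.integrable_G n)
    (h.condExp_C n)

theorem measurable_mid (h : IsPredictiveSystem P ℱ 𝒢 R K N C Λ D G β c u b ℓ) {n : ℕ} {f : Ω → ℝ}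
    (hf : Measurable[ℱ n] f) : Measurable[𝒢 n] f := hf.mono (h.le_mid n) le_rfl

theorem abs_div_le (h : IsPredictiveSystem P ℱ 𝒢 R K N C Λ D G β c u b ℓ) {n : ℕ} {z : ℝ × ℝ}
    (hz : z ∈ weightRegion c u b n) {x y : ℝ} (hx : |x| ≤ y) :
    |x / (z.1 + z.2 + c)| ≤ y / (min u (u + c) * (n + 1)) := by
  have h1 : 0 < min u (u + c) * (n + 1) := mul_pos h.min_pos (by positivity)
  rw [abs_div, abs_of_pos (h1.trans_le hz.2.2)]
  have := (abs_nonneg x).trans hx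
  gcongr
  exact hz.2.2

/-- The sign comes from β ≤ u ≤ `R n`, the size from the linear growth of the total weight. The
upper bound is summable by `ℓ_summable`. -/
theorem drift_bounds (h : IsPredictiveSystem P ℱ 𝒢 R K N C Λ D G β c u b ℓ) (n : ℕ) (ω : Ω) :
    0 ≤ (R n ω - β) * Λ n ω / (totalWeight R (n + 1) ω + c) ∧
    (R n ω - β) * Λ n ω / (totalWeight R (n + 1) ω + c)
      ≤ (b + |β|) / min u (u + c) * (ℓ n / (n + 1)) := by
  have h1 : 0 ≤ R n ω - β := sub_nonneg.2 (h.beta_le.trans (h.le_R n ω))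
  have hΛ := h.Λ_nonneg n ω
  refine ⟨div_nonneg (mul_nonneg h1 hΛ) (h.totalWeight_pos n ω).le, ?_⟩
  have h2 : 0 < min u (u + c) * (n + 1) := mul_pos h.min_pos (by positivity)
  have h3 : R n ω - β ≤ b + |β| := by linarith [h.R_le n ω, neg_abs_le β]
  have h4 := hΛ.trans (h.Λ_le n ω)
  calc _ ≤ (b + |β|) * ℓ n / (min u (u + c) * (n + 1)) := by
        gcongr
        · exact mul_nonneg (h1.trans h3) h4
        · exact h1.trans h3
        · exact h.Λ_le n ω
        · exact h.mul_le_totalWeight n ω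
    _ = _ := by rw [div_mul_div_comm]

/-- The martingale part of the increments of `D`. -/
theorem condExp_increment (h : IsPredictiveSystem P ℱ 𝒢 R K N C Λ D G β c u b ℓ) (n : ℕ) :
    Integrable (fun ω => (R n ω * (K n ω - (D n ω + Λ n ω)) - β * (N n ω - Λ n ω)) /
      (totalWeight R (n + 1) ω + c)) P ∧
    P[fun ω => (R n ω * (K n ω - (D n ω + Λ n ω)) - β * (N n ω - Λ n ω)) /
      (totalWeight R (n + 1) ω + c) | ℱ n] =ᵐ[P] 0 := by
  have h1 := h.condExp_mul_eq_zero ((h.measurable_K n).sub (h.measurable_mid (h.measurable_J n)))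
    ((h.integrable_K n).sub (h.integrable_J n)) (h.condExp_K_sub n)
    (φ := fun z => z.2 / (z.1 + z.2 + c)) (by fun_prop) fun z hz => h.abs_div_le hz
      (abs_le.2 ⟨by linarith [hz.1, h.u_pos, h.b_pos], hz.2.1⟩)
  have h2 := h.condExp_mul_eq_zero ((h.measurable_N n).sub (h.measurable_mid (h.measurable_Λ n)))
    ((h.integrable_N n).sub (h.integrable_Λ n)) (h.condExp_N_sub n)
    (φ := fun z => β / (z.1 + z.2 + c)) (by fun_prop) fun z hz => h.abs_div_le hz le_rfl
  have he : (fun ω => (R n ω * (K n ω - (D n ω + Λ n ω)) - β * (N n ω - Λ n ω)) /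
      (totalWeight R (n + 1) ω + c)) = (fun ω => (K n ω - (D n ω + Λ n ω)) *
        (R n ω / (totalWeight R n ω + R n ω + c))) - fun ω => (N n ω - Λ n ω) *
        (β / (totalWeight R n ω + R n ω + c)) := by
    ext ω
    simp only [Pi.sub_apply, totalWeight_succ]
    ring
  rw [he]
  refine ⟨h1.1.sub h2.1, ?_⟩
  filter_upwards [condExp_sub h1.1 h2.1 (ℱ n), h1.2, h2.2] with ω h3 h4 h5
  refine h3.trans ?_
  simp only [Pi.sub_apply, Pi.zero_apply] at h4 h5 ⊢
  rw [h4, h5, sub_zero]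

theorem integral_increment (h : IsPredictiveSystem P ℱ 𝒢 R K N C Λ D G β c u b ℓ) (n : ℕ) :
    ∫ ω, (R n ω * (K n ω - (D n ω + Λ n ω)) - β * (N n ω - Λ n ω)) /
      (totalWeight R (n + 1) ω + c) ∂P = 0 := by
  rw [← integral_condExp (ℱ.le n), integral_congr_ae (h.condExp_increment n).2]
  simp

theorem integrable_drift (h : IsPredictiveSystem P ℱ 𝒢 R K N C Λ D G β c u b ℓ) (n : ℕ) :
    Integrable (fun ω => (R n ω - β) * Λ n ω / (totalWeight R (n + 1) ω + c)) P := by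
  have hR := (h.measurable_R n).mono (ℱ.le _) le_rfl
  have hT := (h.measurable_totalWeight (n + 1)).mono (ℱ.le _) le_rfl
  have hΛ := (h.measurable_Λ n).mono (ℱ.le _) le_rfl
  refine Integrable.of_bound (by fun_prop : Measurable _).aestronglyMeasurable
    ((b + |β|) / min u (u + c) * (ℓ n / (n + 1))) (ae_of_all _ fun ω => ?_)
  rw [Real.norm_eq_abs, abs_of_nonneg (h.drift_bounds n ω).1]
  exact (h.drift_bounds n ω).2

theorem D_sub' (h : IsPredictiveSystem P ℱ 𝒢 R K N C Λ D G β c u b ℓ) (n : ℕ) :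
    D (n + 1) - D n = (fun ω => (R n ω * (K n ω - (D n ω + Λ n ω)) - β * (N n ω - Λ n ω)) /
      (totalWeight R (n + 1) ω + c)) +
      fun ω => (R n ω - β) * Λ n ω / (totalWeight R (n + 1) ω + c) := by
  ext ω
  rw [Pi.sub_apply, h.D_sub, Pi.add_apply, add_div]

theorem submartingale_D (h : IsPredictiveSystem P ℱ 𝒢 R K N C Λ D G β c u b ℓ) :
    Submartingale D ℱ P := by
  refine submartingale_of_condExp_sub_nonneg_nat (fun n => (h.measurable_D n).stronglyMeasurable)
    h.integrable_D fun n => ?_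
  rw [h.D_sub']
  filter_upwards [condExp_add (h.condExp_increment n).1 (h.integrable_drift n) (ℱ n),
    (h.condExp_increment n).2, condExp_nonneg (m := ℱ n) (μ := P)
      (ae_of_all _ fun ω => (h.drift_bounds n ω).1)] with ω h1 h2 h3
  rw [h1, Pi.add_apply, h2]
  simpa using h3

/-- Only the drift moves the expectation, and its bounds are summable. As `D` is nonnegative, this
is an L¹ bound. -/
theorem integral_D_le (h : IsPredictiveSystem P ℱ 𝒢 R K N C Λ D G β c u b ℓ) (n : ℕ) :
    ∫ ω, D n ω ∂P ≤ (b + |β|) / min u (u + c) * ∑' k, ℓ k / (k + 1) := by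
  have hκ := h.min_pos
  have hb := h.b_pos
  have hℓ : ∀ n, 0 ≤ ℓ n := fun n => by
    obtain ⟨ω⟩ := nonempty_of_isProbabilityMeasure P
    exact (h.Λ_nonneg n ω).trans (h.Λ_le n ω)
  have h1 : ∀ n, ∫ ω, D n ω ∂P ≤ (b + |β|) / min u (u + c) * ∑ k ∈ Finset.range n, ℓ k / (k + 1) := by
    intro n
    induction n with
    | zero => simp [h.D_zero]
    | succ n ih =>
      have h2 : ∫ ω, D (n + 1) ω ∂P - ∫ ω, D n ω ∂P = ∫ ω, (D (n + 1) - D n) ω ∂P :=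
        (integral_sub (h.integrable_D _) (h.integrable_D n)).symm
      rw [h.D_sub', integral_add' (h.condExp_increment n).1 (h.integrable_drift n),
        h.integral_increment] at h2
      have h3 : ∫ ω, (R n ω - β) * Λ n ω / (totalWeight R (n + 1) ω + c) ∂P
          ≤ (b + |β|) / min u (u + c) * (ℓ n / (n + 1)) := by
        refine (integral_mono (h.integrable_drift n) (integrable_const _)
          fun ω => (h.drift_bounds n ω).2).trans ?_
        simp
      rw [Finset.sum_range_succ, mul_add]
      linarith
  refine (h1 n).trans ?_
  gcongr
  exact h.ℓ_summable.sum_le_tsum _ fun k _ => div_nonneg (hℓ k) (by positivity)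

theorem D_nonneg (h : IsPredictiveSystem P ℱ 𝒢 R K N C Λ D G β c u b ℓ) (n : ℕ) :
    ∀ᵐ ω ∂P, 0 ≤ D n ω := by
  filter_upwards [h.G_nonneg n, h.G_le n] with ω h1 h2 using h1.trans h2

theorem exists_tendsto_D (h : IsPredictiveSystem P ℱ 𝒢 R K N C Λ D G β c u b ℓ) :
    ∀ᵐ ω ∂P, ∃ z, Tendsto (fun n => D n ω) atTop (𝓝 z) := by
  refine h.submartingale_D.exists_ae_tendsto_of_bdd
    (R := ((b + |β|) / min u (u + c) * ∑' k, ℓ k / (k + 1)).toNNReal) fun n => ?_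
  rw [eLpNorm_one_eq_lintegral_enorm, ← ofReal_integral_norm_eq_lintegral_enorm (h.integrable_D n)]
  refine ENNReal.ofReal_le_ofReal ((integral_congr_ae ?_).trans_le (h.integral_D_le n))
  filter_upwards [h.D_nonneg n] with ω hω
  exact Real.norm_of_nonneg hω

/-- In `G_sub` the terms with `C - G` and with `K - N - D` are centred; the rest is nonnegative
because `G ≤ D` and `N ≥ 0`. -/
theorem submartingale_G (h : IsPredictiveSystem P ℱ 𝒢 R K N C Λ D G β c u b ℓ) :
    Submartingale G ℱ P := by
  refine submartingale_of_condExp_sub_nonneg_nat (fun n => (h.measurable_G n).stronglyMeasurable)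
    h.integrable_G fun n => ?_
  set κ := min u (u + c) * (n + 1) with hκ
  have hκ0 : 0 < κ := mul_pos h.min_pos (by positivity)
  -- With ρ the ratio of the new weight to the new denominator, the coefficient of `C - G` is 2ρ(1 -
  -- ρ), since the old denominator is the new one minus the weight. In this form it is visibly
  -- bounded.
  have h1 := h.condExp_mul_eq_zero ((h.measurable_C n).sub (h.measurable_mid (h.measurable_G n)))
    ((h.integrable_C n).sub (h.integrable_G n)) (h.condExp_C_sub n)
    (φ := fun z => 2 * (z.2 / (z.1 + z.2 + c) - (z.2 / (z.1 + z.2 + c)) ^ 2))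
    (B := 2 * (b / κ + (b / κ) ^ 2)) (by fun_prop) fun z hz => by
      have h3 := h.abs_div_le hz (abs_le.2 ⟨by linarith [hz.1, h.u_pos, h.b_pos], hz.2.1⟩)
      rw [abs_mul, abs_two]
      gcongr
      refine (abs_sub _ _).trans (add_le_add h3 ?_)
      rw [abs_pow]
      exact pow_le_pow_left₀ (abs_nonneg _) h3 2
  have h2 := h.condExp_mul_eq_zero (ζ := fun ω => (K n ω - (D n ω + Λ n ω)) - (N n ω - Λ n ω))
    (((h.measurable_K n).sub (h.measurable_mid (h.measurable_J n))).sub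
      ((h.measurable_N n).sub (h.measurable_mid (h.measurable_Λ n))))
    (((h.integrable_K n).sub (h.integrable_J n)).sub ((h.integrable_N n).sub (h.integrable_Λ n)))
    (by
      filter_upwards [condExp_sub ((h.integrable_K n).sub (h.integrable_J n))
        ((h.integrable_N n).sub (h.integrable_Λ n)) (ℱ n), h.condExp_K_sub n, h.condExp_N_sub n]
        with ω h3 h4 h5
      refine h3.trans ?_
      rw [Pi.sub_apply]
      exact (congrArg₂ (· - ·) h4 h5).trans (sub_zero _))
    (φ := fun z => (z.2 / (z.1 + z.2 + c)) ^ 2)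
    (B := (b / κ) ^ 2) (by fun_prop) fun z hz => by
      have h3 := h.abs_div_le hz (abs_le.2 ⟨by linarith [hz.1, h.u_pos, h.b_pos], hz.2.1⟩)
      rw [abs_pow]
      exact pow_le_pow_left₀ (abs_nonneg _) h3 2
  set f₁ := fun ω => (C n ω - G n ω) * (2 * (R n ω / (totalWeight R n ω + R n ω + c)
    - (R n ω / (totalWeight R n ω + R n ω + c)) ^ 2)) with hf₁
  set f₂ := fun ω => ((K n ω - (D n ω + Λ n ω)) - (N n ω - Λ n ω)) *
    (R n ω / (totalWeight R n ω + R n ω + c)) ^ 2 with hf₂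
  have hf₁' : Integrable f₁ P ∧ P[f₁ | ℱ n] =ᵐ[P] 0 := h1
  have hf₂' : Integrable f₂ P ∧ P[f₂ | ℱ n] =ᵐ[P] 0 := h2
  have hsub : Integrable (G (n + 1) - G n) P := (h.integrable_G _).sub (h.integrable_G n)
  have h3 : 0 ≤ᵐ[P] (G (n + 1) - G n) - (f₁ + f₂) := by
    filter_upwards [h.G_le n, h.N_nonneg n] with ω hG hN
    have hT := h.totalWeight_pos n ω
    have he : ((G (n + 1) - G n) - (f₁ + f₂)) ω = ((R n ω - β) ^ 2 * N n ω
      + R n ω ^ 2 * (D n ω - G n ω)) / (totalWeight R (n + 1) ω + c) ^ 2 := by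
      simp only [Pi.sub_apply, Pi.add_apply, hf₁, hf₂]
      rw [h.G_sub n ω]
      rw [totalWeight_succ] at hT ⊢
      field_simp
      ring
    rw [he]
    have := sub_nonneg.2 hG
    simp only [Pi.zero_apply]
    positivity
  filter_upwards [condExp_nonneg (m := ℱ n) h3, condExp_sub hsub (hf₁'.1.add hf₂'.1) (ℱ n),
    condExp_add hf₁'.1 hf₂'.1 (ℱ n), hf₁'.2, hf₂'.2] with ω h4 h5 h6 h7 h8
  rw [h5, Pi.sub_apply, h6, Pi.add_apply, h7, h8] at h4
  simpa using h4

/-- The L¹ bound is inherited from `D`, as 0 ≤ `G` ≤ `D`. -/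
theorem exists_tendsto_G (h : IsPredictiveSystem P ℱ 𝒢 R K N C Λ D G β c u b ℓ) :
    ∀ᵐ ω ∂P, ∃ z, Tendsto (fun n => G n ω) atTop (𝓝 z) := by
  refine h.submartingale_G.exists_ae_tendsto_of_bdd
    (R := ((b + |β|) / min u (u + c) * ∑' k, ℓ k / (k + 1)).toNNReal) fun n => ?_
  rw [eLpNorm_one_eq_lintegral_enorm, ← ofReal_integral_norm_eq_lintegral_enorm (h.integrable_G n)]
  refine ENNReal.ofReal_le_ofReal ((integral_mono_ae (h.integrable_G n).norm (h.integrable_D n)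
    ?_).trans (h.integral_D_le n))
  filter_upwards [h.G_nonneg n, h.G_le n] with ω h0 hω
  rw [Real.norm_of_nonneg h0]
  exact hω

end IsPredictiveSystem

end WeightedIBP

namespace WeightedIBP

/-! ### Laws of large numbers for predictive systems -/

variable {Ω : Type*}

/-- The event that the predictive means have not exceeded `a` up to time `n`. -/
def lowMeans (D Λ : ℕ → Ω → ℝ) (a : ℝ) (n : ℕ) : Set Ω := {ω | ∀ j ≤ n, D j ω + Λ j ω ≤ a}

/-- The event that the predictive means never exceed `a`. -/
def allLowMeans (D Λ : ℕ → Ω → ℝ) (a : ℝ) : Set Ω := {ω | ∀ j, D j ω + Λ j ω ≤ a}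

theorem allLowMeans_subset (D Λ : ℕ → Ω → ℝ) (a : ℝ) (n : ℕ) :
    allLowMeans D Λ a ⊆ lowMeans D Λ a n := fun _ hω j _ => hω j

/-- The centred number of dishes, while the predictive means do not exceed `a`. -/
def centered (K D Λ : ℕ → Ω → ℝ) (a : ℝ) (n : ℕ) : Ω → ℝ :=
  (lowMeans D Λ a n).indicator fun ω => K n ω - (D n ω + Λ n ω)

/-- The predictive variance, while the predictive means do not exceed `a`. -/
def lowVariance (D Λ G : ℕ → Ω → ℝ) (a : ℝ) (n : ℕ) : Ω → ℝ :=
  (lowMeans D Λ a n).indicator fun ω => D n ω + Λ n ω - G n ω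

/-- The centred square of the number of dishes, while the predictive means do not exceed `a`. -/
def centeredSq (K D Λ G : ℕ → Ω → ℝ) (a : ℝ) (n : ℕ) : Ω → ℝ :=
  (lowMeans D Λ a n).indicator fun ω =>
    K n ω ^ 2 - ((D n ω + Λ n ω) ^ 2 + (D n ω + Λ n ω - G n ω))

theorem sub_pow_four_le (x y : ℝ) : (x - y) ^ 4 ≤ 8 * x ^ 4 + 8 * y ^ 4 := by
  have h1 : (x - y) ^ 2 ≤ 2 * (x ^ 2 + y ^ 2) := by nlinarith [sq_nonneg (x + y)]
  have h2 : ((x - y) ^ 2) ^ 2 ≤ (2 * (x ^ 2 + y ^ 2)) ^ 2 :=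
    pow_le_pow_left₀ (sq_nonneg _) h1 2
  nlinarith [sq_nonneg (x ^ 2 - y ^ 2)]

namespace IsPredictiveSystem

variable {mΩ : MeasurableSpace Ω} {P : Measure Ω} [IsProbabilityMeasure P] {ℱ : Filtration ℕ mΩ}
  {𝒢 : ℕ → MeasurableSpace Ω} {R K N C Λ D G : ℕ → Ω → ℝ} {β c u b : ℝ} {ℓ : ℕ → ℝ}

theorem measurableSet_lowMeans (h : IsPredictiveSystem P ℱ 𝒢 R K N C Λ D G β c u b ℓ) (a : ℝ)
    (n : ℕ) : MeasurableSet[ℱ n] (lowMeans D Λ a n) := by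
  have : lowMeans D Λ a n = ⋂ j, ⋂ (_ : j ≤ n), {ω | D j ω + Λ j ω ≤ a} := by
    ext ω; simp [lowMeans]
  rw [this]
  refine MeasurableSet.iInter fun j => MeasurableSet.iInter fun hj => ?_
  exact ((h.measurable_J j).mono (ℱ.mono hj) le_rfl) measurableSet_Iic

theorem measurableSet_allLowMeans (h : IsPredictiveSystem P ℱ 𝒢 R K N C Λ D G β c u b ℓ) (a : ℝ) :
    MeasurableSet (allLowMeans D Λ a) := by
  have : allLowMeans D Λ a = ⋂ j, {ω | D j ω + Λ j ω ≤ a} := by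
    ext ω; simp [allLowMeans]
  rw [this]
  exact MeasurableSet.iInter fun j => ((h.measurable_J j).mono (ℱ.le j) le_rfl) measurableSet_Iic

theorem J_nonneg (h : IsPredictiveSystem P ℱ 𝒢 R K N C Λ D G β c u b ℓ) (n : ℕ) :
    ∀ᵐ ω ∂P, 0 ≤ D n ω + Λ n ω := by
  filter_upwards [h.D_nonneg n] with ω hω using add_nonneg hω (h.Λ_nonneg n ω)

theorem V_bounds (h : IsPredictiveSystem P ℱ 𝒢 R K N C Λ D G β c u b ℓ) (n : ℕ) :
    ∀ᵐ ω ∂P, 0 ≤ D n ω + Λ n ω - G n ω ∧ D n ω + Λ n ω - G n ω ≤ D n ω + Λ n ω := by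
  filter_upwards [h.G_nonneg n, h.G_le n] with ω h0 h1
  exact ⟨by linarith [h.Λ_nonneg n ω], by linarith⟩

theorem measurable_centered (h : IsPredictiveSystem P ℱ 𝒢 R K N C Λ D G β c u b ℓ) (a : ℝ) (n : ℕ) :
    Measurable[𝒢 n] (centered K D Λ a n) :=
  ((h.measurable_K n).sub (h.measurable_mid (h.measurable_J n))).indicator
    (h.le_mid n _ (h.measurableSet_lowMeans a n))

theorem measurable_lowVariance (h : IsPredictiveSystem P ℱ 𝒢 R K N C Λ D G β c u b ℓ) (a : ℝ)
    (n : ℕ) : Measurable[ℱ n] (lowVariance D Λ G a n) :=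
  ((h.measurable_J n).sub (h.measurable_G n)).indicator (h.measurableSet_lowMeans a n)

theorem lowVariance_bounds (h : IsPredictiveSystem P ℱ 𝒢 R K N C Λ D G β c u b ℓ) (a : ℝ) (n : ℕ) :
    ∀ᵐ ω ∂P, 0 ≤ lowVariance D Λ G a n ω ∧ lowVariance D Λ G a n ω ≤ |a| := by
  filter_upwards [h.V_bounds n] with ω hω
  by_cases hl : ω ∈ lowMeans D Λ a n
  · rw [lowVariance, Set.indicator_of_mem hl]
    exact ⟨hω.1, hω.2.trans ((hl n le_rfl).trans (le_abs_self a))⟩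
  · rw [lowVariance, Set.indicator_of_notMem hl]
    exact ⟨le_rfl, abs_nonneg a⟩

/-- While the predictive mean is below `a`, it is bounded and the number of dishes has a uniformly
bounded fourth moment. Without this cut no moments beyond the first are assumed of `K`. -/
theorem exists_integral_centered_pow_four_le
    (h : IsPredictiveSystem P ℱ 𝒢 R K N C Λ D G β c u b ℓ) (a : ℝ) :
    ∃ B, ∀ n, Integrable (fun ω => centered K D Λ a n ω ^ 4) P ∧
      ∫ ω, centered K D Λ a n ω ^ 4 ∂P ≤ B := by
  obtain ⟨B, hB⟩ := h.fourth_moment a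
  refine ⟨8 * B + 8 * |a| ^ 4, fun n => ?_⟩
  have hm := (h.measurable_centered a n).mono (h.mid_le' n) le_rfl
  set g := {ω | D n ω + Λ n ω ≤ a}.indicator fun ω => K n ω ^ 4 with hg
  have hgi : Integrable (fun ω => 8 * g ω + 8 * |a| ^ 4) P :=
    ((hB n).1.const_mul 8).add (integrable_const _)
  have hle : ∀ᵐ ω ∂P, centered K D Λ a n ω ^ 4 ≤ 8 * g ω + 8 * |a| ^ 4 := by
    filter_upwards [h.J_nonneg n] with ω hω
    by_cases hl : ω ∈ lowMeans D Λ a n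
    · have hJ := hl n le_rfl
      have hg' : g ω = K n ω ^ 4 :=
        Set.indicator_of_mem (show ω ∈ {ω | D n ω + Λ n ω ≤ a} from hJ) _
      rw [centered, Set.indicator_of_mem hl, hg']
      refine (sub_pow_four_le _ _).trans ?_
      gcongr
      exact hJ.trans (le_abs_self a)
    · rw [centered, Set.indicator_of_notMem hl]
      have : 0 ≤ g ω := Set.indicator_nonneg (fun ω _ => by positivity) ω
      rw [zero_pow (by norm_num)]
      positivity
  have hi : Integrable (fun ω => centered K D Λ a n ω ^ 4) P := by
    refine hgi.mono' (hm.pow_const 4).aestronglyMeasurable ?_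
    filter_upwards [hle] with ω hω
    rwa [Real.norm_of_nonneg (by positivity)]
  refine ⟨hi, (integral_mono_ae hi hgi hle).trans ?_⟩
  rw [integral_add ((hB n).1.const_mul 8) (integrable_const _), integral_const_mul]
  simp only [integral_const, probReal_univ, smul_eq_mul, one_mul]
  linarith [(hB n).2]

theorem integrable_centered_cube (h : IsPredictiveSystem P ℱ 𝒢 R K N C Λ D G β c u b ℓ) (a : ℝ) :
    ∃ B, ∀ n, Integrable (fun ω => |centered K D Λ a n ω| ^ 3) P ∧
      ∫ ω, |centered K D Λ a n ω| ^ 3 ∂P ≤ B ∧ ∫ ω, centered K D Λ a n ω ^ 2 ∂P ≤ B := by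
  obtain ⟨B, hB⟩ := h.exists_integral_centered_pow_four_le a
  refine ⟨1 + B, fun n => ?_⟩
  have hm := (h.measurable_centered a n).mono (h.mid_le' n) le_rfl
  have hgi : Integrable (fun ω => 1 + centered K D Λ a n ω ^ 4) P :=
    (integrable_const _).add (hB n).1
  have hbd : ∀ x : ℝ, |x| ^ 3 ≤ 1 + x ^ 4 ∧ x ^ 2 ≤ 1 + x ^ 4 := fun x => by
    constructor
    · rw [← Even.pow_abs (by decide : Even 4) x]
      nlinarith [abs_nonneg x, sq_nonneg (|x| - 1), sq_nonneg (|x| ^ 2 - |x|), sq_nonneg (|x| ^ 2)]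
    · nlinarith [sq_nonneg (x ^ 2 - 1)]
  have hi : Integrable (fun ω => |centered K D Λ a n ω| ^ 3) P :=
    hgi.mono' (hm.abs.pow_const 3).aestronglyMeasurable (ae_of_all _ fun ω => by
      rw [Real.norm_of_nonneg (by positivity)]; exact (hbd _).1)
  have hle : ∫ ω, (1 + centered K D Λ a n ω ^ 4) ∂P ≤ 1 + B := by
    rw [integral_add (integrable_const _) (hB n).1]
    simp only [integral_const, probReal_univ, smul_eq_mul, one_mul]
    linarith [(hB n).2]
  refine ⟨hi, (integral_mono hi hgi fun ω => (hbd _).1).trans hle, ?_⟩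
  exact (integral_mono (integrable_sq_of_integrable_cube hm hi) hgi fun ω => (hbd _).2).trans hle

theorem integrable_centered_sq (h : IsPredictiveSystem P ℱ 𝒢 R K N C Λ D G β c u b ℓ) (a : ℝ)
    (n : ℕ) : Integrable (fun ω => centered K D Λ a n ω ^ 2) P := by
  obtain ⟨B, hB⟩ := h.integrable_centered_cube a
  exact integrable_sq_of_integrable_cube ((h.measurable_centered a n).mono (h.mid_le' n) le_rfl)
    (hB n).1

theorem condExp_centered (h : IsPredictiveSystem P ℱ 𝒢 R K N C Λ D G β c u b ℓ) (a : ℝ) (n : ℕ) :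
    P[centered K D Λ a n | ℱ n] =ᵐ[P] 0 := by
  refine (condExp_indicator ((h.integrable_K n).sub (h.integrable_J n))
    (h.measurableSet_lowMeans a n)).trans ?_
  filter_upwards [h.condExp_K_sub n] with ω hω
  by_cases hl : ω ∈ lowMeans D Λ a n
  · rw [Set.indicator_of_mem hl]; exact hω
  · rw [Set.indicator_of_notMem hl]; rfl

theorem centeredSq_eq (K D Λ G : ℕ → Ω → ℝ) (a : ℝ) (n : ℕ) :
    centeredSq K D Λ G a n = (lowMeans D Λ a n).indicator
      (({ω | D n ω + Λ n ω ≤ a}.indicator fun ω => K n ω ^ 2) -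
      {ω | D n ω + Λ n ω ≤ a}.indicator fun ω =>
        (D n ω + Λ n ω) ^ 2 + (D n ω + Λ n ω - G n ω)) := by
  ext ω
  by_cases hl : ω ∈ lowMeans D Λ a n
  · have : ω ∈ {ω | D n ω + Λ n ω ≤ a} := hl n le_rfl
    rw [centeredSq, Set.indicator_of_mem hl, Set.indicator_of_mem hl, Pi.sub_apply,
      Set.indicator_of_mem this, Set.indicator_of_mem this]
  · rw [centeredSq, Set.indicator_of_notMem hl, Set.indicator_of_notMem hl]

theorem condExp_centeredSq (h : IsPredictiveSystem P ℱ 𝒢 R K N C Λ D G β c u b ℓ) (a : ℝ) (n : ℕ) :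
    Integrable (centeredSq K D Λ G a n) P ∧ P[centeredSq K D Λ G a n | ℱ n] =ᵐ[P] 0 := by
  obtain ⟨B, hB⟩ := h.fourth_moment a
  have hA : MeasurableSet[ℱ n] {ω | D n ω + Λ n ω ≤ a} := (h.measurable_J n) measurableSet_Iic
  have hKm := (h.measurable_K n).mono (h.mid_le' n) le_rfl
  have h1 : Integrable ({ω | D n ω + Λ n ω ≤ a}.indicator fun ω => K n ω ^ 2) P := by
    refine ((integrable_const (1 : ℝ)).add (hB n).1).mono'
      ((hKm.pow_const 2).indicator (ℱ.le n _ hA)).aestronglyMeasurable (ae_of_all _ fun ω => ?_)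
    by_cases hl : ω ∈ {ω | D n ω + Λ n ω ≤ a}
    · rw [Pi.add_apply, Set.indicator_of_mem hl, Set.indicator_of_mem hl,
        Real.norm_of_nonneg (sq_nonneg _)]
      nlinarith [sq_nonneg (K n ω ^ 2 - 1)]
    · rw [Pi.add_apply, Set.indicator_of_notMem hl, Set.indicator_of_notMem hl]
      simp
  have h2 : Integrable ({ω | D n ω + Λ n ω ≤ a}.indicator fun ω =>
      (D n ω + Λ n ω) ^ 2 + (D n ω + Λ n ω - G n ω)) P :=
    integrable_condExp.congr (h.condExp_sq a n)
  have h2m : Measurable[ℱ n] ({ω | D n ω + Λ n ω ≤ a}.indicator fun ω =>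
      (D n ω + Λ n ω) ^ 2 + (D n ω + Λ n ω - G n ω)) :=
    (((h.measurable_J n).pow_const 2).add ((h.measurable_J n).sub (h.measurable_G n))).indicator hA
  have h3 := condExp_sub_eq_zero (ℱ.le n) h1 h2m h2 (h.condExp_sq a n)
  rw [centeredSq_eq]
  refine ⟨(h1.sub h2).indicator (ℱ.le n _ (h.measurableSet_lowMeans a n)), ?_⟩
  refine (condExp_indicator (h1.sub h2) (h.measurableSet_lowMeans a n)).trans ?_
  filter_upwards [h3] with ω hω
  by_cases hl : ω ∈ lowMeans D Λ a n
  · rw [Set.indicator_of_mem hl]; exact hω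
  · rw [Set.indicator_of_notMem hl]; rfl

/-- With V = J - G, one has (K - J)² = (K² - J² - V) - 2J (K - J) + V. The first two terms are
centred and the last is known. -/
theorem condExp_centered_sq (h : IsPredictiveSystem P ℱ 𝒢 R K N C Λ D G β c u b ℓ) (a : ℝ)
    (n : ℕ) : P[fun ω => centered K D Λ a n ω ^ 2 | ℱ n] =ᵐ[P] lowVariance D Λ G a n := by
  -- The cut makes this coefficient bounded by 2|a|, so it can be pulled out although `K` is merely
  -- integrable.
  set f := (lowMeans D Λ a n).indicator fun ω => -2 * (D n ω + Λ n ω) with hf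
  have hfm : Measurable[ℱ n] f :=
    ((h.measurable_J n).const_mul (-2)).indicator (h.measurableSet_lowMeans a n)
  have hKi := (h.integrable_K n).sub (h.integrable_J n)
  have hfK : Integrable (f * fun ω => K n ω - (D n ω + Λ n ω)) P := by
    refine hKi.bdd_mul (c := 2 * |a|) (hfm.mono (ℱ.le n) le_rfl).aestronglyMeasurable ?_
    filter_upwards [h.J_nonneg n] with ω hω
    by_cases hl : ω ∈ lowMeans D Λ a n
    · rw [hf, Set.indicator_of_mem hl, norm_mul, Real.norm_of_nonneg hω]
      norm_num
      exact (hl n le_rfl).trans (le_abs_self a)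
    · rw [hf, Set.indicator_of_notMem hl]
      simp
  have h1 := condExp_mul_of_stronglyMeasurable_left hfm.stronglyMeasurable hfK hKi
  have hVi : Integrable (lowVariance D Λ G a n) P :=
    ((h.integrable_J n).sub (h.integrable_G n)).indicator
      (ℱ.le n _ (h.measurableSet_lowMeans a n))
  have h2 := condExp_of_stronglyMeasurable (ℱ.le n)
    (h.measurable_lowVariance a n).stronglyMeasurable hVi
  have he : (fun ω => centered K D Λ a n ω ^ 2) = (centeredSq K D Λ G a n +
      f * fun ω => K n ω - (D n ω + Λ n ω)) + lowVariance D Λ G a n := by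
    ext ω
    simp only [Pi.add_apply, Pi.mul_apply, hf]
    by_cases hl : ω ∈ lowMeans D Λ a n
    · simp only [centered, centeredSq, lowVariance, Set.indicator_of_mem hl]
      ring
    · simp only [centered, centeredSq, lowVariance, Set.indicator_of_notMem hl]
      ring
  have hS := h.condExp_centeredSq a n
  rw [he]
  filter_upwards [condExp_add (hS.1.add hfK) hVi (ℱ n), condExp_add hS.1 hfK (ℱ n), h1,
    h.condExp_K_sub n, hS.2] with ω h3 h4 h5 h6 h7
  rw [h3, Pi.add_apply, h4, Pi.add_apply, h5, h7, h2, Pi.mul_apply, h6]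
  simp

theorem exists_integral_centeredSq_sq_le (h : IsPredictiveSystem P ℱ 𝒢 R K N C Λ D G β c u b ℓ)
    (a : ℝ) : ∃ B, ∀ n, Integrable (fun ω => centeredSq K D Λ G a n ω ^ 2) P ∧
      ∫ ω, centeredSq K D Λ G a n ω ^ 2 ∂P ≤ B := by
  obtain ⟨B, hB⟩ := h.fourth_moment a
  refine ⟨2 * B + 2 * (|a| ^ 2 + |a|) ^ 2, fun n => ?_⟩
  set g := {ω | D n ω + Λ n ω ≤ a}.indicator fun ω => K n ω ^ 4 with hg
  have hgi : Integrable (fun ω => 2 * g ω + 2 * (|a| ^ 2 + |a|) ^ 2) P :=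
    ((hB n).1.const_mul 2).add (integrable_const _)
  have hle : ∀ᵐ ω ∂P, centeredSq K D Λ G a n ω ^ 2 ≤ 2 * g ω + 2 * (|a| ^ 2 + |a|) ^ 2 := by
    filter_upwards [h.J_nonneg n, h.V_bounds n] with ω hω hV
    by_cases hl : ω ∈ lowMeans D Λ a n
    · have hJ := hl n le_rfl
      have hJa := hJ.trans (le_abs_self a)
      have hg' : g ω = K n ω ^ 4 :=
        Set.indicator_of_mem (show ω ∈ {ω | D n ω + Λ n ω ≤ a} from hJ) _
      rw [centeredSq, Set.indicator_of_mem hl, hg']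
      have h1 : (D n ω + Λ n ω) ^ 2 + (D n ω + Λ n ω - G n ω) ≤ |a| ^ 2 + |a| :=
        add_le_add (pow_le_pow_left₀ hω hJa 2) (hV.2.trans hJa)
      have h2 := pow_le_pow_left₀ (add_nonneg (sq_nonneg (D n ω + Λ n ω)) hV.1) h1 2
      nlinarith [sq_nonneg (K n ω ^ 2 + ((D n ω + Λ n ω) ^ 2 + (D n ω + Λ n ω - G n ω)))]
    · rw [centeredSq, Set.indicator_of_notMem hl]
      have : 0 ≤ g ω := Set.indicator_nonneg (fun ω _ => by positivity) ω
      rw [zero_pow (by norm_num)]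
      positivity
  have hi : Integrable (fun ω => centeredSq K D Λ G a n ω ^ 2) P := by
    refine hgi.mono' ((h.condExp_centeredSq a n).1.aestronglyMeasurable.pow 2) ?_
    filter_upwards [hle] with ω hω
    rwa [Real.norm_of_nonneg (by positivity)]
  refine ⟨hi, (integral_mono_ae hi hgi hle).trans ?_⟩
  rw [integral_add ((hB n).1.const_mul 2) (integrable_const _), integral_const_mul]
  simp only [integral_const, probReal_univ, smul_eq_mul, one_mul]
  linarith [(hB n).2]

theorem measurable_centeredSq (h : IsPredictiveSystem P ℱ 𝒢 R K N C Λ D G β c u b ℓ) (a : ℝ)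
    (n : ℕ) : Measurable[𝒢 n] (centeredSq K D Λ G a n) :=
  (((h.measurable_K n).pow_const 2).sub (h.measurable_mid (((h.measurable_J n).pow_const 2).add
    ((h.measurable_J n).sub (h.measurable_G n))))).indicator
    (h.le_mid n _ (h.measurableSet_lowMeans a n))

theorem tendsto_Λ (h : IsPredictiveSystem P ℱ 𝒢 R K N C Λ D G β c u b ℓ) (ω : Ω) :
    Tendsto (fun n => Λ n ω) atTop (𝓝 0) :=
  squeeze_zero (fun n => h.Λ_nonneg n ω) (fun n => h.Λ_le n ω) h.ℓ_tendsto

theorem exists_limits (h : IsPredictiveSystem P ℱ 𝒢 R K N C Λ D G β c u b ℓ) :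
    ∃ Z V : Ω → ℝ, Measurable Z ∧ Measurable V ∧
      (∀ᵐ ω ∂P, Tendsto (fun n => D n ω + Λ n ω) atTop (𝓝 (Z ω))) ∧
      (∀ᵐ ω ∂P, Tendsto (fun n => D n ω + Λ n ω - G n ω) atTop (𝓝 (V ω))) := by
  obtain ⟨Z, hZm, hZ⟩ := measurable_limit_of_tendsto_metrizable_ae (μ := P) (L := atTop)
    (f := fun n ω => D n ω + Λ n ω)
    (fun n => ((h.measurable_J n).mono (ℱ.le n) le_rfl).aemeasurable) (by
      filter_upwards [h.exists_tendsto_D] with ω ⟨z, hz⟩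
      exact ⟨z + 0, hz.add (h.tendsto_Λ ω)⟩)
  obtain ⟨V, hVm, hV⟩ := measurable_limit_of_tendsto_metrizable_ae (μ := P) (L := atTop)
    (f := fun n ω => D n ω + Λ n ω - G n ω)
    (fun n => (((h.measurable_J n).sub (h.measurable_G n)).mono (ℱ.le n) le_rfl).aemeasurable) (by
      filter_upwards [hZ, h.exists_tendsto_G] with ω hz ⟨g, hg⟩
      exact ⟨Z ω - g, hz.sub hg⟩)
  exact ⟨Z, V, hZm, hVm, hZ, hV⟩

/-- The predictive means converge, hence are bounded along almost every path. So localizing at the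
levels a ∈ ℕ loses nothing in the limit. -/
theorem exists_mem_allLowMeans (h : IsPredictiveSystem P ℱ 𝒢 R K N C Λ D G β c u b ℓ) :
    ∀ᵐ ω ∂P, ∃ a : ℕ, ω ∈ allLowMeans D Λ a := by
  filter_upwards [h.exists_tendsto_D] with ω ⟨z, hz⟩
  obtain ⟨B, hB⟩ := (hz.add (h.tendsto_Λ ω)).bddAbove_range
  obtain ⟨a, ha⟩ := exists_nat_ge B
  exact ⟨a, fun j => (hB ⟨j, rfl⟩).trans ha⟩

theorem tendsto_measureReal_compl_allLowMeans
    (h : IsPredictiveSystem P ℱ 𝒢 R K N C Λ D G β c u b ℓ) :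
    Tendsto (fun a : ℕ => P.real (allLowMeans D Λ a)ᶜ) atTop (𝓝 0) := by
  have hanti : Antitone fun a : ℕ => (allLowMeans D Λ (a : ℝ))ᶜ := fun a a' haa' =>
    Set.compl_subset_compl.2 fun ω hω j => (hω j).trans (by exact_mod_cast haa')
  have h1 := tendsto_measure_iInter_atTop (μ := P)
    (fun a : ℕ => (h.measurableSet_allLowMeans (a : ℝ)).compl.nullMeasurableSet) hanti
    ⟨0, measure_ne_top _ _⟩
  have h2 : P (⋂ a : ℕ, (allLowMeans D Λ (a : ℝ))ᶜ) = 0 := by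
    rw [← Set.compl_iUnion, ← mem_ae_iff]
    filter_upwards [h.exists_mem_allLowMeans] with ω hω
    exact Set.mem_iUnion.2 hω
  rw [h2] at h1
  have h3 := (ENNReal.tendsto_toReal ENNReal.zero_ne_top).comp h1
  simpa [Function.comp_def, Measure.real] using h3

/-- The strong law holds at every level a, and at some level of the given path the cut is inactive;
there the mean of `K` differs from the Cesàro mean of the convergent predictive means by a null
sequence. -/
theorem tendsto_cesaro_K (h : IsPredictiveSystem P ℱ 𝒢 R K N C Λ D G β c u b ℓ) {Z : Ω → ℝ}
    (hZ : ∀ᵐ ω ∂P, Tendsto (fun n => D n ω + Λ n ω) atTop (𝓝 (Z ω))) :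
    ∀ᵐ ω ∂P, Tendsto (fun n : ℕ => (1 / (n : ℝ)) * ∑ i ∈ Finset.range n, K i ω) atTop
      (𝓝 (Z ω)) := by
  have h1 : ∀ a : ℕ, ∀ᵐ ω ∂P, Tendsto (fun n : ℕ => (1 / (n : ℝ)) *
      ∑ k ∈ Finset.range n, centered K D Λ a k ω) atTop (𝓝 0) := fun a => by
    obtain ⟨B, hB⟩ := h.integrable_centered_cube (a : ℝ)
    exact tendsto_cesaro_martingale_differences
      (fun k => (h.measurable_centered a k).mono (h.mid_le k) le_rfl)
      (h.integrable_centered_sq a) (h.condExp_centered a) fun k => (hB k).2.2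
  filter_upwards [ae_all_iff.2 h1, hZ, h.exists_mem_allLowMeans] with ω h1 hZ ⟨a, ha⟩
  have h2 := (h1 a).add hZ.cesaro
  rw [zero_add] at h2
  refine h2.congr fun n => ?_
  have h3 : ∀ k, centered K D Λ a k ω = K k ω - (D k ω + Λ k ω) := fun k =>
    Set.indicator_of_mem (allLowMeans_subset _ _ _ _ ha) _
  simp only [h3, Finset.sum_sub_distrib, one_div]
  ring

/-- The same argument for squares, whose predictive mean is J² plus the predictive variance. The
form of the limit identifies V with Q - Z². -/
theorem tendsto_cesaro_sq_K (h : IsPredictiveSystem P ℱ 𝒢 R K N C Λ D G β c u b ℓ) {Z V : Ω → ℝ}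
    (hZ : ∀ᵐ ω ∂P, Tendsto (fun n => D n ω + Λ n ω) atTop (𝓝 (Z ω)))
    (hV : ∀ᵐ ω ∂P, Tendsto (fun n => D n ω + Λ n ω - G n ω) atTop (𝓝 (V ω))) :
    ∀ᵐ ω ∂P, Tendsto (fun n : ℕ => (1 / (n : ℝ)) * ∑ i ∈ Finset.range n, K i ω ^ 2) atTop
      (𝓝 (Z ω ^ 2 + V ω)) := by
  have h1 : ∀ a : ℕ, ∀ᵐ ω ∂P, Tendsto (fun n : ℕ => (1 / (n : ℝ)) *
      ∑ k ∈ Finset.range n, centeredSq K D Λ G a k ω) atTop (𝓝 0) := fun a => by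
    obtain ⟨B, hB⟩ := h.exists_integral_centeredSq_sq_le (a : ℝ)
    exact tendsto_cesaro_martingale_differences
      (fun k => (h.measurable_centeredSq a k).mono (h.mid_le k) le_rfl)
      (fun k => (hB k).1) (fun k => (h.condExp_centeredSq a k).2) fun k => (hB k).2
  filter_upwards [ae_all_iff.2 h1, hZ, hV, h.exists_mem_allLowMeans] with ω h1 hZ hV ⟨a, ha⟩
  have h2 := (h1 a).add ((hZ.pow 2).add hV).cesaro
  rw [zero_add] at h2
  refine h2.congr fun n => ?_
  have h3 : ∀ k, centeredSq K D Λ G a k ω =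
      K k ω ^ 2 - ((D k ω + Λ k ω) ^ 2 + (D k ω + Λ k ω - G k ω)) := fun k =>
    Set.indicator_of_mem (allLowMeans_subset _ _ _ _ ha) _
  simp only [h3, Finset.sum_sub_distrib, one_div]
  ring

theorem integrable_comp_R (h : IsPredictiveSystem P ℱ 𝒢 R K N C Λ D G β c u b ℓ) (n j : ℕ) :
    Integrable (fun ω => R n ω ^ j) P := by
  have hR := (h.measurable_R n).mono (ℱ.le _) le_rfl
  refine Integrable.of_bound (hR.pow_const j).aestronglyMeasurable (b ^ j) (ae_of_all _ fun ω => ?_)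
  have := h.u_pos.le.trans (h.le_R n ω)
  rw [Real.norm_of_nonneg (by positivity)]
  exact pow_le_pow_left₀ this (h.R_le n ω) j

/-- Since `R n` is independent of `ℱ n`, subtracting its expectation leaves bounded martingale
differences. -/
theorem tendsto_totalWeight_div (h : IsPredictiveSystem P ℱ 𝒢 R K N C Λ D G β c u b ℓ) {r : ℝ}
    (hr : Tendsto (fun n => ∫ ω, R n ω ∂P) atTop (𝓝 r)) :
    ∀ᵐ ω ∂P, Tendsto (fun n : ℕ => (1 / (n : ℝ)) * totalWeight R n ω) atTop (𝓝 r) := by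
  have hRm := fun n => (h.measurable_R n).mono (ℱ.le _) le_rfl
  have hRi : ∀ n, Integrable (R n) P := fun n => by simpa using h.integrable_comp_R n 1
  have hE : ∀ n, u ≤ ∫ ω, R n ω ∂P ∧ ∫ ω, R n ω ∂P ≤ b := fun n => by
    constructor
    · have := integral_mono (integrable_const u) (hRi n) (h.le_R n)
      simpa using this
    · have := integral_mono (hRi n) (integrable_const b) (h.R_le n)
      simpa using this
  have hbd : ∀ n ω, |R n ω - ∫ ω, R n ω ∂P| ≤ b := fun n ω => by
    have h1 := hE n
    have := h.u_pos
    rw [abs_le]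
    constructor <;> linarith [h.le_R n ω, h.R_le n ω]
  have h1 := tendsto_cesaro_martingale_differences (P := P) (ℱ := ℱ)
    (x := fun n ω => R n ω - ∫ ω, R n ω ∂P) (fun n => (h.measurable_R n).sub_const _)
    (fun n => Integrable.of_bound (((hRm n).sub_const _).pow_const 2).aestronglyMeasurable (b ^ 2)
      (ae_of_all _ fun ω => by
        rw [norm_pow]; exact pow_le_pow_left₀ (abs_nonneg _) (hbd n ω) 2))
    (fun n => by
      refine condExp_sub_eq_zero (ℱ.le n) (hRi n) measurable_const (integrable_const _) ?_
      exact condExp_indep_eq (hRm n).comap_le (ℱ.le n)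
        (comap_measurable (R n)).stronglyMeasurable
        (indep_of_indep_of_le_right (h.indep_R n) (h.le_mid n))) (B := b ^ 2) (fun n => by
      refine (integral_mono_of_nonneg (g := fun _ => b ^ 2) (ae_of_all _ fun ω => sq_nonneg _)
        (integrable_const _) (ae_of_all _ fun ω => ?_)).trans (by simp)
      exact (sq_abs _).symm.trans_le (pow_le_pow_left₀ (abs_nonneg _) (hbd n ω) 2))
  filter_upwards [h1] with ω h1
  have h2 := h1.add hr.cesaro
  rw [zero_add] at h2
  refine h2.congr fun n => ?_
  simp only [Finset.sum_sub_distrib, one_div, totalWeight]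
  ring

end IsPredictiveSystem

end WeightedIBP

namespace WeightedIBP

/-! ### The central limit theorem for predictive systems -/

theorem sum_sub_mul_eq (K B : ℕ → ℝ) (n : ℕ) :
    ∑ k ∈ Finset.range n, (K k - B k - ((k : ℝ) + 1) * (B (k + 1) - B k))
      = ∑ k ∈ Finset.range n, K k - n * B n := by
  induction n with
  | zero => simp
  | succ n ih =>
    rw [Finset.sum_range_succ, ih, Finset.sum_range_succ]
    push_cast
    ring

/-- Summation by parts gives the distance of the mean from B_n as a sum over k < n, and B_N - B_n
telescopes over n ≤ k < N. Weights √n/(k+1) in the second range let both ranges share the term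
(k+1)(B_{k+1} - B_k), whose factor k+1 balances the denominator of the increment. -/
theorem sqrt_mul_mean_sub_eq (K B : ℕ → ℝ) {N : ℕ → ℕ} {n : ℕ} (hN : n ≤ N n) :
    √n * ((1 / (n : ℝ)) * ∑ k ∈ Finset.range n, K k - B (N n))
      = ∑ k ∈ Finset.range (N n), tailWeight N n k *
        ((if k < n then K k - B k else 0) - ((k : ℝ) + 1) * (B (k + 1) - B k)) := by
  rcases Nat.eq_zero_or_pos n with rfl | hn
  · have : ∀ k, tailWeight N 0 k = 0 := fun k => by simp [tailWeight]
    simp [this]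
  have hn' : (0 : ℝ) < n := by exact_mod_cast hn
  have hs : √(n : ℝ) ≠ 0 := (Real.sqrt_pos.2 hn').ne'
  have hss : √(n : ℝ) * √n = n := Real.mul_self_sqrt hn'.le
  rw [← Finset.sum_range_add_sum_Ico _ hN]
  have h1 : ∑ k ∈ Finset.range n, tailWeight N n k *
      ((if k < n then K k - B k else 0) - ((k : ℝ) + 1) * (B (k + 1) - B k))
      = 1 / √n * (∑ k ∈ Finset.range n, K k - n * B n) := by
    rw [← sum_sub_mul_eq, Finset.mul_sum]
    refine Finset.sum_congr rfl fun k hk => ?_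
    have hk := Finset.mem_range.1 hk
    rw [tailWeight, if_pos hk, if_pos hk]
  have h2 : ∑ k ∈ Finset.Ico n (N n), tailWeight N n k *
      ((if k < n then K k - B k else 0) - ((k : ℝ) + 1) * (B (k + 1) - B k))
      = -(√n * (B (N n) - B n)) := by
    rw [← Finset.sum_Ico_sub B hN, Finset.mul_sum, ← Finset.sum_neg_distrib]
    refine Finset.sum_congr rfl fun k hk => ?_
    have hk := Finset.mem_Ico.1 hk
    rw [tailWeight, if_neg (not_lt.2 hk.1), if_pos hk.2, if_neg (not_lt.2 hk.1)]
    have : (k : ℝ) + 1 ≠ 0 := by positivity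
    field_simp
    ring
  rw [h1, h2]
  have h3 : 1 / (n : ℝ) = 1 / √n * (1 / √n) := by rw [div_mul_div_comm, hss, one_mul]
  have h4 : (n : ℝ) * (1 / √n) = √n := by rw [mul_one_div, div_eq_iff hs, hss]
  have h5 : √(n : ℝ) * (1 / √n) = 1 := mul_one_div_cancel hs
  rw [h3]
  linear_combination (1 / √(n : ℝ) * ∑ k ∈ Finset.range n, K k) * h5 + B n * h4

variable {Ω : Type*}

namespace IsPredictiveSystem

variable {mΩ : MeasurableSpace Ω} {P : Measure Ω} [IsProbabilityMeasure P] {ℱ : Filtration ℕ mΩ}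
  {𝒢 : ℕ → MeasurableSpace Ω} {R K N C Λ D G : ℕ → Ω → ℝ} {β c u b : ℝ} {ℓ : ℕ → ℝ}

theorem le_of_tendsto_integral_R (h : IsPredictiveSystem P ℱ 𝒢 R K N C Λ D G β c u b ℓ) {r : ℝ}
    (hr : Tendsto (fun n => ∫ ω, R n ω ∂P) atTop (𝓝 r)) : 0 < r := by
  refine h.u_pos.trans_le (ge_of_tendsto' hr fun n => ?_)
  have hRi : Integrable (R n) P := by simpa using h.integrable_comp_R n 1
  have := integral_mono (integrable_const u) hRi (h.le_R n)
  simpa using this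

theorem tendsto_div_totalWeight (h : IsPredictiveSystem P ℱ 𝒢 R K N C Λ D G β c u b ℓ) {r : ℝ}
    (hr : Tendsto (fun n => ∫ ω, R n ω ∂P) atTop (𝓝 r)) :
    ∀ᵐ ω ∂P, Tendsto (fun n : ℕ => ((n : ℝ) + 1) / (totalWeight R (n + 1) ω + c)) atTop
      (𝓝 (1 / r)) := by
  have hr0 := h.le_of_tendsto_integral_R hr
  filter_upwards [h.tendsto_totalWeight_div hr] with ω hω
  have h1 := ((hω.comp (tendsto_add_atTop_nat 1)).add
    (tendsto_one_div_add_atTop_nhds_zero_nat.const_mul c)).inv₀ (by simpa using hr0.ne')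
  rw [mul_zero, add_zero, ← one_div] at h1
  refine h1.congr fun n => ?_
  have hn : (n : ℝ) + 1 ≠ 0 := by positivity
  have hT := (h.totalWeight_pos n ω).ne'
  simp only [Function.comp_apply]
  push_cast
  rw [inv_eq_one_div, div_eq_div_iff _ hT]
  · field_simp
  · have : 1 / ((n : ℝ) + 1) * totalWeight R (n + 1) ω + c * (1 / ((n : ℝ) + 1))
        = (totalWeight R (n + 1) ω + c) / (n + 1) := by field_simp
    rw [this]
    exact div_ne_zero hT hn

/-- A weighted sum of martingale differences with vanishing second moments is negligible. -/
theorem negligible_weighted_sum (h : IsPredictiveSystem P ℱ 𝒢 R K N C Λ D G β c u b ℓ)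
    {NN : ℕ → ℕ} (hNN : ∀ n, n ≤ NN n) {ζ : ℕ → Ω → ℝ} (hζ : ∀ n, Measurable[𝒢 n] (ζ n))
    (hζ2 : ∀ n, Integrable (fun ω => ζ n ω ^ 2) P) (hζ0 : ∀ n, P[ζ n | ℱ n] =ᵐ[P] 0)
    {φ : ℕ → ℝ × ℝ → ℝ} (hφ : ∀ n, Measurable (φ n)) {B : ℝ}
    (hB : ∀ n, ∀ z ∈ weightRegion c u b n, |φ n z| ≤ B)
    (hlim : Tendsto (fun n => ∫ ω, (ζ n ω * φ n (totalWeight R n ω, R n ω)) ^ 2 ∂P) atTop (𝓝 0)) :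
    NegligibleInProbability P fun n ω => ∑ k ∈ Finset.range (NN n),
      tailWeight NN n k * (ζ k ω * φ k (totalWeight R k ω, R k ω)) := by
  have hRm : ∀ k, Measurable[ℱ (k + 1)] (R k) := h.measurable_R
  have hTm : ∀ k, Measurable[ℱ (k + 1)] (totalWeight R k) := fun k =>
    (h.measurable_totalWeight k).mono (ℱ.mono k.le_succ) le_rfl
  have hζm : ∀ k, Measurable[ℱ (k + 1)] (ζ k) := fun k => (hζ k).mono (h.mid_le k) le_rfl
  set y : ℕ → Ω → ℝ := fun k ω => ζ k ω * φ k (totalWeight R k ω, R k ω) with hy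
  have hym : ∀ k, Measurable[ℱ (k + 1)] (y k) := fun k =>
    (hζm k).mul ((hφ k).comp ((hTm k).prodMk (hRm k)))
  have hζi : ∀ k, Integrable (ζ k) P := fun k =>
    integrable_of_integrable_sq ((hζm k).mono (ℱ.le _) le_rfl).aestronglyMeasurable (hζ2 k)
  have hy2 : ∀ k, Integrable (fun ω => y k ω ^ 2) P := fun k => by
    have : (fun ω => y k ω ^ 2) = fun ω => ζ k ω ^ 2 * φ k (totalWeight R k ω, R k ω) ^ 2 := by
      ext ω; rw [hy, mul_pow]
    rw [this]
    refine (hζ2 k).mul_bdd (c := B ^ 2) ((((hφ k).comp ((hTm k).prodMk (hRm k))).pow_const 2).mono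
      (ℱ.le _) le_rfl).aestronglyMeasurable (ae_of_all _ fun ω => ?_)
    rw [norm_pow]
    exact pow_le_pow_left₀ (norm_nonneg _) (hB k _ (h.mem_weightRegion k ω)) 2
  have hx : ∀ n k, Measurable[ℱ (k + 1)] fun ω => tailWeight NN n k * y k ω := fun n k =>
    (hym k).const_mul _
  have hx2 : ∀ n k, Integrable (fun ω => (tailWeight NN n k * y k ω) ^ 2) P := fun n k => by
    simp_rw [mul_pow]; exact (hy2 k).const_mul _
  have hx0 : ∀ n k, P[fun ω => tailWeight NN n k * y k ω | ℱ k] =ᵐ[P] 0 := fun n k => by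
    have h1 := (h.condExp_mul_eq_zero (hζ k) (hζi k) (hζ0 k) (hφ k) (hB k)).2
    filter_upwards [condExp_smul (μ := P) (tailWeight NN n k) (y k) (ℱ k), h1] with ω h2 h1
    refine h2.trans ?_
    rw [Pi.smul_apply, h1]
    simp
  refine .of_integral_sq (fun n => (measurable_sum_of_measurable_succ (hx n) (NN n)).mono
    (ℱ.le _) le_rfl) (fun n => (integral_sq_sum_eq (hx n) (hx2 n) (hx0 n) (NN n)).1) ?_
  have h3 : ∀ n, ∫ ω, (∑ k ∈ Finset.range (NN n), tailWeight NN n k * y k ω) ^ 2 ∂P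
      = ∑ k ∈ Finset.range (NN n), tailWeight NN n k ^ 2 * ∫ ω, y k ω ^ 2 ∂P := fun n => by
    rw [(integral_sq_sum_eq (hx n) (hx2 n) (hx0 n) (NN n)).2]
    refine Finset.sum_congr rfl fun k _ => ?_
    simp_rw [mul_pow]
    rw [integral_const_mul]
  refine Tendsto.congr (fun n => (h3 n).symm) ?_
  -- By orthogonality the second moment is a weighted average of a null sequence with the squared
  -- weights, which are at most 1/n and have sum at most 2.
  refine tendsto_sum_weights_mul (δ := fun n : ℕ => 1 / (n : ℝ)) (A := 2)
    (fun n k => sq_nonneg _) (fun n k => ?_) tendsto_one_div_atTop_nhds_zero_nat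
    (fun n => sum_range_tailWeight_sq_le (hNN n)) (tendsto_atTop_mono hNN tendsto_id) hlim
  calc tailWeight NN n k ^ 2 ≤ (1 / √(n : ℝ)) ^ 2 :=
        pow_le_pow_left₀ (tailWeight_nonneg _ _ _) (tailWeight_le _ _ _) 2
    _ = 1 / n := by rw [div_pow, one_pow, Real.sq_sqrt (by positivity)]

/-- The error of replacing (k+1) over the denominator by 1/r is bounded and tends to zero almost
surely, so its fourth moments vanish; the centred variables have bounded fourth moments. -/
theorem tendsto_integral_centered_remainder
    (h : IsPredictiveSystem P ℱ 𝒢 R K N C Λ D G β c u b ℓ) {r : ℝ}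
    (hr : Tendsto (fun n => ∫ ω, R n ω ∂P) atTop (𝓝 r)) (a : ℝ) :
    Tendsto (fun n : ℕ => ∫ ω, (centered K D Λ a n ω * (R n ω *
      (1 / r - ((n : ℝ) + 1) / (totalWeight R n ω + R n ω + c)))) ^ 2 ∂P) atTop (𝓝 0) := by
  obtain ⟨B, hB⟩ := h.exists_integral_centered_pow_four_le a
  have hr0 := h.le_of_tendsto_integral_R hr
  have hκ := h.min_pos
  have hb := h.b_pos
  have hRm := fun n => (h.measurable_R n).mono (ℱ.le _) le_rfl
  have hTm := fun n => (h.measurable_totalWeight n).mono (ℱ.le _) le_rfl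
  have hζm := fun n => (h.measurable_centered a n).mono (h.mid_le' n) le_rfl
  set φ : ℕ → Ω → ℝ := fun n ω => R n ω *
    (1 / r - ((n : ℝ) + 1) / (totalWeight R n ω + R n ω + c)) with hφ
  have hφm : ∀ n, Measurable (φ n) := fun n => by
    have := hRm n; have := hTm n; fun_prop
  have hφB : ∀ n ω, |φ n ω| ≤ b * (1 / r + 1 / min u (u + c)) := fun n ω => by
    have h1 := h.abs_div_le (h.mem_weightRegion n ω) (le_refl |((n : ℝ) + 1)|)
    have hn : (0 : ℝ) < (n : ℝ) + 1 := by positivity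
    have h2 : |((n : ℝ) + 1)| / (min u (u + c) * (n + 1)) = 1 / min u (u + c) := by
      rw [abs_of_pos hn]; field_simp
    rw [h2] at h1
    have h3 := h.u_pos.le.trans (h.le_R n ω)
    rw [hφ, abs_mul, abs_of_nonneg h3]
    refine mul_le_mul (h.R_le n ω) ((abs_sub _ _).trans ?_) (abs_nonneg _) hb.le
    rw [abs_of_pos (one_div_pos.2 hr0)]
    gcongr
  have hφ0 : Tendsto (fun n => ∫ ω, φ n ω ^ 4 ∂P) atTop (𝓝 0) := by
    have : Tendsto (fun n => ∫ ω, φ n ω ^ 4 ∂P) atTop (𝓝 (∫ _, (0 : ℝ) ∂P)) := by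
      refine tendsto_integral_of_dominated_convergence
        (fun _ => (b * (1 / r + 1 / min u (u + c))) ^ 4)
        (fun n => ((hφm n).pow_const 4).aestronglyMeasurable) (integrable_const _)
        (fun n => ae_of_all _ fun ω => ?_) ?_
      · rw [norm_pow]
        exact pow_le_pow_left₀ (norm_nonneg _) (hφB n ω) 4
      · filter_upwards [h.tendsto_div_totalWeight hr] with ω hω
        have h1 : Tendsto (fun n => φ n ω) atTop (𝓝 0) := by
          have h2 := (tendsto_const_nhds (x := 1 / r)).sub hω
          rw [sub_self] at h2
          refine squeeze_zero_norm (fun n => ?_)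
            (by simpa only [abs_zero, mul_zero] using h2.abs.const_mul b)
          have h3 := h.u_pos.le.trans (h.le_R n ω)
          rw [hφ, Real.norm_eq_abs, abs_mul, abs_of_nonneg h3, totalWeight_succ]
          exact mul_le_mul_of_nonneg_right (h.R_le n ω) (abs_nonneg _)
        simpa using h1.pow 4
    simpa using this
  have hφ4 : ∀ n, Integrable (fun ω => φ n ω ^ 4) P := fun n =>
    Integrable.of_bound ((hφm n).pow_const 4).aestronglyMeasurable
      ((b * (1 / r + 1 / min u (u + c))) ^ 4) (ae_of_all _ fun ω => by
        rw [norm_pow]; exact pow_le_pow_left₀ (norm_nonneg _) (hφB n ω) 4)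
  have hB0 : 0 ≤ B := (integral_nonneg fun ω => by positivity).trans (hB 0).2
  -- Young's inequality with ε takes the place of Cauchy–Schwarz for the product of squares.
  have hle : ∀ ε > 0, ∀ n, ∫ ω, (centered K D Λ a n ω * φ n ω) ^ 2 ∂P
      ≤ ε * B + 1 / ε * ∫ ω, φ n ω ^ 4 ∂P := by
    intro ε hε n
    have hpt : ∀ ω, (centered K D Λ a n ω * φ n ω) ^ 2
        ≤ ε * centered K D Λ a n ω ^ 4 + 1 / ε * φ n ω ^ 4 := fun ω => by
      have h1 : 0 ≤ (ε * centered K D Λ a n ω ^ 2 - φ n ω ^ 2) ^ 2 / ε := by positivity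
      have h2 : (ε * centered K D Λ a n ω ^ 2 - φ n ω ^ 2) ^ 2 / ε
          = ε * centered K D Λ a n ω ^ 4 + 1 / ε * φ n ω ^ 4
            - 2 * (centered K D Λ a n ω * φ n ω) ^ 2 := by field_simp; ring
      nlinarith [sq_nonneg (centered K D Λ a n ω * φ n ω)]
    refine (integral_mono_of_nonneg (ae_of_all _ fun ω => sq_nonneg _)
      (((hB n).1.const_mul ε).add ((hφ4 n).const_mul (1 / ε))) (ae_of_all _ hpt)).trans ?_
    simp only [Pi.add_apply]
    rw [integral_add ((hB n).1.const_mul ε) ((hφ4 n).const_mul (1 / ε)), integral_const_mul,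
      integral_const_mul]
    gcongr
    exact (hB n).2
  refine tendsto_order.2 ⟨fun x hx => Eventually.of_forall fun n =>
    hx.trans_le (integral_nonneg fun ω => sq_nonneg _), fun x hx => ?_⟩
  set ε := x / (2 * (B + 1)) with hε
  have hε0 : 0 < ε := by positivity
  have h1 : Tendsto (fun n => ε * B + 1 / ε * ∫ ω, φ n ω ^ 4 ∂P) atTop (𝓝 (ε * B)) := by
    simpa using (hφ0.const_mul (1 / ε)).const_add (ε * B)
  have h2 : ε * B < x := by
    rw [hε, div_mul_eq_mul_div, div_lt_iff₀ (by positivity)]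
    nlinarith
  filter_upwards [h1.eventually (gt_mem_nhds h2)] with n hn
  exact (hle ε hε0 n).trans_lt hn

/-- Once the level is exceeded the cut variance is zero for ever, so the limit is V on the paths
that never exceed it and 0 on the others. -/
theorem tendsto_lowVariance (h : IsPredictiveSystem P ℱ 𝒢 R K N C Λ D G β c u b ℓ) {V : Ω → ℝ}
    (hV : ∀ᵐ ω ∂P, Tendsto (fun n => D n ω + Λ n ω - G n ω) atTop (𝓝 (V ω))) (a : ℝ) :
    ∀ᵐ ω ∂P, Tendsto (fun n => lowVariance D Λ G a n ω) atTop
      (𝓝 ((allLowMeans D Λ a).indicator V ω)) := by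
  filter_upwards [hV] with ω hω
  by_cases hl : ω ∈ allLowMeans D Λ a
  · rw [Set.indicator_of_mem hl]
    refine hω.congr fun n => ?_
    rw [lowVariance, Set.indicator_of_mem (allLowMeans_subset _ _ _ _ hl)]
  · rw [Set.indicator_of_notMem hl]
    obtain ⟨j, hj⟩ : ∃ j, ¬ D j ω + Λ j ω ≤ a := by
      simpa [allLowMeans] using hl
    refine tendsto_const_nhds.congr' ?_
    filter_upwards [eventually_ge_atTop j] with n hn
    rw [lowVariance, Set.indicator_of_notMem]
    exact fun hω => hj (hω j hn)

/-- The second moment of the factor by which the centred number of dishes of customer `k + 1`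
enters. -/
def factorMoment (P : Measure Ω) (R : ℕ → Ω → ℝ) (r : ℝ) (n k : ℕ) : ℝ :=
  ∫ ω, ((if k < n then 1 else 0) - R k ω / r) ^ 2 ∂P

theorem factorMoment_bounds (h : IsPredictiveSystem P ℱ 𝒢 R K N C Λ D G β c u b ℓ) {r : ℝ}
    (hr : 0 < r) (n k : ℕ) :
    (∀ ω, |(if k < n then 1 else 0) - R k ω / r| ≤ 1 + b / r) ∧ 0 ≤ factorMoment P R r n k ∧
      factorMoment P R r n k ≤ (1 + b / r) ^ 2 := by
  have h1 : ∀ ω, |(if k < n then 1 else 0) - R k ω / r| ≤ 1 + b / r := fun ω => by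
    have h2 := h.u_pos.le.trans (h.le_R k ω)
    refine (abs_sub _ _).trans (add_le_add ?_ ?_)
    · split_ifs <;> simp
    · rw [abs_of_nonneg (by positivity)]
      have := h.R_le k ω
      gcongr
  refine ⟨h1, integral_nonneg fun ω => sq_nonneg _, ?_⟩
  refine (integral_mono_of_nonneg (g := fun _ => (1 + b / r) ^ 2) (ae_of_all _ fun ω => sq_nonneg _)
    (integrable_const _) (ae_of_all _ fun ω => ?_)).trans (by simp)
  exact (sq_abs _).symm.trans_le (pow_le_pow_left₀ (abs_nonneg _) (h1 ω) 2)

/-- The second moment of the factor tends to 1 - 2 + q/r² on k < n and to q/r² beyond. The squared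
weights have mass 1 on the first range and, in the limit, `L` on the second. -/
theorem tendsto_sum_factorMoment (h : IsPredictiveSystem P ℱ 𝒢 R K N C Λ D G β c u b ℓ) {r q : ℝ}
    (hr : Tendsto (fun n => ∫ ω, R n ω ∂P) atTop (𝓝 r))
    (hq : Tendsto (fun n => ∫ ω, R n ω ^ 2 ∂P) atTop (𝓝 q)) {NN : ℕ → ℕ} (hNN : ∀ n, n ≤ NN n)
    {L : ℝ} (hL : Tendsto (fun n : ℕ => (n : ℝ) * ∑ k ∈ Finset.Ico n (NN n), 1 / ((k : ℝ) + 1) ^ 2)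
      atTop (𝓝 L)) :
    Tendsto (fun n => ∑ k ∈ Finset.range (NN n), tailWeight NN n k ^ 2 * factorMoment P R r n k)
      atTop (𝓝 ((q - r ^ 2) / r ^ 2 + q / r ^ 2 * L)) := by
  have hr0 := h.le_of_tendsto_integral_R hr
  have hR1 : ∀ k, Integrable (R k) P := fun k => by simpa using h.integrable_comp_R k 1
  have hfm : ∀ n k, factorMoment P R r n k = (if k < n then 1 else 0)
      - 2 * (if k < n then 1 else 0) * ((∫ ω, R k ω ∂P) / r) + (∫ ω, R k ω ^ 2 ∂P) / r ^ 2 := by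
    intro n k
    have he : ∀ ω, ((if k < n then 1 else 0) - R k ω / r) ^ 2 = (if k < n then (1 : ℝ) else 0)
        - 2 * (if k < n then 1 else 0) * (R k ω / r) + R k ω ^ 2 / r ^ 2 := fun ω => by
      split_ifs <;> ring
    rw [factorMoment]
    simp_rw [he]
    have h1 : Integrable (fun ω => (if k < n then (1 : ℝ) else 0)
        - 2 * (if k < n then 1 else 0) * (R k ω / r)) P :=
      (integrable_const _).sub (((hR1 k).div_const r).const_mul _)
    rw [integral_add h1 ((h.integrable_comp_R k 2).div_const _),
      integral_sub (integrable_const _) (((hR1 k).div_const r).const_mul _), integral_const_mul,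
      integral_div, integral_div]
    simp
  set a : ℕ → ℝ := fun k => 2 * |(∫ ω, R k ω ∂P) / r - 1| + |(∫ ω, R k ω ^ 2 ∂P) / r ^ 2 - q / r ^ 2|
    with ha
  have ha0 : Tendsto a atTop (𝓝 0) := by
    have h1 := ((hr.div_const r).sub_const 1).abs
    rw [div_self hr0.ne', sub_self, abs_zero] at h1
    have h2 := ((hq.div_const (r ^ 2)).sub_const (q / r ^ 2)).abs
    rw [sub_self, abs_zero] at h2
    simpa using (h1.const_mul 2).add h2
  have hδ : ∀ n k, tailWeight NN n k ^ 2 ≤ 1 / (n : ℝ) := fun n k =>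
    calc tailWeight NN n k ^ 2 ≤ (1 / √(n : ℝ)) ^ 2 :=
          pow_le_pow_left₀ (tailWeight_nonneg _ _ _) (tailWeight_le _ _ _) 2
      _ = 1 / n := by rw [div_pow, one_pow, Real.sq_sqrt (by positivity)]
  have h1 := tendsto_sum_weights_mul (δ := fun n : ℕ => 1 / (n : ℝ)) (A := 2)
    (fun n k => sq_nonneg (tailWeight NN n k)) hδ tendsto_one_div_atTop_nhds_zero_nat
    (fun n => sum_range_tailWeight_sq_le (hNN n)) (tendsto_atTop_mono hNN tendsto_id) ha0
  -- The limiting second moments; the deviation from them is at most `a k`, uniformly in n, so the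
  -- Toeplitz lemma removes it.
  set d : ℕ → ℕ → ℝ := fun n k => (if k < n then -1 else 0) + q / r ^ 2 with hd
  have h2 : Tendsto (fun n => ∑ k ∈ Finset.range (NN n), tailWeight NN n k ^ 2 *
      (factorMoment P R r n k - d n k)) atTop (𝓝 0) := by
    refine squeeze_zero_norm (fun n => ?_) h1
    refine (norm_sum_le _ _).trans (Finset.sum_le_sum fun k _ => ?_)
    rw [norm_mul, Real.norm_of_nonneg (sq_nonneg _)]
    refine mul_le_mul_of_nonneg_left ?_ (sq_nonneg _)
    have he : factorMoment P R r n k - d n k = (if k < n then -2 else 0) *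
        ((∫ ω, R k ω ∂P) / r - 1) + ((∫ ω, R k ω ^ 2 ∂P) / r ^ 2 - q / r ^ 2) := by
      rw [hfm]
      simp only [hd]
      split_ifs <;> ring
    rw [he, ha, Real.norm_eq_abs]
    refine (abs_add_le _ _).trans (add_le_add ?_ le_rfl)
    rw [abs_mul]
    refine mul_le_mul_of_nonneg_right ?_ (abs_nonneg _)
    split_ifs <;> simp
  have h3 : Tendsto (fun n => ∑ k ∈ Finset.range (NN n), tailWeight NN n k ^ 2 * d n k) atTop
      (𝓝 ((q - r ^ 2) / r ^ 2 + q / r ^ 2 * L)) := by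
    refine ((hL.const_mul (q / r ^ 2)).const_add ((q - r ^ 2) / r ^ 2)).congr' ?_
    filter_upwards [eventually_gt_atTop 0] with n hn
    have hn' : (n : ℝ) ≠ 0 := by positivity
    rw [sum_range_tailWeight_sq_mul (hNN n)]
    congr 1
    · rw [Finset.sum_congr rfl (g := fun _ => -1 + q / r ^ 2) fun k hk => by
        rw [hd]; simp only; rw [if_pos (Finset.mem_range.1 hk)]]
      rw [Finset.sum_const, Finset.card_range, nsmul_eq_mul]
      field_simp
      ring
    · have h4 : ∀ k ∈ Finset.Ico n (NN n), 1 / ((k : ℝ) + 1) ^ 2 * d n k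
          = 1 / ((k : ℝ) + 1) ^ 2 * (q / r ^ 2) := fun k hk => by
        simp only [hd]; rw [if_neg (not_lt.2 (Finset.mem_Ico.1 hk).1), zero_add]
      rw [Finset.sum_congr rfl h4, ← Finset.sum_mul]
      ring
  have h5 := h2.add h3
  rw [zero_add] at h5
  refine h5.congr fun n => ?_
  rw [← Finset.sum_add_distrib]
  exact Finset.sum_congr rfl fun k _ => by ring

/-- The leading term in the central limit theorem. -/
theorem tendsto_setIntegral_exp_leading (h : IsPredictiveSystem P ℱ 𝒢 R K N C Λ D G β c u b ℓ)
    {r : ℝ} (hr : 0 < r) {NN : ℕ → ℕ} (hNN : ∀ n, n ≤ NN n) {θ' : ℝ}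
    (hθ : Tendsto (fun n => ∑ k ∈ Finset.range (NN n),
      tailWeight NN n k ^ 2 * factorMoment P R r n k) atTop (𝓝 θ'))
    {V : Ω → ℝ} (hVm : Measurable V)
    (hV : ∀ᵐ ω ∂P, Tendsto (fun n => D n ω + Λ n ω - G n ω) atTop (𝓝 (V ω))) (a : ℝ)
    {H : Set Ω} (hH : MeasurableSet H) (t : ℝ) :
    Tendsto (fun n => ∫ ω in H, Complex.exp (t * (∑ k ∈ Finset.range (NN n), tailWeight NN n k *
        (centered K D Λ a k ω * ((if k < n then 1 else 0) - R k ω / r)) : ℝ) * Complex.I) ∂P) atTop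
      (𝓝 (∫ ω in H, (Real.exp (-(t ^ 2 / 2 * θ' *
        (allLowMeans D Λ a).indicator V ω)) : ℂ) ∂P)) := by
  obtain ⟨B, hB⟩ := h.integrable_centered_cube a
  have hRm := h.measurable_R
  have hRmΩ := fun n => (h.measurable_R n).mono (ℱ.le _) le_rfl
  have hζm := fun n => (h.measurable_centered a n).mono (h.mid_le n) le_rfl
  have hζmΩ := fun n => (h.measurable_centered a n).mono (h.mid_le' n) le_rfl
  have hfac := h.factorMoment_bounds hr
  have hb := h.b_pos
  set A := 1 + b / r with hA
  have hA0 : 0 ≤ A := by positivity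
  -- Clipping makes the bounds on the variance hold everywhere instead of almost everywhere.
  set v : ℕ → Ω → ℝ := fun n ω => min |a| (max 0 (lowVariance D Λ G a n ω)) with hv
  have hvae : ∀ n, ∀ᵐ ω ∂P, v n ω = lowVariance D Λ G a n ω := fun n => by
    filter_upwards [h.lowVariance_bounds a n] with ω hω
    rw [hv]; simp only
    rw [max_eq_right hω.1, min_eq_right hω.2]
  have hδ : ∀ n k, tailWeight NN n k ^ 2 ≤ 1 / (n : ℝ) := fun n k =>
    calc tailWeight NN n k ^ 2 ≤ (1 / √(n : ℝ)) ^ 2 :=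
          pow_le_pow_left₀ (tailWeight_nonneg _ _ _) (tailWeight_le _ _ _) 2
      _ = 1 / n := by rw [div_pow, one_pow, Real.sq_sqrt (by positivity)]
  have hX3' : ∀ n k ω, |tailWeight NN n k * (centered K D Λ a k ω *
      ((if k < n then 1 else 0) - R k ω / r))| ^ 3
      ≤ tailWeight NN n k ^ 3 * A ^ 3 * |centered K D Λ a k ω| ^ 3 := fun n k ω => by
    rw [abs_mul, abs_mul, abs_of_nonneg (tailWeight_nonneg _ _ _), mul_pow, mul_pow, mul_assoc,
      mul_comm (A ^ 3)]
    refine mul_le_mul_of_nonneg_left ?_ (pow_nonneg (tailWeight_nonneg _ _ _) 3)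
    exact mul_le_mul_of_nonneg_left (pow_le_pow_left₀ (abs_nonneg _) ((hfac n k).1 ω) 3)
      (by positivity)
  have hXm : ∀ n k, Measurable[ℱ (k + 1)] fun ω => tailWeight NN n k * (centered K D Λ a k ω *
      ((if k < n then 1 else 0) - R k ω / r)) := fun n k =>
    ((hζm k).mul (measurable_const.sub ((hRm k).div_const r))).const_mul _
  have hX3 : ∀ n k, Integrable (fun ω => |tailWeight NN n k * (centered K D Λ a k ω *
      ((if k < n then 1 else 0) - R k ω / r))| ^ 3) P := fun n k =>
    ((hB k).1.const_mul (tailWeight NN n k ^ 3 * A ^ 3)).mono'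
      (((hXm n k).mono (ℱ.le _) le_rfl).abs.pow_const 3).aestronglyMeasurable
      (ae_of_all _ fun ω => by
        rw [Real.norm_of_nonneg (by positivity)]; exact hX3' n k ω)
  have hwR : ∀ n k, ∀ z ∈ weightRegion c u b k,
      |tailWeight NN n k * ((if k < n then 1 else 0) - z.2 / r)| ≤ tailWeight NN n k * A := by
    intro n k z hz
    rw [abs_mul, abs_of_nonneg (tailWeight_nonneg _ _ _)]
    refine mul_le_mul_of_nonneg_left ((abs_sub _ _).trans (add_le_add ?_ ?_))
      (tailWeight_nonneg _ _ _)
    · split_ifs <;> simp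
    · have := h.u_pos.le.trans hz.1
      rw [abs_of_nonneg (by positivity)]
      have := hz.2.1
      gcongr
  -- The summand 1/(n+1) in `ε` keeps it positive at n = 0, where 1/n is 0.
  refine (tendsto_setIntegral_exp_sum ℱ (v := v) (C := |a|) (θ := fun n k =>
    tailWeight NN n k ^ 2 * factorMoment P R r n k)
    (ε := fun n : ℕ => 1 / (n : ℝ) * A ^ 2 + 1 / ((n : ℝ) + 1))
    (tendsto_atTop_mono hNN tendsto_id) hXm hX3 ?_ ?_
    (fun k => measurable_const.min (measurable_const.max (h.measurable_lowVariance a k)))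
    (fun k ω => le_min (abs_nonneg a) (le_max_left _ _)) (fun k ω => min_le_left _ _)
    (hVm.indicator (h.measurableSet_allLowMeans a)) ?_
    (fun n k => mul_nonneg (sq_nonneg _) (hfac n k).2.1) (fun n k => ?_) (fun n => by positivity)
    ?_ hθ ?_ hH t)
  · intro n k
    have h1 := (h.condExp_mul_eq_zero (h.measurable_centered a k)
      (integrable_of_integrable_cube (hζmΩ k) (hB k).1) (h.condExp_centered a k)
      (φ := fun z => tailWeight NN n k * ((if k < n then 1 else 0) - z.2 / r))
      (by fun_prop) (hwR n k)).2
    have he : (fun ω => centered K D Λ a k ω * (tailWeight NN n k *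
        ((if k < n then 1 else 0) - R k ω / r))) = fun ω => tailWeight NN n k *
        (centered K D Λ a k ω * ((if k < n then 1 else 0) - R k ω / r)) := by
      ext ω; ring
    rwa [he] at h1
  · intro n k
    -- The square of the factor as a function of the weight, cut to the possible weights so that it
    -- is bounded. The conditional variance then splits into a constant and the predictive variance.
    set ψ : ℝ → ℝ := (Set.Icc u b).indicator fun ρ =>
      tailWeight NN n k ^ 2 * ((if k < n then 1 else 0) - ρ / r) ^ 2 with hψ
    have hψR : ∀ ω, ψ (R k ω) = tailWeight NN n k ^ 2 *
        ((if k < n then 1 else 0) - R k ω / r) ^ 2 := fun ω =>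
      Set.indicator_of_mem (show R k ω ∈ Set.Icc u b from ⟨h.le_R k ω, h.R_le k ω⟩) _
    have hψm : Measurable ψ := Measurable.indicator (by fun_prop) measurableSet_Icc
    have h1 := condExp_mul_comp_indep (h.le_mid k) (h.mid_le' k)
      ((h.measurable_centered a k).pow_const 2).stronglyMeasurable (h.integrable_centered_sq a k)
      (h.condExp_centered_sq a k) (hRmΩ k) (h.indep_R k) hψm (B := tailWeight NN n k ^ 2 * A ^ 2)
      (fun ρ => by
        by_cases hρ : ρ ∈ Set.Icc u b
        · rw [hψ, Set.indicator_of_mem hρ, abs_mul, abs_of_nonneg (sq_nonneg (tailWeight NN n k)),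
            abs_pow]
          refine mul_le_mul_of_nonneg_left (pow_le_pow_left₀ (abs_nonneg _)
            ((abs_sub _ _).trans (add_le_add ?_ ?_)) 2) (sq_nonneg _)
          · split_ifs <;> simp
          · have := h.u_pos.le.trans hρ.1
            rw [abs_of_nonneg (by positivity)]
            have := hρ.2
            gcongr
        · rw [hψ, Set.indicator_of_notMem hρ, abs_zero]
          positivity)
    have he : (fun ω => (tailWeight NN n k * (centered K D Λ a k ω *
        ((if k < n then 1 else 0) - R k ω / r))) ^ 2)
        = fun ω => centered K D Λ a k ω ^ 2 * ψ (R k ω) := by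
      ext ω; rw [hψR]; ring
    have hint : ∫ ω, ψ (R k ω) ∂P = tailWeight NN n k ^ 2 * factorMoment P R r n k := by
      simp_rw [hψR]
      rw [integral_const_mul, factorMoment]
    rw [he]
    filter_upwards [h1, hvae k] with ω h1 h2
    rw [h1, hint, h2]
  · filter_upwards [h.tendsto_lowVariance hV a, ae_all_iff.2 hvae] with ω h1 h2
    exact h1.congr fun n => (h2 n).symm
  · have h1 : 1 / (n : ℝ) * A ^ 2 ≤ 1 / (n : ℝ) * A ^ 2 + 1 / ((n : ℝ) + 1) :=
      le_add_of_nonneg_right (by positivity)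
    refine le_trans ?_ h1
    exact mul_le_mul (hδ n k) (hfac n k).2.2 (hfac n k).2.1 (by positivity)
  · simpa using (tendsto_one_div_atTop_nhds_zero_nat.mul_const (A ^ 2)).add
      tendsto_one_div_add_atTop_nhds_zero_nat
  · have hB0 : 0 ≤ B := (integral_nonneg fun ω => by positivity).trans (hB 0).2.1
    -- Lyapunov's condition: one of the three weights is at most 1/√n and the squares of the other
    -- two have a bounded sum.
    have h1 : ∀ n : ℕ, ∑ k ∈ Finset.range (NN n), ∫ ω, |tailWeight NN n k *
        (centered K D Λ a k ω * ((if k < n then 1 else 0) - R k ω / r))| ^ 3 ∂P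
        ≤ 1 / √(n : ℝ) * (2 * (A ^ 3 * B)) := fun n => by
      calc _ ≤ ∑ k ∈ Finset.range (NN n), 1 / √(n : ℝ) * (tailWeight NN n k ^ 2 * (A ^ 3 * B)) := by
            refine Finset.sum_le_sum fun k _ => ?_
            refine (integral_mono (hX3 n k) ((hB k).1.const_mul _) (hX3' n k)).trans ?_
            rw [integral_const_mul]
            have h2 : tailWeight NN n k ^ 3 ≤ 1 / √(n : ℝ) * tailWeight NN n k ^ 2 := by
              rw [pow_succ, mul_comm]
              exact mul_le_mul_of_nonneg_right (tailWeight_le _ _ _) (sq_nonneg _)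
            calc _ ≤ (1 / √(n : ℝ) * tailWeight NN n k ^ 2) * A ^ 3 * B := by
                  have := pow_nonneg (tailWeight_nonneg NN n k) 3
                  gcongr
                  exact (hB k).2.1
              _ = _ := by ring
        _ = 1 / √(n : ℝ) * ((∑ k ∈ Finset.range (NN n), tailWeight NN n k ^ 2) * (A ^ 3 * B)) := by
            rw [← Finset.mul_sum, ← Finset.sum_mul]
        _ ≤ _ := by
            gcongr
            exact sum_range_tailWeight_sq_le (hNN n)
    refine squeeze_zero (fun n => Finset.sum_nonneg fun k _ => integral_nonneg fun ω => by positivity)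
      h1 ?_
    have h2 : Tendsto (fun n : ℕ => 1 / √(n : ℝ)) atTop (𝓝 0) := by
      simp_rw [one_div]
      exact (tendsto_inv_atTop_zero.comp Real.tendsto_sqrt_atTop).comp tendsto_natCast_atTop_atTop
    simpa using h2.mul_const (2 * (A ^ 3 * B))

end IsPredictiveSystem

end WeightedIBP

namespace WeightedIBP

variable {Ω : Type*}

theorem NegligibleInProbability.of_deterministic {mΩ : MeasurableSpace Ω} {P : Measure Ω}
    [IsProbabilityMeasure P] {Y : ℕ → Ω → ℝ} (hY : ∀ n, Measurable (Y n)) {y : ℕ → ℝ}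
    (h : ∀ n ω, |Y n ω| ≤ y n) (hy : Tendsto y atTop (𝓝 0)) : NegligibleInProbability P Y :=
  .of_ae_tendsto (fun n => (hY n).aestronglyMeasurable)
    (ae_of_all _ fun ω => squeeze_zero_norm (fun n => h n ω) hy)

namespace IsPredictiveSystem

variable {mΩ : MeasurableSpace Ω} {P : Measure Ω} [IsProbabilityMeasure P] {ℱ : Filtration ℕ mΩ}
  {𝒢 : ℕ → MeasurableSpace Ω} {R K N C Λ D G : ℕ → Ω → ℝ} {β c u b : ℝ} {ℓ : ℕ → ℝ}

theorem V_nonneg (h : IsPredictiveSystem P ℱ 𝒢 R K N C Λ D G β c u b ℓ) {V : Ω → ℝ}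
    (hV : ∀ᵐ ω ∂P, Tendsto (fun n => D n ω + Λ n ω - G n ω) atTop (𝓝 (V ω))) :
    ∀ᵐ ω ∂P, 0 ≤ V ω := by
  filter_upwards [hV, ae_all_iff.2 h.V_bounds] with ω hω hb
  exact ge_of_tendsto' hω fun n => (hb n).1

/-- The central limit theorem for the distance of the mean to a smoothed predictive mean `B`. -/
theorem tendsto_setIntegral_exp_mean_sub (h : IsPredictiveSystem P ℱ 𝒢 R K N C Λ D G β c u b ℓ)
    {r : ℝ} (hr : Tendsto (fun n => ∫ ω, R n ω ∂P) atTop (𝓝 r))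
    {NN : ℕ → ℕ} (hNN : ∀ n, n ≤ NN n) {θ' : ℝ}
    (hθ : Tendsto (fun n => ∑ k ∈ Finset.range (NN n),
      tailWeight NN n k ^ 2 * factorMoment P R r n k) atTop (𝓝 θ'))
    {V : Ω → ℝ} (hVm : Measurable V)
    (hV : ∀ᵐ ω ∂P, Tendsto (fun n => D n ω + Λ n ω - G n ω) atTop (𝓝 (V ω)))
    {B e : ℕ → Ω → ℝ} (hBm : ∀ n, Measurable (B n)) (hem : ∀ n, Measurable (e n))
    (hB : ∀ n ω, B (n + 1) ω - B n ω = (R n ω * (K n ω - (D n ω + Λ n ω))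
      - β * (N n ω - Λ n ω)) / (totalWeight R (n + 1) ω + c) + e n ω)
    {η : ℕ → ℝ} (hη0 : ∀ n, 0 ≤ η n) (hη : Summable fun n => η n ^ 2)
    (he : ∀ (n : ℕ) ω, |((n : ℝ) + 1) * e n ω| ≤ η n) (hBJ : ∀ n ω, |D n ω + Λ n ω - B n ω| ≤ η n)
    {H : Set Ω} (hH : MeasurableSet H) (t : ℝ) :
    Tendsto (fun n : ℕ => ∫ ω in H, Complex.exp (t * (√n * ((1 / (n : ℝ)) *
        ∑ k ∈ Finset.range n, K k ω - B (NN n) ω) : ℝ) * Complex.I) ∂P) atTop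
      (𝓝 (∫ ω in H, (Real.exp (-(t ^ 2 / 2 * (θ' * V ω))) : ℂ) ∂P)) := by
  have hr0 := h.le_of_tendsto_integral_R hr
  have hκ := h.min_pos
  have hb := h.b_pos
  have hKm := fun n => (h.measurable_K n).mono (h.mid_le' n) le_rfl
  have hNm := fun n => (h.measurable_N n).mono (h.mid_le' n) le_rfl
  have hJm := fun n => (h.measurable_J n).mono (ℱ.le n) le_rfl
  have hRm := fun n => (h.measurable_R n).mono (ℱ.le _) le_rfl
  have hTm := fun n => (h.measurable_totalWeight n).mono (ℱ.le n) le_rfl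
  have hΛm := fun n => (h.measurable_Λ n).mono (ℱ.le n) le_rfl
  have hζm := fun (a : ℝ) n => (h.measurable_centered a n).mono (h.mid_le' n) le_rfl
  have hθ0 : 0 ≤ θ' := ge_of_tendsto' hθ fun n => Finset.sum_nonneg fun k _ =>
    mul_nonneg (sq_nonneg _) (h.factorMoment_bounds hr0 n k).2.1
  set Y' : ℕ → ℕ → Ω → ℝ := fun a n ω => ∑ k ∈ Finset.range (NN n), tailWeight NN n k *
    (centered K D Λ a k ω * ((if k < n then 1 else 0) - R k ω / r)) with hY'
  -- Three remainders: `r₁` from replacing (k+1) over the denominator by 1/r, `r₂` from the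
  -- fluctuation of the number of new dishes, `r₃` from the errors of `B` as a martingale and as a
  -- predictive mean.
  set φ₁ : ℕ → ℝ × ℝ → ℝ := fun k z => z.2 * (1 / r - ((k : ℝ) + 1) / (z.1 + z.2 + c)) with hφ₁
  set φ₂ : ℕ → ℝ × ℝ → ℝ := fun k z => ((k : ℝ) + 1) * β / (z.1 + z.2 + c) with hφ₂
  set r₁ : ℕ → ℕ → Ω → ℝ := fun a n ω => ∑ k ∈ Finset.range (NN n), tailWeight NN n k *
    (centered K D Λ a k ω * φ₁ k (totalWeight R k ω, R k ω)) with hr₁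
  set r₂ : ℕ → Ω → ℝ := fun n ω => ∑ k ∈ Finset.range (NN n), tailWeight NN n k *
    ((N k ω - Λ k ω) * φ₂ k (totalWeight R k ω, R k ω)) with hr₂
  set r₃ : ℕ → Ω → ℝ := fun n ω => ∑ k ∈ Finset.range (NN n), tailWeight NN n k *
    ((if k < n then D k ω + Λ k ω - B k ω else 0) - ((k : ℝ) + 1) * e k ω) with hr₃
  have hφ₁m : ∀ k, Measurable (φ₁ k) := fun k => by fun_prop
  have hφ₂m : ∀ k, Measurable (φ₂ k) := fun k => by fun_prop
  have hr₁m : ∀ a n, Measurable (r₁ a n) := fun a n => Finset.measurable_fun_sum _ fun k _ =>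
    ((hζm a k).mul ((hφ₁m k).comp ((hTm k).prodMk (hRm k)))).const_mul _
  have hr₂m : ∀ n, Measurable (r₂ n) := fun n => Finset.measurable_fun_sum _ fun k _ =>
    (((hNm k).sub (hΛm k)).mul ((hφ₂m k).comp ((hTm k).prodMk (hRm k)))).const_mul _
  have hr₃m : ∀ n, Measurable (r₃ n) := fun n => Finset.measurable_fun_sum _ fun k _ => by
    refine Measurable.const_mul (Measurable.sub ?_ ((hem k).const_mul _)) _
    split_ifs
    · exact (hJm k).sub (hBm k)
    · exact measurable_const
  have hn1 : ∀ k : ℕ, 0 < (k : ℝ) + 1 := fun k => by positivity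
  have hdiv : ∀ (k : ℕ) (x : ℝ), x * ((k : ℝ) + 1) / (min u (u + c) * (k + 1))
      = x / min u (u + c) := fun k x => by
    have := hn1 k
    field_simp
  have hneg₁ : ∀ a : ℕ, NegligibleInProbability P (r₁ a) := fun a => by
    refine h.negligible_weighted_sum hNN (h.measurable_centered a) (h.integrable_centered_sq a)
      (h.condExp_centered a) hφ₁m (B := b * (1 / r + 1 / min u (u + c))) (fun k z hz => ?_)
      (h.tendsto_integral_centered_remainder hr a)
    have h1 := h.abs_div_le hz (le_refl |((k : ℝ) + 1)|)
    have h2 := hdiv k 1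
    rw [one_mul] at h2
    rw [abs_of_pos (hn1 k), h2] at h1
    rw [hφ₁, abs_mul, abs_of_nonneg (h.u_pos.le.trans hz.1)]
    refine mul_le_mul hz.2.1 ((abs_sub _ _).trans ?_) (abs_nonneg _) hb.le
    rw [abs_of_pos (one_div_pos.2 hr0)]
    gcongr
  have hφ₂B : ∀ k, ∀ z ∈ weightRegion c u b k, |φ₂ k z| ≤ |β| / min u (u + c) := fun k z hz => by
    have h1 := h.abs_div_le hz (le_refl |((k : ℝ) + 1) * β|)
    rwa [abs_mul ((k : ℝ) + 1) β, abs_of_pos (hn1 k), mul_comm ((k : ℝ) + 1) |β|, hdiv] at h1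
  have hneg₂ : NegligibleInProbability P r₂ := by
    refine h.negligible_weighted_sum hNN
      (fun n => (h.measurable_N n).sub (h.measurable_mid (h.measurable_Λ n))) h.integrable_sq_N
      h.condExp_N_sub hφ₂m hφ₂B ?_
    -- The new dishes have variance at most `ℓ n`, which tends to zero; hence their noise does not
    -- enter the limit.
    refine squeeze_zero (fun n => integral_nonneg fun ω => sq_nonneg _) (fun n => ?_)
      (by simpa using h.ℓ_tendsto.const_mul ((|β| / min u (u + c)) ^ 2))
    calc _ ≤ ∫ ω, (|β| / min u (u + c)) ^ 2 * (N n ω - Λ n ω) ^ 2 ∂P := by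
          refine integral_mono_of_nonneg (ae_of_all _ fun ω => sq_nonneg _)
            ((h.integrable_sq_N n).const_mul _) (ae_of_all _ fun ω => ?_)
          simp only
          rw [mul_pow, mul_comm]
          refine mul_le_mul_of_nonneg_right ?_ (sq_nonneg _)
          exact (sq_abs _).symm.trans_le
            (pow_le_pow_left₀ (abs_nonneg _) (hφ₂B n _ (h.mem_weightRegion n ω)) 2)
      _ ≤ _ := by
          rw [integral_const_mul]
          exact mul_le_mul_of_nonneg_left (h.integral_sq_N n) (sq_nonneg _)
  have hsqrt : Tendsto (fun n : ℕ => 1 / √(n : ℝ)) atTop (𝓝 0) := by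
    simp_rw [one_div]
    exact (tendsto_inv_atTop_zero.comp Real.tendsto_sqrt_atTop).comp tendsto_natCast_atTop_atTop
  have hneg₃ : NegligibleInProbability P r₃ := by
    -- The martingale errors are deterministic in size and square summable, so no cancellation is
    -- needed for `r₃`.
    have h1 := tendsto_sum_weights_mul_of_summable_sq (tailWeight_nonneg NN) (tailWeight_le NN) hsqrt
      (fun n => sum_range_tailWeight_sq_le (hNN n)) hη0 (tendsto_atTop_mono hNN tendsto_id) hη
    refine .of_deterministic hr₃m (fun n ω => ?_) (by simpa only [mul_zero] using h1.const_mul 2)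
    rw [Finset.mul_sum]
    refine (Finset.abs_sum_le_sum_abs _ _).trans (Finset.sum_le_sum fun k _ => ?_)
    rw [abs_mul, abs_of_nonneg (tailWeight_nonneg _ _ _)]
    have h2 : |(if k < n then D k ω + Λ k ω - B k ω else 0) - ((k : ℝ) + 1) * e k ω| ≤ 2 * η k := by
      refine (abs_sub _ _).trans ?_
      rw [two_mul]
      refine add_le_add ?_ (he k ω)
      split_ifs
      · exact hBJ k ω
      · simpa using hη0 k
    calc _ ≤ tailWeight NN n k * (2 * η k) :=
          mul_le_mul_of_nonneg_left h2 (tailWeight_nonneg _ _ _)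
      _ = _ := by ring
  refine tendsto_setIntegral_exp_of_approx (Y' := Y') (R := fun a n ω => r₁ a n ω + (r₂ n ω + r₃ n ω))
    (v' := fun a => fun ω => θ' * (allLowMeans D Λ (a : ℝ)).indicator V ω)
    (G := fun a : ℕ => allLowMeans D Λ (a : ℝ)) (fun n => ?_)
    (hVm.const_mul θ') ?_ (fun a n => ?_) (fun a n => (hr₁m a n).add ((hr₂m n).add (hr₃m n)))
    (fun a => (hVm.indicator (h.measurableSet_allLowMeans a)).const_mul _) (fun a => ?_)
    (fun a => h.measurableSet_allLowMeans a) h.tendsto_measureReal_compl_allLowMeans (fun a => ?_)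
    (fun a n => ae_of_all _ fun ω hω => ?_) (fun a => ae_of_all _ fun ω hω => ?_) hH t fun a => ?_
  · exact (((Finset.measurable_fun_sum _ fun k _ => hKm k).const_mul _).sub (hBm _)).const_mul _
  · filter_upwards [h.V_nonneg hV] with ω hω using mul_nonneg hθ0 hω
  · exact Finset.measurable_fun_sum _ fun k _ => ((hζm a k).mul
      (measurable_const.sub ((hRm k).div_const r))).const_mul _
  · filter_upwards [h.V_nonneg hV] with ω hω
    exact mul_nonneg hθ0 (Set.indicator_apply_nonneg fun _ => hω)
  · exact .add (fun n => (hr₁m a n).aestronglyMeasurable)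
      (fun n => ((hr₂m n).add (hr₃m n)).aestronglyMeasurable) (hneg₁ a)
      (.add (fun n => (hr₂m n).aestronglyMeasurable) (fun n => (hr₃m n).aestronglyMeasurable)
        hneg₂ hneg₃)
  -- On paths that never exceed the level the cut is inactive, and the decomposition holds summand
  -- by summand after K - B is written as (K - J) + (J - B).
  · rw [sqrt_mul_mean_sub_eq (fun k => K k ω) (fun k => B k ω) (hNN n)]
    simp only [hY', hr₁, hr₂, hr₃]
    rw [← Finset.sum_add_distrib, ← Finset.sum_add_distrib, ← Finset.sum_add_distrib]
    refine Finset.sum_congr rfl fun k _ => ?_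
    have h3 : centered K D Λ a k ω = K k ω - (D k ω + Λ k ω) :=
      Set.indicator_of_mem (allLowMeans_subset _ _ _ _ hω) _
    rw [h3, hB k ω]
    simp only [hφ₁, hφ₂, totalWeight_succ]
    split_ifs <;> ring
  · rw [Set.indicator_of_mem hω]
  · simpa only [mul_assoc] using h.tendsto_setIntegral_exp_leading hr0 hNN hθ hVm hV a hH t

end IsPredictiveSystem

end WeightedIBP

namespace WeightedIBP

variable {Ω : Type*}

theorem centeredGaussian_congr_mul {q r : ℝ} (hr : r ≠ 0) :
    (q - r ^ 2) / r ^ 2 + q / r ^ 2 * 1 = (2 * q - r ^ 2) / r ^ 2 := by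
  field_simp; ring

/-- The series from n on is about 1/n, and cutting it at N ≥ n² costs at most about 1/n², which is
negligible after multiplication by n. -/
theorem tendsto_mul_sum_Ico_one_div_sq {N : ℕ → ℕ} (hN : ∀ n, n ^ 2 ≤ N n) :
    Tendsto (fun n : ℕ => (n : ℝ) * ∑ k ∈ Finset.Ico n (N n), 1 / ((k : ℝ) + 1) ^ 2) atTop
      (𝓝 1) := by
  have hle : ∀ n, n ≤ N n := fun n => (Nat.le_self_pow two_ne_zero n).trans (hN n)
  have h1 : Tendsto (fun n : ℕ => (n : ℝ) / (n + 1) - 1 / ((n : ℝ))) atTop (𝓝 (1 - 0)) :=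
    (tendsto_natCast_div_add_atTop 1).sub tendsto_one_div_atTop_nhds_zero_nat
  rw [sub_zero] at h1
  refine tendsto_of_tendsto_of_tendsto_of_le_of_le' h1 tendsto_const_nhds ?_
    (Eventually.of_forall fun n => sum_Ico_one_div_sq_le n (N n) (hle n))
  filter_upwards [eventually_gt_atTop 0] with n hn
  refine le_trans ?_ (le_sum_Ico_one_div_sq n (N n) (hle n))
  have hn' : (0 : ℝ) < n := by exact_mod_cast hn
  have h2 : (n : ℝ) ^ 2 ≤ N n := by exact_mod_cast hN n
  refine sub_le_sub_left ?_ _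
  rw [div_le_div_iff₀ (by positivity) hn']
  nlinarith

theorem tendsto_setIntegral_exp_of_negligible_sub {mΩ : MeasurableSpace Ω} {P : Measure Ω}
    [IsProbabilityMeasure P] {Y Y' : ℕ → Ω → ℝ} (hY : ∀ n, Measurable (Y n))
    (hY' : ∀ n, Measurable (Y' n)) {v : Ω → ℝ} (hv : Measurable v) (hv0 : ∀ᵐ ω ∂P, 0 ≤ v ω)
    (hYY' : NegligibleInProbability P fun n ω => Y n ω - Y' n ω) {H : Set Ω}
    (hH : MeasurableSet H) (t : ℝ)
    (h : Tendsto (fun n => ∫ ω in H, Complex.exp (t * Y' n ω * Complex.I) ∂P) atTop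
      (𝓝 (∫ ω in H, (Real.exp (-(t ^ 2 / 2 * v ω)) : ℂ) ∂P))) :
    Tendsto (fun n => ∫ ω in H, Complex.exp (t * Y n ω * Complex.I) ∂P) atTop
      (𝓝 (∫ ω in H, (Real.exp (-(t ^ 2 / 2 * v ω)) : ℂ) ∂P)) :=
  tendsto_setIntegral_exp_of_approx hY hv hv0 (Y' := fun _ => Y')
    (R := fun _ n ω => Y n ω - Y' n ω) (v' := fun _ => v) (G := fun _ => Set.univ)
    (fun _ => hY') (fun _ n => (hY n).sub (hY' n)) (fun _ => hv) (fun _ => hv0)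
    (fun _ => MeasurableSet.univ) (by simp) (fun _ => hYY')
    (fun _ n => ae_of_all _ fun ω _ => by ring) (fun _ => ae_of_all _ fun ω _ => rfl) hH t
    fun _ => h

namespace IsPredictiveSystem

variable {mΩ : MeasurableSpace Ω} {P : Measure Ω} [IsProbabilityMeasure P] {ℱ : Filtration ℕ mΩ}
  {𝒢 : ℕ → MeasurableSpace Ω} {R K N C Λ D G : ℕ → Ω → ℝ} {β c u b : ℝ} {ℓ : ℕ → ℝ}

/-- `B` is a predictive mean whose increments are those of a martingale up to terms of order `η`. -/
structure IsSmoothed (R K N Λ D B e : ℕ → Ω → ℝ) (β c : ℝ) (η : ℕ → ℝ) : Prop where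
  sub_eq : ∀ n ω, B (n + 1) ω - B n ω = (R n ω * (K n ω - (D n ω + Λ n ω))
    - β * (N n ω - Λ n ω)) / (totalWeight R (n + 1) ω + c) + e n ω
  η_nonneg : ∀ n, 0 ≤ η n
  η_summable : Summable fun n => η n ^ 2
  η_tendsto : Tendsto (fun n : ℕ => √n * η n) atTop (𝓝 0)
  e_le : ∀ (n : ℕ) ω, |((n : ℝ) + 1) * e n ω| ≤ η n
  sub_le : ∀ n ω, |D n ω + Λ n ω - B n ω| ≤ η n

/-- The case N = n. The conditional expectation may be replaced by `B n`, since they differ by at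
most `η n` almost surely and √n `η n` → 0. -/
theorem stablyConverges_sub_predictive (h : IsPredictiveSystem P ℱ 𝒢 R K N C Λ D G β c u b ℓ)
    {r q : ℝ} (hr : Tendsto (fun n => ∫ ω, R n ω ∂P) atTop (𝓝 r))
    (hq : Tendsto (fun n => ∫ ω, R n ω ^ 2 ∂P) atTop (𝓝 q)) {V : Ω → ℝ} (hVm : Measurable V)
    (hV : ∀ᵐ ω ∂P, Tendsto (fun n => D n ω + Λ n ω - G n ω) atTop (𝓝 (V ω)))
    {B e : ℕ → Ω → ℝ} (hBm : ∀ n, Measurable (B n)) (hem : ∀ n, Measurable (e n)) {η : ℕ → ℝ}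
    (hB : IsSmoothed R K N Λ D B e β c η) {E : ℕ → Ω → ℝ} (hEm : ∀ n, Measurable (E n))
    (hE : ∀ n, E n =ᵐ[P] fun ω => D n ω + Λ n ω) :
    StablyConverges P (fun n ω => √n * ((1 / (n : ℝ)) * ∑ k ∈ Finset.range n, K k ω - E n ω))
      (centeredGaussian fun ω => (q - r ^ 2) / r ^ 2 * V ω) := by
  have hKm := fun n => (h.measurable_K n).mono (h.mid_le' n) le_rfl
  have hr0 := h.le_of_tendsto_integral_R hr
  -- The second range of summation is empty, so the variance factor is (q - r²)/r² alone.
  have hθ := h.tendsto_sum_factorMoment hr hq (NN := id) (fun n => le_rfl) (L := 0) (by simp)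
  rw [mul_zero, add_zero] at hθ
  have hθ0 := ge_of_tendsto' hθ fun n => Finset.sum_nonneg fun k _ =>
    mul_nonneg (sq_nonneg (tailWeight id n k)) (h.factorMoment_bounds hr0 n k).2.1
  have hm : ∀ {E : ℕ → Ω → ℝ}, (∀ n, Measurable (E n)) → ∀ n : ℕ, Measurable fun ω =>
      √n * ((1 / (n : ℝ)) * ∑ k ∈ Finset.range n, K k ω - E n ω) := fun hE n =>
    (((Finset.measurable_fun_sum _ fun k _ => hKm k).const_mul _).sub (hE n)).const_mul _
  have hv0 : ∀ᵐ ω ∂P, 0 ≤ (q - r ^ 2) / r ^ 2 * V ω := by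
    filter_upwards [h.V_nonneg hV] with ω hω using mul_nonneg hθ0 hω
  refine stablyConverges_centeredGaussian (hm hEm) (hVm.const_mul _) hv0 fun H hH t => ?_
  have hlim := h.tendsto_setIntegral_exp_mean_sub hr (NN := id) (fun n => le_rfl) hθ hVm hV
    hBm hem hB.sub_eq hB.η_nonneg hB.η_summable hB.e_le hB.sub_le hH t
  refine tendsto_setIntegral_exp_of_negligible_sub (hm hEm) (hm hBm) (hVm.const_mul _) hv0 ?_ hH t
    (by simpa using hlim)
  refine .of_ae_tendsto (fun n => ((hm hEm n).sub (hm hBm n)).aestronglyMeasurable) ?_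
  filter_upwards [ae_all_iff.2 hE] with ω hω
  refine squeeze_zero_norm (fun n => ?_) hB.η_tendsto
  have h1 : √(n : ℝ) * ((1 / (n : ℝ)) * ∑ k ∈ Finset.range n, K k ω - E n ω)
      - √n * ((1 / (n : ℝ)) * ∑ k ∈ Finset.range n, K k ω - B n ω)
      = √n * -(D n ω + Λ n ω - B n ω) := by rw [hω n]; ring
  rw [h1, norm_mul, norm_neg, Real.norm_of_nonneg (Real.sqrt_nonneg _)]
  exact mul_le_mul_of_nonneg_left (hB.sub_le n ω) (Real.sqrt_nonneg _)

/-- The limit Z need not be known at any finite time; it is approximated by `B` at a time so late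
that the error is small even after multiplication by √n. No rate of convergence of `B` is required.
-/
theorem stablyConverges_sub_limit (h : IsPredictiveSystem P ℱ 𝒢 R K N C Λ D G β c u b ℓ)
    {r q : ℝ} (hr : Tendsto (fun n => ∫ ω, R n ω ∂P) atTop (𝓝 r))
    (hq : Tendsto (fun n => ∫ ω, R n ω ^ 2 ∂P) atTop (𝓝 q)) {Z V : Ω → ℝ} (hZm : Measurable Z)
    (hVm : Measurable V)
    (hZ : ∀ᵐ ω ∂P, Tendsto (fun n => D n ω + Λ n ω) atTop (𝓝 (Z ω)))
    (hV : ∀ᵐ ω ∂P, Tendsto (fun n => D n ω + Λ n ω - G n ω) atTop (𝓝 (V ω)))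
    {B e : ℕ → Ω → ℝ} (hBm : ∀ n, Measurable (B n)) (hem : ∀ n, Measurable (e n)) {η : ℕ → ℝ}
    (hB : IsSmoothed R K N Λ D B e β c η) :
    StablyConverges P (fun n ω => √n * ((1 / (n : ℝ)) * ∑ k ∈ Finset.range n, K k ω - Z ω))
      (centeredGaussian fun ω => (2 * q - r ^ 2) / r ^ 2 * V ω) := by
  have hKm := fun n => (h.measurable_K n).mono (h.mid_le' n) le_rfl
  have hr0 := h.le_of_tendsto_integral_R hr
  have hη0 : Tendsto η atTop (𝓝 0) := by
    have h1 := hB.η_summable.tendsto_atTop_zero.sqrt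
    simp_rw [Real.sqrt_sq (hB.η_nonneg _)] at h1
    simpa using h1
  have hBZ : ∀ᵐ ω ∂P, Tendsto (fun n => B n ω) atTop (𝓝 (Z ω)) := by
    filter_upwards [hZ] with ω hω
    have h1 : Tendsto (fun n => D n ω + Λ n ω - B n ω) atTop (𝓝 0) :=
      squeeze_zero_norm (fun n => hB.sub_le n ω) hη0
    simpa using hω.sub h1
  -- The time is also at least m², which makes the squared weights of the second range have mass
  -- tending to 1.
  have hnegm : ∀ m : ℕ, ∃ k, m ^ 2 ≤ k ∧ ∫ ω, min 1 |√m * (B k ω - Z ω)| ∂P < 1 / ((m : ℝ) + 1) := by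
    intro m
    have h1 : NegligibleInProbability P fun k ω => √m * (B k ω - Z ω) := by
      refine .of_ae_tendsto (fun k => (((hBm k).sub hZm).const_mul _).aestronglyMeasurable) ?_
      filter_upwards [hBZ] with ω hω
      simpa using (hω.sub_const (Z ω)).const_mul √(m : ℝ)
    have h2 := (h1.eventually (gt_mem_nhds (show (0 : ℝ) < 1 / ((m : ℝ) + 1) by positivity))).and
      (eventually_ge_atTop (m ^ 2))
    obtain ⟨k, hk⟩ := h2.exists
    exact ⟨k, hk.2, hk.1⟩
  choose NN hNN2 hNN using hnegm
  have hle : ∀ n, n ≤ NN n := fun n => (Nat.le_self_pow two_ne_zero n).trans (hNN2 n)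
  have hθ := h.tendsto_sum_factorMoment hr hq hle (tendsto_mul_sum_Ico_one_div_sq hNN2)
  rw [centeredGaussian_congr_mul hr0.ne'] at hθ
  have hθ0 := ge_of_tendsto' hθ fun n => Finset.sum_nonneg fun k _ =>
    mul_nonneg (sq_nonneg (tailWeight NN n k)) (h.factorMoment_bounds hr0 n k).2.1
  have hm : ∀ {E : ℕ → Ω → ℝ}, (∀ n, Measurable (E n)) → ∀ n : ℕ, Measurable fun ω =>
      √n * ((1 / (n : ℝ)) * ∑ k ∈ Finset.range n, K k ω - E n ω) := fun hE n =>
    (((Finset.measurable_fun_sum _ fun k _ => hKm k).const_mul _).sub (hE n)).const_mul _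
  have hv0 : ∀ᵐ ω ∂P, 0 ≤ (2 * q - r ^ 2) / r ^ 2 * V ω := by
    filter_upwards [h.V_nonneg hV] with ω hω using mul_nonneg hθ0 hω
  refine stablyConverges_centeredGaussian (hm fun _ => hZm) (hVm.const_mul _) hv0 fun H hH t => ?_
  have hlim := h.tendsto_setIntegral_exp_mean_sub hr hle hθ hVm hV
    hBm hem hB.sub_eq hB.η_nonneg hB.η_summable hB.e_le hB.sub_le hH t
  refine tendsto_setIntegral_exp_of_negligible_sub (hm fun _ => hZm) (hm fun n => hBm (NN n))
    (hVm.const_mul _) hv0 ?_ hH t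
    (by simpa using hlim)
  refine squeeze_zero (fun n => integral_nonneg fun ω => le_min zero_le_one (abs_nonneg _))
    (fun n => ?_) tendsto_one_div_add_atTop_nhds_zero_nat
  refine le_trans (le_of_eq ?_) (hNN n).le
  refine integral_congr_ae (ae_of_all _ fun ω => ?_)
  simp only
  congr 2
  ring

end IsPredictiveSystem

end WeightedIBP

namespace WeightedIBP

/-! ### The rate of new dishes -/

/-- Log-convexity: x + s and y are convex combinations of x and y + s with interchanged weights, and
multiplying the two inequalities restores exponent one. It makes the rate of new dishes decrease in
the total weight. -/
theorem Gamma_add_mul_Gamma_le {x y s : ℝ} (hx : 0 < x) (hxy : x ≤ y) (hs : 0 < s) :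
    Real.Gamma (x + s) * Real.Gamma y ≤ Real.Gamma x * Real.Gamma (y + s) := by
  rcases hxy.eq_or_lt with rfl | hxy
  · rw [mul_comm]
  have hL : 0 < y + s - x := by linarith
  have hy : 0 < y + s := by linarith
  set a := (y - x) / (y + s - x) with ha
  set b := s / (y + s - x) with hb
  have ha0 : 0 < a := div_pos (by linarith) hL
  have hb0 : 0 < b := div_pos hs hL
  have hab : a + b = 1 := by rw [ha, hb, ← add_div, div_eq_one_iff_eq hL.ne']; ring
  have h1 := Real.Gamma_mul_add_mul_le_rpow_Gamma_mul_rpow_Gamma hx hy ha0 hb0 hab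
  have h2 := Real.Gamma_mul_add_mul_le_rpow_Gamma_mul_rpow_Gamma hx hy hb0 ha0
    (by rw [add_comm, hab])
  have e1 : a * x + b * (y + s) = x + s := by rw [ha, hb]; field_simp; ring
  have e2 : b * x + a * (y + s) = y := by rw [ha, hb]; field_simp; ring
  rw [e1] at h1
  rw [e2] at h2
  have hΓx := Real.Gamma_pos_of_pos hx
  have hΓy := Real.Gamma_pos_of_pos hy
  calc _ ≤ (Real.Gamma x ^ a * Real.Gamma (y + s) ^ b) * (Real.Gamma x ^ b * Real.Gamma (y + s) ^ a) :=
        mul_le_mul h1 h2 (Real.Gamma_pos_of_pos (hx.trans hxy)).le (by positivity)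
    _ = (Real.Gamma x ^ a * Real.Gamma x ^ b) * (Real.Gamma (y + s) ^ a * Real.Gamma (y + s) ^ b) := by
        ring
    _ = _ := by
        rw [← Real.rpow_add hΓx, ← Real.rpow_add hΓy, hab, Real.rpow_one, Real.rpow_one]

/-- The left side is Γ(x+1), and x + 1 is interpolated between x + 1 - β and x + 2 - β by
log-convexity. -/
theorem mul_Gamma_le {x β : ℝ} (hx : 0 < x) (hβ0 : 0 ≤ β) (hβ1 : β < 1) :
    x * Real.Gamma x ≤ (x + 1) ^ β * Real.Gamma (x + 1 - β) := by
  have hy : 0 < x + 1 - β := by linarith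
  have hΓ := Real.Gamma_pos_of_pos hy
  rw [← Real.Gamma_add_one hx.ne']
  rcases hβ0.eq_or_lt with rfl | hβ0
  · simp
  have h1 := Real.Gamma_mul_add_mul_le_rpow_Gamma_mul_rpow_Gamma hy (by linarith : 0 < x + 1 - β + 1)
    (sub_pos.2 hβ1) hβ0 (by ring)
  rw [show (1 - β) * (x + 1 - β) + β * (x + 1 - β + 1) = x + 1 by ring,
    Real.Gamma_add_one hy.ne', Real.mul_rpow hy.le hΓ.le, mul_left_comm, ← Real.rpow_add hΓ,
    sub_add_cancel, Real.rpow_one] at h1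
  refine h1.trans (mul_le_mul_of_nonneg_right ?_ hΓ.le)
  exact Real.rpow_le_rpow hy.le (by linarith) hβ0.le

/-- Log-convex interpolation between x and x + 1. -/
theorem Gamma_add_le {x s : ℝ} (hx : 0 < x) (hs0 : 0 < s) (hs1 : s ≤ 1) :
    Real.Gamma (x + s) ≤ x ^ s * Real.Gamma x := by
  have hΓ := Real.Gamma_pos_of_pos hx
  rcases hs1.eq_or_lt with rfl | hs1
  · rw [Real.Gamma_add_one hx.ne', Real.rpow_one]
  have h1 := Real.Gamma_mul_add_mul_le_rpow_Gamma_mul_rpow_Gamma hx (by linarith : 0 < x + 1)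
    (sub_pos.2 hs1) hs0 (by ring)
  rwa [show (1 - s) * x + s * (x + 1) = x + s by ring, Real.Gamma_add_one hx.ne',
    Real.mul_rpow hx.le hΓ.le, mul_left_comm, ← Real.rpow_add hΓ, sub_add_cancel,
    Real.rpow_one] at h1

/-- The rate of new dishes as a function of the total weight. -/
def rateOf (α β c T : ℝ) : ℝ :=
  α * (Real.Gamma (c + 1) * Real.Gamma (c + β + T)) /
    (Real.Gamma (c + β) * Real.Gamma (c + 1 + T))

theorem newRate_eq {Ω : Type*} (α β c : ℝ) (R : ℕ → Ω → ℝ) (n : ℕ) (ω : Ω) :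
    newRate α β c R n ω = rateOf α β c (totalWeight R n ω) := rfl

section Rate

variable {α β c : ℝ}

theorem rateOf_eq (T : ℝ) : rateOf α β c T = α * Real.Gamma (c + 1) / Real.Gamma (c + β) *
    (Real.Gamma (c + β + T) / Real.Gamma (c + 1 + T)) := by
  rw [rateOf]; ring

theorem rate_const_pos (hα : 0 < α) (hβ : β < 1) (hc : -β < c) :
    0 < α * Real.Gamma (c + 1) / Real.Gamma (c + β) :=
  div_pos (mul_pos hα (Real.Gamma_pos_of_pos (by linarith))) (Real.Gamma_pos_of_pos (by linarith))

theorem rateOf_pos (hα : 0 < α) (hβ : β < 1) (hc : -β < c) {T : ℝ} (hT : 0 ≤ T) :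
    0 < rateOf α β c T := by
  rw [rateOf_eq]
  exact mul_pos (rate_const_pos hα hβ hc) (div_pos (Real.Gamma_pos_of_pos (by linarith))
    (Real.Gamma_pos_of_pos (by linarith)))

theorem rateOf_anti (hα : 0 < α) (hβ : β < 1) (hc : -β < c) {T T' : ℝ} (hT : 0 ≤ T) (h : T ≤ T') :
    rateOf α β c T' ≤ rateOf α β c T := by
  rw [rateOf_eq, rateOf_eq]
  refine mul_le_mul_of_nonneg_left ?_ (rate_const_pos hα hβ hc).le
  rw [div_le_div_iff₀ (Real.Gamma_pos_of_pos (by linarith)) (Real.Gamma_pos_of_pos (by linarith))]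
  have h1 := Gamma_add_mul_Gamma_le (x := c + β + T) (y := c + β + T') (s := 1 - β) (by linarith)
    (by linarith) (by linarith)
  rw [show c + β + T + (1 - β) = c + 1 + T by ring,
    show c + β + T' + (1 - β) = c + 1 + T' by ring] at h1
  linarith

/-- The functional equation of the Gamma function. For unit weights this recursion makes the
predictive mean an exact martingale. -/
theorem rateOf_add_one (hβ : β < 1) (hc : -β < c) {T : ℝ} (hT : 0 ≤ T) :
    (c + 1 + T) * rateOf α β c (T + 1) = (c + β + T) * rateOf α β c T := by
  have h1 : 0 < c + β + T := by linarith
  have h2 : 0 < c + 1 + T := by linarith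
  rw [rateOf_eq, rateOf_eq, ← add_assoc, ← add_assoc, Real.Gamma_add_one h1.ne',
    Real.Gamma_add_one h2.ne']
  have := Real.Gamma_pos_of_pos h2
  field_simp

/-- Gamma is continuous away from its poles; clamping the argument at zero yields a function
continuous on the whole line, from which measurability of the random rate follows. -/
theorem continuous_rateOf_max (hβ : β < 1) (hc : -β < c) :
    Continuous fun T => rateOf α β c (max 0 T) := by
  have h : ∀ x : ℝ, 0 < x → Continuous fun T : ℝ => Real.Gamma (x + max 0 T) := fun x hx => by
    refine continuous_iff_continuousAt.2 fun T => ?_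
    have h0 : 0 < x + max 0 T := add_pos_of_pos_of_nonneg hx (le_max_left _ _)
    refine ContinuousAt.comp (g := Real.Gamma) (f := fun T : ℝ => x + max 0 T)
      (Real.differentiableAt_Gamma fun m hm => ?_).continuousAt (by fun_prop)
    have : (0 : ℝ) ≤ m := m.cast_nonneg
    linarith
  have h1 := h (c + β) (by linarith)
  have h2 := h (c + 1) (by linarith)
  refine ((h1.const_mul _).const_mul α).div (h2.const_mul _) fun T => ?_
  have h3 := le_max_left 0 T
  exact (mul_pos (Real.Gamma_pos_of_pos (by linarith)) (Real.Gamma_pos_of_pos (by linarith))).ne'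

theorem rateOf_le_rpow (hα : 0 < α) (hβ : β < 1) (hc : -β < c) {T : ℝ} (hT : 0 ≤ T)
    (hT1 : 1 ≤ c + β + T) :
    rateOf α β c T ≤ α * Real.Gamma (c + 1) / Real.Gamma (c + β) *
      ((c + β + T + 1) ^ max β 0 / (c + β + T)) := by
  rw [rateOf_eq]
  refine mul_le_mul_of_nonneg_left ?_ (rate_const_pos hα hβ hc).le
  have hx : 0 < c + β + T := by linarith
  have h1 := mul_Gamma_le hx (le_max_right β 0) (max_lt hβ one_pos)
  have h2 : Real.Gamma (c + β + T + 1 - max β 0) ≤ Real.Gamma (c + 1 + T) := by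
    rcases le_total 0 β with h | h
    · rw [max_eq_left h]; apply le_of_eq; congr 1; ring
    · rw [max_eq_right h]
      -- The monotonicity used holds from 2 on, and both arguments are at least 2 by `hT1`.
      refine Real.Gamma_strictMonoOn_Ici.monotoneOn ?_ ?_ (by linarith) <;>
      · rw [Set.mem_Ici]; linarith
  have h3 := Real.Gamma_pos_of_pos (by linarith : 0 < c + 1 + T)
  rw [div_le_div_iff₀ h3 hx, mul_comm]
  refine h1.trans ?_
  gcongr

/-- The lower bound of order 1/T makes the rates non-summable, so that for β ≥ 0 some dish is
eventually tried. -/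
theorem inv_le_rateOf (hα : 0 < α) (hβ : β < 1) (hβ0 : 0 ≤ β) (hc : -β < c) {T : ℝ} (hT : 0 ≤ T)
    (hT1 : 1 ≤ c + β + T) :
    α * Real.Gamma (c + 1) / Real.Gamma (c + β) * (1 / (c + β + T)) ≤ rateOf α β c T := by
  rw [rateOf_eq]
  refine mul_le_mul_of_nonneg_left ?_ (rate_const_pos hα hβ hc).le
  have hx : 0 < c + β + T := by linarith
  have h1 := Gamma_add_le hx (sub_pos.2 hβ) (by linarith : 1 - β ≤ 1)
  rw [show c + β + T + (1 - β) = c + 1 + T by ring] at h1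
  rw [div_le_div_iff₀ hx (Real.Gamma_pos_of_pos (by linarith)), one_mul, mul_comm]
  refine h1.trans (mul_le_mul_of_nonneg_right ?_ (Real.Gamma_pos_of_pos hx).le)
  calc (c + β + T) ^ (1 - β) ≤ (c + β + T) ^ (1 : ℝ) :=
        Real.rpow_le_rpow_of_exponent_le hT1 (by linarith)
    _ = _ := Real.rpow_one _

variable {u : ℝ}

theorem rateOf_isBigO (hα : 0 < α) (hβ : β < 1) (hc : -β < c) (hu : 0 < u) :
    (fun n : ℕ => rateOf α β c (u * n)) =O[atTop]
      fun n : ℕ => ((n : ℝ) + 1) ^ (max β 0 - 1) := by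
  set a := min (c + β) u with ha
  have ha0 : 0 < a := lt_min (by linarith) hu
  set A := c + β + u + 1 with hA
  refine Asymptotics.IsBigO.of_bound (α * Real.Gamma (c + 1) / Real.Gamma (c + β) *
    (A ^ max β 0 / a)) ?_
  have h1 : ∀ᶠ n : ℕ in atTop, 1 ≤ c + β + u * n := by
    have : Tendsto (fun n : ℕ => c + β + u * n) atTop atTop :=
      tendsto_atTop_add_const_left _ _ (tendsto_natCast_atTop_atTop.const_mul_atTop hu)
    exact this.eventually_ge_atTop 1
  filter_upwards [h1] with n hn
  have hn0 : (0 : ℝ) ≤ n := n.cast_nonneg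
  have hun : 0 ≤ u * n := by positivity
  rw [Real.norm_of_nonneg (rateOf_pos hα hβ hc hun).le, Real.norm_of_nonneg (by positivity),
    mul_assoc]
  refine (rateOf_le_rpow hα hβ hc hun hn).trans
    (mul_le_mul_of_nonneg_left ?_ (rate_const_pos hα hβ hc).le)
  have h2 : a * (n + 1) ≤ c + β + u * n := by
    have h3 : a * n ≤ u * n := mul_le_mul_of_nonneg_right (min_le_right _ _) hn0
    have h4 : a ≤ c + β := min_le_left _ _
    linarith
  have h5 : c + β + u * n + 1 ≤ A * (n + 1) := by
    have : 0 < c + β := by linarith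
    nlinarith
  have hA0 : 0 ≤ A := by rw [hA]; linarith
  calc (c + β + u * n + 1) ^ max β 0 / (c + β + u * n)
      ≤ (A * (n + 1)) ^ max β 0 / (a * (n + 1)) := by
        gcongr
    _ = A ^ max β 0 / a * ((n : ℝ) + 1) ^ (max β 0 - 1) := by
        rw [Real.mul_rpow hA0 (by positivity), Real.rpow_sub_one (by positivity)]
        field_simp

theorem tendsto_add_one_rpow {p : ℝ} (hp : p < 0) :
    Tendsto (fun n : ℕ => ((n : ℝ) + 1) ^ p) atTop (𝓝 0) := by
  have h1 := tendsto_rpow_neg_atTop (neg_pos.2 hp)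
  rw [neg_neg] at h1
  exact h1.comp (tendsto_atTop_add_const_right _ _ tendsto_natCast_atTop_atTop)

theorem summable_add_one_rpow {p : ℝ} (hp : p < -1) :
    Summable fun n : ℕ => ((n : ℝ) + 1) ^ p := by
  have h1 := (summable_nat_add_iff 1).2 (Real.summable_nat_rpow.2 hp)
  simpa using h1

theorem tendsto_rateOf (hα : 0 < α) (hβ : β < 1) (hc : -β < c) (hu : 0 < u) :
    Tendsto (fun n : ℕ => rateOf α β c (u * n)) atTop (𝓝 0) :=
  (rateOf_isBigO hα hβ hc hu).trans_tendsto
    (tendsto_add_one_rpow (sub_neg.2 (max_lt hβ one_pos)))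

theorem summable_rateOf_div (hα : 0 < α) (hβ : β < 1) (hc : -β < c) (hu : 0 < u) :
    Summable fun n : ℕ => rateOf α β c (u * n) / (n + 1) := by
  refine summable_of_isBigO_nat (g := fun n : ℕ => ((n : ℝ) + 1) ^ (max β 0 - 1 - 1))
    (summable_add_one_rpow (by linarith [max_lt hβ one_pos])) ?_
  refine ((rateOf_isBigO hα hβ hc hu).mul
    (Asymptotics.isBigO_refl (fun n : ℕ => ((n : ℝ) + 1)⁻¹) atTop)).congr_right fun n => ?_
  rw [Real.rpow_sub_one (by positivity) (max β 0 - 1), div_eq_mul_inv]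

/-- The squares decay like n to the power 2(max(β,0) - 1), which is below -1 since β < 1/2. This and
the next lemma are where that assumption is needed. -/
theorem summable_rateOf_sq (hα : 0 < α) (hβ : β < 1 / 2) (hc : -β < c) (hu : 0 < u) :
    Summable fun n : ℕ => rateOf α β c (u * n) ^ 2 := by
  have h1 : max β 0 < 1 / 2 := max_lt hβ (by norm_num)
  refine summable_of_isBigO_nat (g := fun n : ℕ => ((n : ℝ) + 1) ^ ((max β 0 - 1) * 2))
    (summable_add_one_rpow (by linarith)) ?_
  refine ((rateOf_isBigO hα (by linarith) hc hu).pow 2).congr_right fun n => ?_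
  rw [Real.rpow_mul (by positivity)]
  norm_cast

theorem tendsto_sqrt_mul_rateOf (hα : 0 < α) (hβ : β < 1 / 2) (hc : -β < c) (hu : 0 < u) :
    Tendsto (fun n : ℕ => √n * rateOf α β c (u * n)) atTop (𝓝 0) := by
  have h1 : max β 0 < 1 / 2 := max_lt hβ (by norm_num)
  refine Asymptotics.IsBigO.trans_tendsto (g'' := fun n : ℕ => ((n : ℝ) + 1) ^ (max β 0 - 1 / 2)) ?_
    (tendsto_add_one_rpow (by linarith))
  have h2 : (fun n : ℕ => √(n : ℝ)) =O[atTop] fun n : ℕ => ((n : ℝ) + 1) ^ (1 / 2 : ℝ) := by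
    refine Asymptotics.IsBigO.of_bound 1 (Eventually.of_forall fun n => ?_)
    rw [Real.norm_of_nonneg (Real.sqrt_nonneg _), Real.norm_of_nonneg (by positivity), one_mul,
      ← Real.sqrt_eq_rpow]
    exact Real.sqrt_le_sqrt (by linarith)
  refine (h2.mul (rateOf_isBigO hα (by linarith) hc hu)).congr_right fun n => ?_
  rw [← Real.rpow_add (by positivity)]
  congr 1
  ring

end Rate

end WeightedIBP

namespace WeightedIBP

/-! ### Sums of unit point masses -/

section Simple

variable {X : Type*} [MeasurableSpace X] [MeasurableSingletonClass X] {μ : Measure X}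

theorem IsSimple.singleton_eq (h : IsSimple μ) (x : X) : μ {x} = 0 ∨ μ {x} = 1 := by
  by_cases hx : μ {x} = 1
  · exact Or.inr hx
  · refine Or.inl (measure_mono_null (t := {x | ¬ μ {x} = 1}) ?_ (ae_iff.1 h.2))
    rintro y rfl
    exact hx

theorem IsSimple.real_singleton_eq (h : IsSimple μ) (x : X) :
    μ.real {x} = 0 ∨ μ.real {x} = 1 := by
  rcases h.singleton_eq x with hx | hx <;> simp [Measure.real, hx]

theorem IsSimple.finite_points (h : IsSimple μ) : {x | μ {x} = 1}.Finite := by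
  have := h.1
  by_contra hinf
  have h1 : ∀ n : ℕ, (n : ℝ≥0∞) ≤ μ Set.univ := fun n => by
    obtain ⟨F, hF, hn⟩ := Set.Infinite.exists_subset_card_eq hinf n
    calc (n : ℝ≥0∞) = ∑ x ∈ F, μ {x} := by
          rw [Finset.sum_congr rfl fun x hx => hF hx]
          simp [hn]
      _ = μ F := sum_measure_singleton
      _ ≤ μ Set.univ := measure_mono (Set.subset_univ _)
  obtain ⟨n, hn⟩ := ENNReal.exists_nat_gt (measure_ne_top μ Set.univ)
  exact absurd (h1 n) (not_le.2 hn)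

theorem IsSimple.restrict_eq (h : IsSimple μ) {F : Finset X} (hF : ∀ x, μ {x} = 1 → x ∈ F) :
    μ.restrict F = μ := by
  refine Measure.restrict_eq_self_of_ae_mem ?_
  filter_upwards [h.2] with x hx using hF x hx

theorem IsSimple.lintegral_eq (h : IsSimple μ) {F : Finset X} (hF : ∀ x, μ {x} = 1 → x ∈ F)
    (φ : X → ℝ≥0∞) : ∫⁻ x, φ x ∂μ = ∑ x ∈ F, φ x * μ {x} := by
  rw [← lintegral_finset, h.restrict_eq hF]

theorem IsSimple.real_eq_sum (h : IsSimple μ) {F : Finset X} (hF : ∀ x, μ {x} = 1 → x ∈ F)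
    (A : Set X) [DecidablePred (· ∈ A)] (hA : MeasurableSet A) :
    μ.real A = ∑ x ∈ F with x ∈ A, μ.real {x} := by
  have := h.1
  have h1 : μ A = ∑ x ∈ F with x ∈ A, μ {x} := by
    rw [← lintegral_indicator_one hA, h.lintegral_eq hF, Finset.sum_filter]
    refine Finset.sum_congr rfl fun x _ => ?_
    by_cases hx : x ∈ A <;> simp [hx]
  rw [Measure.real, h1, ENNReal.toReal_sum fun x _ => measure_ne_top _ _]
  rfl

end Simple

/-! ### The dishes tried along a fixed realization -/

section Realization

variable {Ω X : Type*} [MeasurableSpace X]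

theorem tried_zero (M : ℕ → Ω → Measure X) (ω : Ω) : tried M 0 ω = ∅ := by simp [tried]

theorem tried_succ (M : ℕ → Ω → Measure X) (n : ℕ) (ω : Ω) :
    tried M (n + 1) ω = tried M n ω ∪ {x | M n ω {x} = 1} := by
  ext x
  simp only [tried, Set.mem_ofPred_eq, Set.mem_union]
  constructor
  · rintro ⟨i, hi, h⟩
    rcases Nat.lt_succ_iff_lt_or_eq.1 hi with hi | rfl
    · exact Or.inl ⟨i, hi, h⟩
    · exact Or.inr h
  · rintro (⟨i, hi, h⟩ | h)
    · exact ⟨i, hi.trans n.lt_succ_self, h⟩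
    · exact ⟨n, n.lt_succ_self, h⟩

theorem tried_mono (M : ℕ → Ω → Measure X) (ω : Ω) {n k : ℕ} (h : n ≤ k) :
    tried M n ω ⊆ tried M k ω := fun _ ⟨i, hi, hx⟩ => ⟨i, hi.trans_le h, hx⟩

/-- The total weight of the customers among the first `n` that tried the dish `x`. -/
def dishWeight (M : ℕ → Ω → Measure X) (R : ℕ → Ω → ℝ) (n : ℕ) (ω : Ω) (x : X) : ℝ :=
  ∑ i ∈ Finset.range n, R i ω * (M i ω).real {x}

theorem inclusionProb_eq (β c : ℝ) (M : ℕ → Ω → Measure X) (R : ℕ → Ω → ℝ) (n : ℕ) (ω : Ω) (x : X) :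
    inclusionProb β c M R n ω x = (dishWeight M R n ω x - β) / (totalWeight R n ω + c) := rfl

theorem dishWeight_succ (M : ℕ → Ω → Measure X) (R : ℕ → Ω → ℝ) (n : ℕ) (ω : Ω) (x : X) :
    dishWeight M R (n + 1) ω x = dishWeight M R n ω x + R n ω * (M n ω).real {x} :=
  Finset.sum_range_succ _ _

variable [MeasurableSingletonClass X] {M : ℕ → Ω → Measure X} {R : ℕ → Ω → ℝ} {β c u : ℝ} {n : ℕ}
  {ω : Ω}

theorem finite_tried (h : ∀ i < n, IsSimple (M i ω)) : (tried M n ω).Finite := by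
  induction n with
  | zero => simp [tried_zero]
  | succ n ih =>
    rw [tried_succ]
    exact (ih fun i hi => h i (hi.trans n.lt_succ_self)).union (h n n.lt_succ_self).finite_points

theorem real_singleton_eq_zero (h : ∀ i < n, IsSimple (M i ω)) {x : X} (hx : x ∉ tried M n ω) {i : ℕ}
    (hi : i < n) : (M i ω).real {x} = 0 := by
  rcases (h i hi).singleton_eq x with h0 | h1
  · simp [Measure.real, h0]
  · exact absurd ⟨i, hi, h1⟩ hx

theorem dishWeight_eq_zero (h : ∀ i < n, IsSimple (M i ω)) {x : X} (hx : x ∉ tried M n ω) :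
    dishWeight M R n ω x = 0 :=
  Finset.sum_eq_zero fun i hi => by
    rw [real_singleton_eq_zero h hx (Finset.mem_range.1 hi), mul_zero]

theorem le_dishWeight (hu : 0 < u) (hR : ∀ i, u ≤ R i ω) (h : ∀ i < n, IsSimple (M i ω)) {x : X} (hx : x ∈ tried M n ω) :
    u ≤ dishWeight M R n ω x := by
  obtain ⟨i, hi, hx⟩ := hx
  have h1 : R i ω * (M i ω).real {x} = R i ω := by simp [Measure.real, hx]
  calc u ≤ R i ω * (M i ω).real {x} := by rw [h1]; exact hR i
    _ ≤ dishWeight M R n ω x := Finset.single_le_sum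
        (f := fun i => R i ω * (M i ω).real {x})
        (fun j _ => mul_nonneg (hu.le.trans (hR j)) measureReal_nonneg) (Finset.mem_range.2 hi)

theorem dishWeight_le (hu : 0 < u) (hR : ∀ i, u ≤ R i ω) (h : ∀ i < n, IsSimple (M i ω)) (x : X) :
    dishWeight M R n ω x ≤ totalWeight R n ω := by
  refine Finset.sum_le_sum fun i hi => ?_
  have h0 := hu.le.trans (hR i)
  rcases (h i (Finset.mem_range.1 hi)).real_singleton_eq x with hx | hx <;> simp [hx, h0]

theorem totalWeight_nonneg (hu : 0 < u) (hR : ∀ i, u ≤ R i ω) : 0 ≤ totalWeight R n ω :=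
  Finset.sum_nonneg fun i _ => hu.le.trans (hR i)

theorem totalWeight_add_pos (hu : 0 < u) (hβu : β < u) (hc : -β < c) (hR : ∀ i, u ≤ R i ω)
    (hn : (tried M n ω).Nonempty) : 0 < totalWeight R n ω + c := by
  obtain ⟨x, i, hi, -⟩ := hn
  have h1 : R i ω ≤ totalWeight R n ω := Finset.single_le_sum (f := fun i => R i ω)
    (fun j _ => hu.le.trans (hR j)) (Finset.mem_range.2 hi)
  linarith [hR i]

/-- A tried dish carries weight at least u > β and at most the total weight, and c > -β. That some
dish has been tried also guarantees a positive denominator. -/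
theorem inclusionProb_bounds (hu : 0 < u) (hβu : β < u) (hc : -β < c) (hR : ∀ i, u ≤ R i ω)
    (h : ∀ i < n, IsSimple (M i ω)) {x : X} (hx : x ∈ tried M n ω) :
    0 < inclusionProb β c M R n ω x ∧ inclusionProb β c M R n ω x ≤ 1 := by
  have h1 := totalWeight_add_pos hu hβu hc hR ⟨x, hx⟩
  have h2 := le_dishWeight hu hR h hx
  have h3 := dishWeight_le hu hR h x
  rw [inclusionProb_eq]
  exact ⟨div_pos (by linarith) h1, (div_le_one h1).2 (by linarith)⟩

/-! Each sum over the dishes tried by the first `n + 1` customers is computed from sums over the dishes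
tried by the first `n` of them. -/

theorem sum_succ_eq (h : ∀ i < n + 1, IsSimple (M i ω)) {S S' : Finset X}
    (hS : (S : Set X) = tried M n ω) (hS' : (S' : Set X) = tried M (n + 1) ω) (f : ℝ → ℝ) :
    ∑ x ∈ S', f (dishWeight M R (n + 1) ω x) =
      ∑ x ∈ S, f (dishWeight M R n ω x + R n ω * (M n ω).real {x})
        + f (R n ω) * (M n ω).real (tried M n ω)ᶜ := by
  classical
  have hmem : ∀ x, x ∈ S ↔ x ∈ tried M n ω := fun x => by rw [← hS]; simp
  have hmem' : ∀ x, x ∈ S' ↔ x ∈ tried M (n + 1) ω := fun x => by rw [← hS']; simp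
  have hsub : S ⊆ S' := fun x hx =>
    (hmem' x).2 (tried_mono M ω n.le_succ ((hmem x).1 hx))
  have hn := h n n.lt_succ_self
  have hh : ∀ i < n, IsSimple (M i ω) := fun i hi => h i (hi.trans n.lt_succ_self)
  have hone : ∀ x ∈ S' \ S, (M n ω).real {x} = 1 := fun x hx => by
    have h1 := (hmem' x).1 (Finset.mem_sdiff.1 hx).1
    rw [tried_succ] at h1
    rcases h1 with h1 | h1
    · exact absurd ((hmem x).2 h1) (Finset.mem_sdiff.1 hx).2
    · simp [Measure.real, show M n ω {x} = 1 from h1]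
  have hF : ∀ x, M n ω {x} = 1 → x ∈ S' := fun x hx =>
    (hmem' x).2 (by rw [tried_succ]; exact Or.inr hx)
  have hfil : ({x ∈ S' | x ∈ (tried M n ω)ᶜ} : Finset X) = S' \ S := by
    ext x; simp [hmem]
  have hN : (M n ω).real (tried M n ω)ᶜ = ((S' \ S).card : ℝ) := by
    rw [hn.real_eq_sum hF _ (finite_tried hh).measurableSet.compl, hfil, Finset.sum_congr rfl hone]
    simp
  -- The dishes split into old ones, which gain the weight if tried again, and new ones, each
  -- carrying exactly the weight of the last customer.
  rw [← Finset.sum_sdiff hsub, hN, add_comm]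
  congr 1
  · exact Finset.sum_congr rfl fun x _ => by rw [dishWeight_succ]
  · rw [Finset.sum_congr rfl (g := fun _ => f (R n ω)) fun x hx => ?_]
    · rw [Finset.sum_const, nsmul_eq_mul, mul_comm]
    · rw [dishWeight_succ, hone x hx, dishWeight_eq_zero hh
        (fun hx' => (Finset.mem_sdiff.1 hx).2 ((hmem x).2 hx')), zero_add, mul_one]

theorem sum_real_singleton_eq (h : ∀ i < n + 1, IsSimple (M i ω)) {S : Finset X}
    (hS : (S : Set X) = tried M n ω) :
    ∑ x ∈ S, (M n ω).real {x} = (M n ω).real Set.univ - (M n ω).real (tried M n ω)ᶜ := by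
  have := (h n n.lt_succ_self).1
  rw [sum_measureReal_singleton, hS]
  have hm : MeasurableSet (tried M n ω) := by rw [← hS]; exact S.measurableSet
  linarith [measureReal_add_measureReal_compl (μ := M n ω) hm]

end Realization

end WeightedIBP

namespace WeightedIBP

/-! ### Predictive quantities along a fixed realization -/

section Predictive

variable {Ω X : Type*} [MeasurableSpace X]

/-- The number of new dishes tried by customer `n + 1`. -/
def newDishes (M : ℕ → Ω → Measure X) (n : ℕ) (ω : Ω) : ℝ := (M n ω).real (tried M n ω)ᶜ

/-- The sum of the inclusion probabilities of the old dishes tried by customer `n + 1`. -/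
def oldProbSum (β c : ℝ) (M : ℕ → Ω → Measure X) (R : ℕ → Ω → ℝ) (n : ℕ) (ω : Ω) : ℝ :=
  (∫⁻ x, (tried M n ω).indicator (fun x => ENNReal.ofReal (inclusionProb β c M R n ω x)) x
    ∂M n ω).toReal

/-- The sum of the inclusion probabilities, defined by its recursion. -/
def probSum (β c : ℝ) (M : ℕ → Ω → Measure X) (R : ℕ → Ω → ℝ) : ℕ → Ω → ℝ
  | 0, _ => 0
  | n + 1, ω => (probSum β c M R n ω * (totalWeight R n ω + c) + R n ω * dishes M n ω
      - β * newDishes M n ω) / (totalWeight R (n + 1) ω + c)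

/-- The sum of the squares of the inclusion probabilities, defined by its recursion. -/
def probSqSum (β c : ℝ) (M : ℕ → Ω → Measure X) (R : ℕ → Ω → ℝ) : ℕ → Ω → ℝ
  | 0, _ => 0
  | n + 1, ω => (probSqSum β c M R n ω * (totalWeight R n ω + c) ^ 2
      + 2 * R n ω * (totalWeight R n ω + c) * oldProbSum β c M R n ω
      + R n ω ^ 2 * (dishes M n ω - newDishes M n ω)
      + (R n ω - β) ^ 2 * newDishes M n ω) / (totalWeight R (n + 1) ω + c) ^ 2

variable [MeasurableSingletonClass X] {M : ℕ → Ω → Measure X} {R : ℕ → Ω → ℝ} {α β c u : ℝ} {n : ℕ}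
  {ω : Ω} {m : Measure X} {S : Finset X}

theorem sum_inclusionProb_mul (hu : 0 < u) (hβu : β < u) (hc : -β < c) (hR : ∀ i, u ≤ R i ω)
    (hS : (S : Set X) = tried M n ω) (g : X → ℝ) :
    (totalWeight R n ω + c) * ∑ x ∈ S, inclusionProb β c M R n ω x * g x
      = ∑ x ∈ S, (dishWeight M R n ω x - β) * g x := by
  rw [Finset.mul_sum]
  refine Finset.sum_congr rfl fun x hx => ?_
  have h1 := totalWeight_add_pos (n := n) hu hβu hc hR ⟨x, by rw [← hS]; exact hx⟩
  rw [inclusionProb_eq, ← mul_assoc, mul_div_cancel₀ _ h1.ne']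

theorem oldProbSum_eq (hu : 0 < u) (hβu : β < u) (hc : -β < c) (hR : ∀ i, u ≤ R i ω)
    (h : ∀ i < n + 1, IsSimple (M i ω)) (hS : (S : Set X) = tried M n ω) :
    oldProbSum β c M R n ω = ∑ x ∈ S, inclusionProb β c M R n ω x * (M n ω).real {x} := by
  have := (h n n.lt_succ_self).1
  have hh : ∀ i < n, IsSimple (M i ω) := fun i hi => h i (hi.trans n.lt_succ_self)
  have hmem : ∀ x ∈ S, x ∈ tried M n ω := fun x hx => by rw [← hS]; exact hx
  rw [oldProbSum, lintegral_indicator (by rw [← hS]; exact S.measurableSet), ← hS,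
    lintegral_finset, ENNReal.toReal_sum fun x _ =>
      ENNReal.mul_ne_top ENNReal.ofReal_ne_top (measure_ne_top _ _)]
  refine Finset.sum_congr rfl fun x hx => ?_
  rw [ENNReal.toReal_mul, ENNReal.toReal_ofReal
    (inclusionProb_bounds hu hβu hc hR hh (hmem x hx)).1.le]
  rfl

/-- Sums over the random set of dishes are awkward to measure, whereas the recursion is visibly
measurable; the two agree along realizations by simple measures. -/
theorem probSum_eq (hu : 0 < u) (hβu : β < u) (hc : -β < c) (hR : ∀ i, u ≤ R i ω)
    (h : ∀ i < n, IsSimple (M i ω)) (hS : (S : Set X) = tried M n ω) :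
    probSum β c M R n ω = ∑ x ∈ S, inclusionProb β c M R n ω x := by
  induction n generalizing S with
  | zero =>
    rw [tried_zero, Finset.coe_eq_empty] at hS
    simp [hS, probSum]
  | succ n ih =>
    have hh : ∀ i < n, IsSimple (M i ω) := fun i hi => h i (hi.trans n.lt_succ_self)
    obtain ⟨S₀, hS₀⟩ := (finite_tried hh).exists_finset_coe
    have h1 := sum_inclusionProb_mul hu hβu hc hR hS₀ fun _ => 1
    have h2 := sum_succ_eq (R := R) h hS₀ hS fun y => y - β
    have h3 := sum_real_singleton_eq h hS₀
    have h4 : ∑ x ∈ S, inclusionProb β c M R (n + 1) ω x =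
        (∑ x ∈ S, (dishWeight M R (n + 1) ω x - β)) / (totalWeight R (n + 1) ω + c) := by
      rw [Finset.sum_div]; rfl
    have h5 : ∑ x ∈ S₀, (dishWeight M R n ω x + R n ω * (M n ω).real {x} - β)
        = ∑ x ∈ S₀, (dishWeight M R n ω x - β) + R n ω * ∑ x ∈ S₀, (M n ω).real {x} := by
      rw [Finset.mul_sum, ← Finset.sum_add_distrib]
      exact Finset.sum_congr rfl fun x _ => by ring
    simp only [mul_one] at h1
    rw [h4, h2, h5, ← h1, h3, probSum, ih hh hS₀, dishes, newDishes]
    congr 1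
    ring

theorem probSqSum_eq (hu : 0 < u) (hβu : β < u) (hc : -β < c) (hR : ∀ i, u ≤ R i ω)
    (h : ∀ i < n, IsSimple (M i ω)) (hS : (S : Set X) = tried M n ω) :
    probSqSum β c M R n ω = ∑ x ∈ S, inclusionProb β c M R n ω x ^ 2 := by
  induction n generalizing S with
  | zero =>
    rw [tried_zero, Finset.coe_eq_empty] at hS
    simp [hS, probSqSum]
  | succ n ih =>
    have hh : ∀ i < n, IsSimple (M i ω) := fun i hi => h i (hi.trans n.lt_succ_self)
    obtain ⟨S₀, hS₀⟩ := (finite_tried hh).exists_finset_coe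
    have h0 : (totalWeight R n ω + c) ^ 2 * ∑ x ∈ S₀, inclusionProb β c M R n ω x ^ 2
        = ∑ x ∈ S₀, (dishWeight M R n ω x - β) ^ 2 := by
      have h1 := sum_inclusionProb_mul hu hβu hc hR hS₀ fun x => dishWeight M R n ω x - β
      have h2 := sum_inclusionProb_mul hu hβu hc hR hS₀ fun x => inclusionProb β c M R n ω x
      simp only [← pow_two] at h1 h2
      rw [← h1, pow_two, mul_assoc, h2]
      congr 1
      exact Finset.sum_congr rfl fun x _ => mul_comm _ _
    have h1 := sum_inclusionProb_mul hu hβu hc hR hS₀ fun x => (M n ω).real {x}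
    rw [← oldProbSum_eq hu hβu hc hR h hS₀] at h1
    have h2 := sum_succ_eq (R := R) h hS₀ hS fun y => (y - β) ^ 2
    have h3 := sum_real_singleton_eq h hS₀
    have h4 : ∑ x ∈ S, inclusionProb β c M R (n + 1) ω x ^ 2 =
        (∑ x ∈ S, (dishWeight M R (n + 1) ω x - β) ^ 2) / (totalWeight R (n + 1) ω + c) ^ 2 := by
      rw [Finset.sum_div]
      exact Finset.sum_congr rfl fun x _ => by rw [inclusionProb_eq, div_pow]
    have h5 : ∑ x ∈ S₀, (dishWeight M R n ω x + R n ω * (M n ω).real {x} - β) ^ 2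
        = ∑ x ∈ S₀, (dishWeight M R n ω x - β) ^ 2
          + 2 * R n ω * ∑ x ∈ S₀, (dishWeight M R n ω x - β) * (M n ω).real {x}
          + R n ω ^ 2 * ∑ x ∈ S₀, (M n ω).real {x} := by
      rw [Finset.mul_sum, Finset.mul_sum, ← Finset.sum_add_distrib, ← Finset.sum_add_distrib]
      refine Finset.sum_congr rfl fun x _ => ?_
      -- The mass at a dish is 0 or 1, so it equals its square.
      rcases (h n n.lt_succ_self).real_singleton_eq x with hx | hx <;> rw [hx] <;> ring
    rw [h4, h2, h5, ← h0, ← h1, h3, probSqSum, ih hh hS₀, dishes, newDishes]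
    congr 1
    ring

theorem probSqSum_bounds (hu : 0 < u) (hβu : β < u) (hc : -β < c) (hR : ∀ i, u ≤ R i ω)
    (h : ∀ i < n, IsSimple (M i ω)) :
    0 ≤ probSqSum β c M R n ω ∧ probSqSum β c M R n ω ≤ probSum β c M R n ω := by
  obtain ⟨S, hS⟩ := (finite_tried h).exists_finset_coe
  rw [probSqSum_eq hu hβu hc hR h hS, probSum_eq hu hβu hc hR h hS]
  refine ⟨Finset.sum_nonneg fun x _ => sq_nonneg _, Finset.sum_le_sum fun x hx => ?_⟩
  have := inclusionProb_bounds hu hβu hc hR h (x := x) (by rw [← hS]; exact hx)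
  nlinarith

/-! ### The hazard measure along a fixed realization -/

theorem lintegral_hazard (hS : (S : Set X) = tried M n ω) {φ : X → ℝ≥0∞} :
    ∫⁻ x, φ x ∂hazard m α β c M R n ω = ∑ x ∈ S, ENNReal.ofReal (inclusionProb β c M R n ω x) * φ x
      + ENNReal.ofReal (newRate α β c R n ω) * ∫⁻ x, φ x ∂m := by
  rw [hazard, lintegral_add_measure, lintegral_sum_measure, lintegral_smul_measure, smul_eq_mul]
  congr 1
  simp only [lintegral_smul_measure, lintegral_dirac, smul_eq_mul]
  rw [← hS]
  exact Finset.tsum_subtype S fun x => ENNReal.ofReal (inclusionProb β c M R n ω x) * φ x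

theorem hazard_singleton (hm : ∀ x, m {x} = 0) (hS : (S : Set X) = tried M n ω) (x : X) :
    hazard m α β c M R n ω {x} =
      (tried M n ω).indicator (fun x => ENNReal.ofReal (inclusionProb β c M R n ω x)) x := by
  classical
  rw [← lintegral_indicator_one (measurableSet_singleton x), lintegral_hazard hS,
    lintegral_indicator_one (measurableSet_singleton x), hm, mul_zero, add_zero]
  have h1 : ∀ y, ENNReal.ofReal (inclusionProb β c M R n ω y) * Set.indicator {x} 1 y
      = if y = x then ENNReal.ofReal (inclusionProb β c M R n ω y) else 0 := fun y => by
    by_cases hy : y = x <;> simp [hy]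
  simp_rw [h1]
  rw [Finset.sum_ite_eq', ← hS]
  by_cases hx : x ∈ S <;> simp [hx]

variable [IsProbabilityMeasure m]

theorem hazard_univ (hu : 0 < u) (hβu : β < u) (hc : -β < c) (hR : ∀ i, u ≤ R i ω)
    (hΛ : 0 ≤ newRate α β c R n ω) (h : ∀ i < n, IsSimple (M i ω)) :
    hazard m α β c M R n ω Set.univ
      = ENNReal.ofReal (probSum β c M R n ω + newRate α β c R n ω) := by
  obtain ⟨S, hS⟩ := (finite_tried h).exists_finset_coe
  have h0 : ∀ x ∈ S, 0 ≤ inclusionProb β c M R n ω x := fun x hx =>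
    (inclusionProb_bounds hu hβu hc hR h (by rw [← hS]; exact hx)).1.le
  rw [← lintegral_one, lintegral_hazard hS, probSum_eq hu hβu hc hR h hS,
    ENNReal.ofReal_add (Finset.sum_nonneg h0) hΛ, ENNReal.ofReal_sum_of_nonneg h0]
  simp

theorem isFiniteMeasure_hazard (hu : 0 < u) (hβu : β < u) (hc : -β < c) (hR : ∀ i, u ≤ R i ω)
    (hΛ : 0 ≤ newRate α β c R n ω) (h : ∀ i < n, IsSimple (M i ω)) :
    IsFiniteMeasure (hazard m α β c M R n ω) :=
  ⟨by rw [hazard_univ hu hβu hc hR hΛ h]; exact ENNReal.ofReal_lt_top⟩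

theorem atoms_hazard (hm : ∀ x, m {x} = 0) (hu : 0 < u) (hβu : β < u) (hc : -β < c)
    (hR : ∀ i, u ≤ R i ω) (h : ∀ i < n, IsSimple (M i ω)) :
    atoms (hazard m α β c M R n ω) = tried M n ω := by
  obtain ⟨S, hS⟩ := (finite_tried h).exists_finset_coe
  ext x
  rw [atoms, Set.mem_ofPred_eq, hazard_singleton hm hS]
  by_cases hx : x ∈ tried M n ω
  · rw [Set.indicator_of_mem hx]
    simpa [hx] using (inclusionProb_bounds hu hβu hc hR h hx).1
  · simp [hx]

theorem hazard_singleton_le (hm : ∀ x, m {x} = 0) (hu : 0 < u) (hβu : β < u) (hc : -β < c)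
    (hR : ∀ i, u ≤ R i ω) (h : ∀ i < n, IsSimple (M i ω)) (x : X) :
    hazard m α β c M R n ω {x} ≤ 1 := by
  obtain ⟨S, hS⟩ := (finite_tried h).exists_finset_coe
  rw [hazard_singleton hm hS]
  by_cases hx : x ∈ tried M n ω
  · rw [Set.indicator_of_mem hx]
    exact ENNReal.ofReal_le_one.2 (inclusionProb_bounds hu hβu hc hR h hx).2
  · simp [hx]

theorem hazard_compl_tried (hm : ∀ x, m {x} = 0) (h : ∀ i < n, IsSimple (M i ω)) :
    hazard m α β c M R n ω (tried M n ω)ᶜ = ENNReal.ofReal (newRate α β c R n ω) := by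
  obtain ⟨S, hS⟩ := (finite_tried h).exists_finset_coe
  have hT : MeasurableSet (tried M n ω) := by rw [← hS]; exact S.measurableSet
  have h0 : m (tried M n ω) = 0 := by
    rw [← hS, ← sum_measure_singleton]; simp [hm]
  have h1 : ∑ x ∈ S, ENNReal.ofReal (inclusionProb β c M R n ω x)
      * (tried M n ω)ᶜ.indicator 1 x = 0 := by
    refine Finset.sum_eq_zero fun x hx => ?_
    have : x ∈ tried M n ω := by rw [← hS]; exact hx
    simp [this]
  rw [← lintegral_indicator_one hT.compl, lintegral_hazard hS, h1, zero_add,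
    lintegral_indicator_one hT.compl, prob_compl_eq_one_sub hT, h0]
  simp

theorem lintegral_hazard_indicator (hu : 0 < u) (hβu : β < u) (hc : -β < c) (hR : ∀ i, u ≤ R i ω)
    (hm : ∀ x, m {x} = 0) (h : ∀ i < n, IsSimple (M i ω)) :
    ∫⁻ x, (tried M n ω).indicator (fun x => ENNReal.ofReal (inclusionProb β c M R n ω x)) x
      ∂hazard m α β c M R n ω = ENNReal.ofReal (probSqSum β c M R n ω) := by
  obtain ⟨S, hS⟩ := (finite_tried h).exists_finset_coe
  have hT : MeasurableSet (tried M n ω) := by rw [← hS]; exact S.measurableSet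
  have h0 : m.restrict (tried M n ω) = 0 := by
    rw [Measure.restrict_eq_zero, ← hS, ← sum_measure_singleton]; simp [hm]
  rw [lintegral_hazard hS, lintegral_indicator hT _ (μ := m), h0, lintegral_zero_measure, mul_zero, add_zero,
    probSqSum_eq hu hβu hc hR h hS, ENNReal.ofReal_sum_of_nonneg fun x _ => sq_nonneg _]
  refine Finset.sum_congr rfl fun x hx => ?_
  have hx' : x ∈ tried M n ω := by rw [← hS]; exact hx
  rw [Set.indicator_of_mem hx', ← ENNReal.ofReal_mul
    (inclusionProb_bounds hu hβu hc hR h hx').1.le, pow_two]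

theorem sum_atoms_hazard_sq (hu : 0 < u) (hβu : β < u) (hc : -β < c) (hR : ∀ i, u ≤ R i ω)
    (hm : ∀ x, m {x} = 0) (h : ∀ i < n, IsSimple (M i ω))
    [Fintype (atoms (hazard m α β c M R n ω))] :
    ∑ z : atoms (hazard m α β c M R n ω), hazard m α β c M R n ω {(z : X)} ^ 2
      = ENNReal.ofReal (probSqSum β c M R n ω) := by
  obtain ⟨S, hS⟩ := (finite_tried h).exists_finset_coe
  have hA := atoms_hazard (α := α) hm hu hβu hc hR h
  rw [probSqSum_eq hu hβu hc hR h hS, ENNReal.ofReal_sum_of_nonneg fun x _ => sq_nonneg _,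
    ← tsum_fintype (L := .unconditional _), tsum_subtype (atoms (hazard m α β c M R n ω))
      fun z => hazard m α β c M R n ω {z} ^ 2, hA, ← hS,
    ← Finset.tsum_subtype' S fun x => ENNReal.ofReal (inclusionProb β c M R n ω x ^ 2)]
  rw [tsum_subtype (S : Set X) fun x => ENNReal.ofReal (inclusionProb β c M R n ω x ^ 2)]
  refine tsum_congr fun x => ?_
  by_cases hx : x ∈ (S : Set X)
  · have hx' : x ∈ tried M n ω := by rw [← hS]; exact hx
    rw [Set.indicator_of_mem hx, Set.indicator_of_mem hx, hazard_singleton hm hS,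
      Set.indicator_of_mem hx', ENNReal.ofReal_pow
        (inclusionProb_bounds hu hβu hc hR h hx').1.le]
  · rw [Set.indicator_of_notMem hx, Set.indicator_of_notMem hx]

end Predictive

end WeightedIBP

namespace WeightedIBP

/-! ### From the buffet process to a predictive system -/

/-- A weighted Indian buffet process with bounded weights, relative to a filtration. -/
structure IsBoundedIBP {Ω X : Type*} [MeasurableSpace X] {mΩ : MeasurableSpace Ω} (P : Measure Ω)
    (ℱ : Filtration ℕ mΩ) (𝒢 : ℕ → MeasurableSpace Ω) (m : Measure X) (α β c u b : ℝ)
    (M : ℕ → Ω → Measure X) (R : ℕ → Ω → ℝ) : Prop where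
  alpha_pos : 0 < α
  beta_lt : β < 1
  c_gt : -β < c
  isProbabilityMeasure : IsProbabilityMeasure m
  diffuse : ∀ x, m {x} = 0
  max_lt : max β 0 < u
  le_mid : ∀ n, ℱ n ≤ 𝒢 n
  mid_le : ∀ n, 𝒢 n ≤ ℱ (n + 1)
  measurable_M : ∀ n, Measurable[𝒢 n] (M n)
  finite_M : ∀ n ω, IsFiniteMeasure (M n ω)
  measurable_R : ∀ n, Measurable[ℱ (n + 1)] (R n)
  le_R : ∀ n ω, u ≤ R n ω
  R_le : ∀ n ω, R n ω ≤ b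
  indep_R : ∀ n, Indep (MeasurableSpace.comap (R n) inferInstance) (𝒢 n) P
  law_M : ∀ n (A : Set (Measure X)), MeasurableSet A →
    P⟦M n ⁻¹' A | ℱ n⟧ =ᵐ[P] fun ω => (bernoulliLaw (hazard m α β c M R n ω)).real A

namespace IsBoundedIBP

variable {Ω X : Type*} [MeasurableSpace X] {mΩ : MeasurableSpace Ω} {P : Measure Ω}
  [IsProbabilityMeasure P] {ℱ : Filtration ℕ mΩ} {𝒢 : ℕ → MeasurableSpace Ω} {m : Measure X}
  {α β c u b : ℝ} {M : ℕ → Ω → Measure X} {R : ℕ → Ω → ℝ}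

theorem u_pos (h : IsBoundedIBP P ℱ 𝒢 m α β c u b M R) : 0 < u := (le_max_right _ _).trans_lt h.max_lt

theorem beta_lt_u (h : IsBoundedIBP P ℱ 𝒢 m α β c u b M R) : β < u :=
  (le_max_left _ _).trans_lt h.max_lt

theorem measurable_M' (h : IsBoundedIBP P ℱ 𝒢 m α β c u b M R) {i n : ℕ} (hi : i < n) :
    Measurable[ℱ n] (M i) :=
  (h.measurable_M i).mono ((h.mid_le i).trans (ℱ.mono hi)) le_rfl

theorem newRate_pos (h : IsBoundedIBP P ℱ 𝒢 m α β c u b M R) (n : ℕ) (ω : Ω) :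
    0 < newRate α β c R n ω := by
  rw [newRate_eq]
  exact rateOf_pos h.alpha_pos h.beta_lt h.c_gt (totalWeight_nonneg h.u_pos fun i => h.le_R i ω)

theorem newRate_le (h : IsBoundedIBP P ℱ 𝒢 m α β c u b M R) (n : ℕ) (ω : Ω) :
    newRate α β c R n ω ≤ rateOf α β c (u * n) := by
  have hu := h.u_pos
  rw [newRate_eq]
  refine rateOf_anti h.alpha_pos h.beta_lt h.c_gt (by positivity) ?_
  have := Finset.card_nsmul_le_sum (Finset.range n) (fun i => R i ω) u fun i _ => h.le_R i ω
  rw [totalWeight]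
  simp only [Finset.card_range, nsmul_eq_mul] at this
  linarith

theorem measurable_totalWeight (h : IsBoundedIBP P ℱ 𝒢 m α β c u b M R) (n : ℕ) :
    Measurable[ℱ n] (totalWeight R n) :=
  measurable_sum_of_measurable_succ h.measurable_R n

theorem measurable_newRate (h : IsBoundedIBP P ℱ 𝒢 m α β c u b M R) (n : ℕ) :
    Measurable[ℱ n] (newRate α β c R n) := by
  have h1 : newRate α β c R n = (fun T => rateOf α β c (max 0 T)) ∘ totalWeight R n := by
    ext ω
    rw [Function.comp_apply, max_eq_right (totalWeight_nonneg h.u_pos fun i => h.le_R i ω),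
      newRate_eq]
  rw [h1]
  exact (continuous_rateOf_max h.beta_lt h.c_gt).measurable.comp (h.measurable_totalWeight n)

variable [MeasurableEq X] [MeasurableSingletonClass X]

/-- Strong induction: if the earlier measures are simple, the hazard measure is finite with finitely
many atoms of mass at most 1, and its Bernoulli law charges simple measures only. -/
theorem ae_isSimple (h : IsBoundedIBP P ℱ 𝒢 m α β c u b M R) (n : ℕ) :
    ∀ᵐ ω ∂P, IsSimple (M n ω) := by
  have := h.isProbabilityMeasure
  induction n using Nat.strong_induction_on with
  | _ n ih =>
    have hgood : ∀ᵐ ω ∂P, ∀ i < n, IsSimple (M i ω) :=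
      ae_all_iff.2 fun i => by
        by_cases hi : i < n
        · filter_upwards [ih i hi] with ω hω using fun _ => hω
        · exact ae_of_all _ fun ω hi' => absurd hi' hi
    have hM : Measurable (M n) := (h.measurable_M' n.lt_succ_self).mono (ℱ.le _) le_rfl
    have hS := measurableSet_isSimple (X := X)
    have h1 : P⟦M n ⁻¹' {μ | IsSimple μ} | ℱ n⟧ =ᵐ[P] fun _ => 1 := by
      filter_upwards [h.law_M n _ hS, hgood] with ω h1 hω
      rw [h1]
      have hfin := isFiniteMeasure_hazard (m := m) h.u_pos h.beta_lt_u h.c_gt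
        (fun i => h.le_R i ω) (h.newRate_pos n ω).le hω
      have : Fintype (atoms (hazard m α β c M R n ω)) := by
        rw [atoms_hazard h.diffuse h.u_pos h.beta_lt_u h.c_gt (fun i => h.le_R i ω) hω]
        exact (finite_tried hω).fintype
      have := isProbabilityMeasure_bernoulliLaw (hazard m α β c M R n ω)
      have h2 := (ae_isSimple_bernoulliLaw (hazard m α β c M R n ω))
      rw [Measure.real, (prob_compl_eq_zero_iff hS).1 h2, ENNReal.toReal_one]
    have h3 := integral_condExp (ℱ.le n) (μ := P)
      (f := (M n ⁻¹' {μ | IsSimple μ}).indicator fun _ => (1 : ℝ))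
    rw [integral_congr_ae h1, integral_indicator_const _ (hM hS)] at h3
    simp only [integral_const, probReal_univ, smul_eq_mul, mul_one] at h3
    have h4 : P (M n ⁻¹' {μ | IsSimple μ}) = 1 := by
      rw [← ofReal_measureReal (measure_ne_top _ _), ← h3, ENNReal.ofReal_one]
    exact (prob_compl_eq_zero_iff (hM hS)).2 h4

theorem ae_forall_isSimple (h : IsBoundedIBP P ℱ 𝒢 m α β c u b M R) :
    ∀ᵐ ω ∂P, ∀ i, IsSimple (M i ω) := ae_all_iff.2 h.ae_isSimple

/-- Integrals of functionals of the past and of the next measure. -/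
theorem setLIntegral_condLaw (h : IsBoundedIBP P ℱ 𝒢 m α β c u b M R) (n : ℕ)
    {Φ : Ω × Measure X → ℝ≥0∞} (hΦ : Measurable[(ℱ n).prod inferInstance] Φ) {A : Set Ω}
    (hA : MeasurableSet[ℱ n] A) :
    ∫⁻ ω in A, Φ (ω, M n ω) ∂P
      = ∫⁻ ω in A, ∫⁻ μ, Φ (ω, μ) ∂bernoulliLaw (hazard m α β c M R n ω) ∂P := by
  classical
  have := h.isProbabilityMeasure
  have hM : Measurable (M n) := (h.measurable_M' n.lt_succ_self).mono (ℱ.le _) le_rfl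
  -- A default law on the null set where the hazard may be infinite, so that every value of `κ` is a
  -- probability measure.
  set κ : Ω → Measure (Measure X) := fun ω => if IsFiniteMeasure (hazard m α β c M R n ω) then
    bernoulliLaw (hazard m α β c M R n ω) else Measure.dirac 0 with hκ
  have hκp : ∀ ω, IsProbabilityMeasure (κ ω) := fun ω => by
    rw [hκ]
    simp only
    split_ifs with hf
    · exact isProbabilityMeasure_bernoulliLaw _
    · infer_instance
  have hae : ∀ᵐ ω ∂P, κ ω = bernoulliLaw (hazard m α β c M R n ω) := by
    filter_upwards [h.ae_forall_isSimple] with ω hω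
    rw [hκ]
    exact if_pos (isFiniteMeasure_hazard h.u_pos h.beta_lt_u h.c_gt (fun i => h.le_R i ω)
      (h.newRate_pos n ω).le fun i _ => hω i)
  have h1 : Measurable[(ℱ n).prod inferInstance] fun q : Ω × Measure X =>
      A.indicator 1 q.1 * Φ q := by
    refine Measurable.mul ?_ hΦ
    exact (Measurable.indicator (@measurable_const ℝ≥0∞ Ω _ (ℱ n) 1) hA).comp (@measurable_fst Ω (Measure X) (ℱ n) _)
  have h2 := (lintegral_condLaw (ℱ.le n) hM hκp (fun B hB => by
    filter_upwards [h.law_M n B hB, hae] with ω h3 h4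
    rw [h3, h4]) h1).2
  rw [← lintegral_indicator (ℱ.le n _ hA), ← lintegral_indicator (ℱ.le n _ hA)]
  have h3 : ∀ ω, A.indicator (fun ω => Φ (ω, M n ω)) ω = A.indicator 1 ω * Φ (ω, M n ω) := fun ω => by
    by_cases hω : ω ∈ A <;> simp [hω]
  simp_rw [h3]
  rw [h2]
  refine lintegral_congr_ae ?_
  filter_upwards [hae] with ω hω
  rw [hω]
  by_cases hω' : ω ∈ A <;> simp [hω']

theorem measurable_finIntegral_prod {𝓗 : MeasurableSpace Ω} {φ : Ω × X → ℝ≥0∞}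
    (hφ : Measurable[𝓗.prod inferInstance] φ) :
    Measurable[𝓗.prod inferInstance] fun q : Ω × Measure X =>
      finIntegral (fun x => φ (q.1, x)) q.2 :=
  @measurable_finIntegral X _ Ω 𝓗 φ hφ

/-- Campbell's formula for the conditional law, with an integrand that may depend on the past. -/
theorem setLIntegral_lintegral (h : IsBoundedIBP P ℱ 𝒢 m α β c u b M R) (n : ℕ)
    {φ : Ω × X → ℝ≥0∞} (hφ : Measurable[(ℱ n).prod inferInstance] φ) {A : Set Ω}
    (hA : MeasurableSet[ℱ n] A) :
    ∫⁻ ω in A, ∫⁻ x, φ (ω, x) ∂M n ω ∂P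
      = ∫⁻ ω in A, ∫⁻ x, φ (ω, x) ∂hazard m α β c M R n ω ∂P := by
  have := h.isProbabilityMeasure
  have := h.finite_M
  have h1 := h.setLIntegral_condLaw n (measurable_finIntegral_prod hφ) hA
  simp only [finIntegral_eq] at h1
  rw [h1]
  refine lintegral_congr_ae (ae_restrict_of_ae ?_)
  filter_upwards [h.ae_forall_isSimple] with ω hω
  have hω' : ∀ i < n, IsSimple (M i ω) := fun i _ => hω i
  have hR : ∀ i, u ≤ R i ω := fun i => h.le_R i ω
  have hfin := isFiniteMeasure_hazard (m := m) h.u_pos h.beta_lt_u h.c_gt hR (h.newRate_pos n ω).le hω'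
  have hat := atoms_hazard (α := α) h.diffuse h.u_pos h.beta_lt_u h.c_gt hR hω'
  have : Fintype (atoms (hazard m α β c M R n ω)) := by
    rw [hat]; exact (finite_tried hω').fintype
  have hd : hazard m α β c M R n ω (atoms (hazard m α β c M R n ω))ᶜ ≠ 0 := by
    rw [hat, hazard_compl_tried h.diffuse hω']
    simpa using h.newRate_pos n ω
  have hsec : Measurable fun x => φ (ω, x) := hφ.comp (@measurable_prodMk_left Ω X (ℱ n) _ ω)
  rw [← lintegral_lintegral_bernoulliLaw _ (hazard_singleton_le h.diffuse h.u_pos h.beta_lt_u h.c_gt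
    hR hω') hd hsec]
  refine lintegral_congr_ae ?_
  filter_upwards [ae_isSimple_bernoulliLaw (hazard m α β c M R n ω)] with μ hμ
  have := hμ.1
  rw [finIntegral_eq]

theorem measurable_singleton_mass (h : IsBoundedIBP P ℱ 𝒢 m α β c u b M R) {i n : ℕ} (hi : i < n) :
    Measurable[(ℱ n).prod inferInstance] fun q : Ω × X => M i q.1 {q.2} := by
  have := h.finite_M
  have h1 : Measurable[(ℱ n).prod inferInstance] fun q : Ω × X => (M i q.1, q.2) :=
    Measurable.prodMk ((h.measurable_M' hi).comp (@measurable_fst Ω X (ℱ n) _))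
      (@measurable_snd Ω X (ℱ n) _)
  have h2 := measurable_pointMass.comp h1
  simpa only [Function.comp_def, pointMass_eq] using h2

theorem measurableSet_tried (h : IsBoundedIBP P ℱ 𝒢 m α β c u b M R) (n : ℕ) :
    MeasurableSet[(ℱ n).prod inferInstance] {q : Ω × X | q.2 ∈ tried M n q.1} := by
  have : {q : Ω × X | q.2 ∈ tried M n q.1} = ⋃ i, ⋃ (_ : i < n), {q : Ω × X | M i q.1 {q.2} = 1} := by
    ext q; simp [tried]
  rw [this]
  exact MeasurableSet.iUnion fun i => MeasurableSet.iUnion fun hi =>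
    (h.measurable_singleton_mass hi) (measurableSet_singleton 1)

theorem measurable_dishWeight (h : IsBoundedIBP P ℱ 𝒢 m α β c u b M R) (n : ℕ) :
    Measurable[(ℱ n).prod inferInstance] fun q : Ω × X => dishWeight M R n q.1 q.2 := by
  refine Finset.measurable_fun_sum _ fun i hi => Measurable.mul ?_ ?_
  · exact ((h.measurable_R i).mono (ℱ.mono (Finset.mem_range.1 hi)) le_rfl).comp
      (@measurable_fst Ω X (ℱ n) _)
  · exact (h.measurable_singleton_mass (Finset.mem_range.1 hi)).ennreal_toReal

theorem measurable_inclusionProb (h : IsBoundedIBP P ℱ 𝒢 m α β c u b M R) (n : ℕ) :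
    Measurable[(ℱ n).prod inferInstance] fun q : Ω × X => inclusionProb β c M R n q.1 q.2 :=
  ((h.measurable_dishWeight n).sub_const β).div
    (((h.measurable_totalWeight n).comp (@measurable_fst Ω X (ℱ n) _)).add_const c)

theorem measurable_lintegral_next (h : IsBoundedIBP P ℱ 𝒢 m α β c u b M R) (n : ℕ)
    {φ : Ω × X → ℝ≥0∞} (hφ : Measurable[(ℱ n).prod inferInstance] φ) :
    Measurable[𝒢 n] fun ω => ∫⁻ x, φ (ω, x) ∂M n ω := by
  have := h.finite_M
  have hid : Measurable[𝒢 n, (ℱ n).prod inferInstance] fun ω => (ω, M n ω) :=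
    @Measurable.prodMk _ (𝒢 n) _ _ (ℱ n) _ _ _ (measurable_id'' (h.le_mid n)) (h.measurable_M n)
  have h1 := (measurable_finIntegral_prod hφ).comp hid
  simpa only [Function.comp_def, finIntegral_eq] using h1

/-- The indicator of the dishes not yet tried. -/
def newIndicator (M : ℕ → Ω → Measure X) (n : ℕ) (q : Ω × X) : ℝ≥0∞ :=
  (tried M n q.1)ᶜ.indicator 1 q.2

/-- The inclusion probability of a dish that has been tried. -/
def oldProb (β c : ℝ) (M : ℕ → Ω → Measure X) (R : ℕ → Ω → ℝ) (n : ℕ) (q : Ω × X) : ℝ≥0∞ :=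
  (tried M n q.1).indicator (fun x => ENNReal.ofReal (inclusionProb β c M R n q.1 x)) q.2

theorem measurable_newIndicator (h : IsBoundedIBP P ℱ 𝒢 m α β c u b M R) (n : ℕ) :
    Measurable[(ℱ n).prod inferInstance] (newIndicator (X := X) M n) :=
  Measurable.indicator (@measurable_const ℝ≥0∞ (Ω × X) _ ((ℱ n).prod inferInstance) 1)
    (h.measurableSet_tried n).compl

theorem measurable_oldProb (h : IsBoundedIBP P ℱ 𝒢 m α β c u b M R) (n : ℕ) :
    Measurable[(ℱ n).prod inferInstance] (oldProb (X := X) β c M R n) :=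
  ((h.measurable_inclusionProb n).ennreal_ofReal.indicator (h.measurableSet_tried n) :
    Measurable[(ℱ n).prod inferInstance] ({q : Ω × X | q.2 ∈ tried M n q.1}.indicator
      fun q => ENNReal.ofReal (inclusionProb β c M R n q.1 q.2)))

theorem measurableSet_tried_section (h : IsBoundedIBP P ℱ 𝒢 m α β c u b M R) (n : ℕ) (ω : Ω) :
    MeasurableSet (tried M n ω) :=
  (@measurable_prodMk_left Ω X (ℱ n) _ ω) (h.measurableSet_tried n)

theorem newDishes_eq (h : IsBoundedIBP P ℱ 𝒢 m α β c u b M R) (n : ℕ) (ω : Ω) :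
    newDishes M n ω = (∫⁻ x, newIndicator M n (ω, x) ∂M n ω).toReal := by
  simp only [newIndicator]
  rw [lintegral_indicator_one (h.measurableSet_tried_section n ω).compl]
  rfl

theorem measurable_dishes (h : IsBoundedIBP P ℱ 𝒢 m α β c u b M R) (n : ℕ) :
    Measurable[𝒢 n] (dishes M n) :=
  ((Measure.measurable_coe MeasurableSet.univ).comp (h.measurable_M n)).ennreal_toReal

theorem measurable_newDishes (h : IsBoundedIBP P ℱ 𝒢 m α β c u b M R) (n : ℕ) :
    Measurable[𝒢 n] (newDishes M n) := by
  have h1 := (h.measurable_lintegral_next n (h.measurable_newIndicator n)).ennreal_toReal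
  have h2 : newDishes M n = fun ω => (∫⁻ x, newIndicator M n (ω, x) ∂M n ω).toReal :=
    funext (h.newDishes_eq n)
  rw [h2]
  exact h1

theorem measurable_oldProbSum (h : IsBoundedIBP P ℱ 𝒢 m α β c u b M R) (n : ℕ) :
    Measurable[𝒢 n] (oldProbSum β c M R n) :=
  (h.measurable_lintegral_next n (h.measurable_oldProb n)).ennreal_toReal

theorem measurable_probSum (h : IsBoundedIBP P ℱ 𝒢 m α β c u b M R) (n : ℕ) :
    Measurable[ℱ n] (probSum β c M R n) := by
  induction n with
  | zero => exact measurable_const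
  | succ n ih =>
    have h1 : Measurable[ℱ (n + 1)] (probSum β c M R n) := ih.mono (ℱ.mono n.le_succ) le_rfl
    have h2 : Measurable[ℱ (n + 1)] (totalWeight R n) :=
      (h.measurable_totalWeight n).mono (ℱ.mono n.le_succ) le_rfl
    have h3 : Measurable[ℱ (n + 1)] (dishes M n) := (h.measurable_dishes n).mono (h.mid_le n) le_rfl
    have h4 : Measurable[ℱ (n + 1)] (newDishes M n) :=
      (h.measurable_newDishes n).mono (h.mid_le n) le_rfl
    exact (((h1.mul (h2.add_const c)).add ((h.measurable_R n).mul h3)).sub (h4.const_mul β)).div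
      ((h.measurable_totalWeight (n + 1)).add_const c)

theorem measurable_probSqSum (h : IsBoundedIBP P ℱ 𝒢 m α β c u b M R) (n : ℕ) :
    Measurable[ℱ n] (probSqSum β c M R n) := by
  induction n with
  | zero => exact measurable_const
  | succ n ih =>
    have h1 : Measurable[ℱ (n + 1)] (probSqSum β c M R n) := ih.mono (ℱ.mono n.le_succ) le_rfl
    have h2 : Measurable[ℱ (n + 1)] (totalWeight R n) :=
      (h.measurable_totalWeight n).mono (ℱ.mono n.le_succ) le_rfl
    have h3 : Measurable[ℱ (n + 1)] (dishes M n) := (h.measurable_dishes n).mono (h.mid_le n) le_rfl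
    have h4 : Measurable[ℱ (n + 1)] (newDishes M n) :=
      (h.measurable_newDishes n).mono (h.mid_le n) le_rfl
    have h5 : Measurable[ℱ (n + 1)] (oldProbSum β c M R n) :=
      (h.measurable_oldProbSum n).mono (h.mid_le n) le_rfl
    have hR := h.measurable_R n
    exact ((((h1.mul ((h2.add_const c).pow_const 2)).add
      (((hR.const_mul 2).mul (h2.add_const c)).mul h5)).add ((hR.pow_const 2).mul (h3.sub h4))).add
      (((hR.sub_const β).pow_const 2).mul h4)).div
      (((h.measurable_totalWeight (n + 1)).add_const c).pow_const 2)

end IsBoundedIBP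

end WeightedIBP

namespace WeightedIBP

namespace IsBoundedIBP

variable {Ω X : Type*} [MeasurableSpace X] {mΩ : MeasurableSpace Ω} {P : Measure Ω}
  [IsProbabilityMeasure P] {ℱ : Filtration ℕ mΩ} {𝒢 : ℕ → MeasurableSpace Ω} {m : Measure X}
  {α β c u b : ℝ} {M : ℕ → Ω → Measure X} {R : ℕ → Ω → ℝ}
  [MeasurableEq X] [MeasurableSingletonClass X]

theorem hazard_properties (h : IsBoundedIBP P ℱ 𝒢 m α β c u b M R) (n : ℕ) {ω : Ω}
    (hω : ∀ i, IsSimple (M i ω)) :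
    IsFiniteMeasure (hazard m α β c M R n ω) ∧
      Nonempty (Fintype (atoms (hazard m α β c M R n ω))) ∧
      (∀ x, hazard m α β c M R n ω {x} ≤ 1) ∧
      hazard m α β c M R n ω (atoms (hazard m α β c M R n ω))ᶜ ≠ 0 ∧
      atoms (hazard m α β c M R n ω) = tried M n ω := by
  have := h.isProbabilityMeasure
  have hω' : ∀ i < n, IsSimple (M i ω) := fun i _ => hω i
  have hR : ∀ i, u ≤ R i ω := fun i => h.le_R i ω
  have hat := atoms_hazard (α := α) h.diffuse h.u_pos h.beta_lt_u h.c_gt hR hω'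
  refine ⟨isFiniteMeasure_hazard h.u_pos h.beta_lt_u h.c_gt hR (h.newRate_pos n ω).le hω', ?_,
    hazard_singleton_le h.diffuse h.u_pos h.beta_lt_u h.c_gt hR hω', ?_, hat⟩
  · rw [hat]; exact ⟨(finite_tried hω').fintype⟩
  · rw [hat, hazard_compl_tried h.diffuse hω']
    simpa using h.newRate_pos n ω

theorem ae_probSqSum_bounds (h : IsBoundedIBP P ℱ 𝒢 m α β c u b M R) (n : ℕ) :
    ∀ᵐ ω ∂P, 0 ≤ probSqSum β c M R n ω ∧ probSqSum β c M R n ω ≤ probSum β c M R n ω := by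
  filter_upwards [h.ae_forall_isSimple] with ω hω
  exact probSqSum_bounds h.u_pos h.beta_lt_u h.c_gt (fun i => h.le_R i ω) fun i _ => hω i

/-- The numbers of dishes and of new dishes and the sum of the old inclusion probabilities are all
integrals of a past-dependent function against the next measure; their conditional means are the
integrals against the hazard. -/
theorem condExp_lintegral_next (h : IsBoundedIBP P ℱ 𝒢 m α β c u b M R) (n : ℕ)
    {φ : Ω × X → ℝ≥0∞} (hφ : Measurable[(ℱ n).prod inferInstance] φ) (hφ1 : ∀ q, φ q ≠ ∞)
    {g : Ω → ℝ} (hg : Measurable[ℱ n] g) (hg0 : ∀ᵐ ω ∂P, 0 ≤ g ω) (hgi : Integrable g P)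
    (hφg : ∀ᵐ ω ∂P, ∫⁻ x, φ (ω, x) ∂hazard m α β c M R n ω = ENNReal.ofReal (g ω)) :
    Integrable (fun ω => (∫⁻ x, φ (ω, x) ∂M n ω).toReal) P ∧
      P[fun ω => (∫⁻ x, φ (ω, x) ∂M n ω).toReal | ℱ n] =ᵐ[P] g := by
  have hfin : ∀ᵐ ω ∂P, ∫⁻ x, φ (ω, x) ∂M n ω ≠ ∞ := by
    filter_upwards [h.ae_isSimple n] with ω hω
    obtain ⟨S, hS⟩ := hω.finite_points.exists_finset_coe
    have := hω.1
    rw [hω.lintegral_eq (F := S) fun x hx => by rw [← Finset.mem_coe, hS]; exact hx]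
    exact ENNReal.sum_ne_top.2 fun x _ => ENNReal.mul_ne_top (hφ1 _) (measure_ne_top _ _)
  refine integrable_and_condExp_eq_of_lintegral (ℱ.le n) ?_ (ae_of_all _ fun ω =>
    ENNReal.toReal_nonneg) hg.stronglyMeasurable hg0 hgi fun A hA => ?_
  · exact ((h.measurable_lintegral_next n hφ).mono ((h.mid_le n).trans (ℱ.le _))
      le_rfl).ennreal_toReal
  · rw [← lintegral_congr_ae (ae_restrict_of_ae hφg), ← h.setLIntegral_lintegral n hφ hA]
    refine lintegral_congr_ae (ae_restrict_of_ae ?_)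
    filter_upwards [hfin] with ω hω using ENNReal.ofReal_toReal hω

theorem integrable_newRate (h : IsBoundedIBP P ℱ 𝒢 m α β c u b M R) (n : ℕ) :
    Integrable (newRate α β c R n) P :=
  Integrable.of_bound ((h.measurable_newRate n).mono (ℱ.le n) le_rfl).aestronglyMeasurable
    (rateOf α β c (u * n)) (ae_of_all _ fun ω => by
      rw [Real.norm_of_nonneg (h.newRate_pos n ω).le]; exact h.newRate_le n ω)

theorem newDishes_condExp (h : IsBoundedIBP P ℱ 𝒢 m α β c u b M R) (n : ℕ) :
    Integrable (newDishes M n) P ∧ P[newDishes M n | ℱ n] =ᵐ[P] newRate α β c R n := by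
  have h1 := h.condExp_lintegral_next n (h.measurable_newIndicator n)
    (fun q => by rw [newIndicator]; exact ne_top_of_le_ne_top ENNReal.one_ne_top
                  (Set.indicator_le_self' (fun _ _ => zero_le) _))
    (h.measurable_newRate n) (ae_of_all _ fun ω => (h.newRate_pos n ω).le)
    (h.integrable_newRate n) (by
      have := h.isProbabilityMeasure
      filter_upwards [h.ae_forall_isSimple] with ω hω
      simp only [newIndicator]
      rw [lintegral_indicator_one (h.measurableSet_tried_section n ω).compl,
        hazard_compl_tried h.diffuse fun i _ => hω i])
  simpa only [← h.newDishes_eq n] using h1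

theorem dishes_condExp (h : IsBoundedIBP P ℱ 𝒢 m α β c u b M R) (n : ℕ)
    (hi : Integrable (probSum β c M R n) P) :
    Integrable (dishes M n) P ∧ P[dishes M n | ℱ n] =ᵐ[P]
      fun ω => probSum β c M R n ω + newRate α β c R n ω := by
  have h0 : ∀ᵐ ω ∂P, 0 ≤ probSum β c M R n ω := by
    filter_upwards [h.ae_probSqSum_bounds n] with ω hω using hω.1.trans hω.2
  have h1 := h.condExp_lintegral_next n (φ := fun _ => 1)
    (@measurable_const ℝ≥0∞ (Ω × X) _ ((ℱ n).prod inferInstance) 1) (fun _ => ENNReal.one_ne_top)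
    (g := fun ω => probSum β c M R n ω + newRate α β c R n ω)
    ((h.measurable_probSum n).add (h.measurable_newRate n))
    (by filter_upwards [h0] with ω hω using add_nonneg hω (h.newRate_pos n ω).le)
    (hi.add (h.integrable_newRate n)) (by
      have := h.isProbabilityMeasure
      filter_upwards [h.ae_forall_isSimple] with ω hω
      rw [lintegral_one, hazard_univ h.u_pos h.beta_lt_u h.c_gt (fun i => h.le_R i ω)
        (h.newRate_pos n ω).le fun i _ => hω i])
  simp only [lintegral_one] at h1
  exact h1

/-- Integrability alternates: that of the predictive mean gives that of the number of dishes, which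
enters the next predictive mean. The denominators stay above u + c > 0. -/
theorem integrable_probSum (h : IsBoundedIBP P ℱ 𝒢 m α β c u b M R) (n : ℕ) :
    Integrable (probSum β c M R n) P := by
  have hu := h.u_pos
  have huc : 0 < u + c := by linarith [h.c_gt, h.beta_lt_u]
  have hT0 : ∀ n ω, u * n ≤ totalWeight R n ω := fun n ω => by
    have := Finset.card_nsmul_le_sum (Finset.range n) (fun i => R i ω) u fun i _ => h.le_R i ω
    simp only [Finset.card_range, nsmul_eq_mul] at this
    rw [totalWeight]
    linarith
  induction n with
  | zero => exact integrable_zero _ _ _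
  | succ n ih =>
    have hT : ∀ ω, u + c ≤ totalWeight R (n + 1) ω + c := fun ω => by
      have := hT0 (n + 1) ω
      push_cast at this
      nlinarith [n.cast_nonneg (α := ℝ)]
    have hK := (h.dishes_condExp n ih).1
    have hN := (h.newDishes_condExp n).1
    have hmeas : ∀ k, Measurable (totalWeight R k) := fun k =>
      (h.measurable_totalWeight k).mono (ℱ.le _) le_rfl
    have hmR : Measurable (R n) := (h.measurable_R n).mono (ℱ.le _) le_rfl
    have hbd : ∀ ω, 0 ≤ totalWeight R n ω ∧ totalWeight R n ω ≤ b * n ∧ u ≤ R n ω ∧ R n ω ≤ b :=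
      fun ω => ⟨totalWeight_nonneg hu fun i => h.le_R i ω, by
        have := Finset.sum_le_card_nsmul (Finset.range n) (fun i => R i ω) b fun i _ => h.R_le i ω
        simp only [Finset.card_range, nsmul_eq_mul] at this
        rw [totalWeight]
        linarith, h.le_R n ω, h.R_le n ω⟩
    have h1 : Integrable (fun ω => probSum β c M R n ω * (totalWeight R n ω + c)
        + dishes M n ω * R n ω - β * newDishes M n ω) P := by
      refine ((ih.mul_bdd (c := b * n + |c|) ((hmeas n).add_const c).aestronglyMeasurable
        (ae_of_all _ fun ω => ?_)).add (hK.mul_bdd (c := b) hmR.aestronglyMeasurable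
        (ae_of_all _ fun ω => ?_))).sub (hN.const_mul β)
      · obtain ⟨h1, h2, -⟩ := hbd ω
        rw [Real.norm_eq_abs]
        refine (abs_add_le _ _).trans ?_
        rw [abs_of_nonneg h1]
        linarith
      · obtain ⟨-, -, h1, h2⟩ := hbd ω
        rw [Real.norm_of_nonneg (hu.le.trans h1)]
        exact h2
    have h2 := h1.mul_bdd (c := 1 / (u + c)) (g := fun ω => (totalWeight R (n + 1) ω + c)⁻¹)
      ((hmeas (n + 1)).add_const c).inv.aestronglyMeasurable (ae_of_all _ fun ω => by
        rw [Real.norm_of_nonneg (inv_nonneg.2 (huc.le.trans (hT ω))), ← one_div]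
        exact one_div_le_one_div_of_le huc (hT ω))
    refine h2.congr (ae_of_all _ fun ω => ?_)
    simp only [probSum]
    rw [div_eq_mul_inv]
    ring

theorem oldProbSum_condExp (h : IsBoundedIBP P ℱ 𝒢 m α β c u b M R) (n : ℕ) :
    Integrable (oldProbSum β c M R n) P ∧
      P[oldProbSum β c M R n | ℱ n] =ᵐ[P] probSqSum β c M R n := by
  refine h.condExp_lintegral_next n (h.measurable_oldProb n)
    (fun q => by
      classical
      rw [oldProb, Set.indicator_apply]
      split_ifs
      · exact ENNReal.ofReal_ne_top
      · exact ENNReal.zero_ne_top)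
    (h.measurable_probSqSum n) ?_ ?_ ?_
  · filter_upwards [h.ae_probSqSum_bounds n] with ω hω using hω.1
  · refine (h.integrable_probSum n).mono'
      ((h.measurable_probSqSum n).mono (ℱ.le _) le_rfl).aestronglyMeasurable ?_
    filter_upwards [h.ae_probSqSum_bounds n] with ω hω
    rw [Real.norm_of_nonneg hω.1]
    exact hω.2
  · have := h.isProbabilityMeasure
    filter_upwards [h.ae_forall_isSimple] with ω hω
    exact lintegral_hazard_indicator h.u_pos h.beta_lt_u h.c_gt (fun i => h.le_R i ω) h.diffuse
      fun i _ => hω i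

theorem newDishes_sq_condExp (h : IsBoundedIBP P ℱ 𝒢 m α β c u b M R) (n : ℕ) :
    Integrable (fun ω => newDishes M n ω ^ 2) P ∧ P[fun ω => newDishes M n ω ^ 2 | ℱ n] =ᵐ[P]
      fun ω => newRate α β c R n ω ^ 2 + newRate α β c R n ω := by
  have := h.isProbabilityMeasure
  have hfm := h.finite_M
  have hΛ0 := fun ω => (h.newRate_pos n ω).le
  refine integrable_and_condExp_eq_of_lintegral (ℱ.le n)
    (((h.measurable_newDishes n).mono ((h.mid_le n).trans (ℱ.le _)) le_rfl).pow_const 2)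
    (ae_of_all _ fun ω => sq_nonneg _)
    (((h.measurable_newRate n).pow_const 2).add (h.measurable_newRate n)).stronglyMeasurable
    (ae_of_all _ fun ω => add_nonneg (sq_nonneg _) (hΛ0 ω)) ?_ fun A hA => ?_
  · refine Integrable.add (Integrable.of_bound (((h.measurable_newRate n).mono (ℱ.le n)
      le_rfl).pow_const 2).aestronglyMeasurable (rateOf α β c (u * n) ^ 2)
      (ae_of_all _ fun ω => ?_)) (h.integrable_newRate n)
    rw [Real.norm_of_nonneg (sq_nonneg _)]
    exact pow_le_pow_left₀ (hΛ0 ω) (h.newRate_le n ω) 2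
  · have h1 := h.setLIntegral_condLaw n
      ((measurable_finIntegral_prod (h.measurable_newIndicator n)).pow_const 2) hA
    have h2 : ∀ ω (μ : Measure X), IsFiniteMeasure μ →
        finIntegral (fun x => newIndicator M n (ω, x)) μ = μ (tried M n ω)ᶜ := fun ω μ hμ => by
      rw [finIntegral_eq]
      simp only [newIndicator]
      rw [lintegral_indicator_one (h.measurableSet_tried_section n ω).compl]
    have h3 : ∀ ω, ENNReal.ofReal (newDishes M n ω ^ 2)
        = finIntegral (fun x => newIndicator M n (ω, x)) (M n ω) ^ 2 := fun ω => by
      rw [h2 ω _ (hfm n ω), newDishes, ENNReal.ofReal_pow measureReal_nonneg,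
        ofReal_measureReal (measure_ne_top _ _)]
    simp_rw [h3]
    rw [h1]
    refine lintegral_congr_ae (ae_restrict_of_ae ?_)
    filter_upwards [h.ae_forall_isSimple] with ω hω
    obtain ⟨hf, ⟨hF⟩, hν, hd, hat⟩ := h.hazard_properties n hω
    have h4 := lintegral_sq_compl_atoms_bernoulliLaw _ hd
    rw [hat, hazard_compl_tried h.diffuse fun i _ => hω i,
      ← ENNReal.ofReal_pow (hΛ0 ω), ← ENNReal.ofReal_add (sq_nonneg _) (hΛ0 ω)] at h4
    rw [← h4]
    refine lintegral_congr_ae ?_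
    filter_upwards [ae_isSimple_bernoulliLaw (hazard m α β c M R n ω)] with μ hμ
    rw [h2 ω μ hμ.1]

/-- The number of new dishes is conditionally Poisson, so the integral equals the expected rate. -/
theorem newDishes_sub_sq (h : IsBoundedIBP P ℱ 𝒢 m α β c u b M R) (n : ℕ) :
    Integrable (fun ω => (newDishes M n ω - newRate α β c R n ω) ^ 2) P ∧
      ∫ ω, (newDishes M n ω - newRate α β c R n ω) ^ 2 ∂P ≤ rateOf α β c (u * n) := by
  obtain ⟨h1, h2⟩ := h.newDishes_condExp n
  obtain ⟨h3, h4⟩ := h.newDishes_sq_condExp n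
  have hm : Measurable (newRate α β c R n) := (h.measurable_newRate n).mono (ℱ.le n) le_rfl
  have hb : ∀ᵐ ω ∂P, ‖newRate α β c R n ω‖ ≤ rateOf α β c (u * n) := ae_of_all _ fun ω => by
    rw [Real.norm_of_nonneg (h.newRate_pos n ω).le]; exact h.newRate_le n ω
  have h5 : Integrable (fun ω => newDishes M n ω * newRate α β c R n ω) P :=
    h1.mul_bdd hm.aestronglyMeasurable hb
  have h6 : Integrable (fun ω => newRate α β c R n ω ^ 2) P := by
    simpa only [pow_two] using (h.integrable_newRate n).mul_bdd hm.aestronglyMeasurable hb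
  have h7 : P[fun ω => newDishes M n ω * newRate α β c R n ω | ℱ n] =ᵐ[P]
      fun ω => newRate α β c R n ω * newRate α β c R n ω := by
    filter_upwards [condExp_mul_of_stronglyMeasurable_right (m := ℱ n)
      (h.measurable_newRate n).stronglyMeasurable h5 h1, h2] with ω h8 h9
    rw [show (fun ω => newDishes M n ω * newRate α β c R n ω)
      = newDishes M n * newRate α β c R n from rfl, h8, Pi.mul_apply, h9]
  have e1 := integral_condExp (ℱ.le n) (μ := P) (f := fun ω => newDishes M n ω ^ 2)
  have e2 := integral_condExp (ℱ.le n) (μ := P)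
    (f := fun ω => newDishes M n ω * newRate α β c R n ω)
  rw [integral_congr_ae h4, integral_add h6 (h.integrable_newRate n)] at e1
  rw [integral_congr_ae h7] at e2
  have h8 : ∀ ω, (newDishes M n ω - newRate α β c R n ω) ^ 2 = newDishes M n ω ^ 2
      - 2 * (newDishes M n ω * newRate α β c R n ω) + newRate α β c R n ω ^ 2 := fun ω => by ring
  simp_rw [h8]
  refine ⟨(h3.sub (h5.const_mul 2)).add h6, ?_⟩
  have e3 : ∫ ω, (newDishes M n ω ^ 2 - 2 * (newDishes M n ω * newRate α β c R n ω)
      + newRate α β c R n ω ^ 2) ∂P = ∫ ω, newDishes M n ω ^ 2 ∂P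
      - 2 * ∫ ω, newDishes M n ω * newRate α β c R n ω ∂P + ∫ ω, newRate α β c R n ω ^ 2 ∂P := by
    rw [← integral_const_mul, ← integral_sub h3 (h5.const_mul 2)]
    exact integral_add (h3.sub (h5.const_mul 2)) h6
  rw [e3, ← e1, ← e2]
  have h9 : ∫ ω, newRate α β c R n ω ∂P ≤ rateOf α β c (u * n) := by
    have := integral_mono (h.integrable_newRate n) (integrable_const (rateOf α β c (u * n)))
      fun ω => h.newRate_le n ω
    simpa using this
  simp_rw [← pow_two]
  linarith

end IsBoundedIBP

end WeightedIBP

namespace WeightedIBP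

namespace IsBoundedIBP

variable {Ω X : Type*} [MeasurableSpace X] {mΩ : MeasurableSpace Ω} {P : Measure Ω}
  [IsProbabilityMeasure P] {ℱ : Filtration ℕ mΩ} {𝒢 : ℕ → MeasurableSpace Ω} {m : Measure X}
  {α β c u b : ℝ} {M : ℕ → Ω → Measure X} {R : ℕ → Ω → ℝ}
  [MeasurableEq X] [MeasurableSingletonClass X]

theorem measurableSet_rate_le (h : IsBoundedIBP P ℱ 𝒢 m α β c u b M R) (a : ℝ) (n : ℕ) :
    MeasurableSet[ℱ n] {ω | probSum β c M R n ω + newRate α β c R n ω ≤ a} :=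
  ((h.measurable_probSum n).add (h.measurable_newRate n)) measurableSet_Iic

/-- The second moment formula of the Bernoulli law under the conditional law. The event bounds the
predictive mean, which secures integrability. -/
theorem condExp_indicator_dishes_sq (h : IsBoundedIBP P ℱ 𝒢 m α β c u b M R) (a : ℝ) (n : ℕ) :
    P[{ω | probSum β c M R n ω + newRate α β c R n ω ≤ a}.indicator
        fun ω => dishes M n ω ^ 2 | ℱ n] =ᵐ[P]
      {ω | probSum β c M R n ω + newRate α β c R n ω ≤ a}.indicator fun ω =>
        (probSum β c M R n ω + newRate α β c R n ω) ^ 2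
          + (probSum β c M R n ω + newRate α β c R n ω - probSqSum β c M R n ω) := by
  have := h.isProbabilityMeasure
  have hfm := h.finite_M
  set B := {ω | probSum β c M R n ω + newRate α β c R n ω ≤ a} with hB
  have hBm := h.measurableSet_rate_le a n
  have hJ := (h.measurable_probSum n).add (h.measurable_newRate n)
  have hg : Measurable[ℱ n] (B.indicator fun ω =>
      (probSum β c M R n ω + newRate α β c R n ω) ^ 2
        + (probSum β c M R n ω + newRate α β c R n ω - probSqSum β c M R n ω)) :=
    ((hJ.pow_const 2).add (hJ.sub (h.measurable_probSqSum n))).indicator hBm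
  have hbd : ∀ᵐ ω ∂P, 0 ≤ probSum β c M R n ω + newRate α β c R n ω ∧ 0 ≤ probSqSum β c M R n ω ∧
      0 ≤ probSum β c M R n ω + newRate α β c R n ω - probSqSum β c M R n ω := by
    filter_upwards [h.ae_probSqSum_bounds n] with ω hω
    have := h.newRate_pos n ω
    exact ⟨by linarith [hω.1, hω.2], hω.1, by linarith [hω.2]⟩
  refine (integrable_and_condExp_eq_of_lintegral (ℱ.le n) ?_ (ae_of_all _ fun ω =>
    Set.indicator_nonneg (fun ω _ => sq_nonneg _) ω) hg.stronglyMeasurable ?_ ?_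
    fun A hA => ?_).2
  · exact (((h.measurable_dishes n).mono ((h.mid_le n).trans (ℱ.le _)) le_rfl).pow_const
      2).indicator (ℱ.le n _ hBm)
  · filter_upwards [hbd] with ω hω
    by_cases hωB : ω ∈ B
    · rw [Set.indicator_of_mem hωB]; exact add_nonneg (sq_nonneg _) hω.2.2
    · rw [Set.indicator_of_notMem hωB]
  · refine Integrable.of_bound (hg.mono (ℱ.le n) le_rfl).aestronglyMeasurable (a ^ 2 + |a|) ?_
    filter_upwards [hbd] with ω hω
    by_cases hωB : ω ∈ B
    · rw [Set.indicator_of_mem hωB, Real.norm_of_nonneg (add_nonneg (sq_nonneg _) hω.2.2)]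
      have h1 : probSum β c M R n ω + newRate α β c R n ω ≤ a := hωB
      have h2 := pow_le_pow_left₀ hω.1 h1 2
      linarith [le_abs_self a, hω.2.1]
    · rw [Set.indicator_of_notMem hωB, norm_zero]; positivity
  · have h1 := h.setLIntegral_condLaw n (Φ := fun q => q.2 Set.univ ^ 2)
      (((Measure.measurable_coe MeasurableSet.univ).comp
        (@measurable_snd Ω (Measure X) (ℱ n) _)).pow_const 2) (hA.inter hBm)
    have e1 : ∀ f : Ω → ℝ, ∀ ω, ENNReal.ofReal (B.indicator f ω)
        = B.indicator (fun ω => ENNReal.ofReal (f ω)) ω := fun f ω => by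
      by_cases hω : ω ∈ B <;> simp [hω]
    simp_rw [e1]
    rw [setLIntegral_indicator (ℱ.le n _ hBm), setLIntegral_indicator (ℱ.le n _ hBm),
      Set.inter_comm B A]
    have h3 : ∀ ω, ENNReal.ofReal (dishes M n ω ^ 2) = M n ω Set.univ ^ 2 := fun ω => by
      rw [dishes, ENNReal.ofReal_pow measureReal_nonneg, ofReal_measureReal (measure_ne_top _ _)]
    simp_rw [h3]
    rw [h1]
    refine lintegral_congr_ae (ae_restrict_of_ae ?_)
    filter_upwards [h.ae_forall_isSimple, hbd] with ω hω hω'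
    obtain ⟨hf, ⟨hF⟩, hν, hd, hat⟩ := h.hazard_properties n hω
    have hR : ∀ i, u ≤ R i ω := fun i => h.le_R i ω
    have h4 := lintegral_sq_univ_bernoulliLaw _ hν hd
    rw [sum_atoms_hazard_sq h.u_pos h.beta_lt_u h.c_gt hR h.diffuse fun i _ => hω i,
      hazard_univ h.u_pos h.beta_lt_u h.c_gt hR (h.newRate_pos n ω).le fun i _ => hω i,
      ← ENNReal.ofReal_pow hω'.1, ← ENNReal.ofReal_add (sq_nonneg _) hω'.1] at h4
    refine ENNReal.eq_sub_of_add_eq ENNReal.ofReal_ne_top h4 |>.trans ?_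
    rw [← ENNReal.ofReal_sub _ hω'.2.1]
    congr 1
    ring

/-- Use x⁴ ≤ 24 eˣ and the exponential moment of the Bernoulli law, whose total hazard is at most
`a` on the event. -/
theorem dishes_fourth_moment (h : IsBoundedIBP P ℱ 𝒢 m α β c u b M R) (a : ℝ) (n : ℕ) :
    Integrable ({ω | probSum β c M R n ω + newRate α β c R n ω ≤ a}.indicator
        fun ω => dishes M n ω ^ 4) P ∧
      ∫ ω, {ω | probSum β c M R n ω + newRate α β c R n ω ≤ a}.indicator
        (fun ω => dishes M n ω ^ 4) ω ∂P ≤ 24 * Real.exp ((Real.exp 1 - 1) * a) := by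
  have := h.isProbabilityMeasure
  have hfm := h.finite_M
  set B := {ω | probSum β c M R n ω + newRate α β c R n ω ≤ a} with hB
  have hBm := h.measurableSet_rate_le a n
  have hf : Measurable (B.indicator fun ω => dishes M n ω ^ 4) :=
    (((h.measurable_dishes n).mono ((h.mid_le n).trans (ℱ.le _)) le_rfl).pow_const
      4).indicator (ℱ.le n _ hBm)
  have hf0 : 0 ≤ B.indicator fun ω => dishes M n ω ^ 4 :=
    Set.indicator_nonneg fun ω _ => by positivity
  have hexp : ∫⁻ ω in B, ENNReal.ofReal (Real.exp (dishes M n ω)) ∂P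
      ≤ ENNReal.ofReal (Real.exp ((Real.exp 1 - 1) * a)) := by
    have h1 := h.setLIntegral_condLaw n
      (Φ := fun q => ENNReal.ofReal (Real.exp (q.2.real Set.univ)))
      (Real.measurable_exp.comp (((Measure.measurable_coe MeasurableSet.univ).comp
        (@measurable_snd Ω (Measure X) (ℱ n) _)).ennreal_toReal)).ennreal_ofReal hBm
    change ∫⁻ ω in B, ENNReal.ofReal (Real.exp ((M n ω).real Set.univ)) ∂P ≤ _
    rw [h1]
    calc _ ≤ ∫⁻ ω in B, ENNReal.ofReal (Real.exp ((Real.exp 1 - 1) * a)) ∂P := by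
          refine lintegral_mono_ae ?_
          filter_upwards [ae_restrict_of_ae h.ae_forall_isSimple,
            ae_restrict_mem (ℱ.le n _ hBm)] with ω hω hωB
          obtain ⟨hf, ⟨hF⟩, hν, hd, hat⟩ := h.hazard_properties n hω
          have hR : ∀ i, u ≤ R i ω := fun i => h.le_R i ω
          have h0 := (probSqSum_bounds h.u_pos h.beta_lt_u h.c_gt hR (n := n) fun i _ => hω i)
          have h0' : 0 ≤ probSum β c M R n ω + newRate α β c R n ω :=
            add_nonneg (h0.1.trans h0.2) (h.newRate_pos n ω).le
          refine (lintegral_exp_univ_bernoulliLaw_le _ hν hd).trans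
            (ENNReal.ofReal_le_ofReal (Real.exp_le_exp.2 (mul_le_mul_of_nonneg_left ?_ ?_)))
          · rw [Measure.real, hazard_univ h.u_pos h.beta_lt_u h.c_gt hR (h.newRate_pos n ω).le
              fun i _ => hω i, ENNReal.toReal_ofReal h0']
            exact hωB
          · linarith [Real.add_one_le_exp (1 : ℝ)]
      _ ≤ _ := by
          rw [setLIntegral_const]
          exact mul_le_of_le_one_right zero_le prob_le_one
  have h4 : ∫⁻ ω, ENNReal.ofReal (B.indicator (fun ω => dishes M n ω ^ 4) ω) ∂P
      ≤ ENNReal.ofReal (24 * Real.exp ((Real.exp 1 - 1) * a)) := by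
    have e1 : ∀ ω, ENNReal.ofReal (B.indicator (fun ω => dishes M n ω ^ 4) ω)
        = B.indicator (fun ω => ENNReal.ofReal (dishes M n ω ^ 4)) ω := fun ω => by
      by_cases hω : ω ∈ B <;> simp [hω]
    simp_rw [e1]
    rw [lintegral_indicator (ℱ.le n _ hBm)]
    calc _ ≤ ∫⁻ ω in B, ENNReal.ofReal 24 * ENNReal.ofReal (Real.exp (dishes M n ω)) ∂P := by
          refine lintegral_mono fun ω => ?_
          rw [← ENNReal.ofReal_mul (by norm_num)]
          refine ENNReal.ofReal_le_ofReal ?_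
          have := Real.pow_div_factorial_le_exp (dishes M n ω) measureReal_nonneg 4
          rw [div_le_iff₀ (by positivity)] at this
          norm_num [Nat.factorial] at this
          linarith
      _ ≤ _ := by
          rw [lintegral_const_mul' _ _ ENNReal.ofReal_ne_top, ENNReal.ofReal_mul (by norm_num)]
          gcongr
  refine ⟨⟨hf.aestronglyMeasurable, ?_⟩, ?_⟩
  · rw [hasFiniteIntegral_iff_ofReal (ae_of_all _ hf0)]
    exact h4.trans_lt ENNReal.ofReal_lt_top
  · rw [integral_eq_lintegral_of_nonneg_ae (ae_of_all _ hf0) hf.aestronglyMeasurable]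
    exact ENNReal.toReal_le_of_le_ofReal (by positivity) h4

theorem isPredictiveSystem (h : IsBoundedIBP P ℱ 𝒢 m α β c u b M R) :
    IsPredictiveSystem P ℱ 𝒢 R (dishes M) (newDishes M) (oldProbSum β c M R) (newRate α β c R)
      (probSum β c M R) (probSqSum β c M R) β c u b fun n => rateOf α β c (u * n) where
  le_mid := h.le_mid
  mid_le := h.mid_le
  u_pos := h.u_pos
  beta_le := h.beta_lt_u.le
  u_add_c := by linarith [h.c_gt, h.beta_lt_u]
  measurable_R := h.measurable_R
  le_R := h.le_R
  R_le := h.R_le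
  indep_R := h.indep_R
  measurable_K := h.measurable_dishes
  measurable_N := h.measurable_newDishes
  measurable_C := h.measurable_oldProbSum
  measurable_Λ := h.measurable_newRate
  measurable_D := h.measurable_probSum
  measurable_G := h.measurable_probSqSum
  integrable_K n := (h.dishes_condExp n (h.integrable_probSum n)).1
  integrable_N n := (h.newDishes_condExp n).1
  integrable_C n := (h.oldProbSum_condExp n).1
  condExp_K n := (h.dishes_condExp n (h.integrable_probSum n)).2
  condExp_N n := (h.newDishes_condExp n).2
  condExp_C n := (h.oldProbSum_condExp n).2
  Λ_nonneg n ω := (h.newRate_pos n ω).le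
  Λ_le := h.newRate_le
  ℓ_tendsto := tendsto_rateOf h.alpha_pos h.beta_lt h.c_gt h.u_pos
  ℓ_summable := summable_rateOf_div h.alpha_pos h.beta_lt h.c_gt h.u_pos
  D_zero _ := rfl
  D_succ _ _ := rfl
  G_succ _ _ := rfl
  N_nonneg _ := ae_of_all _ fun _ => measureReal_nonneg
  G_nonneg n := (h.ae_probSqSum_bounds n).mono fun _ hω => hω.1
  G_le n := (h.ae_probSqSum_bounds n).mono fun _ hω => hω.2
  integrable_sq_N n := (h.newDishes_sub_sq n).1
  integral_sq_N n := (h.newDishes_sub_sq n).2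
  condExp_sq := h.condExp_indicator_dishes_sq
  fourth_moment a := ⟨_, h.dishes_fourth_moment a⟩

/-! ### Smoothing -/

/-- The rate of new dishes is so small that it may be dropped from the predictive mean and treated
as an error in the increments. The maximum in the bound covers both uses. -/
theorem isSmoothed_of_lt_half (h : IsBoundedIBP P ℱ 𝒢 m α β c u b M R) (hβ : β < 1 / 2) :
    IsPredictiveSystem.IsSmoothed R (dishes M) (newDishes M) (newRate α β c R)
      (probSum β c M R) (probSum β c M R)
      (fun n ω => (R n ω - β) * newRate α β c R n ω / (totalWeight R (n + 1) ω + c)) β c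
      fun n => max 1 ((b + |β|) / min u (u + c)) * rateOf α β c (u * n) where
  sub_eq n ω := by
    have h0 := h.isPredictiveSystem.totalWeight_pos n ω
    rw [h.isPredictiveSystem.D_sub, add_div]
  η_nonneg n := by
    have := rateOf_pos h.alpha_pos h.beta_lt h.c_gt (T := u * n) (by have := h.u_pos; positivity)
    positivity
  η_summable := by
    have := (summable_rateOf_sq h.alpha_pos hβ h.c_gt h.u_pos).mul_left
      (max 1 ((b + |β|) / min u (u + c)) ^ 2)
    simpa only [mul_pow] using this
  η_tendsto := by
    have := (tendsto_sqrt_mul_rateOf h.alpha_pos hβ h.c_gt h.u_pos).const_mul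
      (max 1 ((b + |β|) / min u (u + c)))
    rw [mul_zero] at this
    refine this.congr fun n => by ring
  e_le n ω := by
    have hS := h.isPredictiveSystem
    have h0 := hS.totalWeight_pos n ω
    have h1 := hS.mul_le_totalWeight n ω
    have h2 := h.newRate_pos n ω
    have h3 := hS.min_pos
    have h4 : |R n ω - β| ≤ b + |β| := by
      have := h.le_R n ω
      have := h.R_le n ω
      have := h.u_pos
      refine (abs_sub _ _).trans ?_
      rw [abs_of_nonneg (by linarith : 0 ≤ R n ω)]
      linarith
    have h5 : (0 : ℝ) ≤ b + |β| := (abs_nonneg _).trans h4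
    have h6 : 0 ≤ (b + |β|) * rateOf α β c (u * n) := mul_nonneg h5 (h2.le.trans (h.newRate_le n ω))
    rw [abs_mul, abs_div, abs_mul, abs_of_pos h0, abs_of_pos h2,
      abs_of_pos (by positivity : (0 : ℝ) < n + 1)]
    calc ((n : ℝ) + 1) * (|R n ω - β| * newRate α β c R n ω / (totalWeight R (n + 1) ω + c))
        ≤ ((n : ℝ) + 1) * ((b + |β|) * rateOf α β c (u * n) / (min u (u + c) * (n + 1))) := by
          refine mul_le_mul_of_nonneg_left (div_le_div₀ h6 (mul_le_mul h4 (h.newRate_le n ω)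
            h2.le h5) (mul_pos h3 (by positivity)) h1) (by positivity)
      _ = (b + |β|) / min u (u + c) * rateOf α β c (u * n) := by field_simp
      _ ≤ _ := mul_le_mul_of_nonneg_right (le_max_right _ _) (h2.le.trans (h.newRate_le n ω))
  sub_le n ω := by
    have h2 := h.newRate_pos n ω
    rw [add_sub_cancel_left, abs_of_pos h2]
    calc newRate α β c R n ω ≤ 1 * rateOf α β c (u * n) := by
          rw [one_mul]; exact h.newRate_le n ω
      _ ≤ _ := mul_le_mul_of_nonneg_right (le_max_left _ _) (h2.le.trans (h.newRate_le n ω))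

/-- The drift of `probSum` is (1 - β) times the rate over the new denominator, and the decrease of
the rate given by `rateOf_add_one` cancels it exactly. -/
theorem isSmoothed_of_eq_one (h : IsBoundedIBP P ℱ 𝒢 m α β c u b M R) (hR : ∀ n ω, R n ω = 1) :
    IsPredictiveSystem.IsSmoothed R (dishes M) (newDishes M) (newRate α β c R)
      (probSum β c M R) (fun n ω => probSum β c M R n ω + newRate α β c R n ω)
      (fun _ _ => 0) β c fun _ => 0 where
  sub_eq n ω := by
    have h0 := h.isPredictiveSystem.totalWeight_pos n ω
    have h1 := h.isPredictiveSystem.D_sub n ω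
    have h2 := IsPredictiveSystem.totalWeight_succ R n ω
    have h3 := rateOf_add_one (α := α) h.beta_lt h.c_gt
      (totalWeight_nonneg (n := n) h.u_pos fun i => h.le_R i ω)
    rw [hR] at h2
    rw [← h2, ← newRate_eq, ← newRate_eq, show c + 1 + totalWeight R n ω
      = totalWeight R (n + 1) ω + c by rw [h2]; ring] at h3
    have h4 : newRate α β c R (n + 1) ω
        = (c + β + totalWeight R n ω) * newRate α β c R n ω / (totalWeight R (n + 1) ω + c) := by
      rw [eq_div_iff h0.ne', ← h3, mul_comm]
    have h6 : probSum β c M R (n + 1) ω + newRate α β c R (n + 1) ω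
        - (probSum β c M R n ω + newRate α β c R n ω)
        = (probSum β c M R (n + 1) ω - probSum β c M R n ω)
          + (newRate α β c R (n + 1) ω - newRate α β c R n ω) := by ring
    have h7 : newRate α β c R (n + 1) ω - newRate α β c R n ω
        = (β - 1) * newRate α β c R n ω / (totalWeight R (n + 1) ω + c) := by
      rw [h4, eq_div_iff h0.ne', sub_mul, div_mul_cancel₀ _ h0.ne', h2]
      ring
    rw [h6, h1, h7, hR, ← add_div, add_zero]
    congr 1
    ring
  η_nonneg _ := le_rfl
  η_summable := by simp
  η_tendsto := by simp
  e_le n ω := by simp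
  sub_le n ω := by simp

end IsBoundedIBP

end WeightedIBP

namespace WeightedIBP

/-! ### Randomly reinforced urns

The weight `X` of one dish and the total weight `T`, on an event `E` of the past. -/

/-- `I n` indicates that the dish is tried at time `n`, in which case the weight `R n` is added to
its weight `X n`; the total weight `T n` increases by `R n` in any case. -/
structure IsUrn {Ω : Type*} {mΩ : MeasurableSpace Ω} (P : Measure Ω) (ℱ : Filtration ℕ mΩ)
    (𝒢 : ℕ → MeasurableSpace Ω) (E : Set Ω) (R I X T : ℕ → Ω → ℝ) (u b B : ℝ) : Prop where
  measurableSet_event : MeasurableSet[ℱ 0] E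
  le_mid : ∀ n, ℱ n ≤ 𝒢 n
  mid_le : ∀ n, 𝒢 n ≤ ℱ (n + 1)
  measurable_R : ∀ n, Measurable[ℱ (n + 1)] (R n)
  measurable_I : ∀ n, Measurable[𝒢 n] (I n)
  measurable_X : ∀ n, Measurable[ℱ n] (X n)
  measurable_T : ∀ n, Measurable[ℱ n] (T n)
  u_pos : 0 < u
  le_R : ∀ n ω, u ≤ R n ω
  R_le : ∀ n ω, R n ω ≤ b
  indep_R : ∀ n, Indep (MeasurableSpace.comap (R n) inferInstance) (𝒢 n) P
  T_zero_le : ∀ ω ∈ E, T 0 ω ≤ B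
  T_succ : ∀ n ω, T (n + 1) ω = T n ω + R n ω
  X_succ : ∀ n ω, X (n + 1) ω = X n ω + R n ω * I n ω
  I_eq : ∀ᵐ ω ∂P, ω ∈ E → ∀ n, I n ω = 0 ∨ I n ω = 1
  X_zero_pos : ∀ᵐ ω ∂P, ω ∈ E → 0 < X 0 ω
  X_zero_lt : ∀ᵐ ω ∂P, ω ∈ E → X 0 ω < T 0 ω
  condExp_I : ∀ n, P[E.indicator (I n) | ℱ n] =ᵐ[P] E.indicator fun ω => X n ω / T n ω

namespace IsUrn

variable {Ω : Type*} {mΩ : MeasurableSpace Ω} {P : Measure Ω} [IsProbabilityMeasure P]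
  {ℱ : Filtration ℕ mΩ} {𝒢 : ℕ → MeasurableSpace Ω} {E : Set Ω} {R I X T : ℕ → Ω → ℝ} {u b B : ℝ}

theorem ae_bounds (h : IsUrn P ℱ 𝒢 E R I X T u b B) :
    ∀ᵐ ω ∂P, ω ∈ E → 0 < X 0 ω ∧ (∀ n, I n ω = 0 ∨ I n ω = 1) ∧ Monotone (fun n => X n ω) ∧
      ∀ n, X 0 ω ≤ X n ω ∧ X n ω < T n ω ∧ T n ω ≤ B + b * n := by
  filter_upwards [h.I_eq, h.X_zero_pos, h.X_zero_lt] with ω h1 h2 h3 hE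
  have hu := h.u_pos
  have hmono : Monotone fun n => X n ω := monotone_nat_of_le_succ fun n => by
    have hR := h.le_R n ω
    simp only [h.X_succ]
    rcases h1 hE n with hI | hI <;> rw [hI] <;> linarith
  refine ⟨h2 hE, h1 hE, hmono, fun n => ⟨hmono n.zero_le, ?_⟩⟩
  induction n with
  | zero => exact ⟨h3 hE, by simpa using h.T_zero_le ω hE⟩
  | succ n ih =>
    have hR := h.le_R n ω
    have hR' := h.R_le n ω
    rw [h.X_succ, h.T_succ]
    push_cast
    refine ⟨?_, by linarith [ih.2]⟩
    rcases h1 hE n with hI | hI <;> rw [hI] <;> linarith [ih.1]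

theorem measurableSet_event' (h : IsUrn P ℱ 𝒢 E R I X T u b B) (n : ℕ) : MeasurableSet[ℱ n] E :=
  ℱ.mono n.zero_le _ h.measurableSet_event

theorem mid_le' (h : IsUrn P ℱ 𝒢 E R I X T u b B) (n : ℕ) : 𝒢 n ≤ mΩ := (h.mid_le n).trans (ℱ.le _)

theorem integrable_I (h : IsUrn P ℱ 𝒢 E R I X T u b B) (n : ℕ) :
    Integrable (E.indicator (I n)) P := by
  refine Integrable.of_bound (((h.measurable_I n).mono (h.mid_le' n) le_rfl).indicator
    (ℱ.le 0 _ h.measurableSet_event)).aestronglyMeasurable 1 ?_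
  filter_upwards [h.I_eq] with ω hω
  by_cases hE : ω ∈ E
  · rw [Set.indicator_of_mem hE]
    rcases hω hE n with hI | hI <;> simp [hI]
  · simp [hE]

/-- The urn is symmetric in the dish and the rest, so estimates from one side hold on both. -/
theorem complement (h : IsUrn P ℱ 𝒢 E R I X T u b B) :
    IsUrn P ℱ 𝒢 E R (fun n ω => 1 - I n ω) (fun n ω => T n ω - X n ω) T u b B where
  measurableSet_event := h.measurableSet_event
  le_mid := h.le_mid
  mid_le := h.mid_le
  measurable_R := h.measurable_R
  measurable_I n := (h.measurable_I n).const_sub 1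
  measurable_X n := (h.measurable_T n).sub (h.measurable_X n)
  measurable_T := h.measurable_T
  u_pos := h.u_pos
  le_R := h.le_R
  R_le := h.R_le
  indep_R := h.indep_R
  T_zero_le := h.T_zero_le
  T_succ := h.T_succ
  X_succ n ω := by rw [h.T_succ, h.X_succ]; ring
  I_eq := by
    filter_upwards [h.I_eq] with ω hω hE n
    rcases hω hE n with hI | hI <;> simp [hI]
  X_zero_pos := by filter_upwards [h.X_zero_lt] with ω hω hE using sub_pos.2 (hω hE)
  X_zero_lt := by
    filter_upwards [h.X_zero_pos] with ω hω hE
    linarith [hω hE]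
  condExp_I n := by
    have h1 : (E.indicator fun ω => 1 - I n ω) = E.indicator (fun _ => (1 : ℝ)) - E.indicator (I n) := by
      ext ω
      by_cases hE : ω ∈ E <;> simp [hE]
    have h2 : P[E.indicator (fun _ => (1 : ℝ)) | ℱ n] = E.indicator fun _ => (1 : ℝ) :=
      condExp_of_stronglyMeasurable (ℱ.le n)
        ((stronglyMeasurable_const).indicator (h.measurableSet_event' n))
        ((integrable_const _).indicator (ℱ.le 0 _ h.measurableSet_event))
    rw [h1]
    filter_upwards [condExp_sub ((integrable_const (1 : ℝ)).indicator
      (ℱ.le 0 _ h.measurableSet_event)) (h.integrable_I n) (ℱ n), h.condExp_I n, h.ae_bounds]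
      with ω h3 h4 h5
    rw [h3, Pi.sub_apply, h4, h2]
    by_cases hE : ω ∈ E
    · obtain ⟨h6, -, -, h7⟩ := h5 hE
      have : T n ω ≠ 0 := by linarith [(h7 n).1, (h7 n).2.1]
      simp only [Set.indicator_of_mem hE]
      field_simp
    · simp [hE]

/-- The dish is tried infinitely often. -/
theorem tendsto_atTop (h : IsUrn P ℱ 𝒢 E R I X T u b B) :
    ∀ᵐ ω ∂P, ω ∈ E → Tendsto (fun n => X n ω) atTop atTop := by
  -- The index is shifted by one because the conditional Borel–Cantelli lemma wants the n-th event
  -- known at time n.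
  let s : ℕ → Set Ω := fun n => E ∩ {ω | 0 < n ∧ I (n - 1) ω = 1}
  have hs : ∀ n, MeasurableSet[ℱ n] (s n) := fun n => by
    cases n with
    | zero => simp [s]
    | succ k =>
      simp only [s, Nat.succ_pos, true_and, Nat.add_sub_cancel]
      exact (h.measurableSet_event' _).inter
        (((h.measurable_I k).mono (h.mid_le k) le_rfl) (measurableSet_singleton 1))
  have hI : ∀ k, P[(s (k + 1)).indicator (1 : Ω → ℝ) | ℱ k] =ᵐ[P]
      E.indicator fun ω => X k ω / T k ω := fun k => by
    refine EventuallyEq.trans (condExp_congr_ae ?_) (h.condExp_I k)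
    filter_upwards [h.I_eq] with ω hω
    by_cases hE : ω ∈ E
    · rcases hω hE k with h0 | h0 <;> simp [s, hE, h0]
    · simp [s, hE]
  filter_upwards [ae_mem_limsup_atTop_iff P hs, ae_all_iff.2 hI, h.ae_bounds] with ω h1 h2 h3 hE
  obtain ⟨hX0, hI01, hmono, hbd⟩ := h3 hE
  have hu := h.u_pos
  have hub : u ≤ b := (h.le_R 0 ω).trans (h.R_le 0 ω)
  have hB : 0 < B := by
    have := (hbd 0).2.2
    simp only [CharP.cast_eq_zero, mul_zero, add_zero] at this
    linarith [(hbd 0).2.1]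
  have hmem : ω ∈ limsup s atTop := by
    rw [h1]
    -- The weight never falls below its initial value and the total grows at most linearly, so the
    -- conditional probabilities dominate a multiple of the harmonic series.
    have h4 := (Real.tendsto_sum_range_one_div_nat_succ_atTop).const_mul_atTop
      (div_pos hX0 (hB.trans_le (le_max_left B b)))
    refine tendsto_atTop_mono (fun n => ?_) h4
    rw [Finset.mul_sum]
    refine Finset.sum_le_sum fun k _ => ?_
    rw [h2 k, Set.indicator_of_mem hE, div_mul_div_comm, mul_one]
    refine div_le_div₀ (hX0.le.trans (hbd k).1) (hbd k).1 (by linarith [(hbd k).1, (hbd k).2.1])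
      ((hbd k).2.2.trans ?_)
    nlinarith [le_max_left B b, mul_le_mul_of_nonneg_right (le_max_right B b) (k.cast_nonneg (α := ℝ))]
  rcases tendsto_of_monotone hmono with hl | ⟨l, hl⟩
  · exact hl
  -- A convergent weight would have vanishing increments, but infinitely many of them are at least
  -- u.
  · exfalso
    have h5 : Tendsto (fun n => X (n + 1) ω - X n ω) atTop (𝓝 (l - l)) :=
      ((tendsto_add_atTop_iff_nat 1).2 hl).sub hl
    rw [sub_self] at h5
    obtain ⟨N, hN⟩ := eventually_atTop.1 (h5.eventually (gt_mem_nhds hu))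
    rw [mem_limsup_iff_frequently_mem] at hmem
    obtain ⟨n, hn, hns⟩ := frequently_atTop.1 hmem (N + 1)
    obtain ⟨k, rfl⟩ : ∃ k, n = k + 1 := ⟨n - 1, by omega⟩
    have h6 := hN k (by omega)
    rw [h.X_succ, show I k ω = 1 from hns.2.2] at h6
    linarith [h.le_R k ω]

end IsUrn

end WeightedIBP

namespace WeightedIBP

/-- The left side is the mean of the shifted inverse proportion after a draw with weight r. The
difference of the two sides is r(b - r)(t - x) over a positive denominator; the shift by the bound b
is what makes its sign right for every weight r ≤ b. -/
theorem urn_ratio_le {x t r b : ℝ} (hb : 0 < b) (hx : b < x) (hxt : x < t) (hr : 0 < r)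
    (hrb : r ≤ b) :
    (t + r - b) * (x / t / (x + r - b) + (1 - x / t) / (x - b)) ≤ (t - b) / (x - b) := by
  have h1 : 0 < x - b := sub_pos.2 hx
  have h2 : 0 < x + r - b := by linarith
  have h3 : 0 < t := by linarith
  have h4 : (t - b) / (x - b) - (t + r - b) * (x / t / (x + r - b) + (1 - x / t) / (x - b))
      = r * (b - r) * (t - x) / (t * (x - b) * (x + r - b)) := by
    field_simp
    ring
  have h5 : 0 ≤ r * (b - r) * (t - x) / (t * (x - b) * (x + r - b)) :=
    div_nonneg (mul_nonneg (mul_nonneg hr.le (sub_nonneg.2 hrb)) (sub_nonneg.2 hxt.le))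
      (by positivity)
  linarith

namespace IsUrn

variable {Ω : Type*} {mΩ : MeasurableSpace Ω} {P : Measure Ω} [IsProbabilityMeasure P]
  {ℱ : Filtration ℕ mΩ} {𝒢 : ℕ → MeasurableSpace Ω} {E : Set Ω} {R I X T : ℕ → Ω → ℝ} {u b B : ℝ}

theorem b_pos (h : IsUrn P ℱ 𝒢 E R I X T u b B) : 0 < b := by
  obtain ⟨ω⟩ := nonempty_of_isProbabilityMeasure P
  exact h.u_pos.trans_le ((h.le_R 0 ω).trans (h.R_le 0 ω))

theorem ae_ratio_bounds (h : IsUrn P ℱ 𝒢 E R I X T u b B) (n : ℕ) {F : Set Ω} (hFE : F ⊆ E)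
    (hFX : ∀ᵐ ω ∂P, ω ∈ F → b + 1 ≤ X n ω) :
    ∀ᵐ ω ∂P, 0 ≤ F.indicator (fun ω => (T n ω - b) / (X n ω - b)) ω ∧
      F.indicator (fun ω => (T n ω - b) / (X n ω - b)) ω ≤ |B| + b * n := by
  have hb := h.b_pos
  filter_upwards [h.ae_bounds, hFX] with ω h1 h2
  by_cases hω : ω ∈ F
  · obtain ⟨-, -, -, h3⟩ := h1 (hFE hω)
    have h4 := h2 hω
    have h5 := h3 n
    rw [Set.indicator_of_mem hω]
    refine ⟨div_nonneg (by linarith) (by linarith),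
      (div_le_self (by linarith) (by linarith)).trans ?_⟩
    linarith [le_abs_self B]
  · rw [Set.indicator_of_notMem hω]
    exact ⟨le_rfl, by positivity⟩

theorem measurable_ratio (h : IsUrn P ℱ 𝒢 E R I X T u b B) (n : ℕ) {F : Set Ω}
    (hF : MeasurableSet F) : Measurable (F.indicator fun ω => (T n ω - b) / (X n ω - b)) :=
  ((((h.measurable_T n).mono (ℱ.le n) le_rfl).sub_const b).div
    (((h.measurable_X n).mono (ℱ.le n) le_rfl).sub_const b)).indicator hF

theorem integrable_ratio (h : IsUrn P ℱ 𝒢 E R I X T u b B) (n : ℕ) {F : Set Ω}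
    (hF : MeasurableSet F) (hFE : F ⊆ E) (hFX : ∀ᵐ ω ∂P, ω ∈ F → b + 1 ≤ X n ω) :
    Integrable (F.indicator fun ω => (T n ω - b) / (X n ω - b)) P := by
  refine Integrable.of_bound (h.measurable_ratio n hF).aestronglyMeasurable (|B| + b * n) ?_
  filter_upwards [h.ae_ratio_bounds n hFE hFX] with ω hω
  rw [Real.norm_of_nonneg hω.1]
  exact hω.2

theorem condExp_centered (h : IsUrn P ℱ 𝒢 E R I X T u b B) (n : ℕ) {F : Set Ω}
    (hF : MeasurableSet[ℱ n] F) (hFE : F ⊆ E) :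
    Integrable (F.indicator fun ω => I n ω - X n ω / T n ω) P ∧
      P[F.indicator fun ω => I n ω - X n ω / T n ω | ℱ n] =ᵐ[P] 0 := by
  have hp : Integrable (E.indicator fun ω => X n ω / T n ω) P :=
    integrable_condExp.congr (h.condExp_I n)
  have e : (F.indicator fun ω => I n ω - X n ω / T n ω)
      = F.indicator (E.indicator (I n) - E.indicator fun ω => X n ω / T n ω) := by
    ext ω
    by_cases hω : ω ∈ F
    · simp [hω, hFE hω]
    · simp [hω]
  have hi := (h.integrable_I n).sub hp
  rw [e]
  refine ⟨hi.indicator (ℱ.le n _ hF), ?_⟩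
  have hpm : StronglyMeasurable[ℱ n] (E.indicator fun ω => X n ω / T n ω) :=
    (((h.measurable_X n).div (h.measurable_T n)).indicator
      (h.measurableSet_event' n)).stronglyMeasurable
  filter_upwards [condExp_indicator hi hF, condExp_sub (h.integrable_I n) hp (ℱ n), h.condExp_I n]
    with ω h1 h2 h3
  rw [h1]
  by_cases hω : ω ∈ F
  · rw [Set.indicator_of_mem hω, h2, Pi.sub_apply, h3, condExp_of_stronglyMeasurable (ℱ.le n) hpm hp,
      sub_self]
    rfl
  · rw [Set.indicator_of_notMem hω]
    rfl

/-- The new ratio is its mean over the draw plus (I - X/T) times a function of the weights. The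
second term integrates to zero, since the weight is independent of the draw; the first is controlled
by `urn_ratio_le`. -/
theorem integral_ratio_succ_le (h : IsUrn P ℱ 𝒢 E R I X T u b B) (n : ℕ) {F : Set Ω}
    (hF : MeasurableSet[ℱ n] F) (hFE : F ⊆ E) (hFX : ∀ᵐ ω ∂P, ω ∈ F → b + 1 ≤ X n ω) :
    ∫ ω, F.indicator (fun ω => (T (n + 1) ω - b) / (X (n + 1) ω - b)) ω ∂P
      ≤ ∫ ω, F.indicator (fun ω => (T n ω - b) / (X n ω - b)) ω ∂P := by
  have hu := h.u_pos
  have hb := h.b_pos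
  have hmF := ℱ.le n _ hF
  have hFX' : ∀ᵐ ω ∂P, ω ∈ F → b + 1 ≤ X (n + 1) ω := by
    filter_upwards [h.ae_bounds, hFX] with ω h1 h2 hω
    exact (h2 hω).trans ((h1 (hFE hω)).2.2.1 n.le_succ)
  -- The values possible on `F` at time n; requiring b + 1 rather than b keeps the denominators at
  -- least 1.
  let W : Set ((ℝ × ℝ) × ℝ) := {z | b + 1 ≤ z.1.1 ∧ z.1.1 ≤ z.1.2 ∧ z.1.2 ≤ B + b * n ∧
    0 ≤ z.2 ∧ z.2 ≤ b}
  have hW : MeasurableSet W := by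
    have hx : Measurable fun z : (ℝ × ℝ) × ℝ => z.1.1 := by fun_prop
    have ht : Measurable fun z : (ℝ × ℝ) × ℝ => z.1.2 := by fun_prop
    exact (measurableSet_le measurable_const hx).inter ((measurableSet_le hx ht).inter
      ((measurableSet_le ht measurable_const).inter ((measurableSet_le measurable_const
      measurable_snd).inter (measurableSet_le measurable_snd measurable_const))))
  let φ : (ℝ × ℝ) × ℝ → ℝ := W.indicator fun z =>
    (z.1.2 + z.2 - b) * (1 / (z.1.1 + z.2 - b) - 1 / (z.1.1 - b))
  have hφ : Measurable φ := Measurable.indicator (by fun_prop) hW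
  have hφB : ∀ z, |φ z| ≤ (|B| + b * n) * 1 := fun z => by
    by_cases hz : z ∈ W
    · simp only [φ]
      rw [Set.indicator_of_mem hz, abs_mul]
      obtain ⟨h1, h2, h3, h4, h5⟩ := hz
      have h6 : 1 / (z.1.1 + z.2 - b) ≤ 1 / (z.1.1 - b) :=
        one_div_le_one_div_of_le (by linarith) (by linarith)
      have h7 : 0 ≤ 1 / (z.1.1 + z.2 - b) := one_div_nonneg.2 (by linarith)
      have h8 : 1 / (z.1.1 - b) ≤ 1 := (div_le_one (by linarith)).2 (by linarith)
      refine mul_le_mul ?_ ?_ (abs_nonneg _) (by positivity)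
      · rw [abs_of_nonneg (by linarith)]
        linarith [le_abs_self B]
      · rw [abs_of_nonpos (by linarith)]
        linarith
    · simp only [φ, Set.indicator_of_notMem hz, abs_zero]
      positivity
  obtain ⟨hζi, hζ0⟩ := h.condExp_centered n hF hFE
  have hTm : Measurable[ℱ n] fun ω => (X n ω, T n ω) := (h.measurable_X n).prodMk (h.measurable_T n)
  have hRm : Measurable (R n) := (h.measurable_R n).mono (ℱ.le _) le_rfl
  have hζm : StronglyMeasurable[𝒢 n] (F.indicator fun ω => I n ω - X n ω / T n ω) :=
    (((h.measurable_I n).sub (((h.measurable_X n).div (h.measurable_T n)).mono (h.le_mid n)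
      le_rfl)).indicator (h.le_mid n _ hF)).stronglyMeasurable
  have h0 := condExp_mul_indep_eq_zero (h.le_mid n) (h.mid_le' n) hζm hζi hζ0 hTm hRm (h.indep_R n)
    hφ hφB
  have hint : Integrable (fun ω => F.indicator (fun ω => I n ω - X n ω / T n ω) ω
      * φ ((X n ω, T n ω), R n ω)) P :=
    hζi.mul_bdd (c := (|B| + b * n) * 1)
      (hφ.comp ((hTm.mono (ℱ.le n) le_rfl).prodMk hRm)).aestronglyMeasurable
      (ae_of_all _ fun ω => hφB _)
  have h1 := integral_condExp (ℱ.le n) (μ := P) (f := fun ω =>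
    F.indicator (fun ω => I n ω - X n ω / T n ω) ω * φ ((X n ω, T n ω), R n ω))
  rw [integral_congr_ae h0] at h1
  simp only [Pi.zero_apply, integral_zero] at h1
  have h2 := h.integrable_ratio n hmF hFE hFX
  rw [← add_zero (∫ ω, F.indicator (fun ω => (T n ω - b) / (X n ω - b)) ω ∂P), h1,
    ← integral_add h2 hint]
  refine integral_mono_ae (h.integrable_ratio (n + 1) hmF hFE hFX') (h2.add hint) ?_
  filter_upwards [h.ae_bounds, hFX] with ω h3 h4
  by_cases hω : ω ∈ F
  · obtain ⟨-, hI, -, h5⟩ := h3 (hFE hω)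
    have h6 := h4 hω
    have hR := h.le_R n ω
    have hR' := h.R_le n ω
    have h7 : ((X n ω, T n ω), R n ω) ∈ W :=
      ⟨h6, (h5 n).2.1.le, (h5 n).2.2, by simp only; linarith, hR'⟩
    have h8 := urn_ratio_le hb (by linarith : b < X n ω) (h5 n).2.1 (hu.trans_le hR) hR'
    simp only [Set.indicator_of_mem hω, φ, Set.indicator_of_mem h7]
    refine le_trans (le_of_eq ?_) (add_le_add_left h8 _)
    rw [h.T_succ, h.X_succ]
    rcases hI n with hI | hI <;> rw [hI] <;> ring
  · simp [hω]

/-- The share of the dish does not converge to `0` or to `1`. -/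
theorem not_tendsto_zero (h : IsUrn P ℱ 𝒢 E R I X T u b B) :
    ∀ᵐ ω ∂P, ω ∈ E →
      ¬ Tendsto (fun n => X n ω / T n ω * (1 - X n ω / T n ω)) atTop (𝓝 0) := by
  have hb := h.b_pos
  have hc := h.complement
  -- From time k on both colours exceed b + 1, by monotonicity. Both tend to infinity, so these
  -- events exhaust `E` up to a null set.
  let F : ℕ → Set Ω := fun k => E ∩ ({ω | b + 1 ≤ X k ω} ∩ {ω | b + 1 ≤ T k ω - X k ω})
  have hF : ∀ k, MeasurableSet[ℱ k] (F k) := fun k => (h.measurableSet_event' k).inter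
    (((h.measurable_X k) measurableSet_Ici).inter ((hc.measurable_X k) measurableSet_Ici))
  have hFE : ∀ k, F k ⊆ E := fun k => Set.inter_subset_left
  have hfat : ∀ k, ∀ᵐ ω ∂P, ω ∈ F k →
      ¬ Tendsto (fun n => X n ω / T n ω * (1 - X n ω / T n ω)) atTop (𝓝 0) := fun k => by
    have hX : ∀ n, k ≤ n → ∀ᵐ ω ∂P, ω ∈ F k → b + 1 ≤ X n ω := fun n hn => by
      filter_upwards [h.ae_bounds] with ω h1 hω
      exact hω.2.1.trans ((h1 hω.1).2.2.1 hn)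
    have hY : ∀ n, k ≤ n → ∀ᵐ ω ∂P, ω ∈ F k → b + 1 ≤ T n ω - X n ω := fun n hn => by
      filter_upwards [hc.ae_bounds] with ω h1 hω
      exact hω.2.2.trans ((h1 hω.1).2.2.1 hn)
    have hm := ℱ.le k _ (hF k)
    let f : ℕ → Ω → ℝ := fun n => (F k).indicator (fun ω => (T n ω - b) / (X n ω - b))
    let g : ℕ → Ω → ℝ := fun n => (F k).indicator (fun ω => (T n ω - b) / (T n ω - X n ω - b))
    have hbd : ∀ n, ∫ ω, f (n + k) ω ∂P ≤ ∫ ω, f k ω ∂P ∧ ∫ ω, g (n + k) ω ∂P ≤ ∫ ω, g k ω ∂P := by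
      intro n
      induction n with
      | zero => simp
      | succ n ih =>
        rw [show n + 1 + k = n + k + 1 by ring]
        exact ⟨(h.integral_ratio_succ_le (n + k) (ℱ.mono (by omega) _ (hF k)) (hFE k)
          (hX _ (by omega))).trans ih.1, (hc.integral_ratio_succ_le (n + k)
          (ℱ.mono (by omega) _ (hF k)) (hFE k) (hY _ (by omega))).trans ih.2⟩
    have hmeas : ∀ n, Measurable fun ω => ENNReal.ofReal (f (n + k) ω + g (n + k) ω) := fun n =>
      ((h.measurable_ratio _ hm).add (hc.measurable_ratio _ hm)).ennreal_ofReal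
    have hlin : ∀ n, ∫⁻ ω, ENNReal.ofReal (f (n + k) ω + g (n + k) ω) ∂P
        ≤ ENNReal.ofReal (∫ ω, f k ω ∂P + ∫ ω, g k ω ∂P) := fun n => by
      have hfi := h.integrable_ratio (n + k) hm (hFE k) (hX _ (by omega))
      have hgi := hc.integrable_ratio (n + k) hm (hFE k) (hY _ (by omega))
      have h0 : 0 ≤ᵐ[P] fun ω => f (n + k) ω + g (n + k) ω := by
        filter_upwards [h.ae_ratio_bounds (n + k) (hFE k) (hX _ (by omega)),
          hc.ae_ratio_bounds (n + k) (hFE k) (hY _ (by omega))] with ω h1 h2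
        exact add_nonneg h1.1 h2.1
      rw [← ofReal_integral_eq_lintegral_ofReal (f := fun ω => f (n + k) ω + g (n + k) ω)
        (hfi.add hgi) h0]
      refine ENNReal.ofReal_le_ofReal ?_
      exact (integral_add hfi hgi).le.trans (add_le_add (hbd n).1 (hbd n).2)
    -- By Fatou's lemma the lower limit of the sum of the two ratios is integrable, hence almost
    -- surely finite.
    have hlim : ∫⁻ ω, liminf (fun n => ENNReal.ofReal (f (n + k) ω + g (n + k) ω)) atTop ∂P < ∞ := by
      refine (lintegral_liminf_le hmeas).trans_lt (lt_of_le_of_lt ?_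
        (ENNReal.ofReal_lt_top (r := ∫ ω, f k ω ∂P + ∫ ω, g k ω ∂P)))
      exact liminf_le_of_le (by isBoundedDefault) fun a ha => by
        obtain ⟨n, hn⟩ := ha.exists
        exact hn.trans (hlin n)
    filter_upwards [ae_lt_top (.liminf hmeas) hlim.ne, h.ae_bounds, hc.ae_bounds] with ω h1 h2 h2' hω h3
    obtain ⟨hX0, -, hmono, h4⟩ := h2 hω.1
    obtain ⟨-, -, hmono', -⟩ := h2' hω.1
    refine absurd (Tendsto.liminf_eq ?_) h1.ne
    refine ENNReal.tendsto_ofReal_atTop.comp ?_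
    have h5 : Tendsto (fun n => (X (n + k) ω / T (n + k) ω * (1 - X (n + k) ω / T (n + k) ω))⁻¹)
        atTop atTop := by
      refine tendsto_inv_nhdsGT_zero.comp (tendsto_nhdsWithin_iff.2
        ⟨(tendsto_add_atTop_iff_nat (f := fun n => X n ω / T n ω * (1 - X n ω / T n ω)) k).2 h3,
          Eventually.of_forall fun n => ?_⟩)
      have h6 := h4 (n + k)
      have h7 : 0 < T (n + k) ω := by linarith
      exact mul_pos (div_pos (by linarith) h7) (sub_pos.2 ((div_lt_one h7).2 h6.2.1))
    refine tendsto_atTop_mono (fun n => ?_) h5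
    have h6 : b + 1 ≤ X (n + k) ω := hω.2.1.trans (hmono (by omega))
    have h7 : b + 1 ≤ T (n + k) ω - X (n + k) ω := hω.2.2.trans (hmono' (by omega))
    simp only [f, g, Set.indicator_of_mem hω]
    generalize X (n + k) ω = x at h6 h7 ⊢
    generalize T (n + k) ω = t at h6 h7 ⊢
    have hx : 0 < x := by linarith
    have hy : 0 < t - x := by linarith
    have ht : 0 < t := by linarith
    -- Subtracting b from numerator and denominator increases each fraction, so the two ratios
    -- dominate the inverse of p(1 - p), which would tend to infinity.
    have h8 : (x / t * (1 - x / t))⁻¹ = t / x + t / (t - x) := by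
      field_simp
      ring
    rw [h8]
    refine add_le_add ?_ ?_
    · rw [div_le_div_iff₀ hx (by linarith)]
      nlinarith
    · rw [div_le_div_iff₀ hy (by linarith)]
      nlinarith
  have hc' := hc.tendsto_atTop
  filter_upwards [h.tendsto_atTop, hc', ae_all_iff.2 hfat] with ω h1 h2 h3 hE
  obtain ⟨k, h4, h5⟩ := (((h1 hE).eventually_ge_atTop (b + 1)).and
    ((h2 hE).eventually_ge_atTop (b + 1))).exists
  exact h3 k ⟨hE, h4, h5⟩

end IsUrn

end WeightedIBP

namespace WeightedIBP

/-! ### Following one dish as an urn -/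

section Point

variable {X : Type*} [MeasurableSpace X] [MeasurableSingletonClass X] {μ : Measure X} {A : Set X}

theorem IsSimple.exists_unique_point (h : IsSimple μ) (hA : μ A = 1) :
    ∃ x ∈ A, μ {x} = 1 ∧ ∀ y ∈ A, y ≠ x → μ {y} = 0 := by
  have h0 : ∃ x ∈ A, μ {x} = 1 := by
    by_contra! hne
    have h1 : μ A = 0 := measure_mono_null (t := {x | ¬ μ {x} = 1}) (fun x hx => hne x hx)
      (ae_iff.1 h.2)
    rw [h1] at hA
    exact zero_ne_one hA
  obtain ⟨x, hxA, hx⟩ := h0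
  refine ⟨x, hxA, hx, fun y hyA hyx => (h.singleton_eq y).resolve_right fun hy => ?_⟩
  have h2 : μ {x, y} ≤ μ A := measure_mono (Set.insert_subset hxA (Set.singleton_subset_iff.2 hyA))
  rw [Set.insert_eq, measure_union (Set.disjoint_singleton.2 hyx.symm) (measurableSet_singleton y),
    hx, hy, hA] at h2
  norm_num at h2

/-- If the customer has exactly one dish in `A`, the mass function of the customer cut to `A` is the
indicator of that dish. Integrating against it follows the dish measurably, without selecting it. -/
theorem lintegral_indicator_mul_mass {x : X} (hxA : x ∈ A) (hx : μ {x} = 1)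
    (h : ∀ y ∈ A, y ≠ x → μ {y} = 0) (ν : Measure X) (φ : X → ℝ≥0∞) :
    ∫⁻ y, A.indicator 1 y * μ {y} * φ y ∂ν = φ x * ν {x} := by
  have h1 : ∀ y, A.indicator 1 y * μ {y} * φ y = ({x} : Set X).indicator (fun _ => φ x) y :=
    fun y => by
      by_cases hy : y = x
      · subst hy
        simp [hxA, hx]
      · by_cases hyA : y ∈ A
        · simp [hy, h y hyA hy]
        · simp [hy, hyA]
  simp_rw [h1]
  rw [lintegral_indicator_const (measurableSet_singleton x)]

end Point

/-- The filtration after time `k`. -/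
def shiftFiltration {Ω : Type*} {mΩ : MeasurableSpace Ω} (ℱ : Filtration ℕ mΩ) (k : ℕ) :
    Filtration ℕ mΩ where
  seq n := ℱ (k + n)
  mono' _ _ hij := ℱ.mono (by omega)
  le' n := ℱ.le (k + n)

/-- Whether a dish of customer `i + 1` that lies in `A` is tried by customer `k + n + 1`. -/
def triedAgain {Ω X : Type*} [MeasurableSpace X] (M : ℕ → Ω → Measure X) (A : Set X) (i k n : ℕ)
    (ω : Ω) : ℝ :=
  (∫⁻ x, A.indicator 1 x * M i ω {x} * 1 ∂M (k + n) ω).toReal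

/-- The weight of the dish of customer `i + 1` that lies in `A`. -/
def pickedWeight {Ω X : Type*} [MeasurableSpace X] (M : ℕ → Ω → Measure X) (R : ℕ → Ω → ℝ) (β : ℝ)
    (A : Set X) (i k n : ℕ) (ω : Ω) : ℝ :=
  (∫⁻ x, A.indicator 1 x * M i ω {x} * ENNReal.ofReal (dishWeight M R k ω x) ∂M i ω).toReal - β
    + ∑ j ∈ Finset.range n, R (k + j) ω * triedAgain M A i k j ω

namespace IsBoundedIBP

variable {Ω X : Type*} [MeasurableSpace X] {mΩ : MeasurableSpace Ω} {P : Measure Ω}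
  [IsProbabilityMeasure P] {ℱ : Filtration ℕ mΩ} {𝒢 : ℕ → MeasurableSpace Ω} {m : Measure X}
  {α β c u b : ℝ} {M : ℕ → Ω → Measure X} {R : ℕ → Ω → ℝ}
  [MeasurableEq X] [MeasurableSingletonClass X]

theorem measurable_lintegral_prev (h : IsBoundedIBP P ℱ 𝒢 m α β c u b M R) {i n : ℕ} (hi : i < n)
    {φ : Ω × X → ℝ≥0∞} (hφ : Measurable[(ℱ n).prod inferInstance] φ) :
    Measurable[ℱ n] fun ω => ∫⁻ x, φ (ω, x) ∂M i ω := by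
  have := h.finite_M
  have hid : Measurable[ℱ n, (ℱ n).prod inferInstance] fun ω => (ω, M i ω) :=
    @Measurable.prodMk _ (ℱ n) _ _ (ℱ n) _ _ _ (measurable_id'' le_rfl) (h.measurable_M' hi)
  have h1 := (measurable_finIntegral_prod hφ).comp hid
  simpa only [Function.comp_def, finIntegral_eq] using h1

theorem measurable_pick (h : IsBoundedIBP P ℱ 𝒢 m α β c u b M R) {A : Set X} (hA : MeasurableSet A)
    {i n : ℕ} (hi : i < n) :
    Measurable[(ℱ n).prod inferInstance] fun q : Ω × X => A.indicator 1 q.2 * M i q.1 {q.2} :=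
  Measurable.mul ((Measurable.indicator (@measurable_const ℝ≥0∞ X _ _ 1) hA).comp
    (@measurable_snd Ω X (ℱ n) _)) (h.measurable_singleton_mass hi)

theorem measurable_triedAgain (h : IsBoundedIBP P ℱ 𝒢 m α β c u b M R) {A : Set X}
    (hA : MeasurableSet A) {i k : ℕ} (hi : i < k) (n : ℕ) :
    Measurable[𝒢 (k + n)] (triedAgain M A i k n) :=
  (h.measurable_lintegral_next (k + n)
    ((h.measurable_pick hA (by omega : i < k + n)).mul_const 1)).ennreal_toReal

theorem measurable_pickedWeight (h : IsBoundedIBP P ℱ 𝒢 m α β c u b M R) {A : Set X}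
    (hA : MeasurableSet A) {i k : ℕ} (hi : i < k) (n : ℕ) :
    Measurable[ℱ (k + n)] (pickedWeight M R β A i k n) := by
  refine Measurable.add ?_ (Finset.measurable_fun_sum _ fun j hj => Measurable.mul ?_ ?_)
  · exact ((h.measurable_lintegral_prev hi ((h.measurable_pick hA hi).mul
      (h.measurable_dishWeight k).ennreal_ofReal)).ennreal_toReal.sub_const β).mono
      (ℱ.mono (by omega)) le_rfl
  · exact (h.measurable_R (k + j)).mono (ℱ.mono (by have := Finset.mem_range.1 hj; omega)) le_rfl
  · exact (h.measurable_triedAgain hA hi j).mono ((h.mid_le _).trans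
      (ℱ.mono (by have := Finset.mem_range.1 hj; omega))) le_rfl

/-- The dish of customer `i + 1` that lies in `A`, if it is unique. -/
theorem ae_exists_point (h : IsBoundedIBP P ℱ 𝒢 m α β c u b M R) (A : Set X) (i : ℕ) :
    ∀ᵐ ω ∂P, M i ω A = 1 → (∀ j, IsSimple (M j ω)) ∧ ∃ x, M i ω {x} = 1 ∧
      ∀ (ν : Measure X) (φ : X → ℝ≥0∞),
        ∫⁻ y, A.indicator 1 y * M i ω {y} * φ y ∂ν = φ x * ν {x} := by
  filter_upwards [h.ae_forall_isSimple] with ω hω hA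
  obtain ⟨x, hxA, hx, hy⟩ := (hω i).exists_unique_point hA
  exact ⟨hω, x, hx, lintegral_indicator_mul_mass hxA hx hy⟩

theorem ae_picked_eq (h : IsBoundedIBP P ℱ 𝒢 m α β c u b M R) (A : Set X) {i k : ℕ} (hi : i < k) :
    ∀ᵐ ω ∂P, M i ω A = 1 → (∀ j, IsSimple (M j ω)) ∧ ∃ x, (∀ n, x ∈ tried M (k + n) ω) ∧
      (∀ (ν : Measure X) (φ : X → ℝ≥0∞),
        ∫⁻ y, A.indicator 1 y * M i ω {y} * φ y ∂ν = φ x * ν {x}) ∧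
      (∀ n, triedAgain M A i k n ω = (M (k + n) ω).real {x}) ∧
      ∀ n, pickedWeight M R β A i k n ω = dishWeight M R (k + n) ω x - β := by
  filter_upwards [h.ae_exists_point A i] with ω hω hA
  obtain ⟨hs, x, hx1, hint⟩ := hω hA
  have hx : ∀ k, i < k → x ∈ tried M k ω := fun k hk => ⟨i, hk, hx1⟩
  have h1 : ∀ n, triedAgain M A i k n ω = (M (k + n) ω).real {x} := fun n => by
    rw [triedAgain, hint _ fun _ => 1, one_mul]; rfl
  refine ⟨hs, x, fun n => hx _ (by omega), hint, h1, fun n => ?_⟩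
  have hR : ∀ i, u ≤ R i ω := fun i => h.le_R i ω
  induction n with
  | zero =>
    rw [pickedWeight, hint, hx1, mul_one, Finset.sum_range_zero, add_zero, add_zero,
      ENNReal.toReal_ofReal (h.u_pos.le.trans (le_dishWeight h.u_pos hR (fun i _ => hs i)
        (hx k hi)))]
  | succ n ih =>
    rw [pickedWeight, Finset.sum_range_succ, ← add_assoc, ← pickedWeight, ih, ← add_assoc,
      dishWeight_succ, h1]
    ring

/-- With β subtracted from the weight of the dish and c added to the total, the proportion is the
inclusion probability. The dish has positive content because β < u, and so has the rest because c >
-β. -/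
theorem isUrn (h : IsBoundedIBP P ℱ 𝒢 m α β c u b M R) {A : Set X} (hA : MeasurableSet A) {i k : ℕ}
    (hi : i < k) :
    IsUrn P (shiftFiltration ℱ k) (fun n => 𝒢 (k + n)) {ω | M i ω A = 1} (fun n => R (k + n))
      (triedAgain M A i k) (pickedWeight M R β A i k) (fun n ω => totalWeight R (k + n) ω + c) u b
      (b * k + c) where
  measurableSet_event := ((Measure.measurable_coe hA).comp (h.measurable_M' hi))
    (measurableSet_singleton 1)
  le_mid n := h.le_mid (k + n)
  mid_le n := h.mid_le (k + n)
  measurable_R n := h.measurable_R (k + n)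
  measurable_I n := h.measurable_triedAgain hA hi n
  measurable_X n := h.measurable_pickedWeight hA hi n
  measurable_T n := (h.measurable_totalWeight (k + n)).add_const c
  u_pos := h.u_pos
  le_R n := h.le_R (k + n)
  R_le n := h.R_le (k + n)
  indep_R n := h.indep_R (k + n)
  T_zero_le ω _ := by
    have := Finset.sum_le_card_nsmul (Finset.range k) (fun i => R i ω) b fun i _ => h.R_le i ω
    simp only [Finset.card_range, nsmul_eq_mul] at this
    rw [add_zero, totalWeight]
    linarith
  T_succ n ω := by
    rw [← add_assoc, IsPredictiveSystem.totalWeight_succ]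
    ring
  X_succ n ω := by
    rw [pickedWeight, Finset.sum_range_succ, ← add_assoc, ← pickedWeight]
  I_eq := by
    filter_upwards [h.ae_picked_eq (R := R) A hi] with ω hω hE n
    obtain ⟨hs, x, -, -, h1, -⟩ := hω hE
    rw [h1]
    exact (hs _).real_singleton_eq x
  X_zero_pos := by
    filter_upwards [h.ae_picked_eq A hi] with ω hω hE
    obtain ⟨hs, x, hx, -, -, h1⟩ := hω hE
    rw [h1]
    have := le_dishWeight h.u_pos (fun i => h.le_R i ω) (fun i _ => hs i) (hx 0)
    linarith [h.beta_lt_u]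
  X_zero_lt := by
    filter_upwards [h.ae_picked_eq A hi] with ω hω hE
    obtain ⟨hs, x, hx, -, -, h1⟩ := hω hE
    rw [h1]
    have := dishWeight_le (n := k + 0) h.u_pos (fun i => h.le_R i ω) (fun i _ => hs i) x
    linarith [h.c_gt]
  condExp_I n := by
    classical
    set E := {ω | M i ω A = 1} with hE
    have hEm : MeasurableSet[ℱ (k + n)] E := ((Measure.measurable_coe hA).comp
      (h.measurable_M' (by omega : i < k + n))) (measurableSet_singleton 1)
    have hgm : Measurable[ℱ (k + n)] (E.indicator fun ω =>
        pickedWeight M R β A i k n ω / (totalWeight R (k + n) ω + c)) :=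
      ((h.measurable_pickedWeight hA hi n).div
        ((h.measurable_totalWeight (k + n)).add_const c)).indicator hEm
    have hg01 : ∀ᵐ ω ∂P, 0 ≤ E.indicator (fun ω =>
        pickedWeight M R β A i k n ω / (totalWeight R (k + n) ω + c)) ω ∧ E.indicator (fun ω =>
        pickedWeight M R β A i k n ω / (totalWeight R (k + n) ω + c)) ω ≤ 1 := by
      filter_upwards [h.ae_picked_eq A hi] with ω hω
      by_cases hωE : ω ∈ E
      · obtain ⟨hs, x, hx, -, -, h1⟩ := hω hωE
        rw [Set.indicator_of_mem hωE, h1]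
        have := inclusionProb_bounds h.u_pos h.beta_lt_u h.c_gt (fun i => h.le_R i ω)
          (fun i _ => hs i) (hx n)
        exact ⟨this.1.le, this.2⟩
      · simp [hωE]
    have hφm : Measurable[(ℱ (k + n)).prod inferInstance] fun q : Ω × X =>
        E.indicator 1 q.1 * (A.indicator 1 q.2 * M i q.1 {q.2} * 1) := by
      refine Measurable.mul ?_ ((h.measurable_pick hA (by omega : i < k + n)).mul_const 1)
      exact (Measurable.indicator (@measurable_const ℝ≥0∞ Ω _ (ℱ (k + n)) 1) hEm).comp
        (@measurable_fst Ω X (ℱ (k + n)) _)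
    have hfin := h.finite_M
    have h2 := (h.condExp_lintegral_next (k + n) hφm (fun q => ?_) hgm (hg01.mono fun _ h => h.1)
      (Integrable.of_bound (hgm.mono (ℱ.le _) le_rfl).aestronglyMeasurable 1 ?_) ?_).2
    · refine EventuallyEq.trans (condExp_congr_ae (ae_of_all _ fun ω => ?_)) h2
      by_cases hωE : ω ∈ E
      · simp [hωE, triedAgain]
      · simp [hωE]
    · by_cases hqE : q.1 ∈ E <;> by_cases hqA : q.2 ∈ A <;> simp [hqE, hqA]
    · filter_upwards [hg01] with ω hω
      rw [Real.norm_of_nonneg hω.1]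
      exact hω.2
    · filter_upwards [h.ae_picked_eq A hi] with ω hω
      by_cases hωE : ω ∈ E
      · obtain ⟨hs, x, hx, hint, -, h1⟩ := hω hωE
        obtain ⟨S, hS⟩ := (finite_tried (n := k + n) fun i _ => hs i).exists_finset_coe
        have h3 := hint (hazard m α β c M R (k + n) ω) fun _ => 1
        simp only [Set.indicator_of_mem hωE, Pi.one_apply, one_mul]
        rw [h3, one_mul, hazard_singleton h.diffuse hS, Set.indicator_of_mem (hx n), h1]
        rfl
      · simp [hωE]

end IsBoundedIBP

end WeightedIBP

/-! ### Positivity of the limiting variance -/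

namespace WeightedIBP

namespace IsBoundedIBP

variable {Ω X : Type*} [MeasurableSpace X] {mΩ : MeasurableSpace Ω} {P : Measure Ω}
  [IsProbabilityMeasure P] {ℱ : Filtration ℕ mΩ} {𝒢 : ℕ → MeasurableSpace Ω} {m : Measure X}
  {α β c u b : ℝ} {M : ℕ → Ω → Measure X} {R : ℕ → Ω → ℝ}

section Measurable

variable [MeasurableEq X] [MeasurableSingletonClass X]

/-- The predictive variance is the rate of new dishes plus the sum of p(1 - p) over the dishes, so V
= 0 would force p(1 - p) → 0 for the dish in `A`, which the urn excludes. -/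
theorem V_pos_of_measure_eq_one (h : IsBoundedIBP P ℱ 𝒢 m α β c u b M R) {V : Ω → ℝ}
    (hV : ∀ᵐ ω ∂P, Tendsto (fun n => probSum β c M R n ω + newRate α β c R n ω
      - probSqSum β c M R n ω) atTop (𝓝 (V ω))) {A : Set X} (hA : MeasurableSet A) (i : ℕ) :
    ∀ᵐ ω ∂P, M i ω A = 1 → 0 < V ω := by
  filter_upwards [(h.isUrn hA i.lt_succ_self).not_tendsto_zero, h.ae_picked_eq A i.lt_succ_self,
    hV, h.isPredictiveSystem.V_nonneg hV] with ω h1 h2 h3 h4 hE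
  refine h4.lt_of_ne fun h0 => h1 hE ?_
  obtain ⟨hs, x, hx, -, -, h5⟩ := h2 hE
  rw [← h0] at h3
  have h6 := h3.comp (tendsto_add_atTop_nat (i + 1))
  have hR : ∀ i, u ≤ R i ω := fun i => h.le_R i ω
  have hb := fun n => inclusionProb_bounds h.u_pos h.beta_lt_u h.c_gt hR (fun i _ => hs i) (hx n)
  refine squeeze_zero (fun n => ?_) (fun n => ?_) h6
  · rw [h5]
    exact mul_nonneg (hb n).1.le (sub_nonneg.2 (hb n).2)
  · obtain ⟨S, hS⟩ := (finite_tried (n := i + 1 + n) fun i _ => hs i).exists_finset_coe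
    have h7 := h.newRate_pos (i + 1 + n) ω
    rw [h5, Function.comp_apply, add_comm n,
      probSum_eq h.u_pos h.beta_lt_u h.c_gt hR (fun i _ => hs i) hS,
      probSqSum_eq h.u_pos h.beta_lt_u h.c_gt hR (fun i _ => hs i) hS]
    have h8 : ∑ y ∈ S, inclusionProb β c M R (i + 1 + n) ω y *
        (1 - inclusionProb β c M R (i + 1 + n) ω y)
        = ∑ y ∈ S, inclusionProb β c M R (i + 1 + n) ω y
          - ∑ y ∈ S, inclusionProb β c M R (i + 1 + n) ω y ^ 2 := by
      rw [← Finset.sum_sub_distrib]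
      exact Finset.sum_congr rfl fun y _ => by ring
    have h9 := Finset.single_le_sum (f := fun y => inclusionProb β c M R (i + 1 + n) ω y *
        (1 - inclusionProb β c M R (i + 1 + n) ω y)) (s := S) (a := x) (fun y hy => by
      have := inclusionProb_bounds h.u_pos h.beta_lt_u h.c_gt hR (fun i _ => hs i)
        (by rw [← hS]; exact hy : y ∈ tried M (i + 1 + n) ω)
      exact mul_nonneg this.1.le (sub_nonneg.2 this.2)) (by rw [← Finset.mem_coe, hS]; exact hx n)
    simp only [inclusionProb_eq] at h8 h9 ⊢
    linarith

/-- A customer tries some new dish with conditional probability 1 - exp(-Λ) ≥ Λ/(1 + Λ), and Λ is at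
most its value for total weight zero. For β ≥ 0 the rates are at least of order 1/k, so the
conditional Borel–Cantelli lemma applies. -/
theorem ae_exists_dishes_ne_zero (h : IsBoundedIBP P ℱ 𝒢 m α β c u b M R) (hβ : 0 ≤ β) :
    ∀ᵐ ω ∂P, ∃ n, dishes M n ω ≠ 0 := by
  have := h.isProbabilityMeasure
  have hfm := h.finite_M
  let D : Set (Measure X) := {μ | μ Set.univ ≠ 0}
  have hD : MeasurableSet D :=
    (Measure.measurable_coe MeasurableSet.univ) (measurableSet_singleton 0).compl
  let s : ℕ → Set Ω := fun n => {ω | 0 < n ∧ M (n - 1) ω ∈ D}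
  have hs1 : ∀ k, s (k + 1) = M k ⁻¹' D := fun k => by
    ext ω
    simp [s]
  have hs : ∀ n, MeasurableSet[ℱ n] (s n) := fun n => by
    cases n with
    | zero => simp [s]
    | succ k =>
      rw [hs1]
      exact h.measurable_M' k.lt_succ_self hD
  have hκ := rate_const_pos h.alpha_pos h.beta_lt h.c_gt
  have hlow : ∀ᵐ ω ∂P, ∀ k, newRate α β c R k ω / (1 + rateOf α β c (u * 0)) ≤
      (P[(s (k + 1)).indicator (1 : Ω → ℝ) | ℱ k]) ω := by
    refine ae_all_iff.2 fun k => ?_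
    filter_upwards [h.law_M k D hD, h.ae_forall_isSimple] with ω h1 hω
    obtain ⟨hf, ⟨hF⟩, hν, hd, hat⟩ := h.hazard_properties k hω
    have := isProbabilityMeasure_bernoulliLaw (hazard m α β c M R k ω)
    have h2 := bernoulliLaw_compl_atoms_eq_zero _ hd
    have hΛ := h.newRate_pos k ω
    have h3 : (hazard m α β c M R k ω).real (tried M k ω)ᶜ = newRate α β c R k ω := by
      rw [Measure.real, hazard_compl_tried h.diffuse fun i _ => hω i, ENNReal.toReal_ofReal hΛ.le]
    rw [hat, h3] at h2
    have h4 : 1 - Real.exp (-newRate α β c R k ω)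
        ≤ (bernoulliLaw (hazard m α β c M R k ω)).real D := by
      have h5 : Dᶜ ⊆ {μ | μ (tried M k ω)ᶜ = 0} := fun μ hμ => by
        have : μ Set.univ = 0 := not_not.1 hμ
        exact measure_mono_null (Set.subset_univ _) this
      have h6 := measureReal_mono (μ := bernoulliLaw (hazard m α β c M R k ω)) h5
      rw [measureReal_compl hD, probReal_univ, Measure.real, Measure.real, h2,
        ENNReal.toReal_ofReal (Real.exp_nonneg _)] at h6
      rw [Measure.real]
      linarith
    rw [hs1]
    refine le_trans ?_ (h4.trans h1.ge)
    have h7 : newRate α β c R k ω ≤ rateOf α β c (u * 0) := by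
      rw [newRate_eq]
      refine rateOf_anti h.alpha_pos h.beta_lt h.c_gt (by simp) ?_
      rw [mul_zero]
      exact totalWeight_nonneg h.u_pos fun i => h.le_R i ω
    have h8 := Real.add_one_le_exp (newRate α β c R k ω)
    rw [Real.exp_neg, div_le_iff₀ (by linarith)]
    have h9 : (Real.exp (newRate α β c R k ω))⁻¹ ≤ (newRate α β c R k ω + 1)⁻¹ :=
      inv_anti₀ (by linarith) h8
    calc newRate α β c R k ω = (1 - (newRate α β c R k ω + 1)⁻¹) * (1 + newRate α β c R k ω) := by
          field_simp
          ring
      _ ≤ _ := by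
          refine mul_le_mul (by linarith) (by linarith) (by linarith) ?_
          linarith [inv_le_one_of_one_le₀ (by linarith : 1 ≤ newRate α β c R k ω + 1)]
  filter_upwards [hlow, ae_mem_limsup_atTop_iff P hs] with ω h1 h2
  have hu := h.u_pos
  have hub : u ≤ b := (h.le_R 0 ω).trans (h.R_le 0 ω)
  have hmem : ω ∈ limsup s atTop := by
    rw [h2]
    refine tendsto_atTop_mono (fun n => Finset.sum_le_sum fun k _ => h1 k) ?_
    have hpos : 0 < 1 + rateOf α β c (u * 0) := by
      have := rateOf_pos h.alpha_pos h.beta_lt h.c_gt (T := u * 0) (by simp)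
      linarith
    refine (not_summable_iff_tendsto_nat_atTop_of_nonneg fun k =>
      div_nonneg (h.newRate_pos k ω).le hpos.le).1 fun hsum => ?_
    have hT : ∀ n : ℕ, u * n ≤ totalWeight R n ω ∧ totalWeight R n ω ≤ b * n := fun n => by
      have h3 := Finset.sum_le_card_nsmul (Finset.range n) (fun i => R i ω) b fun i _ => h.R_le i ω
      have h4 := Finset.card_nsmul_le_sum (Finset.range n) (fun i => R i ω) u fun i _ => h.le_R i ω
      simp only [Finset.card_range, nsmul_eq_mul] at h3 h4
      rw [totalWeight]
      constructor <;> linarith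
    have hcβ : 0 < c + β := by linarith [h.c_gt]
    have hsum' : Summable fun n : ℕ => newRate α β c R n ω := by
      have := hsum.mul_right (1 + rateOf α β c (u * 0))
      refine this.congr fun n => by rw [div_mul_cancel₀ _ hpos.ne']
    obtain ⟨N, hN⟩ := exists_nat_ge ((1 : ℝ) / u)
    -- After N + 1 customers with N ≥ 1/u the total weight is at least 1, where the lower bound on
    -- the rate is valid.
    refine Real.not_summable_one_div_natCast ((summable_nat_add_iff (N + 1)).1 ?_)
    have h5 : ∀ n : ℕ, 1 / ((n + (N + 1) : ℕ) : ℝ) ≤ ((α * Real.Gamma (c + 1) / Real.Gamma (c + β))⁻¹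
        * (c + β + b)) * newRate α β c R (n + (N + 1)) ω := fun n => by
      obtain ⟨h6, h7⟩ := hT (n + (N + 1))
      have hn1 : (1 : ℝ) ≤ ((n + (N + 1) : ℕ) : ℝ) := by
        exact_mod_cast (by omega : 1 ≤ n + (N + 1))
      have hn2 : (N : ℝ) ≤ ((n + (N + 1) : ℕ) : ℝ) := by
        exact_mod_cast (by omega : N ≤ n + (N + 1))
      have h8 : 1 ≤ u * ((n + (N + 1) : ℕ) : ℝ) := by
        rw [div_le_iff₀ hu] at hN
        nlinarith
      have h9 := inv_le_rateOf h.alpha_pos h.beta_lt hβ h.c_gt (T := totalWeight R (n + (N + 1)) ω)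
        (by linarith) (by linarith)
      rw [← newRate_eq] at h9
      generalize ((n + (N + 1) : ℕ) : ℝ) = y at *
      have hy : 0 < y := by linarith
      have h10 : 1 / ((c + β + b) * y) ≤ 1 / (c + β + totalWeight R (n + (N + 1)) ω) :=
        one_div_le_one_div_of_le (by linarith) (by nlinarith)
      calc 1 / y = ((α * Real.Gamma (c + 1) / Real.Gamma (c + β))⁻¹ * (c + β + b)) *
            (α * Real.Gamma (c + 1) / Real.Gamma (c + β) * (1 / ((c + β + b) * y))) := by
            generalize α * Real.Gamma (c + 1) / Real.Gamma (c + β) = κ at hκ ⊢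
            have : 0 < c + β + b := by linarith
            field_simp
        _ ≤ _ := by
            refine mul_le_mul_of_nonneg_left ((mul_le_mul_of_nonneg_left h10 hκ.le).trans h9) ?_
            exact mul_nonneg (inv_nonneg.2 hκ.le) (by linarith)
    exact Summable.of_nonneg_of_le (fun n => by positivity) h5
      (((summable_nat_add_iff (N + 1)).2 hsum').mul_left _)
  rw [mem_limsup_iff_frequently_mem] at hmem
  obtain ⟨n, hn⟩ := hmem.exists
  refine ⟨n - 1, fun h0 => hn.2 ?_⟩
  exact (measureReal_eq_zero_iff).1 h0

end Measurable

section Topological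

variable [TopologicalSpace X] [T1Space X] [SecondCountableTopology X] [OpensMeasurableSpace X]
  [MeasurableEq X]

/-- A customer has finitely many dishes, so each of them is isolated from the others by a set of a
countable base. Countability lets the exceptional null sets of these sets be united. -/
theorem V_pos (h : IsBoundedIBP P ℱ 𝒢 m α β c u b M R) {V : Ω → ℝ}
    (hV : ∀ᵐ ω ∂P, Tendsto (fun n => probSum β c M R n ω + newRate α β c R n ω
      - probSqSum β c M R n ω) atTop (𝓝 (V ω))) :
    ∀ᵐ ω ∂P, (∃ i, dishes M i ω ≠ 0) → 0 < V ω := by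
  have hcount := TopologicalSpace.countable_countableBasis X
  have hall : ∀ᵐ ω ∂P, ∀ i, ∀ A ∈ TopologicalSpace.countableBasis X, M i ω A = 1 → 0 < V ω :=
    ae_all_iff.2 fun i => (ae_ball_iff hcount).2 fun A hA => h.V_pos_of_measure_eq_one hV
      ((TopologicalSpace.isBasis_countableBasis X).isOpen hA).measurableSet i
  filter_upwards [hall, h.ae_forall_isSimple] with ω h1 hω ⟨i, hi⟩
  have hfin := (hω i).finite_points
  obtain ⟨F, hF⟩ := hfin.exists_finset_coe
  have := (hω i).1
  have hne : ∃ x, M i ω {x} = 1 := by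
    by_contra! hne
    refine hi ?_
    have h2 : M i ω Set.univ = 0 := measure_mono_null (t := {x | ¬ M i ω {x} = 1})
      (fun x _ => hne x) (ae_iff.1 (hω i).2)
    simp [dishes, Measure.real, h2]
  obtain ⟨x, hx⟩ := hne
  have hcl : IsClosed ({x | M i ω {x} = 1} \ {x}) := (hfin.subset Set.diff_subset).isClosed
  obtain ⟨A, hA, hxA, hAsub⟩ := (TopologicalSpace.isBasis_countableBasis X).exists_subset_of_mem_open
    (a := x) (u := ({x | M i ω {x} = 1} \ {x})ᶜ) (by simp) hcl.isOpen_compl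
  refine h1 i A hA ?_
  have hAm := ((TopologicalSpace.isBasis_countableBasis X).isOpen hA).measurableSet
  have h3 : M i ω (A \ {x}) = 0 := measure_mono_null (t := {x | ¬ M i ω {x} = 1})
    (fun y hy hy1 => hAsub hy.1 ⟨hy1, hy.2⟩) (ae_iff.1 (hω i).2)
  rw [← measure_diff_add_inter A (measurableSet_singleton x), h3, zero_add,
    Set.inter_eq_right.2 (Set.singleton_subset_iff.2 hxA), hx]

end Topological

end IsBoundedIBP

end WeightedIBP

namespace WeightedIBP

/-! ### Truncation of the weights and conclusion -/

section Main

variable {Ω X : Type*} [MeasurableSpace X] {mΩ : MeasurableSpace Ω} {P : Measure Ω}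
  {m : Measure X} {α β c u b r q : ℝ} {M : ℕ → Ω → Measure X} {R : ℕ → Ω → ℝ}

/-- The filtration generated by the measures and the weights. -/
def pastFiltration (hM : ∀ n, Measurable (M n)) (hR : ∀ n, Measurable (R n)) :
    Filtration ℕ mΩ where
  seq := past M R
  mono' _ _ hij := iSup_mono fun _ => iSup_mono' fun hi => ⟨lt_of_lt_of_le hi hij, le_rfl⟩
  le' _ := iSup_le fun i => iSup_le fun _ => sup_le (hM i).comap_le (hR i).comap_le

/-- The weights, truncated so that the bounds hold everywhere. -/
def truncWeight (R : ℕ → Ω → ℝ) (u b : ℝ) (n : ℕ) (ω : Ω) : ℝ := max u (min b (R n ω))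

theorem truncWeight_eq {n : ℕ} {ω : Ω} (hu : u ≤ R n ω) (hb : R n ω ≤ b) :
    truncWeight R u b n ω = R n ω := by
  rw [truncWeight, min_eq_right hb, max_eq_right hu]

theorem comap_le_past_succ (M : ℕ → Ω → Measure X) (R : ℕ → Ω → ℝ) (n : ℕ) :
    MeasurableSpace.comap (M n) inferInstance ⊔ MeasurableSpace.comap (R n) inferInstance
      ≤ past M R (n + 1) :=
  le_iSup_of_le n (le_iSup_of_le n.lt_succ_self le_rfl)

/-- Truncation changes the weights on a null set only, hence neither the hazard almost surely nor
the independence. The σ-fields remain those of the original weights, so the conditional expectation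
in the conclusion is the intended one. -/
theorem IsWeightedIBP.isBoundedIBP [IsProbabilityMeasure P] (h : IsWeightedIBP P m α β c M R)
    (hu : max β 0 < u) (hub : u ≤ b) (hle : ∀ n, ∀ᵐ ω ∂P, u ≤ R n ω)
    (hge : ∀ n, ∀ᵐ ω ∂P, R n ω ≤ b) :
    IsBoundedIBP P (pastFiltration h.measurable_M h.measurable_R)
      (fun n => past M R n ⊔ MeasurableSpace.comap (M n) inferInstance) m α β c u b M
      (truncWeight R u b) where
  alpha_pos := h.alpha_pos
  beta_lt := h.beta_lt
  c_gt := h.c_gt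
  isProbabilityMeasure := h.isProbabilityMeasure
  diffuse := h.diffuse
  max_lt := hu
  le_mid _ := le_sup_left
  mid_le n := sup_le ((pastFiltration h.measurable_M h.measurable_R).mono n.le_succ)
    (le_sup_left.trans (comap_le_past_succ M R n))
  measurable_M n := (comap_measurable (M n)).mono le_sup_right le_rfl
  finite_M := h.finite_M
  measurable_R n := measurable_const.max (measurable_const.min ((comap_measurable (R n)).mono
    (le_sup_right.trans (comap_le_past_succ M R n)) le_rfl))
  le_R _ _ := le_max_left _ _
  R_le _ _ := max_le hub (min_le_left _ _)
  indep_R n := by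
    refine indep_of_indep_of_le_left (h.indep_R n) ?_
    exact (measurable_const.max (measurable_const.min (comap_measurable (R n)))).comap_le
  law_M n A hA := by
    refine (h.law_M n A hA).trans ?_
    filter_upwards [ae_all_iff.2 hle, ae_all_iff.2 hge] with ω h1 h2
    have h3 : ∀ i, truncWeight R u b i ω = R i ω := fun i => truncWeight_eq (h1 i) (h2 i)
    have h4 : hazard m α β c M (truncWeight R u b) n ω = hazard m α β c M R n ω := by
      simp only [hazard, inclusionProb, newRate, totalWeight, h3]
    rw [h4]

variable [IsProbabilityMeasure P] [TopologicalSpace X] [T1Space X] [SecondCountableTopology X]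
  [OpensMeasurableSpace X] [MeasurableEq X] {ℱ : Filtration ℕ mΩ} {𝒢 : ℕ → MeasurableSpace Ω}

/-- Here Q is defined as Z² + V, so that Q - Z² is the limiting predictive variance and its
positivity is `V_pos`. -/
theorem IsBoundedIBP.exists_stable_limits (h : IsBoundedIBP P ℱ 𝒢 m α β c u b M R)
    (hr : Tendsto (fun n => ∫ ω, R n ω ∂P) atTop (𝓝 r))
    (hq : Tendsto (fun n => ∫ ω, R n ω ^ 2 ∂P) atTop (𝓝 q))
    {B e : ℕ → Ω → ℝ} (hBm : ∀ n, Measurable (B n)) (hem : ∀ n, Measurable (e n)) {η : ℕ → ℝ}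
    (hB : IsPredictiveSystem.IsSmoothed R (dishes M) (newDishes M) (newRate α β c R)
      (probSum β c M R) B e β c η) :
    (∀ n, Integrable (dishes M n) P) ∧
    ∃ Z Q : Ω → ℝ, Measurable Z ∧ Measurable Q ∧
      (∀ᵐ ω ∂P, Tendsto (fun n => meanDishes M n ω) atTop (𝓝 (Z ω))) ∧
      (∀ᵐ ω ∂P, Tendsto (fun n : ℕ => (1 / (n : ℝ)) *
        ∑ i ∈ Finset.range n, dishes M i ω ^ 2) atTop (𝓝 (Q ω))) ∧
      (0 ≤ β → ∀ᵐ ω ∂P, Z ω ^ 2 < Q ω) ∧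
      (∀ᵐ ω ∂P, (∃ i, dishes M i ω ≠ 0) → Z ω ^ 2 < Q ω) ∧
      StablyConverges P (fun n ω => √n * (meanDishes M n ω - Z ω))
        (centeredGaussian fun ω => (2 * q - r ^ 2) / r ^ 2 * (Q ω - Z ω ^ 2)) ∧
      StablyConverges P (fun n ω => √n * (meanDishes M n ω - (P[dishes M n | ℱ n]) ω))
        (centeredGaussian fun ω => (q - r ^ 2) / r ^ 2 * (Q ω - Z ω ^ 2)) := by
  have hS := h.isPredictiveSystem
  obtain ⟨Z, V, hZm, hVm, hZ, hV⟩ := hS.exists_limits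
  have hpos := h.V_pos hV
  refine ⟨hS.integrable_K, Z, fun ω => Z ω ^ 2 + V ω, hZm, (hZm.pow_const 2).add hVm,
    hS.tendsto_cesaro_K hZ, hS.tendsto_cesaro_sq_K hZ hV, fun hβ => ?_, ?_, ?_, ?_⟩
  · filter_upwards [hpos, h.ae_exists_dishes_ne_zero hβ] with ω h1 h2
    linarith [h1 h2]
  · filter_upwards [hpos] with ω h1 h2
    linarith [h1 h2]
  · simp only [add_sub_cancel_left]
    exact IsPredictiveSystem.stablyConverges_sub_limit hS hr hq hZm hVm hZ hV hBm hem hB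
  · simp only [add_sub_cancel_left]
    exact IsPredictiveSystem.stablyConverges_sub_predictive hS hr hq hVm hV hBm hem hB
      (fun n => stronglyMeasurable_condExp.measurable.mono (ℱ.le n) le_rfl) hS.condExp_K

end Main

end WeightedIBP

end

theorem mainTheorem1 {Ω X : Type*} [MeasurableSpace Ω]
    [MetricSpace X] [TopologicalSpace.SeparableSpace X] [MeasurableSpace X] [BorelSpace X]
    (P : Measure Ω) [IsProbabilityMeasure P] (m : Measure X) (α β c : ℝ)
    (M : ℕ → Ω → Measure X) (R : ℕ → Ω → ℝ)
    (hM : WeightedIBP.IsWeightedIBP P m α β c M R)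
    (b r q : ℝ)
    (hb : ∀ n, ∀ᵐ ω ∂P, R n ω ≤ b)
    (hr : Tendsto (fun n => ∫ ω, R n ω ∂P) atTop (𝓝 r))
    (hq : Tendsto (fun n => ∫ ω, R n ω ^ 2 ∂P) atTop (𝓝 q))
    (hβ : β < 1 / 2 ∨ ∀ n, ∀ᵐ ω ∂P, R n ω = 1) :
    (∀ n, Integrable (WeightedIBP.dishes M n) P) ∧
    ∃ Z Q : Ω → ℝ, Measurable Z ∧ Measurable Q ∧
      (∀ᵐ ω ∂P, Tendsto (fun n => WeightedIBP.meanDishes M n ω) atTop (𝓝 (Z ω))) ∧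
      (∀ᵐ ω ∂P, Tendsto (fun n : ℕ => (1 / (n : ℝ)) *
        ∑ i ∈ Finset.range n, WeightedIBP.dishes M i ω ^ 2) atTop (𝓝 (Q ω))) ∧
      (0 ≤ β → ∀ᵐ ω ∂P, Z ω ^ 2 < Q ω) ∧
      (∀ᵐ ω ∂P, (∃ i, WeightedIBP.dishes M i ω ≠ 0) → Z ω ^ 2 < Q ω) ∧
      WeightedIBP.StablyConverges P
        (fun n ω => Real.sqrt n * (WeightedIBP.meanDishes M n ω - Z ω))
        (WeightedIBP.centeredGaussian fun ω =>
          (2 * q - r ^ 2) / r ^ 2 * (Q ω - Z ω ^ 2)) ∧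
      WeightedIBP.StablyConverges P
        (fun n ω => Real.sqrt n * (WeightedIBP.meanDishes M n ω -
          (P[WeightedIBP.dishes M n | WeightedIBP.past M R n]) ω))
        (WeightedIBP.centeredGaussian fun ω =>
          (q - r ^ 2) / r ^ 2 * (Q ω - Z ω ^ 2)) := by
  -- For almost surely unit weights both truncation bounds are taken to be 1, which is admissible
  -- because β < 1; the truncated weights then equal 1 everywhere, as the exact martingale argument
  -- requires.
  obtain ⟨u, b', hu, hub, hle, hge, hβ'⟩ : ∃ u b' : ℝ, max β 0 < u ∧ u ≤ b' ∧
      (∀ n, ∀ᵐ ω ∂P, u ≤ R n ω) ∧ (∀ n, ∀ᵐ ω ∂P, R n ω ≤ b') ∧ (β < 1 / 2 ∨ u = 1 ∧ b' = 1) := by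
    rcases hβ with hβ | hR
    · obtain ⟨u, hu, hle⟩ := hM.weight_ge
      refine ⟨u, max u b, hu, le_max_left _ _, hle, fun n => ?_, Or.inl hβ⟩
      filter_upwards [hb n] with ω hω using hω.trans (le_max_right _ _)
    · exact ⟨1, 1, max_lt hM.beta_lt one_pos, le_rfl, fun n => (hR n).mono fun ω hω => hω.ge,
        fun n => (hR n).mono fun ω hω => hω.le, Or.inr ⟨rfl, rfl⟩⟩
  have h := hM.isBoundedIBP hu hub hle hge
  have hR : ∀ n, WeightedIBP.truncWeight R u b' n =ᵐ[P] R n := fun n => by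
    filter_upwards [hle n, hge n] with ω h1 h2 using WeightedIBP.truncWeight_eq h1 h2
  have hr' : Tendsto (fun n => ∫ ω, WeightedIBP.truncWeight R u b' n ω ∂P) atTop (𝓝 r) :=
    hr.congr fun n => integral_congr_ae (hR n).symm
  have hq' : Tendsto (fun n => ∫ ω, WeightedIBP.truncWeight R u b' n ω ^ 2 ∂P) atTop (𝓝 q) :=
    hq.congr fun n => integral_congr_ae ((hR n).symm.mono fun ω hω => by simp only [hω])
  have : SecondCountableTopology X := UniformSpace.secondCountable_of_separable X
  have hm : ∀ n, Measurable (WeightedIBP.probSum β c M (WeightedIBP.truncWeight R u b') n) :=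
    fun n => (h.measurable_probSum n).mono (Filtration.le _ n) le_rfl
  have hΛ : ∀ n, Measurable (WeightedIBP.newRate α β c (WeightedIBP.truncWeight R u b') n) :=
    fun n => (h.measurable_newRate n).mono (Filtration.le _ n) le_rfl
  rcases hβ' with hβ' | ⟨rfl, rfl⟩
  · refine h.exists_stable_limits hr' hq' hm (fun n => ?_) (h.isSmoothed_of_lt_half hβ')
    exact ((((h.measurable_R n).mono (Filtration.le _ _) le_rfl).sub_const β).mul (hΛ n)).div
      (((h.measurable_totalWeight (n + 1)).mono (Filtration.le _ _) le_rfl).add_const c)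
  · refine h.exists_stable_limits hr' hq' (fun n => (hm n).add (hΛ n)) (fun _ => measurable_const)
      (h.isSmoothed_of_eq_one fun n ω => le_antisymm (h.R_le n ω) (h.le_R n ω))
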